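/- Let $V$ be a positive definite quadratic space over $\mathbb{Q}$ of dimension $3$, with symmetric bilinear form $B$ and $Q(x)=B(x,x)$. Let $L$ be a lattice on $V$ (a finitely generated $\mathbb{Z}$-submodule with $\mathbb{Q}L=V$) which is integral, i.e. $B(L,L)\subseteq\mathbb{Z}$. Let $A$ be the Gram matrix $(B(e_i,e_j))$ of a $\mathbb{Z}$-basis of $L$, let $d_L=\det A$, and let $N_L$ be the smallest positive integer such that $N_LA^{-1}$ has integral entries. Let $\nu\in L$ and let $a$ be a positive integer such that the coset $aL+\nu$ has conductor $a$, i.e. $a$ is the smallest positive integer $b$ with $b\nu\in aL$. For a coset $X\subseteq V$ put $\Theta_X(z)=\sum_{x\in X}e^{2\pi i zQ(x)}$ and $o^+(X)=|\{\sigma\in O^+(V):\sigma(X)=X\}|$. The proper genus $\mathrm{gen}^+(aL+\nu)$ is the orbit of $aL+\nu$ under the adelic rotation group $O_A^+(V)$: it consists of the cosets $aK+\mu$ ($K$ a lattice on $V$) with $aK_q+\mu=\sigma_q(aL_q+\nu)$ for all primes $q$, for some $(\sigma_q)_q$ with $\sigma_q\in O^+(V_q)$ and $\sigma_qL_q=L_q$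 for almost all $q$. Its theta series is $$\Theta_{\mathrm{gen}^+(aL+\nu)}=\Big(\sum_{X}\frac1{o^+(X)}\Big)^{-1}\sum_{X}\frac{\Theta_X}{o^+(X)},$$ where $X$ runs over representatives of the $O^+(V)$-orbits (proper classes) in $\mathrm{gen}^+(aL+\nu)$. Let $N=4N_La^2$ and $\psi(d)=\left(\frac{4d_L}{d}\right)$. On $M_{3/2}(\Gamma_0(N)\cap\Gamma_1(a),\psi)=\bigoplus_{\chi}M_{3/2}(\Gamma_0(N),\chi\psi)$, where $\chi$ runs over the Dirichlet characters modulo $a$, let $T(p^2)$ be the direct sum of Shimura's Hecke operators $T(p^2)$ on the spaces $M_{3/2}(\Gamma_0(N),\chi\psi)$. Then $\Theta_{\mathrm{gen}^+(aL+\nu)}\in M_{3/2}(\Gamma_0(N)\cap\Gamma_1(a),\psi)$, and for every prime $p\nmid 4N_La^2$ and every integer $\bar p$ with $p\bar p\equiv1\pmod a$, $$\Theta_{\mathrm{gen}^+(aL+\nu)}\,|\,T(p^2)=(p+1)\,\Theta_{\mathrm{gen}^+(aL+\bar p\nu)}.$$ In particular, if moreover $p\equiv\pm1\pmod a$, then $\Theta_{\mathrm{gen}^+(aL+\nu)}$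 is a (non-zero) eigenform of $T(p^2)$ with eigenvalue $p+1$. -/

import Mathlib

open scoped TensorProduct MatrixGroups UpperHalfPlane Manifold

noncomputable section

namespace TernaryCoset

/-! ## Quadratic spaces, lattice cosets, proper genera -/

section Rotations

variable {K W : Type*} [Field K] [AddCommGroup W] [Module K W]

/-- The rotation group `O⁺(W)` of a space `W` with bilinear form `B`. -/
def rotationGroup (B : LinearMap.BilinForm K W) : Subgroup (W ≃ₗ[K] W) where
  carrier := {σ | (∀ x y, B (σ x) (σ y) = B x y) ∧ LinearMap.det (σ : W →ₗ[K] W) = 1}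
  one_mem' := ⟨fun _ _ => rfl, LinearMap.det_id⟩
  mul_mem' := by
    rintro σ τ ⟨h₁, d₁⟩ ⟨h₂, d₂⟩
    refine ⟨fun x y => ?_, ?_⟩
    · rw [LinearEquiv.mul_apply, LinearEquiv.mul_apply, h₁, h₂]
    · have : ((σ * τ : W ≃ₗ[K] W) : W →ₗ[K] W) = (σ : W →ₗ[K] W) * (τ : W →ₗ[K] W) := rfl
      rw [this, map_mul, d₁, d₂, one_mul]
  inv_mem' := by
    rintro σ ⟨h, d⟩
    have e : ∀ x, σ (σ⁻¹ x) = x := σ.apply_symm_apply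
    refine ⟨fun x y => ?_, ?_⟩
    · rw [← h, e, e]
    · have : (σ : W →ₗ[K] W) * ((σ⁻¹ : W ≃ₗ[K] W) : W →ₗ[K] W) = 1 := LinearMap.ext e
      have := congrArg LinearMap.det this
      rwa [map_mul, d, one_mul, map_one] at this

end Rotations

variable {V : Type*} [AddCommGroup V] [Module ℚ V]

/-- `L` is a lattice on `V`: finitely generated over `ℤ` and spanning `V` over `ℚ`. -/
def IsLattice (L : Submodule ℤ V) : Prop :=
  L.FG ∧ Submodule.span ℚ (L : Set V) = ⊤

/-- The set `aL + ν`. -/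
def latticeCoset (a : ℕ) (L : Submodule ℤ V) (ν : V) : Set V :=
  {x | ∃ y ∈ L, x = a • y + ν}

/-- The conductor of `aL + ν` (with respect to `aL`) is `a`: the smallest positive integer `b`
with `bν ∈ aL` is `a`. -/
def HasConductor (a : ℕ) (L : Submodule ℤ V) (ν : V) : Prop :=
  IsLeast {b : ℕ | 0 < b ∧ b • ν ∈ latticeCoset a L 0} a

/-- The Gram matrix `(B(eᵢ, eⱼ))` of a basis of `L`. -/
def gram (B : LinearMap.BilinForm ℚ V) {L : Submodule ℤ V} {n : ℕ}
    (e : Module.Basis (Fin n) ℤ L) : Matrix (Fin n) (Fin n) ℚ :=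
  Matrix.of fun i j => B (e i) (e j)

/-- The discriminant `d_L`, the determinant of the Gram matrix; for integral `L` it is an integer,
so that taking the numerator loses nothing. -/
def discr (B : LinearMap.BilinForm ℚ V) {L : Submodule ℤ V} {n : ℕ}
    (e : Module.Basis (Fin n) ℤ L) : ℤ :=
  (gram B e).det.num

/-- The level `N_L`, the smallest positive integer `N` such that `N A⁻¹` has integral entries,
where `A` is the Gram matrix. -/
def level (B : LinearMap.BilinForm ℚ V) {L : Submodule ℤ V} {n : ℕ}
    (e : Module.Basis (Fin n) ℤ L) : ℕ :=
  sInf {N : ℕ | 0 < N ∧ ∀ i j, ∃ m : ℤ, (N : ℚ) * (gram B e)⁻¹ i j = m}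

/-- `L_p`, the `ℤ_p`-span of `L` in `V_p = ℚ_p ⊗ V`. -/
def localLattice (p : ℕ) [Fact p.Prime] (L : Submodule ℤ V) : Submodule ℤ_[p] (ℚ_[p] ⊗[ℚ] V) :=
  Submodule.span ℤ_[p] ((fun x : V => (1 : ℚ_[p]) ⊗ₜ[ℚ] x) '' (L : Set V))

/-- The local coset `aL_p + ν ⊆ V_p`. -/
def localCoset (p : ℕ) [Fact p.Prime] (a : ℕ) (L : Submodule ℤ V) (ν : V) :
    Set (ℚ_[p] ⊗[ℚ] V) :=
  {x | ∃ y ∈ localLattice p L, x = a • y + (1 : ℚ_[p]) ⊗ₜ[ℚ] ν}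

/-- The finite components of an element of `O⁺_A(V)`: rotations `σ_p ∈ O⁺(V_p)` with
`σ_p L_p = L_p` for almost all `p` (a condition that does not depend on the lattice `L` on `V`).
The component at the infinite place acts trivially on cosets, as `L_∞ = V_∞`. -/
structure AdelicRotation (B : LinearMap.BilinForm ℚ V) (L : Submodule ℤ V) where
  comp : ∀ (p : ℕ) [Fact p.Prime], rotationGroup (B.baseChange ℚ_[p])
  almost_all : {p : ℕ | ∃ _ : Fact p.Prime,
    (comp p).1 '' (localLattice p L : Set (ℚ_[p] ⊗[ℚ] V)) ≠
      (localLattice p L : Set (ℚ_[p] ⊗[ℚ] V))}.Finite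

/-- The proper genus `gen⁺(aL + ν)`: the orbit of `aL + ν` under `O⁺_A(V)`. Here `σ(aL + ν)` is
the coset `aK + μ` in `V` with `aK_p + μ = σ_p(aL_p + ν)` for all primes `p`. -/
def properGenus (B : LinearMap.BilinForm ℚ V) (a : ℕ) (L : Submodule ℤ V) (ν : V) :
    Set (Set V) :=
  {X | ∃ (K : Submodule ℤ V) (μ : V), IsLattice K ∧ X = latticeCoset a K μ ∧
    ∃ σ : AdelicRotation B L, ∀ (p : ℕ) [Fact p.Prime],
      (σ.comp p).1 '' localCoset p a L ν = localCoset p a K μ}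

/-- The relation "in the same proper class" (same orbit under `O⁺(V)`) on a set of cosets. -/
def properClass (B : LinearMap.BilinForm ℚ V) (G : Set (Set V)) : Setoid G where
  r X Y := ∃ σ ∈ rotationGroup B, σ '' (X : Set V) = Y
  iseqv :=
    { refl := fun X => ⟨1, one_mem _, Set.image_id _⟩
      symm := by
        rintro X Y ⟨σ, hσ, h⟩
        refine ⟨σ⁻¹, inv_mem hσ, ?_⟩
        rw [← h, Set.image_image]
        have e : ∀ x, σ⁻¹ (σ x) = x := σ.symm_apply_apply
        simp [e]
      trans := by
        rintro X Y Z ⟨σ, hσ, h⟩ ⟨τ, hτ, h'⟩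
        refine ⟨τ * σ, mul_mem hτ hσ, ?_⟩
        rw [← h', ← h, Set.image_image]
        rfl }

/-- `o⁺(X)`, the number of `σ ∈ O⁺(V)` with `σ(X) = X`. -/
def oPlus (B : LinearMap.BilinForm ℚ V) (X : Set V) : ℕ :=
  Nat.card {σ : V ≃ₗ[ℚ] V // σ ∈ rotationGroup B ∧ σ '' X = X}

/-! ## Theta series -/

/-- `Θ_X(z) = ∑_{x ∈ X} q^{Q(x)}`, where `q = e^{2πiz}` and `Q(x) = B(x, x)`. -/
def theta (B : LinearMap.BilinForm ℚ V) (X : Set V) (z : ℍ) : ℂ :=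
  ∑' x : X, Complex.exp (2 * Real.pi * Complex.I * ((B x x : ℚ) : ℂ) * z)

/-- `Mass(G)`: the sum of `1 / o⁺` over representatives of the proper classes in `G`. -/
def mass (B : LinearMap.BilinForm ℚ V) (G : Set (Set V)) : ℂ :=
  ∑ᶠ c : Quotient (properClass B G), 1 / (oPlus B (c.out : Set V) : ℂ)

/-- The theta series of a proper genus `G`: the average of the theta series of representatives of
the proper classes in `G`, with weights `1 / o⁺`. -/
def thetaGenus (B : LinearMap.BilinForm ℚ V) (G : Set (Set V)) (z : ℍ) : ℂ :=
  1 / mass B G *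
    ∑ᶠ c : Quotient (properClass B G), theta B (c.out : Set V) z / (oPlus B (c.out : Set V) : ℂ)

/-! ## Modular forms of half-integral weight -/

/-- The Kronecker symbol `(c / d)` for odd `d`; in particular `(0 / ±1) = 1`, and `(c / -1)` is the
sign of `c` for `c ≠ 0`. -/
def kronecker (c d : ℤ) : ℤ :=
  if c < 0 ∧ d < 0 then -jacobiSym c d.natAbs else jacobiSym c d.natAbs

/-- `ε_d` for odd `d`: `1` if `d ≡ 1 (mod 4)` and `i` if `d ≡ 3 (mod 4)`. -/
def epsilon (d : ℤ) : ℂ := if d % 4 = 1 then 1 else Complex.I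

/-- The slash operator of weight `k / 2` (`k` odd) for `γ = (a b; c d) ∈ Γ₀(4)`:
`(f|γ)(z) = (c/d) ε_d^k (cz + d)^(-k/2) f(γz)`, with the principal branch. -/
def slash (k : ℕ) (γ : SL(2, ℤ)) (f : ℍ → ℂ) (z : ℍ) : ℂ :=
  (kronecker (γ 1 0) (γ 1 1) : ℂ) * epsilon (γ 1 1) ^ k *
    ((γ 1 0 : ℂ) * z + (γ 1 1 : ℂ)) ^ (-(k : ℂ) / 2) * f (γ • z)

/-- `f` is a (holomorphic) modular form of weight `k / 2` (`k` odd) on `Γ ⊆ Γ₀(4)` with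
character `ω`: it transforms by `f|γ = ω(d) f`, is holomorphic, and grows at most polynomially in
`y = Im z` as `z` approaches `ℚ ∪ {i∞}`. -/
structure IsModularForm (k : ℕ) (Γ : Subgroup SL(2, ℤ)) (ω : ℤ → ℂ) (f : ℍ → ℂ) : Prop where
  slash_eq : ∀ γ ∈ Γ, slash k γ f = ω (γ 1 1) • f
  holo : MDifferentiable 𝓘(ℂ) 𝓘(ℂ) f
  growth : ∃ (C : ℝ) (n : ℕ), ∀ z : ℍ, ‖f z‖ ≤ C * (z.im + z.im⁻¹) ^ n

/-! ## Hecke operators -/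

/-- The integral matrix `ξ = (1 0; 0 p²)`. -/
def heckeMatrix (p : ℕ) : Matrix (Fin 2) (Fin 2) ℤ := !![1, 0; 0, (p : ℤ) ^ 2]

/-- Two elements `γ, γ'` of `Γ₀(N)` are equivalent if `Γ₀(N) ξ γ = Γ₀(N) ξ γ'`; so the classes
correspond to the elements `Γ₀(N) ξ γ` of `Γ₀(N) \ Γ₀(N) ξ Γ₀(N)`. -/
def heckeCosets (N p : ℕ) : Setoid (CongruenceSubgroup.Gamma0 N) where
  r γ γ' := ∃ δ : CongruenceSubgroup.Gamma0 N,
    (δ.1 : Matrix (Fin 2) (Fin 2) ℤ) * (heckeMatrix p * (γ.1 : Matrix (Fin 2) (Fin 2) ℤ)) =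
      heckeMatrix p * (γ'.1 : Matrix (Fin 2) (Fin 2) ℤ)
  iseqv :=
    { refl := fun γ => ⟨1, by simp⟩
      symm := by
        rintro γ γ' ⟨δ, h⟩
        refine ⟨δ⁻¹, ?_⟩
        have e : ((δ⁻¹).1 : Matrix (Fin 2) (Fin 2) ℤ) * (δ.1 : Matrix (Fin 2) (Fin 2) ℤ) = 1 := by
          rw [← Matrix.SpecialLinearGroup.coe_mul, ← Subgroup.coe_mul]
          simp
        rw [← h, ← Matrix.mul_assoc, e, Matrix.one_mul]
      trans := by
        rintro γ γ' γ'' ⟨δ, h⟩ ⟨δ', h'⟩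
        refine ⟨δ' * δ, ?_⟩
        rw [← h', ← h, Subgroup.coe_mul, Matrix.SpecialLinearGroup.coe_mul, Matrix.mul_assoc] }

/-- The action of `ξ`, lifted to the metaplectic group as `(ξ, p^(1/2))`:
`(f|ξ)(z) = p^(-k/2) f(z / p²)`. -/
def slashXi (k p : ℕ) (f : ℍ → ℂ) (z : ℍ) : ℂ :=
  (p : ℂ) ^ (-(k : ℂ) / 2) * f (UpperHalfPlane.ofComplex ((z : ℂ) / (p : ℂ) ^ 2))

/-- Shimura's Hecke operator `T(p²)` on the forms of weight `k / 2` on `Γ₀(N)` with character `ω`,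
given by the double coset of `ξ`:
`f|T(p²) = p^(k/2 - 2) ∑_ν ω(a_ν) f|ξ_ν`,
where `ξ_ν = ξγ` runs over representatives of `Γ₀(N) \ Γ₀(N) ξ Γ₀(N)` (with `γ ∈ Γ₀(N)`, lifted to
the metaplectic group in the standard way) and `a_ν` is the upper left entry of `ξ_ν`, which is
that of `γ`. -/
def heckeGamma0 (k N p : ℕ) (ω : ℤ → ℂ) (f : ℍ → ℂ) : ℍ → ℂ :=
  (p : ℂ) ^ ((k : ℂ) / 2 - 2) •
    ∑ᶠ c : Quotient (heckeCosets N p),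
      ω (c.out.1 0 0) • slash k c.out.1 (slashXi k p f)

/-- The character `d ↦ χ(d) ψ(d)` for a Dirichlet character `χ` modulo `M`. -/
def twist {M : ℕ} (χ : DirichletCharacter ℂ M) (ψ : ℤ → ℂ) (d : ℤ) : ℂ := χ (d : ZMod M) * ψ d

/-- `f = ∑_χ F_χ` with `F_χ` in `M_{k/2}(Γ₀(N), χψ)`, where `χ` runs over all Dirichlet characters
modulo `M`. -/
def IsDecomposition (k N M : ℕ) (ψ : ℤ → ℂ) (f : ℍ → ℂ)
    (F : DirichletCharacter ℂ M → ℍ → ℂ) : Prop :=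
  (∀ χ, IsModularForm k (CongruenceSubgroup.Gamma0 N) (twist χ ψ) (F χ)) ∧ f = ∑ᶠ χ, F χ

open Classical in
/-- The Hecke operator `T(p²)` on `M_{k/2}(Γ₀(N) ∩ Γ₁(M), ψ) = ⨁_χ M_{k/2}(Γ₀(N), χψ)`: the direct
sum of Shimura's operators on the summands. (It is set to `0` on functions that do not have such
a decomposition.) -/
def hecke (k N M p : ℕ) (ψ : ℤ → ℂ) (f : ℍ → ℂ) : ℍ → ℂ :=
  if h : ∃ F, IsDecomposition k N M ψ f F then
    ∑ᶠ χ, heckeGamma0 k N p (twist χ ψ) (h.choose χ)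
  else 0

/-- `f` is an eigenform of `T(p²)` in `M_{k/2}(Γ₀(N) ∩ Γ₁(M), ψ)` with eigenvalue `c`. -/
def IsHeckeEigenform (k N M p : ℕ) (ψ : ℤ → ℂ) (f : ℍ → ℂ) (c : ℂ) : Prop :=
  IsModularForm k (CongruenceSubgroup.Gamma0 N ⊓ CongruenceSubgroup.Gamma1 M) ψ f ∧ f ≠ 0 ∧
    hecke k N M p ψ f = c • f

end TernaryCoset

end

noncomputable section

namespace TernaryCoset

section

/-! ## The Kronecker symbol and the factor `ε_d` -/

/-! The theorem is a counting statement about neighbors of lattices. For a coset `X = aK + μ` in the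
genus, `T(p²)` turns `Θ_X` into the sum of `Θ_Y` over the `p + 1` cosets `Y = aK' + p̄μ`, where `K'`
runs over the `p`-neighbors of `K`. Averaging this identity over the genus gives the factor `p + 1`.

Local count. Since `p` does not divide `2N_L`, `K` is unimodular at `p` and `K/pK` is a
nondegenerate ternary quadratic space over `F_p`, with exactly `p + 1` isotropic lines. Each line
lifts to a vector `w` with `p² ∣ Q(w)`, and `K'` is generated by `w/p` and the `x ∈ K` with `p ∣
B(x, w)`. For `px ∈ K` the number of `K'` containing `x` is the sum of three terms: `1` if `p² ∣
Q(px)`, the quadratic character of `-d Q(x)` if `x ∈ K`, and `p` if `x ∈ pK`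
(`IsReduction.exists_neighbors`, from `sum_isoPoint_orthogonal`). These are the three terms of the
coefficient of `T(p²)Θ_X` at the vector `px`.

Hecke operator. The right cosets are the points of the projective line over `ℤ/p²`, so there are
`p²`, `p - 1` and `1` representatives of three kinds (`heckeRep_bijective`). They produce a sum over
additive characters, a quadratic Gauss sum (whose sign is needed, `sum_exp_sq_eq`) and a dilation;
`hecke_theta` reads off the coefficients. The operator is defined through a decomposition by
characters modulo `a`; it can be evaluated on the family of the `aK + bμ`, because `Γ₀(N)` only
permutes the multiples `bμ` (`IsThetaFamily.hecke_eq`).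

Genus. A half turn maps `K_p` onto `K'_p`, so passing to a neighbor leads from the proper genus of
`aL + ν` to that of `aL + p̄ν` (`neighbor_mem_properGenus`). The neighbor relation commutes with
rotations and has degree `p + 1` in both directions. Double counting with weights `1/o⁺`
(`sum_correspondence`) gives the identity of sums, and with the constant function `1` the equality
of the masses. Reduction theory (`exists_bounded_basis`) makes the class number and the groups of
automorphisms finite, so that these sums are meaningful.

Modularity. The Jacobi theta function transforms with the theta multiplier under `Γ₀(4)`, by
Euclid's algorithm from translation and inversion (`thetaLaw_of_four_dvd`). In orthogonal
coordinates `Θ_X` is a finite sum of products of three such series, which gives the law on some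
small `Γ₀(N')`. The matrices `(1 0; n 1)` with `N ∣ n` are treated by inversion and the dual
lattice, and together these give all of `Γ₀(N)` (`slash_theta`).

If `p ≡ ±1` modulo `a`, then `p̄ = ±1`; the map `x ↦ -x` shows that `ν` and `-ν` have the same genus
theta series, and the value at `z = i` is positive. -/

open NumberTheorySymbols in
-- Factors `2` of `c` are split off, since `(2/·)` is even as a function modulo `8`. For odd `c`
-- quadratic reciprocity applies: the factor `(-1/c)` from `m ≡ -d` cancels the change of the
-- reciprocity sign between `m` and `d`.
theorem jacobiSym_eq_of_dvd_add (c : ℕ) : ∀ {m d : ℕ}, Odd m → Odd d → c ≠ 0 → 4 * c ∣ m + d →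
    J((c : ℤ) | m) = J((c : ℤ) | d) := by
  induction c using Nat.strong_induction_on with
  | _ c ih =>
  intro m d hm hd hc h
  rcases Nat.even_or_odd' c with ⟨c', rfl | rfl⟩
  · have h8 : 8 ∣ m + d := (Dvd.intro c' (by ring : 8 * c' = 4 * (2 * c'))).trans h
    have h1 := ih c' (by omega) hm hd (by omega) ((Dvd.intro_left 2 (by ring)).trans h)
    have h2 : J(2 | m) = J(2 | d) := by
      rw [jacobiSym.at_two hm, jacobiSym.at_two hd]
      have : ((m : ℕ) : ZMod 8) = -(d : ZMod 8) := by
        rw [eq_neg_iff_add_eq_zero, ← Nat.cast_add]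
        exact (ZMod.natCast_eq_zero_iff _ _).2 h8
      rw [this]
      generalize (d : ZMod 8) = x
      revert x
      decide
    rw [Nat.cast_mul, jacobiSym.mul_left, jacobiSym.mul_left, h1]
    simp only [Nat.cast_ofNat]
    rw [h2]
  · set c := 2 * c' + 1
    have hco : Odd c := ⟨c', rfl⟩
    rw [jacobiSym.quadratic_reciprocity' hco hm, jacobiSym.quadratic_reciprocity' hco hd]
    have h1 : J((m : ℤ) | c) = J(-(d : ℤ) | c) := by
      apply jacobiSym.mod_left'
      apply Int.emod_emod_of_dvd _ (dvd_refl (c : ℤ)) |>.symm.trans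
      rw [Int.emod_emod_of_dvd _ (dvd_refl (c : ℤ))]
      refine Int.ModEq.symm (Int.modEq_iff_dvd.2 ?_)
      have : (c : ℤ) ∣ ((m + d : ℕ) : ℤ) := Int.natCast_dvd_natCast.2 ((Dvd.intro_left 4 rfl).trans h)
      simpa using this
    rw [h1, jacobiSym.neg _ hco]
    have h4 : 4 ∣ m + d := (Dvd.intro c rfl).trans h
    have hcm : c % 4 = 1 ∨ c % 4 = 3 := by omega
    have hmm : m % 4 = 1 ∨ m % 4 = 3 := by have := hm; rw [Nat.odd_iff] at this; omega
    rcases hcm with h' | h'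
    · rw [ZMod.χ₄_nat_one_mod_four h', qrSign.symm hm hco, qrSign.symm hd hco, qrSign, qrSign,
        ZMod.χ₄_nat_one_mod_four h']
      simp
    · rw [ZMod.χ₄_nat_three_mod_four h', qrSign, qrSign]
      rcases hmm with h'' | h''
      · rw [ZMod.χ₄_nat_one_mod_four h'', ZMod.χ₄_nat_three_mod_four (show d % 4 = 3 by omega)]
        simp [jacobiSym.at_neg_one hco, ZMod.χ₄_nat_three_mod_four h']
      · rw [ZMod.χ₄_nat_three_mod_four h'', ZMod.χ₄_nat_one_mod_four (show d % 4 = 1 by omega)]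
        simp [jacobiSym.at_neg_one hco, ZMod.χ₄_nat_three_mod_four h']

theorem jacobiSym_eq_of_modEq {c : ℤ} (hc : 4 ∣ c) {m d : ℕ} (hm : Odd m) (hd : Odd d)
    (h : c ∣ (m : ℤ) - d) : jacobiSym c m = jacobiSym c d := by
  obtain ⟨c, rfl⟩ := hc
  rw [jacobiSym.mul_left, jacobiSym.mul_left, jacobiSym.at_four hm, jacobiSym.at_four hd,
    jacobiSym.mod_right c hm, jacobiSym.mod_right c hd]
  congr 2
  have : m ≡ d [MOD (4 * c.natAbs)] := by
    rw [← Int.natCast_modEq_iff]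
    refine (Int.modEq_iff_dvd.2 ?_).symm
    push_cast
    rw [← abs_of_pos (show (0 : ℤ) < 4 by norm_num), ← abs_mul, abs_dvd]
    exact h
  exact this

/-- For negative `c` the extra factor `(-1/·)` takes opposite values at `m` and `d`, because `m ≡
-d` modulo `4`. -/
theorem jacobiSym_eq_sign_mul {c : ℤ} (hc : 4 ∣ c) (hc0 : c ≠ 0) {m d : ℕ} (hm : Odd m)
    (hd : Odd d) (h : c ∣ (m : ℤ) + d) : jacobiSym c m = c.sign * jacobiSym c d := by
  obtain ⟨c, rfl⟩ := hc
  rw [jacobiSym.mul_left, jacobiSym.mul_left, jacobiSym.at_four hm, jacobiSym.at_four hd]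
  have hc0' : c ≠ 0 := by rintro rfl; simp at hc0
  have h4 : 4 * c.natAbs ∣ m + d := by
    rw [← Int.natCast_dvd_natCast]
    push_cast
    rw [← abs_of_pos (show (0 : ℤ) < 4 by norm_num), ← abs_mul, abs_dvd]
    exact h
  have key := jacobiSym_eq_of_dvd_add c.natAbs hm hd (by simpa using hc0') h4
  rcases lt_or_gt_of_ne hc0' with hneg | hpos
  · have e : c = -(c.natAbs : ℤ) := by omega
    have hs : (4 * c).sign = -1 := Int.sign_eq_neg_one_of_neg (by omega)
    rw [hs, e, jacobiSym.neg _ hm, jacobiSym.neg _ hd, key]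
    have h4' : 4 ∣ m + d := (Dvd.intro _ rfl).trans h4
    have hmm : m % 4 = 1 ∨ m % 4 = 3 := by have := hm; rw [Nat.odd_iff] at this; omega
    rcases hmm with h'' | h''
    · rw [ZMod.χ₄_nat_one_mod_four h'', ZMod.χ₄_nat_three_mod_four (show d % 4 = 3 by omega)]
      ring
    · rw [ZMod.χ₄_nat_three_mod_four h'', ZMod.χ₄_nat_one_mod_four (show d % 4 = 1 by omega)]
      ring
  · have e : c = (c.natAbs : ℤ) := by omega
    have hs : (4 * c).sign = 1 := Int.sign_eq_one_of_pos (by omega)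
    rw [hs, e, key]
    ring

/-- If `d` and `d + nc` have opposite signs, their absolute values are negatives of each other
modulo `c`. The factor `sign c` which this produces is exactly what the sign convention in
`kronecker` absorbs. -/
theorem kronecker_add_mul {c d : ℤ} (hc : 4 ∣ c) (hd : d % 2 = 1) (n : ℤ) :
    kronecker c (d + n * c) = kronecker c d := by
  rcases eq_or_ne c 0 with rfl | hc0
  · simp
  have hd' : (d + n * c) % 2 = 1 := by
    obtain ⟨k, rfl⟩ := hc
    rw [show d + n * (4 * k) = d + 2 * (2 * n * k) by ring]
    generalize 2 * n * k = m
    omega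
  set d' := d + n * c with hdd
  have hsub : c ∣ d' - d := ⟨n, by rw [hdd]; ring⟩
  have o1 : Odd d.natAbs := by rw [Nat.odd_iff]; omega
  have o2 : Odd d'.natAbs := by rw [Nat.odd_iff]; omega
  unfold kronecker
  rcases lt_or_gt_of_ne (show d ≠ 0 by omega) with h1 | h1 <;>
  rcases lt_or_gt_of_ne (show d' ≠ 0 by omega) with h2 | h2
  · rw [jacobiSym_eq_of_modEq hc o2 o1]
    · simp [h1, h2]
    · have : ((d'.natAbs : ℤ)) - d.natAbs = -(d' - d) := by omega
      rw [this]; exact (dvd_neg).2 hsub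
  · rw [jacobiSym_eq_sign_mul hc hc0 o2 o1]
    · rcases lt_or_gt_of_ne hc0 with h3 | h3
      · simp [h1, h3, h2.le, Int.sign_eq_neg_one_of_neg h3]
      · simp [h3.not_gt, Int.sign_eq_one_of_pos h3]
    · have : ((d'.natAbs : ℤ)) + d.natAbs = (d' - d) := by omega
      rw [this]; exact hsub
  · rw [jacobiSym_eq_sign_mul hc hc0 o2 o1]
    · rcases lt_or_gt_of_ne hc0 with h3 | h3
      · simp [h1.le, h3, h2, Int.sign_eq_neg_one_of_neg h3]
      · simp [h3.not_gt, Int.sign_eq_one_of_pos h3]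
    · have : ((d'.natAbs : ℤ)) + d.natAbs = -(d' - d) := by omega
      rw [this]; exact (dvd_neg).2 hsub
  · rw [jacobiSym_eq_of_modEq hc o2 o1]
    · simp [h1.not_gt, h2.not_gt]
    · have : ((d'.natAbs : ℤ)) - d.natAbs = (d' - d) := by omega
      rw [this]; exact hsub

theorem epsilon_congr {d d' : ℤ} (h : (4 : ℤ) ∣ d' - d) : epsilon d' = epsilon d := by
  unfold epsilon
  rw [show d' % 4 = d % 4 by omega]

theorem kronecker_of_pos {d : ℤ} (hd : 0 < d) (c : ℤ) : kronecker c d = jacobiSym c d.natAbs := by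
  unfold kronecker; simp [hd.le]

theorem kronecker_add_mul_left {d : ℤ} (hd : 0 < d) (c m : ℤ) :
    kronecker (c + m * d) d = kronecker c d := by
  rw [kronecker_of_pos hd, kronecker_of_pos hd]
  apply jacobiSym.mod_left'
  have : (d.natAbs : ℤ) = d := by omega
  rw [this, Int.add_mul_emod_self_right]

theorem epsilon_sq {d : ℤ} (hd : d % 2 = 1) : epsilon d ^ 2 = (kronecker (-1) d : ℂ) := by
  have o1 : Odd d.natAbs := by rw [Nat.odd_iff]; omega
  unfold epsilon kronecker
  rw [jacobiSym.at_neg_one o1]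
  rcases lt_or_gt_of_ne (show d ≠ 0 by omega) with h1 | h1
  · rcases (show d % 4 = 1 ∨ d % 4 = 3 by omega) with h | h
    · rw [ZMod.χ₄_nat_three_mod_four (by omega)]
      simp [h, h1]
    · rw [ZMod.χ₄_nat_one_mod_four (by omega)]
      simp [h, h1]
  · rcases (show d % 4 = 1 ∨ d % 4 = 3 by omega) with h | h
    · rw [ZMod.χ₄_nat_one_mod_four (by omega)]
      simp [h, h1.le]
    · rw [ZMod.χ₄_nat_three_mod_four (by omega)]
      simp [h, h1.le]

theorem epsilon_ne_zero (d : ℤ) : epsilon d ≠ 0 := by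
  unfold epsilon; split_ifs <;> simp

theorem epsilon_pow_four (d : ℤ) : epsilon d ^ 4 = 1 := by
  unfold epsilon; split_ifs <;> simp

theorem jacobiSym_sq_of_isCoprime {c d : ℤ} (h : IsCoprime c d) : jacobiSym c d.natAbs ^ 2 = 1 := by
  apply jacobiSym.sq_one
  rw [Int.isCoprime_iff_gcd_eq_one] at h
  exact h

theorem kronecker_sq {c d : ℤ} (h : IsCoprime c d) : kronecker c d ^ 2 = 1 := by
  have := jacobiSym_sq_of_isCoprime h
  unfold kronecker
  split_ifs
  · rw [neg_sq, this]
  · exact this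

theorem kronecker_sq_complex {c d : ℤ} (h : IsCoprime c d) : (kronecker c d : ℂ) ^ 2 = 1 := by
  exact_mod_cast congrArg (Int.cast : ℤ → ℂ) (kronecker_sq h)

theorem kronecker_mul_of_pos {t : ℤ} (ht : 0 < t) (c d : ℤ) :
    kronecker (c * t) d = kronecker c d * jacobiSym t d.natAbs := by
  unfold kronecker
  rw [jacobiSym.mul_left]
  have : c * t < 0 ↔ c < 0 := by constructor <;> intro h <;> nlinarith
  simp only [this]
  split_ifs <;> ring

theorem kronecker_neg_neg {c d : ℤ} (hc : c ≠ 0) (hd : 0 < d) (hd2 : d % 2 = 1) :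
    (kronecker (-c) (-d) : ℂ) = -(c.sign : ℂ) * epsilon d ^ 2 * kronecker c d := by
  have o1 : Odd d.natAbs := by rw [Nat.odd_iff]; omega
  rw [epsilon_sq hd2, kronecker_of_pos hd, kronecker_of_pos hd]
  unfold kronecker
  rw [Int.natAbs_neg, jacobiSym.neg _ o1, ← jacobiSym.at_neg_one o1]
  rcases lt_or_gt_of_ne hc with h | h
  · simp [Int.sign_eq_neg_one_of_neg h, h.le, hd]
  · simp [Int.sign_eq_one_of_pos h, h, hd]

end

section

/-! ## The transformation law of the theta function of two variables under `Γ₀(4)` -/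

open Complex

theorem cpow_half_mul {x y : ℂ} (hx : x ≠ 0) (hy : y ≠ 0) (h : arg x + arg y ∈ Set.Ioc (-Real.pi) Real.pi) :
    (x * y) ^ (1 / 2 : ℂ) = x ^ (1 / 2 : ℂ) * y ^ (1 / 2 : ℂ) := by
  rw [cpow_def_of_ne_zero (mul_ne_zero hx hy), cpow_def_of_ne_zero hx, cpow_def_of_ne_zero hy,
    (log_mul_eq_add_log_iff hx hy).2 h, add_mul, Complex.exp_add]

theorem im_mul_eq_sin (x y : ℂ) : (x * y).im = ‖x‖ * ‖y‖ * Real.sin (arg x + arg y) := by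
  rw [Real.sin_add, mul_im]
  conv_lhs => rw [← norm_mul_cos_arg x, ← norm_mul_cos_arg y, ← norm_mul_sin_arg x,
    ← norm_mul_sin_arg y]
  ring

theorem cpow_half_mul_of_im_pos {x y : ℂ} (hx : 0 < x.im) (hy : 0 < y.im) (h : 0 < (x * y).im) :
    (x * y) ^ (1 / 2 : ℂ) = x ^ (1 / 2 : ℂ) * y ^ (1 / 2 : ℂ) := by
  have hx0 : x ≠ 0 := by rintro rfl; simp at hx
  have hy0 : y ≠ 0 := by rintro rfl; simp at hy
  apply cpow_half_mul hx0 hy0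
  have h1 := arg_nonneg_iff.2 hx.le
  have h2 := arg_nonneg_iff.2 hy.le
  have h3 := arg_le_pi x
  have h4 := arg_le_pi y
  refine ⟨by linarith [Real.pi_pos], ?_⟩
  by_contra! hc
  rw [im_mul_eq_sin] at h
  have : Real.sin (arg x + arg y) ≤ 0 := by
    have := Real.sin_nonneg_of_nonneg_of_le_pi (x := arg x + arg y - Real.pi) (by linarith)
      (by linarith)
    rw [Real.sin_sub_pi] at this
    linarith
  have := mul_nonneg (norm_nonneg x) (norm_nonneg y)
  nlinarith

theorem cpow_half_mul_of_im_neg {x y : ℂ} (hx : x.im < 0) (hy : y.im < 0) (h : (x * y).im < 0) :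
    (x * y) ^ (1 / 2 : ℂ) = x ^ (1 / 2 : ℂ) * y ^ (1 / 2 : ℂ) := by
  have hx0 : x ≠ 0 := by rintro rfl; simp at hx
  have hy0 : y ≠ 0 := by rintro rfl; simp at hy
  apply cpow_half_mul hx0 hy0
  have h1 := arg_neg_iff.2 hx
  have h2 := arg_neg_iff.2 hy
  have h3 := neg_pi_lt_arg x
  have h4 := neg_pi_lt_arg y
  refine ⟨?_, by linarith [Real.pi_pos]⟩
  by_contra! hc
  rw [im_mul_eq_sin] at h
  have : 0 ≤ Real.sin (arg x + arg y) := by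
    have := Real.sin_nonneg_of_nonneg_of_le_pi (x := arg x + arg y + 2 * Real.pi) (by linarith)
      (by linarith)
    rwa [Real.sin_add_two_pi] at this
  have := mul_nonneg (norm_nonneg x) (norm_nonneg y)
  nlinarith

theorem cpow_half_mul_of_im_opp {x y : ℂ} (hx : x.im < 0) (hy : 0 < y.im) :
    (x * y) ^ (1 / 2 : ℂ) = x ^ (1 / 2 : ℂ) * y ^ (1 / 2 : ℂ) := by
  have hx0 : x ≠ 0 := by rintro rfl; simp at hx
  have hy0 : y ≠ 0 := by rintro rfl; simp at hy
  apply cpow_half_mul hx0 hy0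
  have h1 := arg_neg_iff.2 hx
  have h2 := arg_nonneg_iff.2 hy.le
  have h3 := neg_pi_lt_arg x
  have h4 := arg_le_pi y
  exact ⟨by linarith, by linarith⟩

theorem cpow_half_mul_of_pos {x y : ℂ} (hx0 : x ≠ 0) {r : ℝ} (hr : 0 < r) (hy : y = r) :
    (x * y) ^ (1 / 2 : ℂ) = x ^ (1 / 2 : ℂ) * y ^ (1 / 2 : ℂ) := by
  apply cpow_half_mul hx0 (by rw [hy]; exact_mod_cast hr.ne')
  rw [hy, arg_ofReal_of_nonneg hr.le, add_zero]
  exact arg_mem_Ioc x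

theorem cpow_half_div_of_re_pos {x y : ℂ} (hx : 0 < x.re) (hy : 0 < y.re) :
    (x / y) ^ (1 / 2 : ℂ) = x ^ (1 / 2 : ℂ) / y ^ (1 / 2 : ℂ) := by
  have hx0 : x ≠ 0 := by rintro rfl; simp at hx
  have hy0 : y ≠ 0 := by rintro rfl; simp at hy
  have h1 := abs_arg_lt_pi_div_two_iff.2 (Or.inl hx)
  have h2 := abs_arg_lt_pi_div_two_iff.2 (Or.inl hy)
  have hne : arg y ≠ Real.pi := fun h => by
    rw [h, abs_of_pos Real.pi_pos] at h2; linarith [Real.pi_pos]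
  rw [abs_lt] at h1 h2
  have e : arg (y⁻¹) = - arg y := by rw [arg_inv, if_neg hne]
  rw [div_eq_mul_inv, cpow_half_mul hx0 (inv_ne_zero hy0) (by rw [e]; exact ⟨by linarith, by linarith⟩),
    inv_cpow _ _ hne, ← div_eq_mul_inv]

theorem jacobiTheta₂_add_two_mul_int (z τ : ℂ) (n : ℤ) :
    jacobiTheta₂ z (τ + 2 * n) = jacobiTheta₂ z τ := by
  have : Function.Periodic (jacobiTheta₂ z) 2 := jacobiTheta₂_add_right z
  rw [mul_comm]
  exact this.int_mul n τ

theorem jacobiTheta₂_add_int (z τ : ℂ) (n : ℤ) : jacobiTheta₂ (z + n) τ = jacobiTheta₂ z τ := by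
  have : Function.Periodic (fun z => jacobiTheta₂ z τ) 1 := fun z => jacobiTheta₂_add_left z τ
  have := this.int_mul n z
  rwa [mul_one] at this

theorem int_mul_add_ne_zero (c d : ℤ) (h : c ≠ 0 ∨ d ≠ 0) (τ : ℍ) : (c : ℂ) * τ + d ≠ 0 := by
  intro h0
  have h1 := congrArg Complex.im h0
  simp at h1
  have hτ : τ.im ≠ 0 := τ.im_ne_zero
  rcases h1 with h1 | h1
  · subst h1
    simp at h0
    rcases h with h | h
    · exact h rfl
    · exact h h0
  · exact hτ h1

theorem denom_ne_zero (γ : SL(2, ℤ)) (τ : ℍ) : (γ 1 0 : ℂ) * τ + γ 1 1 ≠ 0 := by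
  apply int_mul_add_ne_zero
  by_contra! h
  have := γ.det_coe
  rw [Matrix.det_fin_two, h.1, h.2] at this
  simp at this

theorem coe_sl_smul (γ : SL(2, ℤ)) (τ : ℍ) :
    ((γ • τ : ℍ) : ℂ) = ((γ 0 0 : ℂ) * τ + γ 0 1) / ((γ 1 0 : ℂ) * τ + γ 1 1) := by
  rw [UpperHalfPlane.specialLinearGroup_apply]
  simp

/-- The theta multiplier of weight `1 / 2`. -/
def thetaFactor (γ : SL(2, ℤ)) (τ : ℍ) : ℂ :=
  (kronecker (γ 1 0) (γ 1 1) : ℂ) * (epsilon (γ 1 1))⁻¹ *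
    ((γ 1 0 : ℂ) * τ + γ 1 1) ^ (1 / 2 : ℂ)

/-- The transformation law of the theta function under `γ`. -/
def ThetaLaw (γ : SL(2, ℤ)) : Prop := ∀ (w : ℂ) (τ : ℍ),
  jacobiTheta₂ (w / ((γ 1 0 : ℂ) * τ + γ 1 1)) (2 * ((γ • τ : ℍ) : ℂ)) =
    thetaFactor γ τ * cexp (2 * Real.pi * I * (γ 1 0 * w ^ 2 / (4 * ((γ 1 0 : ℂ) * τ + γ 1 1)))) *
      jacobiTheta₂ w (2 * τ)

theorem thetaLaw_of_eq_zero {γ : SL(2, ℤ)} (h : γ 1 0 = 0) : ThetaLaw γ := by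
  intro w τ
  have hdet := γ.det_coe
  rw [Matrix.det_fin_two, h, mul_zero, sub_zero] at hdet
  rw [coe_sl_smul, thetaFactor, h]
  rcases Int.eq_one_or_neg_one_of_mul_eq_one' hdet with ⟨ha, hd⟩ | ⟨ha, hd⟩
  · rw [ha, hd]
    have : 2 * ((((1 : ℤ) : ℂ) * (τ : ℂ) + (γ 0 1 : ℂ)) / (((0 : ℤ) : ℂ) * τ + ((1 : ℤ) : ℂ))) =
      2 * τ + 2 * (γ 0 1 : ℤ) := by push_cast; ring
    rw [this, jacobiTheta₂_add_two_mul_int]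
    simp [kronecker, epsilon]
  · rw [ha, hd]
    have : 2 * ((((-1 : ℤ) : ℂ) * (τ : ℂ) + (γ 0 1 : ℂ)) / (((0 : ℤ) : ℂ) * τ + ((-1 : ℤ) : ℂ))) =
      2 * τ + 2 * ((-γ 0 1 : ℤ) : ℂ) := by push_cast; ring
    rw [this, jacobiTheta₂_add_two_mul_int]
    -- The principal root of `-1` is `I`, and it is cancelled by the inverse of `epsilon (-1) = I`.
    have hI : (-1 : ℂ) ^ (1 / 2 : ℂ) = I := by
      rw [cpow_def_of_ne_zero (by simp), log_neg_one]
      rw [show (Real.pi : ℂ) * I * (1 / 2) = Real.pi / 2 * I by ring, exp_pi_div_two_mul_I]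
    rw [show w / (((0 : ℤ) : ℂ) * τ + ((-1 : ℤ) : ℂ)) = - w by push_cast; ring,
      jacobiTheta₂_neg_left]
    have : (((0 : ℤ) : ℂ) * τ + ((-1 : ℤ) : ℂ)) = -1 := by push_cast; ring
    rw [this, hI]
    simp [kronecker, epsilon]

theorem denom_mul (γ δ : SL(2, ℤ)) (τ : ℍ) :
    ((γ * δ) 1 0 : ℂ) * τ + (γ * δ) 1 1 =
      ((γ 1 0 : ℂ) * (δ • τ : ℍ) + γ 1 1) * ((δ 1 0 : ℂ) * τ + δ 1 1) := by
  have h := denom_ne_zero δ τ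
  rw [coe_sl_smul, Matrix.SpecialLinearGroup.coe_mul, Matrix.mul_apply, Matrix.mul_apply]
  simp only [Fin.sum_univ_two]
  push_cast
  field_simp
  ring

theorem thetaLaw_exponent (γ δ : SL(2, ℤ)) (w : ℂ) (τ : ℍ) :
    (2 * Real.pi * I * ((γ * δ) 1 0 * w ^ 2 / (4 * (((γ * δ) 1 0 : ℂ) * τ + (γ * δ) 1 1)))) =
      2 * Real.pi * I * (γ 1 0 * (w / ((δ 1 0 : ℂ) * τ + δ 1 1)) ^ 2 /
        (4 * ((γ 1 0 : ℂ) * (δ • τ : ℍ) + γ 1 1))) +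
      2 * Real.pi * I * (δ 1 0 * w ^ 2 / (4 * ((δ 1 0 : ℂ) * τ + δ 1 1))) := by
  have h1 := denom_ne_zero δ τ
  have h2 := denom_ne_zero γ (δ • τ)
  have hm := denom_mul γ δ τ
  rw [← mul_add]
  congr 1
  have hc : ((γ * δ) 1 0 : ℂ) * ((δ 1 0 : ℂ) * τ + δ 1 1) =
      γ 1 0 + δ 1 0 * (((γ * δ) 1 0 : ℂ) * τ + (γ * δ) 1 1) := by
    have hdet := δ.det_coe
    rw [Matrix.det_fin_two] at hdet
    have hdet' : (δ 0 0 : ℂ) * δ 1 1 - δ 0 1 * δ 1 0 = 1 := by exact_mod_cast hdet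
    rw [Matrix.SpecialLinearGroup.coe_mul, Matrix.mul_apply, Matrix.mul_apply]
    simp only [Fin.sum_univ_two]
    push_cast
    linear_combination (γ 1 0 : ℂ) * hdet'
  rw [hm] at hc ⊢
  field_simp
  linear_combination w ^ 2 * hc

/-- The theta values and the exponential factors compose along the action by themselves, so the law
for a product costs only the cocycle relation of the multipliers. -/
theorem ThetaLaw.mul {γ δ : SL(2, ℤ)} (h : ThetaLaw γ) (h' : ThetaLaw δ)
    (hf : ∀ τ : ℍ, thetaFactor (γ * δ) τ = thetaFactor γ (δ • τ) * thetaFactor δ τ) :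
    ThetaLaw (γ * δ) := by
  intro w τ
  have hm := denom_mul γ δ τ
  have e1 := h (w / ((δ 1 0 : ℂ) * τ + δ 1 1)) (δ • τ)
  rw [h' w τ] at e1
  rw [div_div, mul_comm ((δ 1 0 : ℂ) * τ + δ 1 1), ← hm, ← mul_smul] at e1
  rw [e1, hf τ, thetaLaw_exponent, Complex.exp_add]
  ring

/-- The matrix `(1 n; 0 1)`. -/
def upperU (n : ℤ) : SL(2, ℤ) := ⟨!![1, n; 0, 1], by simp [Matrix.det_fin_two]⟩

/-- The matrix `(1 0; n 1)`. -/
def lowerU (n : ℤ) : SL(2, ℤ) := ⟨!![1, 0; n, 1], by simp [Matrix.det_fin_two]⟩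

@[simp] theorem upperU_00 (n : ℤ) : upperU n 0 0 = 1 := rfl
@[simp] theorem upperU_01 (n : ℤ) : upperU n 0 1 = n := rfl
@[simp] theorem upperU_10 (n : ℤ) : upperU n 1 0 = 0 := rfl
@[simp] theorem upperU_11 (n : ℤ) : upperU n 1 1 = 1 := rfl
@[simp] theorem lowerU_00 (n : ℤ) : lowerU n 0 0 = 1 := rfl
@[simp] theorem lowerU_01 (n : ℤ) : lowerU n 0 1 = 0 := rfl
@[simp] theorem lowerU_10 (n : ℤ) : lowerU n 1 0 = n := rfl
@[simp] theorem lowerU_11 (n : ℤ) : lowerU n 1 1 = 1 := rfl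

theorem coe_upperU_smul (n : ℤ) (τ : ℍ) : ((upperU n • τ : ℍ) : ℂ) = τ + n := by
  rw [coe_sl_smul]; simp

theorem coe_lowerU_smul (n : ℤ) (τ : ℍ) : ((lowerU n • τ : ℍ) : ℂ) = τ / (n * τ + 1) := by
  rw [coe_sl_smul]; simp

theorem mul_apply_sl (γ δ : SL(2, ℤ)) (i j : Fin 2) :
    (γ * δ) i j = γ i 0 * δ 0 j + γ i 1 * δ 1 j := by
  rw [Matrix.SpecialLinearGroup.coe_mul, Matrix.mul_apply, Fin.sum_univ_two]

theorem thetaFactor_upperU (n : ℤ) (τ : ℍ) : thetaFactor (upperU n) τ = 1 := by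
  simp [thetaFactor, kronecker, epsilon]

theorem thetaFactor_lowerU (n : ℤ) (τ : ℍ) :
    thetaFactor (lowerU n) τ = ((n : ℂ) * τ + 1) ^ (1 / 2 : ℂ) := by
  simp [thetaFactor, kronecker, epsilon]

theorem thetaFactor_mul_upperU {γ : SL(2, ℤ)} (h4 : (4 : ℤ) ∣ γ 1 0) (hodd : γ 1 1 % 2 = 1)
    (n : ℤ) (τ : ℍ) :
    thetaFactor (γ * upperU n) τ = thetaFactor γ (upperU n • τ) * thetaFactor (upperU n) τ := by
  rw [thetaFactor_upperU, mul_one, thetaFactor, thetaFactor, denom_mul]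
  have h1 : (γ * upperU n) 1 0 = γ 1 0 := by rw [mul_apply_sl]; simp
  have h2 : (γ * upperU n) 1 1 = γ 1 1 + n * γ 1 0 := by rw [mul_apply_sl]; simp; ring
  rw [h1, h2, kronecker_add_mul h4 hodd, epsilon_congr (d := γ 1 1)]
  · simp
  · rw [add_sub_cancel_left]; exact h4.mul_left n

/-- The imaginary parts of the two factors and of their product have the signs of `c`, `m` and `c +
md`. As `d > 0`, two equal signs force the third, so the arguments do not wrap around; with opposite
signs they cannot. -/
theorem sqrt_denom_mul_lowerU {γ : SL(2, ℤ)} (hd : 0 < γ 1 1) (m : ℤ) (τ : ℍ) :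
    (((γ 1 0 : ℂ) * (lowerU m • τ : ℍ) + γ 1 1) * ((m : ℂ) * τ + 1)) ^ (1 / 2 : ℂ) =
    ((γ 1 0 : ℂ) * (lowerU m • τ : ℍ) + γ 1 1) ^ (1 / 2 : ℂ) * ((m : ℂ) * τ + 1) ^ (1 / 2 : ℂ) := by
  have hprod : (((γ 1 0 : ℂ) * (lowerU m • τ : ℍ) + γ 1 1) * ((m : ℂ) * τ + 1)) =
      ((γ 1 0 + m * γ 1 1 : ℤ) : ℂ) * τ + γ 1 1 := by
    have := denom_mul γ (lowerU m) τ
    rw [mul_apply_sl, mul_apply_sl] at this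
    simp only [lowerU_00, lowerU_01, lowerU_10, lowerU_11, mul_one, mul_zero, zero_add] at this
    push_cast at this
    rw [← this]
    push_cast
    ring
  have himp : ((((γ 1 0 : ℂ) * (lowerU m • τ : ℍ) + γ 1 1) * ((m : ℂ) * τ + 1))).im =
      ((γ 1 0 + m * γ 1 1 : ℤ) : ℝ) * τ.im := by
    rw [hprod]; simp
  have hx : ((γ 1 0 : ℂ) * (lowerU m • τ : ℍ) + γ 1 1).im = (γ 1 0 : ℝ) * (lowerU m • τ).im := by
    simp
  have hy : ((m : ℂ) * τ + 1).im = m * τ.im := by simp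
  have p1 := τ.im_pos
  have p2 := (lowerU m • τ).im_pos
  have hy0 : (m : ℂ) * τ + 1 ≠ 0 := by
    have := denom_ne_zero (lowerU m) τ; simpa using this
  have hx0 := denom_ne_zero γ (lowerU m • τ)
  rcases lt_trichotomy m 0 with hm | rfl | hm
  · have hm' : (m : ℝ) < 0 := by exact_mod_cast hm
    have hyn : ((m : ℂ) * τ + 1).im < 0 := by rw [hy]; exact mul_neg_of_neg_of_pos hm' p1
    rcases lt_trichotomy (γ 1 0) 0 with hc | hc | hc
    · have hc' : (γ 1 0 : ℝ) < 0 := by exact_mod_cast hc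
      apply cpow_half_mul_of_im_neg _ hyn
      · rw [himp]
        apply mul_neg_of_neg_of_pos _ p1
        have : γ 1 0 + m * γ 1 1 < 0 := by nlinarith
        exact_mod_cast this
      · rw [hx]; exact mul_neg_of_neg_of_pos hc' p2
    · rw [mul_comm, mul_comm (_ ^ (1 / 2 : ℂ))]
      exact cpow_half_mul_of_pos hy0 (r := (γ 1 1 : ℝ)) (by exact_mod_cast hd) (by rw [hc]; simp)
    · have hc' : (0 : ℝ) < γ 1 0 := by exact_mod_cast hc
      rw [mul_comm, mul_comm (_ ^ (1 / 2 : ℂ))]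
      exact cpow_half_mul_of_im_opp hyn (by rw [hx]; exact mul_pos hc' p2)
  · simp
  · have hm' : (0 : ℝ) < m := by exact_mod_cast hm
    have hyn : 0 < ((m : ℂ) * τ + 1).im := by rw [hy]; exact mul_pos hm' p1
    rcases lt_trichotomy (γ 1 0) 0 with hc | hc | hc
    · have hc' : (γ 1 0 : ℝ) < 0 := by exact_mod_cast hc
      exact cpow_half_mul_of_im_opp (by rw [hx]; exact mul_neg_of_neg_of_pos hc' p2) hyn
    · rw [mul_comm, mul_comm (_ ^ (1 / 2 : ℂ))]
      exact cpow_half_mul_of_pos hy0 (r := (γ 1 1 : ℝ)) (by exact_mod_cast hd) (by rw [hc]; simp)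
    · have hc' : (0 : ℝ) < γ 1 0 := by exact_mod_cast hc
      apply cpow_half_mul_of_im_pos _ hyn
      · rw [himp]
        apply mul_pos _ p1
        have : 0 < γ 1 0 + m * γ 1 1 := by nlinarith
        exact_mod_cast this
      · rw [hx]; exact mul_pos hc' p2

theorem thetaFactor_mul_lowerU {γ : SL(2, ℤ)} (hd : 0 < γ 1 1) (m : ℤ) (τ : ℍ) :
    thetaFactor (γ * lowerU m) τ = thetaFactor γ (lowerU m • τ) * thetaFactor (lowerU m) τ := by
  rw [thetaFactor_lowerU, thetaFactor, thetaFactor, denom_mul]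
  have h1 : (γ * lowerU m) 1 0 = γ 1 0 + m * γ 1 1 := by rw [mul_apply_sl]; simp; ring
  have h2 : (γ * lowerU m) 1 1 = γ 1 1 := by rw [mul_apply_sl]; simp
  rw [h1, h2, kronecker_add_mul_left hd, lowerU_10, lowerU_11, Int.cast_one,
    sqrt_denom_mul_lowerU hd]
  ring

theorem sqrt_denom_lowerU (m : ℤ) (τ : ℍ) {r : ℝ} (hr : 0 < r) : ((m : ℂ) * τ + 1) ^ (1 / 2 : ℂ) =
    (-I * (r * (τ : ℂ))) ^ (1 / 2 : ℂ) / (-I * (r * ((lowerU m • τ : ℍ) : ℂ))) ^ (1 / 2 : ℂ) := by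
  have h1 : ∀ σ : ℍ, 0 < (-I * (r * (σ : ℂ))).re := fun σ => by
    simpa using mul_pos hr σ.im_pos
  rw [← cpow_half_div_of_re_pos (h1 _) (h1 _)]
  congr 1
  rw [coe_lowerU_smul]
  have := denom_ne_zero (lowerU m) τ
  simp at this
  have := τ.ne_zero
  have : (r : ℂ) ≠ 0 := by exact_mod_cast hr.ne'
  field_simp

/-- The functional equation exchanges `2τ` and `-1/(2τ)`. On the latter `lowerU (4m)` acts as
translation by `-2m`, under which the theta function is invariant; what remains is a quotient of two
square roots. -/
theorem thetaLaw_lowerU (m : ℤ) : ThetaLaw (lowerU (4 * m)) := by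
  intro w τ
  rw [thetaFactor_lowerU, coe_lowerU_smul, lowerU_10, lowerU_11]
  have hD := denom_ne_zero (lowerU (4 * m)) τ
  rw [lowerU_10, lowerU_11] at hD
  have hτ := τ.ne_zero
  have hs := sqrt_denom_lowerU (4 * m) τ (r := 2) (by norm_num)
  rw [coe_lowerU_smul] at hs
  set D := (((4 * m : ℤ) : ℂ)) * τ + ((1 : ℤ) : ℂ) with hDdef
  have hD1 : (((4 * m : ℤ) : ℂ)) * τ + 1 = D := by rw [hDdef]; simp
  rw [hD1] at hs ⊢
  push_cast at hs
  have e1 : w / D / (2 * (τ / D)) = w / (2 * τ) := by field_simp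
  have e2 : -1 / (2 * (τ / D)) = -1 / (2 * (τ : ℂ)) + 2 * ((-m : ℤ) : ℂ) := by
    rw [hDdef]; push_cast; field_simp; ring
  have hsq : (-I * (2 * (τ : ℂ))) ^ (1 / 2 : ℂ) ≠ 0 := by
    rw [Ne, cpow_eq_zero_iff]; simp [hτ]
  have e3 : cexp (-Real.pi * I * (w / D) ^ 2 / (2 * (τ / D))) =
      cexp (2 * Real.pi * I * (((4 * m : ℤ) : ℂ) * w ^ 2 / (4 * D))) *
        cexp (-Real.pi * I * w ^ 2 / (2 * τ)) := by
    rw [← Complex.exp_add]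
    congr 1
    rw [hDdef] at hD ⊢
    push_cast at hD ⊢
    field_simp
    ring
  rw [jacobiTheta₂_functional_equation (w / D), jacobiTheta₂_functional_equation w, e1, e2,
    jacobiTheta₂_add_two_mul_int, e3, hs]
  field_simp

theorem cpow_half_neg {x : ℂ} {s : ℤ} (hs : (s = 1 ∧ 0 < x.im) ∨ (s = -1 ∧ x.im < 0)) :
    (-x) ^ (1 / 2 : ℂ) = -(s : ℂ) * I * x ^ (1 / 2 : ℂ) := by
  have hx0 : x ≠ 0 := by rintro rfl; simp at hs
  rw [cpow_def_of_ne_zero (neg_ne_zero.2 hx0), cpow_def_of_ne_zero hx0]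
  have hl : log (-x) = log x - s * (Real.pi * I) := by
    rw [log, log, norm_neg]
    rcases hs with ⟨rfl, h⟩ | ⟨rfl, h⟩
    · rw [arg_neg_eq_arg_sub_pi_of_im_pos h]; push_cast; ring
    · rw [arg_neg_eq_arg_add_pi_of_im_neg h]; push_cast; ring
  rw [hl, sub_mul, Complex.exp_sub]
  rcases hs with ⟨rfl, h⟩ | ⟨rfl, h⟩
  · rw [show ((1 : ℤ) : ℂ) * (Real.pi * I) * (1 / 2) = Real.pi / 2 * I by push_cast; ring,
      exp_pi_div_two_mul_I, div_I]
    push_cast; ring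
  · rw [show ((-1 : ℤ) : ℂ) * (Real.pi * I) * (1 / 2) = -(Real.pi / 2 * I) by push_cast; ring,
      Complex.exp_neg, exp_pi_div_two_mul_I]
    rw [inv_I]; field_simp; push_cast; ring_nf; simp

theorem epsilon_neg {d : ℤ} (hd : d % 2 = 1) : I * epsilon d ^ 2 * (epsilon (-d))⁻¹ = (epsilon d)⁻¹ := by
  unfold epsilon
  rcases (show d % 4 = 1 ∨ d % 4 = 3 by omega) with h | h
  · rw [if_pos h, if_neg (by omega)]; simp
  · rw [if_neg (by omega), if_pos (by omega)]; simp

/-- Negating the denominator multiplies its root by `±I`, with sign opposite to that of `c`; the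
change of the symbol and of `ε_d` compensates for this. A pair `±γ` acts identically, so consistency
requires it. -/
theorem thetaFactor_neg {γ : SL(2, ℤ)} (hc : γ 1 0 ≠ 0) (hd : 0 < γ 1 1) (hd2 : γ 1 1 % 2 = 1) (τ : ℍ) :
    thetaFactor (-γ) τ = thetaFactor γ τ := by
  have h1 : (-γ) 1 0 = - γ 1 0 := by simp
  have h2 : (-γ) 1 1 = - γ 1 1 := by simp
  rw [thetaFactor, thetaFactor, h1, h2, kronecker_neg_neg hc hd hd2]
  have hx : ((γ 1 0 : ℂ) * τ + γ 1 1).im = (γ 1 0 : ℝ) * τ.im := by simp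
  have hs : ((γ 1 0).sign = 1 ∧ 0 < ((γ 1 0 : ℂ) * τ + γ 1 1).im) ∨
      ((γ 1 0).sign = -1 ∧ ((γ 1 0 : ℂ) * τ + γ 1 1).im < 0) := by
    rw [hx]
    rcases lt_or_gt_of_ne hc with h | h
    · exact Or.inr ⟨Int.sign_eq_neg_one_of_neg h, mul_neg_of_neg_of_pos (by exact_mod_cast h) τ.im_pos⟩
    · exact Or.inl ⟨Int.sign_eq_one_of_pos h, mul_pos (by exact_mod_cast h) τ.im_pos⟩
  have hsq : ((γ 1 0).sign : ℂ) ^ 2 = 1 := by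
    rcases hs with ⟨h, -⟩ | ⟨h, -⟩ <;> rw [h] <;> simp
  rw [show (((-γ 1 0 : ℤ)) : ℂ) * τ + ((-γ 1 1 : ℤ) : ℂ) = -((γ 1 0 : ℂ) * τ + γ 1 1) by push_cast; ring,
    cpow_half_neg hs, ← epsilon_neg hd2]
  linear_combination I * epsilon (γ 1 1) ^ 2 * (kronecker (γ 1 0) (γ 1 1) : ℂ) *
    (epsilon (-γ 1 1))⁻¹ * ((γ 1 0 : ℂ) * τ + γ 1 1) ^ (1 / 2 : ℂ) * hsq

theorem ThetaLaw.neg {γ : SL(2, ℤ)} (h : ThetaLaw γ) (hc : γ 1 0 ≠ 0) (hd : 0 < γ 1 1)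
    (hd2 : γ 1 1 % 2 = 1) : ThetaLaw (-γ) := by
  intro w τ
  have h1 : (-γ) 1 0 = - γ 1 0 := by simp
  have h2 : (-γ) 1 1 = - γ 1 1 := by simp
  rw [thetaFactor_neg hc hd hd2, ModularGroup.SL_neg_smul, h1, h2]
  have e : (((-γ 1 0 : ℤ)) : ℂ) * τ + ((-γ 1 1 : ℤ) : ℂ) = -((γ 1 0 : ℂ) * τ + γ 1 1) := by
    push_cast; ring
  rw [e, div_neg, jacobiTheta₂_neg_left, h w τ]
  congr 3
  rw [mul_neg, div_neg, Int.cast_neg, neg_mul, neg_div, neg_neg]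

theorem odd_of_four_dvd {γ : SL(2, ℤ)} (h : (4 : ℤ) ∣ γ 1 0) : γ 1 1 % 2 = 1 := by
  have hdet := γ.det_coe
  rw [Matrix.det_fin_two] at hdet
  obtain ⟨k, hk⟩ := h
  rw [hk] at hdet
  rcases Int.emod_two_eq_zero_or_one (γ 1 1) with h0 | h0
  · obtain ⟨m, hm⟩ := Int.dvd_of_emod_eq_zero h0
    rw [hm] at hdet
    have : γ 0 0 * (2 * m) - γ 0 1 * (4 * k) = 2 * (γ 0 0 * m - 2 * (γ 0 1 * k)) := by ring
    omega
  · exact h0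

theorem upperU_mul_neg (n : ℤ) : upperU n * upperU (-n) = 1 := by
  ext i j
  rw [mul_apply_sl]
  fin_cases i <;> fin_cases j <;> simp

theorem lowerU_mul_neg (n : ℤ) : lowerU n * lowerU (-n) = 1 := by
  ext i j
  rw [mul_apply_sl]
  fin_cases i <;> fin_cases j <;> simp

/-- The theta function of two variables transforms with the theta multiplier under `Γ₀(4)`. -/
theorem thetaLaw_of_four_dvd (γ : SL(2, ℤ)) (h : (4 : ℤ) ∣ γ 1 0) : ThetaLaw γ := by
  -- Euclid's algorithm on the bottom row `(c, d)`: if `|c| < 2|d|`, then `upperU (±1)` decreases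
  -- `|d|`; if `|c| > 2|d|`, then `lowerU (±4)` decreases `|c|`.
  induction hn : (γ 1 0).natAbs + (γ 1 1).natAbs using Nat.strong_induction_on generalizing γ with
  | _ n ih =>
  have hodd := odd_of_four_dvd h
  rcases eq_or_ne (γ 1 0) 0 with hc | hc
  · exact thetaLaw_of_eq_zero hc
  have hU : ∀ m : ℤ, (4 : ℤ) ∣ (γ * upperU m) 1 0 → ((γ 1 1) + m * γ 1 0).natAbs < (γ 1 1).natAbs →
      ThetaLaw γ := by
    intro m h4 hlt
    have e1 : (γ * upperU m) 1 0 = γ 1 0 := by rw [mul_apply_sl]; simp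
    have e2 : (γ * upperU m) 1 1 = γ 1 1 + m * γ 1 0 := by rw [mul_apply_sl]; simp; ring
    have h' := ih _ (by rw [e1, e2, ← hn]; omega) (γ * upperU m) h4 rfl
    have := h'.mul (thetaLaw_of_eq_zero (upperU_10 (-m)))
      (thetaFactor_mul_upperU h4 (odd_of_four_dvd h4) (-m))
    rwa [mul_assoc, upperU_mul_neg, mul_one] at this
  have hL : ∀ δ : SL(2, ℤ), (4 : ℤ) ∣ δ 1 0 → (δ 1 0).natAbs = (γ 1 0).natAbs →
      (δ 1 1).natAbs = (γ 1 1).natAbs → 0 < δ 1 1 → 2 * (δ 1 1).natAbs < (δ 1 0).natAbs →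
      ThetaLaw δ := by
    intro δ h4 hδc hδd hpos hlt
    have key : ∀ m : ℤ, (δ 1 0 + 4 * m * δ 1 1).natAbs < (δ 1 0).natAbs → ThetaLaw δ := by
      intro m hm
      have e1 : (δ * lowerU (4 * m)) 1 0 = δ 1 0 + 4 * m * δ 1 1 := by
        rw [mul_apply_sl]; simp; ring
      have e2 : (δ * lowerU (4 * m)) 1 1 = δ 1 1 := by rw [mul_apply_sl]; simp
      have h4' : (4 : ℤ) ∣ (δ * lowerU (4 * m)) 1 0 := by
        rw [e1, mul_assoc]; exact dvd_add h4 (dvd_mul_right _ _)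
      have h' := ih _ (by rw [e1, e2, ← hn]; omega) (δ * lowerU (4 * m)) h4' rfl
      have := h'.mul (thetaLaw_lowerU (-m)) (thetaFactor_mul_lowerU (by rw [e2]; exact hpos) _)
      rwa [mul_assoc, mul_neg, lowerU_mul_neg, mul_one] at this
    rcases lt_or_ge (δ 1 0) 0 with hneg | hge
    · exact key 1 (by omega)
    · exact key (-1) (by omega)
  -- Equality cannot occur: `c` is divisible by `4` and `d` is odd.
  have hne : (γ 1 0).natAbs ≠ 2 * (γ 1 1).natAbs := by omega
  have e1 : ∀ m, (γ * upperU m) 1 0 = γ 1 0 := fun m => by rw [mul_apply_sl]; simp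
  rcases lt_or_ge (γ 1 0).natAbs (2 * (γ 1 1).natAbs) with hlt | hge
  · by_cases hs : 0 < γ 1 0 ↔ 0 < γ 1 1
    · exact hU (-1) (by rw [e1]; exact h) (by omega)
    · exact hU 1 (by rw [e1]; exact h) (by omega)
  · rcases lt_or_ge 0 (γ 1 1) with hd | hd
    · exact hL γ h rfl rfl hd (by omega)
    -- The cocycle relation for `lowerU` is only available for `d > 0`, so for negative `d` the
    -- matrix is replaced by its negative.
    · have h1 : (-γ) 1 0 = - γ 1 0 := by simp
      have h2 : (-γ) 1 1 = - γ 1 1 := by simp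
      have := (hL (-γ) (by rw [h1]; exact h.neg_right) (by rw [h1]; omega) (by rw [h2]; omega)
        (by rw [h2]; omega) (by rw [h1, h2]; omega)).neg (by rw [h1]; omega) (by rw [h2]; omega)
        (by rw [h2]; omega)
      rwa [neg_neg] at this

end

section

/-! ## The slash operator as a right action of `Γ₀(4)` -/

open Complex

theorem integral_exp_two_pi_int (n : ℤ) :
    ∫ x in (0 : ℝ)..1, cexp (2 * Real.pi * I * n * x) = if n = 0 then 1 else 0 := by
  split_ifs with h
  · simp [h]
  · have h0 : (2 * Real.pi * I * n : ℂ) ≠ 0 := by simp [h, Real.pi_ne_zero]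
    rw [integral_exp_mul_complex h0]
    have : cexp (2 * Real.pi * I * n * (1 : ℝ)) = 1 := by
      rw [show (2 * Real.pi * I * n * (1 : ℝ) : ℂ) = n * (2 * Real.pi * I) by push_cast; ring]
      exact exp_int_mul_two_pi_mul_I n
    rw [this]
    simp

/-- The mean value over `z ∈ [0, 1]` is the constant Fourier coefficient, which is `1`. -/
theorem exists_jacobiTheta₂_ne_zero {τ : ℂ} (hτ : 0 < τ.im) : ∃ w, jacobiTheta₂ w τ ≠ 0 := by
  by_contra! h
  let f : ℤ → C(ℝ, ℂ) := fun n => ⟨fun x => jacobiTheta₂_term n x τ, by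
    unfold jacobiTheta₂_term; fun_prop⟩
  have hnorm : ∀ n (x : ℝ), ‖jacobiTheta₂_term n x τ‖ = ‖jacobiTheta₂_term n 0 τ‖ := by
    intro n x
    rw [norm_jacobiTheta₂_term, norm_jacobiTheta₂_term]; simp
  have hs : Summable fun n : ℤ => ‖(f n).restrict (⟨Set.uIcc (0 : ℝ) 1, isCompact_uIcc⟩ :
      TopologicalSpace.Compacts ℝ)‖ := by
    refine Summable.of_nonneg_of_le (fun _ => norm_nonneg _) (fun n => ?_)
      (((summable_jacobiTheta₂_term_iff 0 τ).2 hτ).norm)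
    rw [ContinuousMap.norm_le _ (norm_nonneg _)]
    rintro ⟨x, hx⟩
    exact (hnorm n x).le
  have h1 := intervalIntegral.hasSum_intervalIntegral_of_summable_norm hs
  have h2 : ∀ x : ℝ, ∑' n, f n x = 0 := fun x => h x
  simp only [h2, intervalIntegral.integral_zero] at h1
  have h3 : ∀ n : ℤ, ∫ x in (0 : ℝ)..1, f n x = if n = 0 then 1 else 0 := by
    intro n
    have : ∀ x : ℝ, f n x = cexp (2 * Real.pi * I * n * x) * cexp (Real.pi * I * n ^ 2 * τ) := by
      intro x
      rw [← Complex.exp_add]; rfl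
    simp_rw [this]
    rw [intervalIntegral.integral_mul_const, integral_exp_two_pi_int]
    split_ifs with hn <;> simp [hn]
  simp_rw [h3] at h1
  exact zero_ne_one (h1.unique (hasSum_ite_eq 0 1))

theorem thetaFactor_ne_zero {γ : SL(2, ℤ)} (h : (4 : ℤ) ∣ γ 1 0) (τ : ℍ) : thetaFactor γ τ ≠ 0 := by
  obtain ⟨w, hw⟩ := exists_jacobiTheta₂_ne_zero (τ := 2 * ((γ • τ : ℍ) : ℂ)) (by
    simpa using (γ • τ).im_pos)
  intro h0
  have := thetaLaw_of_four_dvd γ h (w * ((γ 1 0 : ℂ) * τ + γ 1 1)) τ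
  rw [h0, mul_div_cancel_right₀ _ (denom_ne_zero γ τ)] at this
  exact hw (by rw [this]; ring)

theorem four_dvd_mul {γ δ : SL(2, ℤ)} (h : (4 : ℤ) ∣ γ 1 0) (h' : (4 : ℤ) ∣ δ 1 0) :
    (4 : ℤ) ∣ (γ * δ) 1 0 := by
  rw [mul_apply_sl]
  exact dvd_add (h.mul_right _) (h'.mul_left _)

/-- The theta law for `γδ` is obtained in two ways, directly and by composition; comparing them at a
`w` where the theta function does not vanish gives the cocycle relation without any further
discussion of branches. -/
theorem thetaFactor_mul {γ δ : SL(2, ℤ)} (h : (4 : ℤ) ∣ γ 1 0) (h' : (4 : ℤ) ∣ δ 1 0) (τ : ℍ) :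
    thetaFactor (γ * δ) τ = thetaFactor γ (δ • τ) * thetaFactor δ τ := by
  obtain ⟨w, hw⟩ := exists_jacobiTheta₂_ne_zero (τ := 2 * (τ : ℂ)) (by simpa using τ.im_pos)
  have h1 := denom_ne_zero δ τ
  have h2 := denom_ne_zero γ (δ • τ)
  have h3 := denom_ne_zero (γ * δ) τ
  have hm := denom_mul γ δ τ
  have e1 := thetaLaw_of_four_dvd γ h (w / ((δ 1 0 : ℂ) * τ + δ 1 1)) (δ • τ)
  rw [thetaLaw_of_four_dvd δ h' w τ, div_div, mul_comm ((δ 1 0 : ℂ) * τ + δ 1 1), ← hm, ← mul_smul,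
    thetaLaw_of_four_dvd _ (four_dvd_mul h h') w τ, thetaLaw_exponent] at e1
  rw [Complex.exp_add] at e1
  have := mul_right_cancel₀ hw (e1.trans (by ring : _ = thetaFactor γ (δ • τ) * thetaFactor δ τ *
    (cexp (2 * Real.pi * I * (γ 1 0 * (w / ((δ 1 0 : ℂ) * τ + δ 1 1)) ^ 2 /
        (4 * ((γ 1 0 : ℂ) * (δ • τ : ℍ) + γ 1 1)))) *
      cexp (2 * Real.pi * I * (δ 1 0 * w ^ 2 / (4 * ((δ 1 0 : ℂ) * τ + δ 1 1))))) *
      jacobiTheta₂ w (2 * τ)))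
  exact mul_right_cancel₀ (mul_ne_zero (Complex.exp_ne_zero _) (Complex.exp_ne_zero _)) this

theorem isCoprime_bottom (γ : SL(2, ℤ)) : IsCoprime (γ 1 0) (γ 1 1) := by
  have hdet := γ.det_coe
  rw [Matrix.det_fin_two] at hdet
  exact ⟨-γ 0 1, γ 0 0, by linarith⟩

/-- For odd `k` the symbol, being `±1`, is its own inverse `k`-th power. In this form the cocycle
relation of the theta multiplier makes `slash` a right action of `Γ₀(4)`. -/
theorem slash_eq_thetaFactor {k : ℕ} (hk : Odd k) (γ : SL(2, ℤ)) (f : ℍ → ℂ) (z : ℍ) :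
    slash k γ f z = ((thetaFactor γ z) ^ k)⁻¹ * f (γ • z) := by
  unfold slash thetaFactor
  congr 1
  have hkr : (kronecker (γ 1 0) (γ 1 1) : ℂ)⁻¹ ^ k = kronecker (γ 1 0) (γ 1 1) := by
    have h2 := kronecker_sq_complex (isCoprime_bottom γ)
    have h0 : (kronecker (γ 1 0) (γ 1 1) : ℂ) ≠ 0 := fun h => by rw [h] at h2; simp at h2
    obtain ⟨m, rfl⟩ := hk
    rw [inv_pow, pow_succ, pow_mul, h2, one_pow, one_mul]
    field_simp
    exact h2.symm
  rw [← inv_pow, mul_inv, mul_inv, mul_pow, mul_pow, hkr, inv_inv, inv_pow, ← cpow_nat_mul]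
  congr 1
  rw [← cpow_neg]
  congr 1
  ring

theorem slash_mul {k : ℕ} (hk : Odd k) {γ δ : SL(2, ℤ)} (h : (4 : ℤ) ∣ γ 1 0) (h' : (4 : ℤ) ∣ δ 1 0)
    (f : ℍ → ℂ) : slash k (γ * δ) f = slash k δ (slash k γ f) := by
  ext z
  rw [slash_eq_thetaFactor hk, slash_eq_thetaFactor hk, slash_eq_thetaFactor hk,
    thetaFactor_mul h h', mul_smul, mul_pow, mul_inv]
  ring

theorem slash_smul (k : ℕ) (γ : SL(2, ℤ)) (c : ℂ) (f : ℍ → ℂ) :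
    slash k γ (c • f) = c • slash k γ f := by
  ext z; simp only [slash, Pi.smul_apply, smul_eq_mul]; ring

theorem slash_sum {ι : Type*} (k : ℕ) (γ : SL(2, ℤ)) (s : Finset ι) (f : ι → ℍ → ℂ) :
    slash k γ (∑ i ∈ s, f i) = ∑ i ∈ s, slash k γ (f i) := by
  ext z; simp only [slash, Finset.sum_apply, Finset.mul_sum]

end

section

/-! ## Theta series of rank one with congruence conditions -/

open Complex

/-- `∑_{k ≡ r (mod D)} e^{2πi s k² τ}`. -/
def thetaOne (s : ℚ) (D : ℕ) (r : ZMod D) (τ : ℍ) : ℂ :=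
  ∑' k : ℤ, if (k : ZMod D) = r then cexp (2 * Real.pi * I * ((s * k ^ 2 : ℚ) : ℂ) * τ) else 0

theorem norm_exp_two_pi_rat (q : ℚ) (τ : ℍ) :
    ‖cexp (2 * Real.pi * I * (q : ℂ) * τ)‖ = Real.exp (-(2 * Real.pi * q * τ.im)) := by
  rw [Complex.norm_exp]
  congr 1
  have : (2 * Real.pi * I * (q : ℂ) * τ : ℂ) = ((2 * Real.pi * q : ℝ) : ℂ) * (τ * I) := by
    push_cast; ring
  rw [this, re_ofReal_mul]
  simp

theorem summable_exp_neg_mul_sq {c : ℝ} (hc : 0 < c) :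
    Summable fun k : ℤ => Real.exp (-(c * (k : ℝ) ^ 2)) := by
  have hc' : 0 < (I * ((c / Real.pi : ℝ) : ℂ)).im := by simpa using div_pos hc Real.pi_pos
  refine (((summable_jacobiTheta₂_term_iff 0 (I * ((c / Real.pi : ℝ) : ℂ))).2 hc').norm).congr
    fun k => ?_
  rw [norm_jacobiTheta₂_term]
  congr 1
  have := Real.pi_ne_zero
  simp
  field_simp

theorem summable_norm_thetaOne {s : ℚ} (hs : 0 < s) (D : ℕ) (r : ZMod D) (τ : ℍ) :
    Summable fun k : ℤ =>
      ‖if (k : ZMod D) = r then cexp (2 * Real.pi * I * ((s * k ^ 2 : ℚ) : ℂ) * τ) else 0‖ := by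
  have hc : 0 < 2 * Real.pi * s * τ.im := by
    have : (0 : ℝ) < s := by exact_mod_cast hs
    have := τ.im_pos
    have := Real.pi_pos
    positivity
  refine Summable.of_nonneg_of_le (fun _ => norm_nonneg _) (fun k => ?_) (summable_exp_neg_mul_sq hc)
  split_ifs
  · rw [norm_exp_two_pi_rat]
    push_cast
    apply le_of_eq
    congr 1
    ring
  · simp [(Real.exp_pos _).le]

theorem thetaOne_eq {s : ℚ} {D : ℕ} (hD : D ≠ 0) (r : ℤ) (τ : ℍ) :
    thetaOne s D (r : ZMod D) τ = cexp (2 * Real.pi * I * ((s * r ^ 2 : ℚ) : ℂ) * τ) *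
      jacobiTheta₂ (2 * s * D * r * τ) (2 * (s * D ^ 2 * τ)) := by
  have hinj : Function.Injective fun k : ℤ => r + D * k := by
    intro k l h
    have : (D : ℤ) * k = D * l := by simpa using h
    exact mul_left_cancel₀ (by exact_mod_cast hD) this
  rw [thetaOne, jacobiTheta₂, ← tsum_mul_left, ← hinj.tsum_eq]
  · apply tsum_congr
    intro k
    rw [if_pos (by simp), jacobiTheta₂_term, ← Complex.exp_add]
    congr 1
    push_cast
    ring
  · intro k hk
    rw [Function.mem_support] at hk
    have hk' : (k : ZMod D) = r := by by_contra h; simp [h] at hk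
    rw [ZMod.intCast_eq_intCast_iff_dvd_sub] at hk'
    obtain ⟨m, hm⟩ := hk'
    exact ⟨-m, by simp only; linarith⟩

/-- The transformation law under `Γ₀(4t)`, where `t = s D²`. -/
theorem thetaOne_smul {s : ℚ} {D : ℕ} (hD : D ≠ 0) {t : ℤ} (ht : 0 < t) (hst : (t : ℚ) = s * D ^ 2)
    (γ : SL(2, ℤ)) (hγ : 4 * t ∣ γ 1 0) (r : ℤ) (hr : ∃ m : ℤ, (m : ℚ) = 2 * (s * D * r)) (τ : ℍ) :
    thetaOne s D (r : ZMod D) (γ • τ) = thetaFactor γ τ * (jacobiSym t (γ 1 1).natAbs : ℂ) *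
      cexp (2 * Real.pi * I * ((γ 0 0 * γ 0 1 * (s * r ^ 2) : ℚ) : ℂ)) *
      thetaOne s D ((γ 0 0 : ZMod D) * r) τ := by
  obtain ⟨c, hc⟩ := hγ
  obtain ⟨m, hm⟩ := hr
  have hdet := γ.det_coe
  rw [Matrix.det_fin_two] at hdet
  -- Conjugation by `diag(t, 1)` carries `γ` to an element `γ'` of `Γ₀(4)` and `τ` to `τ' = tτ`. The
  -- multipliers differ by the symbol `(t/d)`, since the lower left entry has lost the factor `t`.
  let γ' : SL(2, ℤ) := ⟨!![γ 0 0, γ 0 1 * t; 4 * c, γ 1 1], by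
    rw [Matrix.det_fin_two]; simp; rw [hc] at hdet; linarith⟩
  let τ' : ℍ := ⟨t * τ, by
    have : (0 : ℝ) < t := by exact_mod_cast ht
    simpa using mul_pos this τ.im_pos⟩
  have hτ' : (τ' : ℂ) = t * τ := rfl
  have g00 : γ' 0 0 = γ 0 0 := rfl
  have g01 : γ' 0 1 = γ 0 1 * t := rfl
  have g10 : γ' 1 0 = 4 * c := rfl
  have g11 : γ' 1 1 = γ 1 1 := rfl
  have ht0 : (t : ℂ) ≠ 0 := by exact_mod_cast ht.ne'
  have hstC : (t : ℂ) = s * D ^ 2 := by exact_mod_cast congrArg (Rat.cast : ℚ → ℂ) hst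
  have hmC : (m : ℂ) = 2 * (s * D * r) := by exact_mod_cast congrArg (Rat.cast : ℚ → ℂ) hm
  have hcC : (γ 1 0 : ℂ) = 4 * t * c := by rw [hc]; push_cast; ring
  have hden : ((γ' 1 0 : ℂ) * τ' + γ' 1 1) = (γ 1 0 : ℂ) * τ + γ 1 1 := by
    rw [g10, g11, hτ', hcC]; push_cast; ring
  have hD0 := denom_ne_zero γ τ
  have hsm : ((γ' • τ' : ℍ) : ℂ) = t * ((γ • τ : ℍ) : ℂ) := by
    rw [coe_sl_smul, hden, coe_sl_smul, g00, g01, hτ']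
    push_cast; field_simp
  have hfac : thetaFactor γ' τ' = thetaFactor γ τ * (jacobiSym t (γ 1 1).natAbs : ℂ) := by
    rw [thetaFactor, thetaFactor, hden, g10, g11]
    have hcop : IsCoprime t (γ 1 1) := by
      have := isCoprime_bottom γ
      rw [hc] at this
      exact this.of_isCoprime_of_dvd_left ⟨4 * c, by ring⟩
    have h2 : ((jacobiSym t (γ 1 1).natAbs : ℤ) : ℂ) ^ 2 = 1 := by
      exact_mod_cast congrArg (Int.cast : ℤ → ℂ) (jacobiSym_sq_of_isCoprime hcop)
    have : kronecker (γ 1 0) (γ 1 1) = kronecker (4 * c) (γ 1 1) * jacobiSym t (γ 1 1).natAbs := by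
      rw [← kronecker_mul_of_pos ht, hc]; congr 1; ring
    rw [this]
    push_cast
    linear_combination -(kronecker (4 * c) (γ 1 1) * (epsilon (γ 1 1))⁻¹ *
      (((γ 1 0 : ℂ) * τ + γ 1 1) ^ (1 / 2 : ℂ))) * h2
  have hlaw := thetaLaw_of_four_dvd γ' (by rw [g10]; exact dvd_mul_right _ _)
    (2 * s * D * r * (γ 0 0 * τ + γ 0 1)) τ'
  rw [hsm, hden, hfac] at hlaw
  rw [thetaOne_eq hD]
  have e1 : (2 * s * D * r * ((γ • τ : ℍ) : ℂ)) =
      2 * s * D * r * (γ 0 0 * τ + γ 0 1) / ((γ 1 0 : ℂ) * τ + γ 1 1) := by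
    rw [coe_sl_smul]; ring
  rw [e1, ← hstC, hlaw]
  have e2 : ((γ 0 0 : ZMod D) * (r : ZMod D)) = ((γ 0 0 * r : ℤ) : ZMod D) := by push_cast; ring
  rw [e2, thetaOne_eq hD, ← hstC]
  -- The elliptic argument is shifted by `2sDr` times an integer; this is integral by `hr`, so the
  -- shift is a period.
  have e3 : (2 * s * D * r * (γ 0 0 * τ + γ 0 1) : ℂ) =
      2 * s * D * ((γ 0 0 * r : ℤ) : ℂ) * τ + ((m * γ 0 1 : ℤ) : ℂ) := by
    push_cast; rw [hmC]; ring
  have e4 : cexp (2 * Real.pi * I * ((s * r ^ 2 : ℚ) : ℂ) * ((γ • τ : ℍ) : ℂ)) *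
      cexp (2 * Real.pi * I * (γ' 1 0 * (2 * s * D * r * (γ 0 0 * τ + γ 0 1)) ^ 2 /
        (4 * ((γ 1 0 : ℂ) * τ + γ 1 1)))) =
      cexp (2 * Real.pi * I * ((γ 0 0 * γ 0 1 * (s * r ^ 2) : ℚ) : ℂ)) *
      cexp (2 * Real.pi * I * ((s * (γ 0 0 * r : ℤ) ^ 2 : ℚ) : ℂ) * τ) := by
    rw [← Complex.exp_add, ← Complex.exp_add, g10, coe_sl_smul]
    congr 1
    have hdetC : (γ 0 0 : ℂ) * γ 1 1 - γ 0 1 * γ 1 0 = 1 := by exact_mod_cast hdet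
    have h4 : (((4 * c : ℤ)) : ℂ) * (s * D ^ 2) = γ 1 0 := by
      rw [← hstC, hcC]; push_cast; ring
    have h5 : (((4 * c : ℤ)) : ℂ) * (2 * s * D * r * (γ 0 0 * τ + γ 0 1)) ^ 2 =
        4 * (γ 1 0 * s * r ^ 2 * (γ 0 0 * τ + γ 0 1) ^ 2) := by
      rw [← h4]; ring
    have h6 : ((γ 0 0 * τ + γ 0 1) + γ 1 0 * (γ 0 0 * τ + γ 0 1) ^ 2 : ℂ) *
        ((γ 1 0 : ℂ) * τ + γ 1 1)⁻¹ = γ 0 0 * γ 0 1 + γ 0 0 ^ 2 * τ := by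
      rw [← div_eq_mul_inv, div_eq_iff hD0]
      linear_combination (-(γ 0 0 * τ + γ 0 1) : ℂ) * hdetC
    rw [h5, mul_div_mul_left _ _ (by norm_num : (4 : ℂ) ≠ 0)]
    push_cast
    linear_combination (2 * Real.pi * I * s * r ^ 2) * h6
  rw [e3, jacobiTheta₂_add_int, ← e3, hτ']
  linear_combination (thetaFactor γ τ * (jacobiSym t (γ 1 1).natAbs : ℂ) *
    jacobiTheta₂ (2 * s * D * ((γ 0 0 * r : ℤ) : ℂ) * τ) (2 * (t * τ))) * e4

/-- The inversion formula. -/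
theorem thetaOne_inversion {s : ℚ} (hs : 0 < s) {D : ℕ} (hD : D ≠ 0) (r : ℤ) (τ : ℍ) :
    thetaOne s D (r : ZMod D) τ = 1 / (-I * (((2 * s * D ^ 2 : ℝ) : ℂ) * τ)) ^ (1 / 2 : ℂ) *
      jacobiTheta₂ (r / D) (-1 / (((2 * s * D ^ 2 : ℝ) : ℂ) * τ)) := by
  have hτ := τ.ne_zero
  have hDC : (D : ℂ) ≠ 0 := by exact_mod_cast hD
  have hsC : (s : ℂ) ≠ 0 := by exact_mod_cast hs.ne'
  have e0 : (((2 * s * D ^ 2 : ℝ) : ℂ) * τ) = 2 * (s * D ^ 2 * τ) := by push_cast; ring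
  rw [thetaOne_eq hD, jacobiTheta₂_functional_equation, e0]
  have e1 : (2 * s * D * r * τ : ℂ) / (2 * (s * D ^ 2 * τ)) = r / D := by field_simp
  have e2 : cexp (2 * Real.pi * I * ((s * r ^ 2 : ℚ) : ℂ) * τ) *
      cexp (-Real.pi * I * (2 * s * D * r * τ) ^ 2 / (2 * (s * D ^ 2 * τ))) = 1 := by
    rw [← Complex.exp_add, Complex.exp_eq_one_iff]
    refine ⟨0, ?_⟩
    push_cast
    field_simp
    ring
  rw [e1]
  linear_combination (1 / (-I * (2 * (s * D ^ 2 * τ))) ^ (1 / 2 : ℂ) *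
    jacobiTheta₂ (r / D) (-1 / (2 * (s * D ^ 2 * τ)))) * e2

/-- After inversion the elliptic variable of the theta function is the constant `r/D`, so that only
differentiability in the modular variable is needed. -/
theorem differentiableOn_thetaOne {s : ℚ} (hs : 0 < s) {D : ℕ} (hD : D ≠ 0) (r : ZMod D) :
    DifferentiableOn ℂ (thetaOne s D r ∘ UpperHalfPlane.ofComplex) {z | 0 < z.im} := by
  obtain ⟨r, rfl⟩ := ZMod.intCast_surjective r
  have : Set.EqOn (thetaOne s D (r : ZMod D) ∘ UpperHalfPlane.ofComplex)
      (fun z : ℂ => 1 / (-I * (((2 * s * D ^ 2 : ℝ) : ℂ) * z)) ^ (1 / 2 : ℂ) *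
      jacobiTheta₂ (r / D) (-1 / (((2 * s * D ^ 2 : ℝ) : ℂ) * z))) {z | 0 < z.im} := by
    intro z hz
    simp only [Function.comp]
    rw [thetaOne_inversion hs hD, UpperHalfPlane.ofComplex_apply_of_im_pos hz]
  refine DifferentiableOn.congr ?_ this
  intro z hz
  have hz' : 0 < z.im := hz
  have hz0 : z ≠ 0 := by rintro rfl; simp at hz'
  have hr : (0 : ℝ) < 2 * s * D ^ 2 := by
    have : (0 : ℝ) < s := by exact_mod_cast hs
    have : (0 : ℝ) < D := by exact_mod_cast Nat.pos_of_ne_zero hD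
    positivity
  have hrC : (((2 * s * D ^ 2 : ℝ)) : ℂ) ≠ 0 := by exact_mod_cast hr.ne'
  apply DifferentiableAt.differentiableWithinAt
  have hre : 0 < (-I * (((2 * s * D ^ 2 : ℝ) : ℂ) * z)).re := by
    have : (-I * (((2 * s * D ^ 2 : ℝ) : ℂ) * z)).re = (2 * s * D ^ 2) * z.im := by
      rw [mul_left_comm, re_ofReal_mul]; simp
    rw [this]; exact mul_pos hr hz'
  apply DifferentiableAt.mul
  · apply DifferentiableAt.div (differentiableAt_const _)
    · exact DifferentiableAt.cpow (by fun_prop) (by fun_prop) (Or.inl hre)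
    · rw [Ne, cpow_eq_zero_iff]; simp [hz0, hs.ne', hD]
  · have him : 0 < (-1 / (((2 * s * D ^ 2 : ℝ) : ℂ) * z)).im := by
      have : (-1 / (((2 * s * D ^ 2 : ℝ) : ℂ) * z)) = (((2 * s * D ^ 2)⁻¹ : ℝ) : ℂ) * (-z⁻¹) := by
        push_cast; field_simp
      rw [this, im_ofReal_mul]
      apply mul_pos (inv_pos.2 hr)
      rw [neg_im, inv_im, neg_div, neg_neg]
      exact div_pos hz' (normSq_pos.2 hz0)
    exact (differentiableAt_jacobiTheta₂_snd (r / D : ℂ) him).comp z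
      (DifferentiableAt.div (differentiableAt_const _) (by fun_prop) (mul_ne_zero hrC hz0))

/-! ## Sums over `ℤ³` -/

theorem summable_norm_prod_and_tsum (n : ℕ) (f : Fin n → ℤ → ℂ) (hf : ∀ i, Summable fun k => ‖f i k‖) :
    (Summable fun m : Fin n → ℤ => ‖∏ i, f i (m i)‖) ∧
      ∑' m : Fin n → ℤ, ∏ i, f i (m i) = ∏ i, ∑' k, f i k := by
  induction n with
  | zero => exact ⟨(hasSum_fintype _).summable, by simp⟩
  | succ n ih =>
    obtain ⟨h1, h2⟩ := ih (fun i => f i.succ) (fun i => hf i.succ)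
    have e : ∀ x : ℤ × (Fin n → ℤ), ∏ i, f i ((Fin.consEquiv fun _ => ℤ) x i) =
        f 0 x.1 * ∏ i, f (Fin.succ i) (x.2 i) := by
      rintro ⟨k, m⟩
      rw [Fin.prod_univ_succ]
      simp [Fin.consEquiv]
    constructor
    · rw [← (Fin.consEquiv fun _ => ℤ).summable_iff]
      have : Summable fun x : ℤ × (Fin n → ℤ) => ‖f 0 x.1 * ∏ i, f (Fin.succ i) (x.2 i)‖ := by
        refine ((hf 0).mul_of_nonneg h1 (fun _ => norm_nonneg _) (fun _ => norm_nonneg _)).congr ?_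
        intro x
        rw [norm_mul]
      refine this.congr fun x => ?_
      simp only [Function.comp]
      rw [e]
    · rw [← (Fin.consEquiv fun _ => ℤ).tsum_eq]
      simp_rw [e]
      rw [Fin.prod_univ_succ, ← h2, tsum_mul_tsum_of_summable_norm (hf 0) h1]

end

section

/-! ## Theta series of periodic sets in a space with an orthogonal basis -/

open Complex

variable {V : Type*} [AddCommGroup V] [Module ℚ V]

/-- The vector with integral coordinates `n`. -/
def pt (u : Module.Basis (Fin 3) ℚ V) (n : Fin 3 → ℤ) : V := ∑ i, (n i : ℚ) • u i

theorem repr_pt (u : Module.Basis (Fin 3) ℚ V) (n : Fin 3 → ℤ) (i : Fin 3) : u.repr (pt u n) i = n i := by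
  unfold pt
  rw [map_sum, Finset.sum_apply']
  simp [Finsupp.single_apply]

theorem pt_injective (u : Module.Basis (Fin 3) ℚ V) : Function.Injective (pt u) := by
  intro n m h
  ext i
  have := congrArg (fun x => u.repr x i) h
  simp only [repr_pt] at this
  exact_mod_cast this

theorem pt_add (u : Module.Basis (Fin 3) ℚ V) (n m : Fin 3 → ℤ) : pt u (n + m) = pt u n + pt u m := by
  simp [pt, add_smul, Finset.sum_add_distrib]

theorem pt_smul (u : Module.Basis (Fin 3) ℚ V) (d : ℤ) (n : Fin 3 → ℤ) : pt u (d • n) = d • pt u n := by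
  simp only [pt, Pi.smul_apply, smul_eq_mul, Finset.smul_sum]
  refine Finset.sum_congr rfl fun i _ => ?_
  push_cast
  rw [mul_smul, Int.cast_smul_eq_zsmul]

/-- The set `X` consists of vectors that are integral with respect to the orthogonal basis `u`, is
invariant under translation by `D u_i`, and has integral norms and integral products with `D u_i`. -/
structure Adapted (B : LinearMap.BilinForm ℚ V) (u : Module.Basis (Fin 3) ℚ V) (D : ℕ) (X : Set V) :
    Prop where
  orth : ∀ i j, i ≠ j → B (u i) (u j) = 0
  pos : ∀ i, 0 < B (u i) (u i)
  ne : D ≠ 0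
  mem : ∀ x ∈ X, ∃ n, x = pt u n
  per : ∀ n m : Fin 3 → ℤ, pt u n ∈ X → pt u (n + (D : ℤ) • m) ∈ X
  int_self : ∀ x ∈ X, ∃ z : ℤ, B x x = z
  int_mul : ∀ x ∈ X, ∀ i, ∃ z : ℤ, (z : ℚ) = D * B x (u i)

theorem form_pt_basis {B : LinearMap.BilinForm ℚ V} {u : Module.Basis (Fin 3) ℚ V}
    (h : ∀ i j, i ≠ j → B (u i) (u j) = 0) (n : Fin 3 → ℤ) (i : Fin 3) :
    B (pt u n) (u i) = n i * B (u i) (u i) := by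
  unfold pt
  rw [map_sum, LinearMap.sum_apply, Finset.sum_eq_single i]
  · simp
  · intro j _ hj; simp [h j i hj]
  · simp

theorem form_pt {B : LinearMap.BilinForm ℚ V} {u : Module.Basis (Fin 3) ℚ V}
    (h : ∀ i j, i ≠ j → B (u i) (u j) = 0) (n m : Fin 3 → ℤ) :
    B (pt u n) (pt u m) = ∑ i, B (u i) (u i) * (n i * m i) := by
  conv_lhs => rw [pt.eq_def u m]
  rw [map_sum]
  refine Finset.sum_congr rfl fun i _ => ?_
  rw [map_smul, form_pt_basis h, smul_eq_mul]
  ring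

theorem exp_form_pt {B : LinearMap.BilinForm ℚ V} {u : Module.Basis (Fin 3) ℚ V}
    (h : ∀ i j, i ≠ j → B (u i) (u j) = 0) (n : Fin 3 → ℤ) (τ : ℂ) :
    cexp (2 * Real.pi * I * ((B (pt u n) (pt u n) : ℚ) : ℂ) * τ) =
      ∏ i, cexp (2 * Real.pi * I * ((B (u i) (u i) * n i ^ 2 : ℚ) : ℂ) * τ) := by
  rw [← Complex.exp_sum, form_pt h]
  congr 1
  push_cast
  rw [Finset.mul_sum, Finset.sum_mul]
  refine Finset.sum_congr rfl fun i _ => by ring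

theorem tsum_coset_eq {u : Module.Basis (Fin 3) ℚ V} {X : Set V}
    (hX : ∀ x ∈ X, ∃ n, x = pt u n) (f : V → ℂ) :
    ∑' x : X, f x = ∑' n : Fin 3 → ℤ, X.indicator f (pt u n) := by
  rw [tsum_subtype X f, ← (pt_injective u).tsum_eq]
  intro x hx
  obtain ⟨n, hn⟩ := hX x (Set.mem_of_indicator_ne_zero hx)
  exact ⟨n, hn.symm⟩

theorem summable_pt {B : LinearMap.BilinForm ℚ V} {u : Module.Basis (Fin 3) ℚ V}
    (ho : ∀ i j, i ≠ j → B (u i) (u j) = 0) (hp : ∀ i, 0 < B (u i) (u i)) (τ : ℍ) :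
    Summable fun n : Fin 3 → ℤ => ‖cexp (2 * Real.pi * I * ((B (pt u n) (pt u n) : ℚ) : ℂ) * τ)‖ := by
  have := (summable_norm_prod_and_tsum 3 (fun i k => if (k : ZMod 1) = 0 then
    cexp (2 * Real.pi * I * ((B (u i) (u i) * k ^ 2 : ℚ) : ℂ) * τ) else 0)
    (fun i => summable_norm_thetaOne (hp i) 1 0 τ)).1
  refine this.congr fun n => ?_
  rw [exp_form_pt ho]
  congr 1
  refine Finset.prod_congr rfl fun i _ => ?_
  rw [if_pos (Subsingleton.elim _ _)]

theorem summable_theta {B : LinearMap.BilinForm ℚ V} {u : Module.Basis (Fin 3) ℚ V}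
    (ho : ∀ i j, i ≠ j → B (u i) (u j) = 0) (hp : ∀ i, 0 < B (u i) (u i)) {X : Set V}
    (hX : ∀ x ∈ X, ∃ n, x = pt u n) (τ : ℍ) :
    Summable fun x : X => ‖cexp (2 * Real.pi * I * ((B x x : ℚ) : ℂ) * τ)‖ := by
  choose g hg using hX
  let i : X → (Fin 3 → ℤ) := fun x => g x.1 x.2
  have hi : Function.Injective i := by
    intro x y h
    apply Subtype.ext
    rw [hg x.1 x.2, hg y.1 y.2]
    exact congrArg (pt u) h
  refine ((summable_pt ho hp τ).comp_injective hi).congr fun x => ?_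
  simp only [Function.comp]
  rw [← hg x.1 x.2]

/-- The residue class `r` of coordinates belongs to `X`. -/
def resMem (u : Module.Basis (Fin 3) ℚ V) (D : ℕ) (X : Set V) (r : Fin 3 → ZMod D) : Prop :=
  ∃ n : Fin 3 → ℤ, (∀ i, (n i : ZMod D) = r i) ∧ pt u n ∈ X

theorem Adapted.mem_iff {B : LinearMap.BilinForm ℚ V} {u : Module.Basis (Fin 3) ℚ V} {D : ℕ}
    {X : Set V} (h : Adapted B u D X) (n : Fin 3 → ℤ) :
    pt u n ∈ X ↔ resMem u D X (fun i => (n i : ZMod D)) := by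
  constructor
  · exact fun hn => ⟨n, fun _ => rfl, hn⟩
  · rintro ⟨m, hm, hmX⟩
    have : ∀ i, ∃ k : ℤ, n i = m i + D * k := by
      intro i
      obtain ⟨k, hk⟩ := (ZMod.intCast_eq_intCast_iff_dvd_sub _ _ _).1 (hm i)
      exact ⟨k, by linarith⟩
    choose k hk using this
    have e : n = m + (D : ℤ) • k := by ext i; simp [hk]
    rw [e]
    exact h.per m k hmX

open Classical in
-- Since `X` is periodic modulo `D`, it is a union of residue classes of coordinates. On each class
-- `Q` is diagonal and the sum factors over the three coordinates.
theorem theta_eq_sum {B : LinearMap.BilinForm ℚ V} {u : Module.Basis (Fin 3) ℚ V} {D : ℕ} [NeZero D]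
    {X : Set V} (h : Adapted B u D X) (τ : ℍ) :
    theta B X τ = ∑ r : Fin 3 → ZMod D, if resMem u D X r then
      ∏ i, thetaOne (B (u i) (u i)) D (r i) τ else 0 := by
  have hone := fun r : Fin 3 → ZMod D => summable_norm_prod_and_tsum 3 (fun i k =>
    if (k : ZMod D) = r i then cexp (2 * Real.pi * I * ((B (u i) (u i) * k ^ 2 : ℚ) : ℂ) * τ) else 0)
    (fun i => summable_norm_thetaOne (h.pos i) D (r i) τ)
  have e1 : ∀ r : Fin 3 → ZMod D, (if resMem u D X r then
      ∏ i, thetaOne (B (u i) (u i)) D (r i) τ else 0) = ∑' n : Fin 3 → ℤ, if resMem u D X r then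
      ∏ i, (if (n i : ZMod D) = r i then
        cexp (2 * Real.pi * I * ((B (u i) (u i) * n i ^ 2 : ℚ) : ℂ) * τ) else 0) else 0 := by
    intro r
    split_ifs
    · exact (hone r).2.symm
    · simp
  unfold theta
  rw [tsum_coset_eq h.mem (fun x => cexp (2 * Real.pi * I * ((B x x : ℚ) : ℂ) * τ))]
  simp_rw [e1]
  rw [← Summable.tsum_finsetSum]
  · apply tsum_congr
    intro n
    rw [Finset.sum_eq_single (fun i => (n i : ZMod D))]
    · by_cases hn : pt u n ∈ X
      · rw [Set.indicator_of_mem hn, if_pos ((h.mem_iff n).1 hn), exp_form_pt h.orth]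
        simp
      · rw [Set.indicator_of_notMem hn, if_neg fun h' => hn ((h.mem_iff n).2 h')]
    · intro r _ hr
      split_ifs with h'
      · obtain ⟨i, hi⟩ := Function.ne_iff.1 hr
        exact Finset.prod_eq_zero (Finset.mem_univ i) (if_neg fun e => hi e.symm)
      · rfl
    · simp
  · intro r _
    split_ifs
    · exact (hone r).1.of_norm
    · exact summable_zero

theorem mdifferentiable_theta {B : LinearMap.BilinForm ℚ V} {u : Module.Basis (Fin 3) ℚ V} {D : ℕ}
    {X : Set V} (h : Adapted B u D X) : MDifferentiable 𝓘(ℂ) 𝓘(ℂ) (theta B X) := by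
  classical
  have : NeZero D := ⟨h.ne⟩
  rw [UpperHalfPlane.mdifferentiable_iff]
  have : theta B X ∘ UpperHalfPlane.ofComplex = fun z : ℂ => ∑ r : Fin 3 → ZMod D,
      if resMem u D X r then
      ∏ i, (thetaOne (B (u i) (u i)) D (r i) ∘ UpperHalfPlane.ofComplex) z else 0 := by
    ext z
    exact theta_eq_sum h _
  rw [this]
  apply DifferentiableOn.fun_sum
  intro r _
  split_ifs
  · apply DifferentiableOn.fun_finsetProd
    intro i _
    exact differentiableOn_thetaOne (h.pos i) h.ne (r i)
  · exact differentiableOn_const _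

/-- Because `k ≤ k²`, each half of the sum is at most `1/(1 - e^{-c}) ≤ 1 + 1/c`. The constant `3`
is generous. -/
theorem tsum_exp_neg_mul_sq_le {c : ℝ} (hc : 0 < c) :
    ∑' k : ℤ, Real.exp (-(c * (k : ℝ) ^ 2)) ≤ 3 * (1 + 1 / c) := by
  have hs := summable_exp_neg_mul_sq hc
  have hr : Real.exp (-c) < 1 := by rw [Real.exp_lt_one_iff]; linarith
  have hg : HasSum (fun n : ℕ => Real.exp (-c) ^ n) (1 - Real.exp (-c))⁻¹ :=
    hasSum_geometric_of_lt_one (Real.exp_pos _).le hr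
  have hle : ∀ n : ℕ, Real.exp (-(c * (n : ℝ) ^ 2)) ≤ Real.exp (-c) ^ n := by
    intro n
    rw [← Real.exp_nat_mul]
    apply Real.exp_le_exp.2
    have : (n : ℝ) ≤ (n : ℝ) ^ 2 := by exact_mod_cast Nat.le_self_pow two_ne_zero n
    nlinarith
  have hN : Summable fun n : ℕ => Real.exp (-(c * (n : ℝ) ^ 2)) :=
    Summable.of_nonneg_of_le (fun _ => (Real.exp_pos _).le) hle hg.summable
  have hNle : ∑' n : ℕ, Real.exp (-(c * (n : ℝ) ^ 2)) ≤ 1 + 1 / c := by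
    refine (hN.tsum_le_tsum hle hg.summable).trans ?_
    rw [hg.tsum_eq, inv_le_comm₀ (by linarith) (by positivity)]
    have h1 : Real.exp (-c) ≤ 1 / (1 + c) := by
      rw [Real.exp_neg, ← one_div]
      apply one_div_le_one_div_of_le (by linarith)
      linarith [Real.add_one_le_exp c]
    have h2 : (1 + 1 / c)⁻¹ = 1 - 1 / (1 + c) := by field_simp; ring
    rw [h2]; linarith
  have hle' : ∀ n : ℕ, Real.exp (-(c * ((-(n + 1 : ℕ) : ℤ) : ℝ) ^ 2)) ≤ Real.exp (-(c * (n : ℝ) ^ 2)) := by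
    intro n
    apply Real.exp_le_exp.2
    push_cast
    nlinarith [Nat.cast_nonneg (α := ℝ) n]
  have hN' : Summable fun n : ℕ => Real.exp (-(c * ((-(n + 1 : ℕ) : ℤ) : ℝ) ^ 2)) :=
    Summable.of_nonneg_of_le (fun _ => (Real.exp_pos _).le) hle' hN
  rw [tsum_of_nat_of_neg_add_one (f := fun k : ℤ => Real.exp (-(c * (k : ℝ) ^ 2)))
    (by simpa using hN) (by simpa using hN')]
  have h1 := hN'.tsum_le_tsum hle' hN
  have h2 : 0 < 1 / c := by positivity
  simp only [Int.cast_natCast]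
  push_cast at h1 ⊢
  linarith

/-- Enlarging `X` to all integral points makes the sum a product of three one-dimensional sums, each
`O(1 + 1/y)`, and both `1` and `1/y` are at most `y + 1/y`. -/
theorem norm_theta_le {B : LinearMap.BilinForm ℚ V} {u : Module.Basis (Fin 3) ℚ V}
    (ho : ∀ i j, i ≠ j → B (u i) (u j) = 0) (hp : ∀ i, 0 < B (u i) (u i)) {X : Set V}
    (hX : ∀ x ∈ X, ∃ n, x = pt u n) : ∃ (C : ℝ) (n : ℕ), ∀ z : ℍ, ‖theta B X z‖ ≤ C * (z.im + z.im⁻¹) ^ n := by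
  have hpR : ∀ i, 0 < 2 * Real.pi * (B (u i) (u i) : ℝ) := fun i =>
    mul_pos Real.two_pi_pos (by exact_mod_cast hp i)
  refine ⟨∏ i : Fin 3, (3 * (1 + 1 / (2 * Real.pi * (B (u i) (u i) : ℝ)))), 3, fun z => ?_⟩
  have hz := z.im_pos
  unfold theta
  rw [tsum_coset_eq hX (fun x => cexp (2 * Real.pi * I * ((B x x : ℚ) : ℂ) * z))]
  have hs := summable_pt ho hp z
  have hle : ∀ n : Fin 3 → ℤ, ‖X.indicator (fun x => cexp (2 * Real.pi * I * ((B x x : ℚ) : ℂ) * z)) (pt u n)‖ ≤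
      ‖cexp (2 * Real.pi * I * ((B (pt u n) (pt u n) : ℚ) : ℂ) * z)‖ := fun n =>
    norm_indicator_le_norm_self _ _
  refine (norm_tsum_le_tsum_norm (Summable.of_nonneg_of_le (fun _ => norm_nonneg _) hle hs)).trans ?_
  refine ((Summable.of_nonneg_of_le (fun _ => norm_nonneg _) hle hs).tsum_le_tsum hle hs).trans ?_
  have hc : ∀ i, 0 < 2 * Real.pi * (B (u i) (u i) : ℝ) * z.im := fun i => mul_pos (hpR i) hz
  have hprod := (summable_norm_prod_and_tsum 3 (fun i k =>
    ((Real.exp (-(2 * Real.pi * (B (u i) (u i) : ℝ) * z.im * (k : ℝ) ^ 2)) : ℝ) : ℂ)) (fun i => by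
      refine (summable_exp_neg_mul_sq (hc i)).congr fun k => ?_
      rw [Complex.norm_real, Real.norm_of_nonneg (Real.exp_pos _).le])).2
  have e : ∑' n : Fin 3 → ℤ, ‖cexp (2 * Real.pi * I * ((B (pt u n) (pt u n) : ℚ) : ℂ) * z)‖ =
      ∏ i : Fin 3, ∑' k : ℤ, Real.exp (-(2 * Real.pi * (B (u i) (u i) : ℝ) * z.im * (k : ℝ) ^ 2)) := by
    have : ∀ n : Fin 3 → ℤ, ‖cexp (2 * Real.pi * I * ((B (pt u n) (pt u n) : ℚ) : ℂ) * z)‖ =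
        ∏ i : Fin 3, Real.exp (-(2 * Real.pi * (B (u i) (u i) : ℝ) * z.im * (n i : ℝ) ^ 2)) := by
      intro n
      rw [exp_form_pt ho, norm_prod]
      refine Finset.prod_congr rfl fun i _ => ?_
      rw [norm_exp_two_pi_rat]
      congr 1
      push_cast
      ring
    simp_rw [this]
    exact_mod_cast hprod
  rw [e, ← Fin.prod_const 3, ← Finset.prod_mul_distrib]
  refine Finset.prod_le_prod (fun i _ => tsum_nonneg fun _ => (Real.exp_pos _).le) fun i _ => ?_
  refine (tsum_exp_neg_mul_sq_le (hc i)).trans ?_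
  have h1 : 1 ≤ z.im + z.im⁻¹ := by
    rcases le_total 1 z.im with h | h
    · linarith [inv_pos.2 hz]
    · linarith [(one_le_inv₀ hz).2 h]
  have h2 : z.im⁻¹ ≤ z.im + z.im⁻¹ := by linarith
  have h3 : 1 / (2 * Real.pi * (B (u i) (u i) : ℝ) * z.im) =
      1 / (2 * Real.pi * (B (u i) (u i) : ℝ)) * z.im⁻¹ := by
    rw [one_div, mul_inv, one_div]
  have h4 : 0 < 1 / (2 * Real.pi * (B (u i) (u i) : ℝ)) := one_div_pos.2 (hpR i)
  rw [h3]
  nlinarith [mul_le_mul_of_nonneg_left h2 h4.le]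

/-! ### Transformation laws -/

theorem prod_jacobiSym (t : Fin 3 → ℤ) (d : ℕ) : ∏ i, jacobiSym (t i) d = jacobiSym (∏ i, t i) d := by
  simp [Fin.prod_univ_three, jacobiSym.mul_left]

open Classical in
/-- Transformation under elements of `Γ₀(N')`, where `N'` is divisible by `D` and all `4 t_i`. -/
theorem theta_smul {B : LinearMap.BilinForm ℚ V} {u : Module.Basis (Fin 3) ℚ V} {D : ℕ}
    {X X' : Set V} (h : Adapted B u D X) (h' : Adapted B u D X') {t : Fin 3 → ℤ}
    (ht : ∀ i, (t i : ℚ) = B (u i) (u i) * D ^ 2) (γ : SL(2, ℤ)) (hγt : ∀ i, 4 * t i ∣ γ 1 0)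
    (hγD : (D : ℤ) ∣ γ 1 0) (hXX' : ∀ n, pt u n ∈ X' ↔ pt u (γ 1 1 • n) ∈ X) (τ : ℍ) :
    theta B X (γ • τ) = thetaFactor γ τ ^ 3 * (jacobiSym (∏ i, t i) (γ 1 1).natAbs : ℂ) *
      theta B X' τ := by
  have : NeZero D := ⟨h.ne⟩
  have htpos : ∀ i, 0 < t i := by
    intro i
    have h1 : (0 : ℚ) < D := by exact_mod_cast Nat.pos_of_ne_zero h.ne
    have h2 : (0 : ℚ) < t i := by rw [ht]; exact mul_pos (h.pos i) (by positivity)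
    exact_mod_cast h2
  have hdet := γ.det_coe
  rw [Matrix.det_fin_two] at hdet
  have hunit : (γ 0 0 : ZMod D) * (γ 1 1 : ZMod D) = 1 := by
    have h0 : ((γ 1 0 : ℤ) : ZMod D) = 0 := (ZMod.intCast_zmod_eq_zero_iff_dvd _ _).2 hγD
    have := congrArg (Int.cast : ℤ → ZMod D) hdet
    push_cast at this
    rw [h0] at this
    simpa using this
  -- `D ∣ c` gives `ad ≡ 1` modulo `D`, so multiplication by `a` permutes the residue classes; it
  -- carries the classes of `X` to those of `X'`.
  let ε : (Fin 3 → ZMod D) ≃ (Fin 3 → ZMod D) :=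
    { toFun := fun r i => (γ 0 0 : ZMod D) * r i
      invFun := fun r i => (γ 1 1 : ZMod D) * r i
      left_inv := fun r => by ext i; simp only; rw [← mul_assoc, mul_comm (γ 1 1 : ZMod D), hunit, one_mul]
      right_inv := fun r => by ext i; simp only; rw [← mul_assoc, hunit, one_mul] }
  rw [theta_eq_sum h, theta_eq_sum h', Finset.mul_sum, ← ε.sum_comp (fun r => thetaFactor γ τ ^ 3 *
    (jacobiSym (∏ i, t i) (γ 1 1).natAbs : ℂ) *
      (if resMem u D X' r then ∏ i, thetaOne (B (u i) (u i)) D (r i) τ else 0))]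
  refine Finset.sum_congr rfl fun r _ => ?_
  have hiff : resMem u D X' (ε r) ↔ resMem u D X r := by
    choose n hn using fun i => ZMod.intCast_surjective (r i)
    have e1 : r = fun i => (n i : ZMod D) := funext fun i => (hn i).symm
    have e2 : ε r = fun i => (((γ 0 0 • n) i : ℤ) : ZMod D) := by
      rw [e1]; ext i; simp [ε]
    rw [e2, ← h'.mem_iff, hXX', h.mem_iff, e1]
    have : (fun i => (((γ 1 1 • γ 0 0 • n) i : ℤ) : ZMod D)) = fun i => (n i : ZMod D) := by
      ext i
      simp only [Pi.smul_apply, smul_eq_mul]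
      push_cast
      rw [← mul_assoc, mul_comm (γ 1 1 : ZMod D), hunit, one_mul]
    rw [this]
  rw [if_congr hiff rfl rfl]
  split_ifs with hr
  · obtain ⟨n, hn, hnX⟩ := hr
    have hint : ∀ i, ∃ m : ℤ, (m : ℚ) = 2 * (B (u i) (u i) * D * n i) := by
      intro i
      obtain ⟨m, hm⟩ := h.int_mul _ hnX i
      rw [form_pt_basis h.orth] at hm
      exact ⟨2 * m, by push_cast; rw [hm]; ring⟩
    have e : ∀ i, thetaOne (B (u i) (u i)) D (r i) (γ • τ) = thetaFactor γ τ *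
        (jacobiSym (t i) (γ 1 1).natAbs : ℂ) *
        cexp (2 * Real.pi * I * ((γ 0 0 * γ 0 1 * (B (u i) (u i) * n i ^ 2) : ℚ) : ℂ)) *
        thetaOne (B (u i) (u i)) D (ε r i) τ := by
      intro i
      rw [← hn i, thetaOne_smul h.ne (htpos i) (ht i) γ (hγt i) (n i) (hint i) τ]
      rw [show ε r i = (γ 0 0 : ZMod D) * r i from rfl, hn i]
    simp_rw [e]
    rw [Finset.prod_mul_distrib, Finset.prod_mul_distrib, Finset.prod_mul_distrib, Fin.prod_const,
      ← Complex.exp_sum]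
    -- The three roots of unity combine to `e(ab Q(x))` for a vector `x` of `X`, and `Q(x)` is an
    -- integer, although the single summands need not be.
    have e1 : cexp (∑ i, 2 * Real.pi * I * ((γ 0 0 * γ 0 1 * (B (u i) (u i) * n i ^ 2) : ℚ) : ℂ)) = 1 := by
      obtain ⟨z, hz⟩ := h.int_self _ hnX
      rw [form_pt h.orth] at hz
      rw [Complex.exp_eq_one_iff]
      refine ⟨γ 0 0 * γ 0 1 * z, ?_⟩
      have hz' : ((∑ i, B (u i) (u i) * ((n i : ℚ) * n i) : ℚ) : ℂ) = z := by rw [hz]; push_cast; rfl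
      push_cast at hz' ⊢
      rw [← hz', Finset.mul_sum, Finset.sum_mul]
      refine Finset.sum_congr rfl fun i _ => by ring
    rw [e1, ← prod_jacobiSym]
    push_cast
    ring
  · simp

theorem theta_upperU {B : LinearMap.BilinForm ℚ V} {X : Set V}
    (h : ∀ x ∈ X, ∃ z : ℤ, B x x = z) (n : ℤ) (τ : ℍ) :
    theta B X (upperU n • τ) = theta B X τ := by
  unfold theta
  refine tsum_congr fun x => ?_
  obtain ⟨z, hz⟩ := h x.1 x.2
  rw [coe_upperU_smul, mul_add, Complex.exp_add, hz]
  have : cexp (2 * Real.pi * I * (((z : ℤ) : ℚ) : ℂ) * n) = 1 := by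
    rw [Complex.exp_eq_one_iff]
    exact ⟨z * n, by push_cast; ring⟩
  rw [this, mul_one]

open Classical in
/-- The coefficients of the theta series at the cusp `0`. -/
def dualCoeff (u : Module.Basis (Fin 3) ℚ V) (D : ℕ) [NeZero D] (X : Set V) (m : Fin 3 → ℤ) : ℂ :=
  ∑ r : Fin 3 → ZMod D, if resMem u D X r then
    cexp (2 * Real.pi * I * ((∑ i, m i * (r i).val / D : ℚ) : ℂ)) else 0

/-- Coordinatewise inversion; the roots of unity attached to the residue classes of `X` add up to a
finite Fourier transform of `X`, namely `dualCoeff`. -/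
theorem theta_inversion {B : LinearMap.BilinForm ℚ V} {u : Module.Basis (Fin 3) ℚ V} {D : ℕ} [NeZero D]
    {X : Set V} (h : Adapted B u D X) (τ : ℍ) :
    theta B X τ =
      (∏ i, 1 / (-I * (((2 * B (u i) (u i) * D ^ 2 : ℝ) : ℂ) * τ)) ^ (1 / 2 : ℂ)) *
      ∑' m : Fin 3 → ℤ, dualCoeff u D X m *
        cexp (2 * Real.pi * I * ((∑ i, m i ^ 2 / (4 * (B (u i) (u i) * D ^ 2)) : ℚ) : ℂ) * (-1 / τ)) := by
  classical
  have hτ := τ.ne_zero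
  have hDC : (D : ℂ) ≠ 0 := by exact_mod_cast h.ne
  have hpos : ∀ i, (0 : ℝ) < 2 * B (u i) (u i) * D ^ 2 := fun i => by
    have : (0 : ℝ) < B (u i) (u i) := by exact_mod_cast h.pos i
    have : (0 : ℝ) < D := by exact_mod_cast Nat.pos_of_ne_zero h.ne
    positivity
  have him : ∀ i, 0 < (-1 / (((2 * B (u i) (u i) * D ^ 2 : ℝ) : ℂ) * τ)).im := by
    intro i
    have hne : (((2 * B (u i) (u i) * D ^ 2 : ℝ) : ℂ)) ≠ 0 := by exact_mod_cast (hpos i).ne'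
    have : (-1 / (((2 * B (u i) (u i) * D ^ 2 : ℝ) : ℂ) * τ)) =
        (((2 * B (u i) (u i) * D ^ 2)⁻¹ : ℝ) : ℂ) * (-(τ : ℂ)⁻¹) := by
      rw [Complex.ofReal_inv]; field_simp
    rw [this, im_ofReal_mul]
    apply mul_pos (inv_pos.2 (hpos i))
    rw [neg_im, inv_im, neg_div, neg_neg]
    exact div_pos τ.im_pos (normSq_pos.2 hτ)
  have hsum := fun r : Fin 3 → ZMod D => summable_norm_prod_and_tsum 3 (fun i k =>
    jacobiTheta₂_term k (((r i).val : ℤ) / D) (-1 / (((2 * B (u i) (u i) * D ^ 2 : ℝ) : ℂ) * τ)))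
    (fun i => ((summable_jacobiTheta₂_term_iff _ _).2 (him i)).norm)
  have hterm : ∀ (r : Fin 3 → ZMod D) (m : Fin 3 → ℤ), ∏ i, jacobiTheta₂_term (m i) (((r i).val : ℤ) / D)
      (-1 / (((2 * B (u i) (u i) * D ^ 2 : ℝ) : ℂ) * τ)) =
      cexp (2 * Real.pi * I * ((∑ i, m i * (r i).val / D : ℚ) : ℂ)) *
        cexp (2 * Real.pi * I * ((∑ i, m i ^ 2 / (4 * (B (u i) (u i) * D ^ 2)) : ℚ) : ℂ) * (-1 / τ)) := by
    intro r m
    unfold jacobiTheta₂_term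
    rw [← Complex.exp_sum, ← Complex.exp_add]
    congr 1
    push_cast
    rw [Finset.mul_sum, Finset.mul_sum, Finset.sum_mul, ← Finset.sum_add_distrib]
    refine Finset.sum_congr rfl fun i _ => ?_
    have : (B (u i) (u i) : ℂ) ≠ 0 := by exact_mod_cast (h.pos i).ne'
    field_simp
    ring
  rw [theta_eq_sum h]
  have e : ∀ r : Fin 3 → ZMod D, (if resMem u D X r then
      ∏ i, thetaOne (B (u i) (u i)) D (r i) τ else 0) =
      (∏ i, 1 / (-I * (((2 * B (u i) (u i) * D ^ 2 : ℝ) : ℂ) * τ)) ^ (1 / 2 : ℂ)) *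
      ∑' m : Fin 3 → ℤ, (if resMem u D X r then
        cexp (2 * Real.pi * I * ((∑ i, m i * (r i).val / D : ℚ) : ℂ)) else 0) *
        cexp (2 * Real.pi * I * ((∑ i, m i ^ 2 / (4 * (B (u i) (u i) * D ^ 2)) : ℚ) : ℂ) * (-1 / τ)) := by
    intro r
    split_ifs
    · have : ∀ i, r i = (((r i).val : ℤ) : ZMod D) := fun i => by simp
      calc ∏ i, thetaOne (B (u i) (u i)) D (r i) τ
          = ∏ i, (1 / (-I * (((2 * B (u i) (u i) * D ^ 2 : ℝ) : ℂ) * τ)) ^ (1 / 2 : ℂ) *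
            jacobiTheta₂ (((r i).val : ℤ) / D) (-1 / (((2 * B (u i) (u i) * D ^ 2 : ℝ) : ℂ) * τ))) := by
            refine Finset.prod_congr rfl fun i _ => ?_
            conv_lhs => rw [this i]
            exact thetaOne_inversion (h.pos i) h.ne _ τ
        _ = _ := by
            rw [Finset.prod_mul_distrib]
            congr 1
            rw [← tsum_congr (hterm r), (hsum r).2]
            rfl
    · simp
  simp_rw [e]
  rw [← Finset.mul_sum]
  congr 1
  rw [← Summable.tsum_finsetSum]
  · refine tsum_congr fun m => ?_
    rw [dualCoeff, Finset.sum_mul]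
  · intro r _
    split_ifs
    · exact ((hsum r).1.of_norm).congr (hterm r)
    · simp

/-- Invariance under `(1 0; n 1)`. -/
theorem theta_lowerU {B : LinearMap.BilinForm ℚ V} {u : Module.Basis (Fin 3) ℚ V} {D : ℕ} [NeZero D]
    {X : Set V} (h : Adapted B u D X) (n : ℤ)
    (hn : ∀ m : Fin 3 → ℤ, dualCoeff u D X m ≠ 0 → ∃ z : ℤ,
      (n : ℚ) * ∑ i, m i ^ 2 / (4 * (B (u i) (u i) * D ^ 2)) = z) (τ : ℍ) :
    theta B X (lowerU n • τ) = thetaFactor (lowerU n) τ ^ 3 * theta B X τ := by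
  have hpos : ∀ i, (0 : ℝ) < 2 * B (u i) (u i) * D ^ 2 := fun i => by
    have : (0 : ℝ) < B (u i) (u i) := by exact_mod_cast h.pos i
    have : (0 : ℝ) < D := by exact_mod_cast Nat.pos_of_ne_zero h.ne
    positivity
  have hfac : ∀ i, 1 / (-I * (((2 * B (u i) (u i) * D ^ 2 : ℝ) : ℂ) * (lowerU n • τ : ℍ))) ^ (1 / 2 : ℂ) =
      thetaFactor (lowerU n) τ *
        (1 / (-I * (((2 * B (u i) (u i) * D ^ 2 : ℝ) : ℂ) * τ)) ^ (1 / 2 : ℂ)) := by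
    intro i
    rw [thetaFactor_lowerU, sqrt_denom_lowerU n τ (hpos i)]
    have : (-I * (((2 * B (u i) (u i) * D ^ 2 : ℝ) : ℂ) * τ)) ^ (1 / 2 : ℂ) ≠ 0 := by
      rw [Ne, cpow_eq_zero_iff]
      rintro ⟨h1, -⟩
      have h2 : (((2 * B (u i) (u i) * D ^ 2 : ℝ) : ℂ)) ≠ 0 := by exact_mod_cast (hpos i).ne'
      exact (mul_ne_zero (neg_ne_zero.2 I_ne_zero) (mul_ne_zero h2 τ.ne_zero)) h1
    rw [div_mul_div_comm, mul_one, mul_comm, div_mul_cancel_right₀ this, one_div]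
  rw [theta_inversion h, theta_inversion h]
  simp_rw [hfac]
  rw [Finset.prod_mul_distrib, Fin.prod_const, mul_assoc]
  congr 2
  refine tsum_congr fun m => ?_
  by_cases hm : dualCoeff u D X m = 0
  · simp [hm]
  obtain ⟨z, hz⟩ := hn m hm
  congr 1
  have h1 := denom_ne_zero (lowerU n) τ
  simp only [lowerU_10, lowerU_11, Int.cast_one] at h1
  have hτ := τ.ne_zero
  -- In the variable `-1/τ` the matrix acts as translation by `-n`. This does not affect the
  -- exponentials with nonzero coefficient, by `hn`.
  have e : (-1 / ((lowerU n • τ : ℍ) : ℂ)) = -1 / τ - n := by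
    rw [coe_lowerU_smul]; field_simp; ring
  rw [e, mul_sub, Complex.exp_sub]
  have : cexp (2 * Real.pi * I * ((∑ i, m i ^ 2 / (4 * (B (u i) (u i) * D ^ 2)) : ℚ) : ℂ) * n) = 1 := by
    rw [Complex.exp_eq_one_iff]
    refine ⟨z, ?_⟩
    have hz' : ((n * ∑ i, m i ^ 2 / (4 * (B (u i) (u i) * D ^ 2)) : ℚ) : ℂ) = z := by rw [hz]; push_cast; rfl
    rw [← hz']; push_cast; ring
  rw [this, div_one]

end

section

/-! ## The sign of the quadratic Gauss sum -/

open Complex Filter Topology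

/-- Near the cusp `1/p` the theta function splits into residue classes modulo `p`, each weighted
with a term of the Gauss sum. -/
theorem jacobiTheta₂_zero_eq_sum (p : ℕ) [NeZero p] (τ σ : ℍ) (hσ : (σ : ℂ) = 1 / p + τ) :
    jacobiTheta₂ 0 (2 * σ) = ∑ r : ZMod p, cexp (2 * Real.pi * I * ((r.val : ℂ) ^ 2 / p)) * thetaOne 1 p r τ := by
  have hs := fun r : ZMod p => summable_norm_thetaOne (s := 1) one_pos p r τ
  unfold thetaOne
  simp_rw [← tsum_mul_left]
  rw [← Summable.tsum_finsetSum fun r _ => (hs r).of_norm.mul_left _, jacobiTheta₂]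
  refine tsum_congr fun n => ?_
  rw [Finset.sum_eq_single (n : ZMod p)]
  · rw [if_pos rfl, jacobiTheta₂_term, ← Complex.exp_add, hσ]
    have h1 : ∃ k : ℤ, n = ((n : ZMod p).val : ℤ) + p * k := by
      have : ((n : ZMod p)) = ((((n : ZMod p).val : ℤ)) : ZMod p) := by simp
      rw [eq_comm, ZMod.intCast_eq_intCast_iff_dvd_sub] at this
      obtain ⟨k, hk⟩ := this
      exact ⟨k, by linarith⟩
    obtain ⟨k, hk⟩ := h1
    generalize (n : ZMod p).val = v at hk
    have hp : (p : ℂ) ≠ 0 := by exact_mod_cast NeZero.ne p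
    have hkC : (n : ℂ) = v + p * k := by rw [hk]; push_cast; ring
    rw [Complex.exp_eq_exp_iff_exists_int]
    refine ⟨2 * v * k + p * k ^ 2, ?_⟩
    push_cast
    rw [hkC]
    field_simp
    ring
  · intro r _ hr
    rw [if_neg (fun h => hr h.symm), mul_zero]
  · simp

theorem tendsto_jacobiTheta₂_ofReal (x : ℝ) :
    Tendsto (fun y : ℝ => jacobiTheta₂ x (I * y)) atTop (𝓝 1) := by
  obtain ⟨q, hq, h⟩ := HurwitzZeta.isBigO_atTop_cosKernel_sub (x : UnitAddCircle)
  have h0 : Tendsto (fun y : ℝ => Real.exp (-q * y)) atTop (𝓝 0) := by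
    apply Real.tendsto_exp_atBot.comp
    exact (tendsto_id.const_mul_atTop_of_neg (neg_neg_of_pos hq))
  have h1 := h.trans_tendsto h0
  have h2 : Tendsto (fun y : ℝ => HurwitzZeta.cosKernel (x : UnitAddCircle) y) atTop (𝓝 1) := by
    simpa using h1.add_const 1
  have h3 := (Complex.continuous_ofReal.tendsto 1).comp h2
  simp only [Function.comp_def, HurwitzZeta.cosKernel_def, ofReal_one] at h3
  exact h3

theorem tendsto_jacobiTheta₂_zero (x : ℝ) {k : ℝ} (hk : 0 < k) :
    Tendsto (fun y : ℝ => jacobiTheta₂ 0 (x + I * (k * y : ℝ))) atTop (𝓝 1) := by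
  have h1 : Tendsto (fun y : ℝ => x + I * (k * y : ℝ)) atTop (comap im atTop) := by
    rw [tendsto_comap_iff]
    refine (tendsto_id.const_mul_atTop hk).congr fun y => ?_
    simp
  have h2 := isBigO_at_im_infty_jacobiTheta_sub_one.comp_tendsto h1
  have h0 : Tendsto ((fun τ : ℂ => Real.exp (-Real.pi * τ.im)) ∘ fun y : ℝ => (x + I * (k * y : ℝ) : ℂ))
      atTop (𝓝 0) := by
    apply Real.tendsto_exp_atBot.comp
    have : Tendsto (fun y : ℝ => -Real.pi * (k * y)) atTop atBot :=
      (tendsto_id.const_mul_atTop hk).const_mul_atTop_of_neg (neg_neg_of_pos Real.pi_pos)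
    refine this.congr fun y => ?_
    simp
  have h3 := h2.trans_tendsto h0
  have h4 := h3.add_const 1
  simp only [Function.comp_def, sub_add_cancel, zero_add, jacobiTheta_eq_jacobiTheta₂] at h4
  exact h4

/-- The behaviour of the theta function at the points `1/p + i/y` for `y → ∞` is computed twice.
Splitting into residue classes gives the Gauss sum; an element of `Γ₀(4)` that moves `1/p` to `0`,
followed by inversion, gives the theta multiplier with its `ε_p`. -/
theorem sum_exp_sq_eq {p : ℕ} [Fact p.Prime] (hp2 : p ≠ 2) :
    ∑ r : ZMod p, cexp (2 * Real.pi * I * ((r.val : ℂ) ^ 2 / p)) = epsilon p * (p : ℂ) ^ (1 / 2 : ℂ) := by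
  have hp : p.Prime := Fact.out
  have hpodd : p % 2 = 1 := (hp.eq_two_or_odd).resolve_left hp2
  have hp0 : (p : ℂ) ≠ 0 := by exact_mod_cast hp.ne_zero
  have hpR : (0 : ℝ) < p := by exact_mod_cast hp.pos
  set c : ℤ := (p : ℤ) ^ 2 - 1 with hc
  have h4 : (4 : ℤ) ∣ -c := by
    rcases (show (p : ℤ) % 4 = 1 ∨ (p : ℤ) % 4 = 3 by omega) with h | h
    · obtain ⟨k, hk⟩ : ∃ k : ℤ, (p : ℤ) = 4 * k + 1 := ⟨p / 4, by omega⟩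
      exact ⟨-(4 * k ^ 2 + 2 * k), by rw [hc, hk]; ring⟩
    · obtain ⟨k, hk⟩ : ∃ k : ℤ, (p : ℤ) = 4 * k + 3 := ⟨p / 4, by omega⟩
      exact ⟨-(4 * k ^ 2 + 6 * k + 2), by rw [hc, hk]; ring⟩
  -- The cusp `1/p` goes to `0`. The lower right entry `p` brings `ε_p` into the multiplier, and the
  -- lower left entry `1 - p²` is divisible by `4` and congruent to `1` modulo `p`, so that the
  -- symbol is trivial.
  let γ : SL(2, ℤ) := ⟨!![(p : ℤ), -1; -c, p], by rw [Matrix.det_fin_two]; simp [hc]; ring⟩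
  have g00 : γ 0 0 = p := rfl
  have g01 : γ 0 1 = -1 := rfl
  have g10 : γ 1 0 = -c := rfl
  have g11 : γ 1 1 = p := rfl
  have hkr : kronecker (-c) p = 1 := by
    have : -c = 1 + (-p) * p := by rw [hc]; ring
    rw [this, kronecker_add_mul_left (by exact_mod_cast hp.pos), kronecker_of_pos (by exact_mod_cast hp.pos),
      jacobiSym.one_left]
  set G := ∑ r : ZMod p, cexp (2 * Real.pi * I * ((r.val : ℂ) ^ 2 / p)) with hG
  have hcp : ((c : ℤ) : ℂ) = p ^ 2 - 1 := by rw [hc]; push_cast; ring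
  -- the exact identity behind the limit
  have key : ∀ y : ℝ, 0 < y →
      1 / (2 * p / (1 / p - c * I / y : ℂ)) ^ (1 / 2 : ℂ) *
        jacobiTheta₂ 0 (((c / (2 * p) : ℝ) : ℂ) + I * ((1 / (2 * p ^ 2)) * y : ℝ)) =
      (epsilon p)⁻¹ * (1 / p - c * I / y : ℂ) ^ (1 / 2 : ℂ) *
        ∑ r : ZMod p, cexp (2 * Real.pi * I * ((r.val : ℂ) ^ 2 / p)) *
          (1 / (2 * (p : ℂ) ^ 2) ^ (1 / 2 : ℂ) *
            jacobiTheta₂ ((r.val / p : ℝ) : ℂ) (I * ((1 / (2 * p ^ 2) : ℝ) * y : ℝ))) := by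
    intro y hy
    have hyC : (y : ℂ) ≠ 0 := by exact_mod_cast hy.ne'
    let z : ℍ := ⟨I * (y⁻¹ : ℝ), by simpa using hy⟩
    have hz : (z : ℂ) = I / y := by
      change I * ((y⁻¹ : ℝ) : ℂ) = _
      push_cast; rw [div_eq_mul_inv]
    let σ : ℍ := ⟨1 / p + I / y, by
      have : ((1 / p + I / y : ℂ)).im = y⁻¹ := by
        have e : (1 / p + I / y : ℂ) = (((p : ℝ)⁻¹ : ℝ) : ℂ) + ((y⁻¹ : ℝ) : ℂ) * I := by
          push_cast; rw [one_div, div_eq_mul_inv]; ring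
        rw [e, add_im, im_ofReal_mul]; simp
      rw [this]; exact inv_pos.2 hy⟩
    have hσ : (σ : ℂ) = 1 / p + z := by rw [hz]
    have hden : ((γ 1 0 : ℂ) * σ + γ 1 1) = 1 / p - c * I / y := by
      rw [g10, g11, hσ, hz]; push_cast; rw [hcp]; field_simp; ring
    have hD0 : (1 / p - c * I / y : ℂ) ≠ 0 := by rw [← hden]; exact denom_ne_zero γ σ
    have hτ : ((γ • σ : ℍ) : ℂ) = (p * I / y) / (1 / p - c * I / y) := by
      rw [coe_sl_smul, hden, g00, g01, hσ, hz]; push_cast; field_simp; ring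
    have hlaw := thetaLaw_of_four_dvd γ (by rw [g10]; exact h4) 0 σ
    have e0 : (2 * Real.pi * I * (γ 1 0 * (0 : ℂ) ^ 2 / (4 * ((γ 1 0 : ℂ) * σ + γ 1 1)))) = 0 := by simp
    rw [e0, Complex.exp_zero, zero_div, mul_one, thetaFactor, hden, g10, g11, hkr,
      jacobiTheta₂_zero_eq_sum p z σ hσ, jacobiTheta₂_functional_equation 0, hτ] at hlaw
    have e1 : (-1 / (2 * ((p * I / y) / (1 / p - c * I / y))) : ℂ) =
        ((c / (2 * p) : ℝ) : ℂ) + I * ((1 / (2 * p ^ 2)) * y : ℝ) := by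
      have hI2 : I ^ 2 = -1 := I_sq
      push_cast
      field_simp
      ring_nf
      rw [hI2]; ring
    have e2 : (-I * (2 * ((p * I / y) / (1 / p - c * I / y))) : ℂ) =
        (2 * p / (1 / p - c * I / y : ℂ)) * ((y⁻¹ : ℝ) : ℂ) := by
      have hI2 : I ^ 2 = -1 := I_sq
      push_cast
      field_simp
      rw [hI2]; ring
    have hs := cpow_half_mul_of_pos (x := 2 * p / (1 / p - c * I / y : ℂ)) (y := ((y⁻¹ : ℝ) : ℂ))
      (div_ne_zero (mul_ne_zero two_ne_zero hp0) hD0) (inv_pos.2 hy) rfl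
    have hs2 := cpow_half_mul_of_pos (x := 2 * (p : ℂ) ^ 2) (y := ((y⁻¹ : ℝ) : ℂ))
      (mul_ne_zero two_ne_zero (pow_ne_zero 2 hp0)) (inv_pos.2 hy) rfl
    have e3 : ∀ r : ZMod p, thetaOne 1 p r z = 1 / (2 * (p : ℂ) ^ 2) ^ (1 / 2 : ℂ) *
        (1 / ((y⁻¹ : ℝ) : ℂ) ^ (1 / 2 : ℂ)) *
        jacobiTheta₂ ((r.val / p : ℝ) : ℂ) (I * ((1 / (2 * p ^ 2) : ℝ) * y : ℝ)) := by
      intro r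
      have hr : r = ((r.val : ℤ) : ZMod p) := by simp
      conv_lhs => rw [hr]
      rw [thetaOne_inversion one_pos hp.ne_zero]
      have e4 : (-I * (((2 * (1 : ℚ) * p ^ 2 : ℝ) : ℂ) * z)) = 2 * (p : ℂ) ^ 2 * ((y⁻¹ : ℝ) : ℂ) := by
        rw [hz]; push_cast; field_simp; rw [I_sq]; ring
      have e5 : (-1 / (((2 * (1 : ℚ) * p ^ 2 : ℝ) : ℂ) * z)) = I * ((1 / (2 * p ^ 2) : ℝ) * y : ℝ) := by
        rw [hz]; push_cast; field_simp; rw [I_sq]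
      rw [e4, hs2, e5]
      push_cast
      rw [one_div_mul_one_div]
    simp_rw [e3] at hlaw
    rw [e1, e2, hs] at hlaw
    have hy0 : ((y⁻¹ : ℝ) : ℂ) ^ (1 / 2 : ℂ) ≠ 0 := by
      rw [Ne, cpow_eq_zero_iff]
      rintro ⟨h, -⟩
      exact (inv_ne_zero hy.ne') (by exact_mod_cast h)
    have hA : ∀ S : ZMod p → ℂ, ∀ P Q : ℂ, ∑ r, S r * (P * (1 / ((y⁻¹ : ℝ) : ℂ) ^ (1 / 2 : ℂ)) * Q) =
      (1 / ((y⁻¹ : ℝ) : ℂ) ^ (1 / 2 : ℂ)) * ∑ r, S r * (P * Q) := by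
      intro S P Q; rw [Finset.mul_sum]; exact Finset.sum_congr rfl fun _ _ => by ring
    have hsum : ∑ r : ZMod p, cexp (2 * Real.pi * I * ((r.val : ℂ) ^ 2 / p)) *
        (1 / (2 * (p : ℂ) ^ 2) ^ (1 / 2 : ℂ) * (1 / ((y⁻¹ : ℝ) : ℂ) ^ (1 / 2 : ℂ)) *
        jacobiTheta₂ ((r.val / p : ℝ) : ℂ) (I * ((1 / (2 * p ^ 2) : ℝ) * y : ℝ))) =
        (1 / ((y⁻¹ : ℝ) : ℂ) ^ (1 / 2 : ℂ)) * ∑ r : ZMod p, cexp (2 * Real.pi * I * ((r.val : ℂ) ^ 2 / p)) *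
          (1 / (2 * (p : ℂ) ^ 2) ^ (1 / 2 : ℂ) *
            jacobiTheta₂ ((r.val / p : ℝ) : ℂ) (I * ((1 / (2 * p ^ 2) : ℝ) * y : ℝ))) := by
      rw [Finset.mul_sum]; exact Finset.sum_congr rfl fun _ _ => by ring
    rw [hsum] at hlaw
    have e6 : (-Real.pi * I * 0 ^ 2 / (2 * ((p * I / y) / (1 / p - c * I / y))) : ℂ) = 0 := by simp
    rw [e6, Complex.exp_zero, mul_one, zero_div] at hlaw
    rw [← one_div_mul_one_div] at hlaw
    have hy1 := one_div_ne_zero hy0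
    apply mul_left_cancel₀ hy1
    simp only [Int.cast_one, one_mul] at hlaw
    linear_combination hlaw
  -- pass to the limit
  have hlimD : Tendsto (fun y : ℝ => (1 / p - c * I / y : ℂ)) atTop (𝓝 (1 / p)) := by
    have h1 : Tendsto (fun y : ℝ => (c * I) * (((y⁻¹ : ℝ)) : ℂ)) atTop (𝓝 ((c * I) * ((0 : ℝ) : ℂ))) :=
      ((Complex.continuous_ofReal.tendsto 0).comp tendsto_inv_atTop_zero).const_mul _
    have := h1.const_sub (1 / p : ℂ)
    simp only [ofReal_zero, mul_zero, sub_zero] at this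
    refine this.congr fun y => ?_
    push_cast; rw [div_eq_mul_inv (c * I : ℂ)]
  have hslit : (1 / p : ℂ) ∈ slitPlane := by
    left; rw [show (1 / p : ℂ) = ((1 / p : ℝ) : ℂ) by push_cast; rfl, ofReal_re]; positivity
  have hslit2 : (2 * p / (1 / p) : ℂ) ∈ slitPlane := by
    left; rw [show (2 * p / (1 / p) : ℂ) = ((2 * p / (1 / p) : ℝ) : ℂ) by push_cast; rfl, ofReal_re]
    positivity
  have hL : Tendsto (fun y : ℝ => 1 / (2 * p / (1 / p - c * I / y : ℂ)) ^ (1 / 2 : ℂ) *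
        jacobiTheta₂ 0 (((c / (2 * p) : ℝ) : ℂ) + I * ((1 / (2 * p ^ 2)) * y : ℝ))) atTop
        (𝓝 (1 / (2 * p / (1 / p)) ^ (1 / 2 : ℂ) * 1)) := by
    refine Tendsto.mul (Tendsto.div tendsto_const_nhds ?_ ?_)
      (tendsto_jacobiTheta₂_zero _ (by positivity))
    · exact (tendsto_const_nhds.div hlimD (by simpa using hp0)).cpow tendsto_const_nhds hslit2
    · rw [Ne, cpow_eq_zero_iff]; simp [hp0]
  have hR : Tendsto (fun y : ℝ => (epsilon p)⁻¹ * (1 / p - c * I / y : ℂ) ^ (1 / 2 : ℂ) *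
        ∑ r : ZMod p, cexp (2 * Real.pi * I * ((r.val : ℂ) ^ 2 / p)) *
          (1 / (2 * (p : ℂ) ^ 2) ^ (1 / 2 : ℂ) *
            jacobiTheta₂ ((r.val / p : ℝ) : ℂ) (I * ((1 / (2 * p ^ 2) : ℝ) * y : ℝ)))) atTop
      (𝓝 ((epsilon p)⁻¹ * (1 / p) ^ (1 / 2 : ℂ) *
        ∑ r : ZMod p, cexp (2 * Real.pi * I * ((r.val : ℂ) ^ 2 / p)) *
          (1 / (2 * (p : ℂ) ^ 2) ^ (1 / 2 : ℂ) * 1))) := by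
    refine Tendsto.mul (tendsto_const_nhds.mul (hlimD.cpow tendsto_const_nhds hslit)) ?_
    refine tendsto_finsetSum _ fun r _ => tendsto_const_nhds.mul (tendsto_const_nhds.mul ?_)
    exact (tendsto_jacobiTheta₂_ofReal _).comp (tendsto_id.const_mul_atTop (by positivity))
  have heq := tendsto_nhds_unique (hL.congr' ((eventually_gt_atTop 0).mono key)) hR
  rw [← Finset.sum_mul, ← hG] at heq
  have e7 : (2 * p / (1 / p) : ℂ) = 2 * (p : ℂ) ^ 2 := by field_simp
  have h20 : (2 * (p : ℂ) ^ 2) ^ (1 / 2 : ℂ) ≠ 0 := by rw [Ne, cpow_eq_zero_iff]; simp [hp0]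
  have hinv : (1 / p : ℂ) ^ (1 / 2 : ℂ) = ((p : ℂ) ^ (1 / 2 : ℂ))⁻¹ := by
    rw [one_div, inv_cpow]
    rw [natCast_arg]; exact Real.pi_pos.ne
  have hp1 : (p : ℂ) ^ (1 / 2 : ℂ) ≠ 0 := by rw [Ne, cpow_eq_zero_iff]; simp [hp0]
  have hε := epsilon_ne_zero p
  rw [e7, hinv] at heq
  field_simp at heq
  rw [← heq]

/-- Since `b` has `1 + χ(b)` square roots, the exponential sum over squares is the Gauss sum of `χ`.
The frequency `n` is removed by substituting `nb` if `p ∤ n`; otherwise both sides vanish. -/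
theorem sum_quadraticChar_exp {p : ℕ} [Fact p.Prime] (hp2 : p ≠ 2) (n : ℤ) :
    ∑ b : ZMod p, (quadraticChar (ZMod p) (-b) : ℂ) * cexp (2 * Real.pi * I * ((b.val : ℂ) * n / p)) =
      (quadraticChar (ZMod p) (-n) : ℂ) * epsilon p * (p : ℂ) ^ (1 / 2 : ℂ) := by
  have hψ : ∀ b : ZMod p, cexp (2 * Real.pi * I * ((b.val : ℂ) * n / p)) = ZMod.stdAddChar ((n : ZMod p) * b) := by
    intro b
    have : ((n : ZMod p) * b) = ((n * b.val : ℤ) : ZMod p) := by simp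
    rw [this, ZMod.stdAddChar_coe]
    congr 1
    push_cast
    ring
  have hring : ringChar (ZMod p) ≠ 2 := by rwa [ZMod.ringChar_zmod_n]
  have hG : ∑ b : ZMod p, (quadraticChar (ZMod p) b : ℂ) * ZMod.stdAddChar b =
      epsilon p * (p : ℂ) ^ (1 / 2 : ℂ) := by
    rw [← sum_exp_sq_eq hp2]
    have h1 : ∀ r : ZMod p, cexp (2 * Real.pi * I * ((r.val : ℂ) ^ 2 / p)) = ZMod.stdAddChar (r ^ 2) := by
      intro r
      have : (r ^ 2) = (((r.val : ℤ) ^ 2 : ℤ) : ZMod p) := by simp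
      rw [this, ZMod.stdAddChar_coe]
      congr 1
      push_cast
      ring
    simp_rw [h1]
    rw [← Finset.sum_fiberwise (g := fun r : ZMod p => r ^ 2) Finset.univ
      (fun r : ZMod p => (ZMod.stdAddChar (r ^ 2) : ℂ))]
    have h2 : ∀ b : ZMod p, ∑ r ∈ Finset.univ.filter (fun r : ZMod p => r ^ 2 = b), (ZMod.stdAddChar (r ^ 2) : ℂ) =
        ((quadraticChar (ZMod p) b : ℂ) + 1) * ZMod.stdAddChar b := by
      intro b
      rw [Finset.sum_congr rfl (g := fun _ => (ZMod.stdAddChar b : ℂ)) (by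
        intro r hr; rw [(Finset.mem_filter.1 hr).2]), Finset.sum_const, nsmul_eq_mul]
      congr 1
      have := quadraticChar_card_sqrts hring b
      have e : {x : ZMod p | x ^ 2 = b}.toFinset = Finset.univ.filter (fun r : ZMod p => r ^ 2 = b) := by
        ext; simp
      rw [e] at this
      exact_mod_cast congrArg (Int.cast : ℤ → ℂ) this
    rw [Finset.sum_congr rfl fun b _ => h2 b]
    simp_rw [add_mul, one_mul, Finset.sum_add_distrib]
    rw [AddChar.sum_eq_zero_of_ne_one, add_zero]
    simpa [AddChar.mulShift_one] using ZMod.isPrimitive_stdAddChar p (one_ne_zero (α := ZMod p))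
  simp_rw [hψ]
  by_cases hn : (n : ZMod p) = 0
  · simp only [hn, neg_zero, MulChar.map_zero, zero_mul, Int.cast_zero, AddChar.map_zero_eq_one, mul_one]
    have h0 := quadraticChar_sum_zero hring
    have h1 : ∑ b : ZMod p, quadraticChar (ZMod p) (-b) = 0 := by
      rw [← h0]; exact Equiv.sum_comp (Equiv.neg (ZMod p)) fun b => quadraticChar (ZMod p) b
    exact_mod_cast congrArg (Int.cast : ℤ → ℂ) h1
  · rw [mul_assoc, ← hG, Finset.mul_sum,
      ← Equiv.sum_comp (Equiv.mulLeft₀ (n : ZMod p) hn) fun b => (quadraticChar (ZMod p) (-n) : ℂ) *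
        ((quadraticChar (ZMod p) b : ℂ) * ZMod.stdAddChar b)]
    refine Finset.sum_congr rfl fun b _ => ?_
    simp only [Equiv.mulLeft₀_apply]
    have h2 : (quadraticChar (ZMod p) (n : ZMod p)) ^ 2 = 1 := quadraticChar_sq_one hn
    have h3 : quadraticChar (ZMod p) (-b) = quadraticChar (ZMod p) (-n) *
        quadraticChar (ZMod p) (n * b) := by
      rw [← neg_one_mul, ← neg_one_mul (n : ZMod p), map_mul, map_mul, map_mul]
      linear_combination (-(quadraticChar (ZMod p) (-1) * quadraticChar (ZMod p) b)) * h2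
    rw [h3]
    push_cast
    ring

end

section

/-! ## Hecke operators on families of theta type -/

open Complex CongruenceSubgroup

/-- `ψ` behaves like a quadratic character modulo `N`. -/
structure IsQuadChar (N : ℕ) (ψ : ℤ → ℂ) : Prop where
  one : ψ 1 = 1
  mul : ∀ m n, m ≠ 0 → n ≠ 0 → ψ (m * n) = ψ m * ψ n
  per : ∀ d d', IsCoprime d (N : ℤ) → (N : ℤ) ∣ d' - d → ψ d' = ψ d
  sq : ∀ d, IsCoprime d (N : ℤ) → ψ d ^ 2 = 1

/-- A family of forms on `Γ₀(N) ∩ Γ₁(a)` permuted by the diamond operators of `Γ₀(N)`. -/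
structure IsThetaFamily (N a : ℕ) (ψ : ℤ → ℂ) (Θ : ZMod a → ℍ → ℂ) : Prop where
  slash_eq : ∀ γ ∈ Gamma0 N, ∀ b, slash 3 γ (Θ b) = ψ (γ 1 1) • Θ ((γ 0 0 : ZMod a) * b)
  holo : ∀ b, MDifferentiable 𝓘(ℂ) 𝓘(ℂ) (Θ b)
  growth : ∀ b, ∃ (C : ℝ) (n : ℕ), ∀ z : ℍ, ‖Θ b z‖ ≤ C * (z.im + z.im⁻¹) ^ n

theorem dvd_of_mem_Gamma0 {N : ℕ} {γ : SL(2, ℤ)} (h : γ ∈ Gamma0 N) : (N : ℤ) ∣ γ 1 0 :=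
  (ZMod.intCast_zmod_eq_zero_iff_dvd _ _).1 (Gamma0_mem.1 h)

theorem mem_Gamma0_of_dvd {N : ℕ} {γ : SL(2, ℤ)} (h : (N : ℤ) ∣ γ 1 0) : γ ∈ Gamma0 N :=
  Gamma0_mem.2 ((ZMod.intCast_zmod_eq_zero_iff_dvd _ _).2 h)

theorem det_eq (γ : SL(2, ℤ)) : γ 0 0 * γ 1 1 - γ 0 1 * γ 1 0 = 1 := by
  have := γ.det_coe
  rwa [Matrix.det_fin_two] at this

theorem isCoprime_11 {N : ℕ} {γ : SL(2, ℤ)} (h : γ ∈ Gamma0 N) : IsCoprime (γ 1 1) (N : ℤ) := by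
  obtain ⟨k, hk⟩ := dvd_of_mem_Gamma0 h
  have := det_eq γ
  exact ⟨γ 0 0, -γ 0 1 * k, by rw [hk] at this; linarith⟩

theorem isCoprime_00 {N : ℕ} {γ : SL(2, ℤ)} (h : γ ∈ Gamma0 N) : IsCoprime (γ 0 0) (N : ℤ) := by
  obtain ⟨k, hk⟩ := dvd_of_mem_Gamma0 h
  have := det_eq γ
  exact ⟨γ 1 1, -γ 0 1 * k, by rw [hk] at this; linarith⟩

theorem cast_00_mul_11 {N a : ℕ} (ha : a ∣ N) {γ : SL(2, ℤ)} (h : γ ∈ Gamma0 N) :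
    (γ 0 0 : ZMod a) * (γ 1 1 : ZMod a) = 1 := by
  have h0 : ((γ 1 0 : ℤ) : ZMod a) = 0 := (ZMod.intCast_zmod_eq_zero_iff_dvd _ _).2
    ((Int.natCast_dvd_natCast.2 ha).trans (dvd_of_mem_Gamma0 h))
  have := congrArg (Int.cast : ℤ → ZMod a) (det_eq γ)
  push_cast at this
  rw [h0] at this
  simpa using this

theorem IsQuadChar.twist_sq {N : ℕ} {ψ : ℤ → ℂ} (hψ : IsQuadChar N ψ) {γ : SL(2, ℤ)} (h : γ ∈ Gamma0 N) :
    ψ (γ 0 0) = ψ (γ 1 1) := by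
  have h1 := hψ.sq _ (isCoprime_11 h)
  have h2 : ψ (γ 0 0) * ψ (γ 1 1) = 1 := by
    -- Multiplicativity of `ψ` is only assumed for nonzero arguments. A zero diagonal entry forces
    -- `N ∣ 1`, and then periodicity makes `ψ` constant.
    by_cases h0 : γ 0 0 = 0 ∨ γ 1 1 = 0
    · have hN : (N : ℤ) ∣ 1 := by
        rcases h0 with h0 | h0
        · have := det_eq γ
          rw [h0] at this
          have hd := (dvd_of_mem_Gamma0 h).mul_left (-γ 0 1)
          rwa [show -γ 0 1 * γ 1 0 = 1 by linarith] at hd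
        · have := det_eq γ
          rw [h0] at this
          have hd := (dvd_of_mem_Gamma0 h).mul_left (-γ 0 1)
          rwa [show -γ 0 1 * γ 1 0 = 1 by linarith] at hd
      have key : ∀ d, ψ d = 1 := fun d => by
        rw [← hψ.one]
        exact hψ.per 1 d isCoprime_one_left (hN.trans (one_dvd _))
      rw [key, key, one_mul]
    · push Not at h0
      rw [← hψ.mul _ _ h0.1 h0.2, ← hψ.one]
      refine hψ.per 1 _ isCoprime_one_left ?_
      have := det_eq γ
      rw [show γ 0 0 * γ 1 1 - 1 = γ 0 1 * γ 1 0 by linarith]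
      exact (dvd_of_mem_Gamma0 h).mul_left _
  linear_combination ψ (γ 1 1) * h2 - ψ (γ 0 0) * h1

theorem mdifferentiable_fun_sum {ι : Type*} (s : Finset ι) (f : ι → ℍ → ℂ)
    (h : ∀ i ∈ s, MDifferentiable 𝓘(ℂ) 𝓘(ℂ) (f i)) : MDifferentiable 𝓘(ℂ) 𝓘(ℂ) (∑ i ∈ s, f i) := by
  rw [UpperHalfPlane.mdifferentiable_iff]
  have : (∑ i ∈ s, f i) ∘ UpperHalfPlane.ofComplex = fun z => ∑ i ∈ s, (f i ∘ UpperHalfPlane.ofComplex) z := by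
    ext z; simp
  rw [this]
  exact DifferentiableOn.fun_sum fun i hi => UpperHalfPlane.mdifferentiable_iff.1 (h i hi)

theorem mdifferentiable_smul (c : ℂ) {f : ℍ → ℂ} (h : MDifferentiable 𝓘(ℂ) 𝓘(ℂ) f) :
    MDifferentiable 𝓘(ℂ) 𝓘(ℂ) (c • f) := by
  rw [UpperHalfPlane.mdifferentiable_iff] at h ⊢
  exact h.const_smul c

theorem one_le_im_add_inv (z : ℍ) : 1 ≤ z.im + z.im⁻¹ := by
  have hz := z.im_pos
  rcases le_total 1 z.im with h | h
  · linarith [inv_pos.2 hz]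
  · linarith [(one_le_inv₀ hz).2 h]

theorem growth_sum {ι : Type*} (s : Finset ι) (f : ι → ℍ → ℂ)
    (h : ∀ i ∈ s, ∃ (C : ℝ) (n : ℕ), ∀ z : ℍ, ‖f i z‖ ≤ C * (z.im + z.im⁻¹) ^ n) :
    ∃ (C : ℝ) (n : ℕ), ∀ z : ℍ, ‖(∑ i ∈ s, f i) z‖ ≤ C * (z.im + z.im⁻¹) ^ n := by
  classical
  induction s using Finset.induction_on with
  | empty => exact ⟨0, 0, fun z => by simp⟩
  | insert i s hi ih =>
    obtain ⟨C, n, h1⟩ := ih fun j hj => h j (Finset.mem_insert_of_mem hj)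
    obtain ⟨C', n', h2⟩ := h i (Finset.mem_insert_self i s)
    refine ⟨|C| + |C'|, n + n', fun z => ?_⟩
    rw [Finset.sum_insert hi, Pi.add_apply]
    have hz := one_le_im_add_inv z
    have e1 := pow_le_pow_right₀ hz (Nat.le_add_right n n')
    have e2 := pow_le_pow_right₀ hz (Nat.le_add_left n' n)
    have e3 : 0 ≤ (z.im + z.im⁻¹) ^ n := by positivity
    have e4 : 0 ≤ (z.im + z.im⁻¹) ^ n' := by positivity
    calc ‖f i z + (∑ i ∈ s, f i) z‖ ≤ ‖f i z‖ + ‖(∑ i ∈ s, f i) z‖ := norm_add_le _ _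
      _ ≤ |C'| * (z.im + z.im⁻¹) ^ n' + |C| * (z.im + z.im⁻¹) ^ n :=
        add_le_add ((h2 z).trans (mul_le_mul_of_nonneg_right (le_abs_self _) e4))
          ((h1 z).trans (mul_le_mul_of_nonneg_right (le_abs_self _) e3))
      _ ≤ |C'| * (z.im + z.im⁻¹) ^ (n + n') + |C| * (z.im + z.im⁻¹) ^ (n + n') :=
        add_le_add (mul_le_mul_of_nonneg_left e2 (abs_nonneg _))
          (mul_le_mul_of_nonneg_left e1 (abs_nonneg _))
      _ = _ := by ring

theorem growth_smul (c : ℂ) {f : ℍ → ℂ}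
    (h : ∃ (C : ℝ) (n : ℕ), ∀ z : ℍ, ‖f z‖ ≤ C * (z.im + z.im⁻¹) ^ n) :
    ∃ (C : ℝ) (n : ℕ), ∀ z : ℍ, ‖(c • f) z‖ ≤ C * (z.im + z.im⁻¹) ^ n := by
  obtain ⟨C, n, h⟩ := h
  refine ⟨‖c‖ * C, n, fun z => ?_⟩
  rw [Pi.smul_apply, norm_smul, mul_assoc]
  exact mul_le_mul_of_nonneg_left (h z) (norm_nonneg c)

/-- The members of a theta family decompose into forms with characters. -/
theorem IsThetaFamily.exists_decomposition {N a : ℕ} [NeZero a] (haN : a ∣ N) {ψ : ℤ → ℂ}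
    {Θ : ZMod a → ℍ → ℂ} (h : IsThetaFamily N a ψ Θ) : ∃ F, IsDecomposition 3 N a ψ (Θ 1) F := by
  classical
  have hφ : (a.totient : ℂ) ≠ 0 := by
    exact_mod_cast (Nat.totient_pos.2 (Nat.pos_of_ne_zero (NeZero.ne a))).ne'
  -- Projection to the `χ`-part by averaging against `χ`; orthogonality of characters recovers `Θ 1`
  -- from the parts.
  refine ⟨fun χ => (a.totient : ℂ)⁻¹ • ∑ b : ZMod a, χ b • Θ b, fun χ => ⟨?_, ?_, ?_⟩, ?_⟩
  · intro γ hγ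
    rw [slash_smul, slash_sum, smul_comm]
    congr 1
    have hu := cast_00_mul_11 haN hγ
    have hu' : (γ 1 1 : ZMod a) * (γ 0 0 : ZMod a) = 1 := by rw [mul_comm]; exact hu
    let ε : ZMod a ≃ ZMod a :=
      { toFun := fun r => (γ 0 0 : ZMod a) * r
        invFun := fun r => (γ 1 1 : ZMod a) * r
        left_inv := fun r => by simp only; rw [← mul_assoc, hu', one_mul]
        right_inv := fun r => by simp only; rw [← mul_assoc, hu, one_mul] }
    rw [Finset.smul_sum, ← Equiv.sum_comp ε fun b => twist χ ψ (γ 1 1) • χ b • Θ b]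
    refine Finset.sum_congr rfl fun b _ => ?_
    rw [slash_smul, h.slash_eq γ hγ, smul_smul, smul_smul]
    congr 1
    simp only [twist, ε, Equiv.coe_fn_mk, map_mul]
    have : χ (γ 1 1 : ZMod a) * χ (γ 0 0 : ZMod a) = 1 := by rw [← map_mul, hu', map_one]
    linear_combination (-(χ b * ψ (γ 1 1))) * this
  · exact mdifferentiable_smul _ (mdifferentiable_fun_sum _ _ fun b _ => mdifferentiable_smul _ (h.holo b))
  · exact growth_smul _ (growth_sum _ _ fun b _ => growth_smul _ (h.growth b))
  · rw [finsum_eq_sum_of_fintype, ← Finset.smul_sum, Finset.sum_comm]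
    simp_rw [← Finset.sum_smul]
    have key : ∀ b : ZMod a, ∑ χ : DirichletCharacter ℂ a, χ b = if b = 1 then (a.totient : ℂ) else 0 := by
      intro b
      have := DirichletCharacter.sum_char_inv_mul_char_eq ℂ (isUnit_one (M := ZMod a)) b
      simp only [ZMod.inv_one, MulChar.map_one, one_mul] at this
      rw [this]
      exact if_congr eq_comm rfl rfl
    simp_rw [key, ite_smul, zero_smul]
    rw [Finset.sum_ite_eq' Finset.univ (1 : ZMod a), if_pos (Finset.mem_univ _), smul_smul,
      inv_mul_cancel₀ hφ, one_smul]

theorem slashXi_sum {ι : Type*} (k p : ℕ) (s : Finset ι) (f : ι → ℍ → ℂ) :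
    slashXi k p (∑ i ∈ s, f i) = ∑ i ∈ s, slashXi k p (f i) := by
  ext z; simp only [slashXi, Finset.sum_apply, Finset.mul_sum]

theorem slashXi_smul (k p : ℕ) (c : ℂ) (f : ℍ → ℂ) : slashXi k p (c • f) = c • slashXi k p f := by
  ext z; simp only [slashXi, Pi.smul_apply, smul_eq_mul]; ring

theorem inv_11 (γ : SL(2, ℤ)) : (γ⁻¹) 1 1 = γ 0 0 := by
  rw [Matrix.SpecialLinearGroup.SL2_inv_expl]; rfl

theorem inv_00 (γ : SL(2, ℤ)) : (γ⁻¹) 0 0 = γ 1 1 := by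
  rw [Matrix.SpecialLinearGroup.SL2_inv_expl]; rfl

/-- The contribution of the right coset of `ξγ` to the image of a theta family. -/
def heckeTerm (p : ℕ) {a : ℕ} (ψ : ℤ → ℂ) (Θ : ZMod a → ℍ → ℂ) (γ : SL(2, ℤ)) : ℍ → ℂ :=
  ψ (γ 0 0) • slash 3 γ (slashXi 3 p (Θ (γ 1 1 : ZMod a)))

/-- The decomposition chosen in `hecke` is arbitrary, but only the sums of the `(χψ)(γ 0 0) F_χ`
over `χ` enter. Such a sum is the slash of `Θ 1` with `γ⁻¹`, hence `ψ(γ 0 0) Θ (γ 1 1)`,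
independently of the choice. -/
theorem IsThetaFamily.hecke_eq {N a : ℕ} [NeZero a] (haN : a ∣ N) {ψ : ℤ → ℂ}
    {Θ : ZMod a → ℍ → ℂ} (h : IsThetaFamily N a ψ Θ) (p : ℕ) [Finite (Quotient (heckeCosets N p))] :
    hecke 3 N a p ψ (Θ 1) = ((p : ℂ) ^ ((3 : ℂ) / 2 - 2)) •
      ∑ᶠ c : Quotient (heckeCosets N p), heckeTerm p ψ Θ c.out.1 := by
  classical
  have := Fintype.ofFinite (Quotient (heckeCosets N p))
  unfold hecke
  rw [dif_pos (h.exists_decomposition haN)]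
  obtain ⟨hF, hsum⟩ := (h.exists_decomposition haN).choose_spec
  set F := (h.exists_decomposition haN).choose
  rw [finsum_eq_sum_of_fintype, finsum_eq_sum_of_fintype]
  unfold heckeGamma0
  simp_rw [finsum_eq_sum_of_fintype]
  rw [← Finset.smul_sum, Finset.sum_comm]
  congr 1
  refine Finset.sum_congr rfl fun c _ => ?_
  set γ := c.out
  have h1 : ∑ χ, twist χ ψ (γ.1 0 0) • F χ = ψ (γ.1 0 0) • Θ (γ.1 1 1 : ZMod a) := by
    have e1 := h.slash_eq (γ.1⁻¹) (inv_mem γ.2) 1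
    rw [hsum, finsum_eq_sum_of_fintype, slash_sum, inv_11, inv_00, mul_one] at e1
    rw [← e1]
    refine Finset.sum_congr rfl fun χ _ => ?_
    rw [(hF χ).slash_eq _ (inv_mem γ.2), inv_11]
  calc ∑ χ, twist χ ψ (γ.1 0 0) • slash 3 γ.1 (slashXi 3 p (F χ))
      = slash 3 γ.1 (slashXi 3 p (∑ χ, twist χ ψ (γ.1 0 0) • F χ)) := by
        rw [slashXi_sum, slash_sum]
        refine Finset.sum_congr rfl fun χ _ => ?_
        rw [slashXi_smul, slash_smul]
    _ = _ := by rw [h1, slashXi_smul, slash_smul]; rfl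

end

section

/-! ## Representatives for the Hecke operator -/

open Complex CongruenceSubgroup

theorem ofComplex_eq {w : ℂ} {z : ℍ} (h : w = z) : UpperHalfPlane.ofComplex w = z := by
  rw [h, UpperHalfPlane.ofComplex_apply]

theorem coe_ofComplex_affine {r : ℝ} (hr : 0 < r) (s : ℝ) (z : ℍ) :
    ((UpperHalfPlane.ofComplex (r * z + s) : ℍ) : ℂ) = r * z + s := by
  have : 0 < (r * z + s : ℂ).im := by simpa using mul_pos hr z.im_pos
  rw [UpperHalfPlane.ofComplex_apply_of_im_pos this]

theorem coe_ofComplex_div {p : ℕ} (hp : p ≠ 0) (z : ℍ) :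
    ((UpperHalfPlane.ofComplex ((z : ℂ) / (p : ℂ) ^ 2) : ℍ) : ℂ) = (z : ℂ) / (p : ℂ) ^ 2 := by
  have h := coe_ofComplex_affine (r := ((p : ℝ) ^ 2)⁻¹) (by
    have : (0 : ℝ) < p := by exact_mod_cast Nat.pos_of_ne_zero hp
    positivity) 0 z
  have e : ((((p : ℝ) ^ 2)⁻¹ : ℝ) : ℂ) * z + ((0 : ℝ) : ℂ) = (z : ℂ) / (p : ℂ) ^ 2 := by
    push_cast; rw [add_zero, div_eq_mul_inv, mul_comm]
  rwa [e] at h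

/-- Conjugation with `ξ`: the lower left entries of `δ` and `δ'` differ by the square `p²`,
invisible to the Kronecker symbol, so the standard lifts to the metaplectic group are compatible. -/
theorem slash_slashXi {p : ℕ} (hp : p ≠ 0) {δ δ' : SL(2, ℤ)} (h00 : δ 0 0 = δ' 0 0)
    (h01 : δ' 0 1 = p ^ 2 * δ 0 1) (h10 : δ 1 0 = p ^ 2 * δ' 1 0) (h11 : δ 1 1 = δ' 1 1)
    (f : ℍ → ℂ) : slash 3 δ' (slashXi 3 p f) = slashXi 3 p (slash 3 δ f) := by
  ext z
  have hpC : (p : ℂ) ≠ 0 := by exact_mod_cast hp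
  have hw := coe_ofComplex_div hp z
  set w : ℍ := UpperHalfPlane.ofComplex ((z : ℂ) / (p : ℂ) ^ 2)
  have hden : (δ 1 0 : ℂ) * w + δ 1 1 = (δ' 1 0 : ℂ) * z + δ' 1 1 := by
    rw [hw, h10, h11]; push_cast; field_simp
  have hpt : ((δ' • z : ℍ) : ℂ) / (p : ℂ) ^ 2 = ((δ • w : ℍ) : ℂ) := by
    have := denom_ne_zero δ' z
    rw [coe_sl_smul, coe_sl_smul, hden, hw, h00, h01]; push_cast; field_simp
  have hkr : kronecker (δ 1 0) (δ 1 1) = kronecker (δ' 1 0) (δ' 1 1) := by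
    have hcop : IsCoprime (p : ℤ) (δ' 1 1) := by
      have := isCoprime_bottom δ
      rw [h10, h11] at this
      exact this.of_isCoprime_of_dvd_left ⟨p * δ' 1 0, by ring⟩
    rw [h10, h11, mul_comm, kronecker_mul_of_pos (by positivity), jacobiSym.sq_one', mul_one]
    rw [Int.isCoprime_iff_gcd_eq_one] at hcop
    exact hcop
  simp only [slash, slashXi]
  rw [ofComplex_eq hpt, hden, hkr, h11]
  ring

/-- Independence of the representative. The factor `δ'` with `γ' = δ'γ` is moved through `ξ`, acts
on `Θ` through its diagonal entries, and cancels against the changes of the index and of the value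
of `ψ`; the latter occurs squared. -/
theorem heckeTerm_congr {N a p : ℕ} (haN : a ∣ N) (h4 : 4 ∣ N) (hp : p ≠ 0) {ψ : ℤ → ℂ}
    (hψ : IsQuadChar N ψ)
    {Θ : ZMod a → ℍ → ℂ} (h : IsThetaFamily N a ψ Θ) {γ γ' : Gamma0 N}
    (hr : (heckeCosets N p).r γ γ') : heckeTerm p ψ Θ γ.1 = heckeTerm p ψ Θ γ'.1 := by
  obtain ⟨δ, hδ⟩ := hr
  set δ' : SL(2, ℤ) := γ'.1 * γ.1⁻¹ with hδ'
  have hδ'N : δ' ∈ Gamma0 N := mul_mem γ'.2 (inv_mem γ.2)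
  have hγ' : γ'.1 = δ' * γ.1 := by rw [hδ', inv_mul_cancel_right]
  have hmat : (δ.1 : Matrix (Fin 2) (Fin 2) ℤ) * heckeMatrix p = heckeMatrix p * (δ' : Matrix (Fin 2) (Fin 2) ℤ) := by
    have e1 : (γ.1 : Matrix (Fin 2) (Fin 2) ℤ) * ((γ.1⁻¹ : SL(2, ℤ)) : Matrix (Fin 2) (Fin 2) ℤ) = 1 := by
      rw [← Matrix.SpecialLinearGroup.coe_mul, mul_inv_cancel, Matrix.SpecialLinearGroup.coe_one]
    have := congrArg (· * ((γ.1⁻¹ : SL(2, ℤ)) : Matrix (Fin 2) (Fin 2) ℤ)) hδ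
    simp only [Matrix.mul_assoc] at this
    rw [e1, Matrix.mul_one] at this
    rw [this, hδ', Matrix.SpecialLinearGroup.coe_mul]
  have hp2 : (p : ℤ) ^ 2 ≠ 0 := by positivity
  have m00 := congrFun (congrFun hmat 0) 0
  have m01 := congrFun (congrFun hmat 0) 1
  have m10 := congrFun (congrFun hmat 1) 0
  have m11 := congrFun (congrFun hmat 1) 1
  simp only [heckeMatrix, Matrix.mul_apply, Fin.sum_univ_two, Matrix.of_apply, Matrix.cons_val',
    Matrix.cons_val_zero, Matrix.cons_val_one, Matrix.cons_val_fin_one, mul_one, mul_zero, zero_mul,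
    one_mul, add_zero, zero_add] at m00 m01 m10 m11
  have m11' : δ.1 1 1 = δ' 1 1 := mul_right_cancel₀ hp2 (m11.trans (mul_comm _ _))
  have hs := slash_slashXi (p := p) hp m00 (m01.symm.trans (mul_comm _ _)) m10 m11'
  have h4' : ∀ {g : SL(2, ℤ)}, g ∈ Gamma0 N → (4 : ℤ) ∣ g 1 0 := fun hg =>
    (by exact_mod_cast h4 : (4 : ℤ) ∣ N).trans (dvd_of_mem_Gamma0 hg)
  have hne : ∀ {g : SL(2, ℤ)}, g ∈ Gamma0 N → g 0 0 ≠ 0 := by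
    intro g hg h0
    have hc := isCoprime_00 hg
    rw [h0, isCoprime_zero_left, Int.isUnit_iff] at hc
    omega
  unfold heckeTerm
  have e00 : ψ (γ'.1 0 0) = ψ (δ' 0 0) * ψ (γ.1 0 0) := by
    rw [← hψ.mul _ _ (hne hδ'N) (hne γ.2)]
    have hcop : IsCoprime (δ' 0 0 * γ.1 0 0) (N : ℤ) := (isCoprime_00 hδ'N).mul_left (isCoprime_00 γ.2)
    refine hψ.per _ _ hcop ?_
    rw [hγ', mul_apply_sl, add_sub_cancel_left]
    exact (dvd_of_mem_Gamma0 γ.2).mul_left _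
  have e11 : (γ'.1 1 1 : ZMod a) = (δ' 1 1 : ZMod a) * (γ.1 1 1 : ZMod a) := by
    have h0 : ((δ' 1 0 : ℤ) : ZMod a) = 0 := (ZMod.intCast_zmod_eq_zero_iff_dvd _ _).2
      ((Int.natCast_dvd_natCast.2 haN).trans (dvd_of_mem_Gamma0 hδ'N))
    rw [hγ', mul_apply_sl]
    push_cast
    rw [h0, zero_mul, zero_add]
  rw [e11, e00, hγ', slash_mul (by decide) (h4' hδ'N) (h4' γ.2), hs, h.slash_eq _ δ.2, slashXi_smul,
    slash_smul, smul_smul, ← mul_assoc, m00, cast_00_mul_11 haN hδ'N, one_mul, m11',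
    hψ.twist_sq hδ'N]
  congr 1
  linear_combination (-ψ (γ.1 0 0)) * hψ.sq _ (isCoprime_11 hδ'N)

/-- Conjugating `γ'γ⁻¹` by `ξ` stays integral exactly when its upper right entry is divisible by
`p²`. So the coset of `γ` is the point of the projective line over `ℤ/p²` given by the top row. -/
theorem heckeCosets_iff {N p : ℕ} (hp : p ≠ 0) (γ γ' : Gamma0 N) :
    (heckeCosets N p).r γ γ' ↔ (p : ℤ) ^ 2 ∣ γ.1 0 0 * γ'.1 0 1 - γ'.1 0 0 * γ.1 0 1 := by
  have hp2 : (p : ℤ) ^ 2 ≠ 0 := by positivity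
  have hdet := det_eq γ.1
  constructor
  · rintro ⟨δ, hδ⟩
    have m00 := congrFun (congrFun hδ 0) 0
    have m01 := congrFun (congrFun hδ 0) 1
    simp only [heckeMatrix, Matrix.mul_apply, Fin.sum_univ_two, Matrix.of_apply, Matrix.cons_val',
      Matrix.cons_val_zero, Matrix.cons_val_one, Matrix.cons_val_fin_one, zero_mul, one_mul,
      add_zero, zero_add] at m00 m01
    refine ⟨δ.1 0 1, ?_⟩
    rw [← m00, ← m01]
    linear_combination (p : ℤ) ^ 2 * δ.1 0 1 * hdet
  · rintro ⟨k, hk⟩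
    set δ' : SL(2, ℤ) := γ'.1 * γ.1⁻¹ with hδ'
    have hδ'N : δ' ∈ Gamma0 N := mul_mem γ'.2 (inv_mem γ.2)
    have hγ' : γ'.1 = δ' * γ.1 := by rw [hδ', inv_mul_cancel_right]
    have h01 : δ' 0 1 = p ^ 2 * k := by
      have e : ∀ j, (γ.1⁻¹) 0 j = ![γ.1 1 1, -γ.1 0 1] j ∧ (γ.1⁻¹) 1 j = ![-γ.1 1 0, γ.1 0 0] j := by
        intro j
        rw [Matrix.SpecialLinearGroup.SL2_inv_expl]
        fin_cases j <;> exact ⟨rfl, rfl⟩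
      rw [hδ', mul_apply_sl, (e 1).1, (e 1).2, ← hk]
      simp; ring
    clear_value δ'
    have hdet' := det_eq δ'
    let δ : SL(2, ℤ) := ⟨!![δ' 0 0, k; p ^ 2 * δ' 1 0, δ' 1 1], by
      rw [Matrix.det_fin_two]; simp; rw [h01] at hdet'; linarith⟩
    refine ⟨⟨δ, mem_Gamma0_of_dvd ?_⟩, ?_⟩
    · exact (dvd_of_mem_Gamma0 hδ'N).mul_left _
    · rw [hγ', Matrix.SpecialLinearGroup.coe_mul, ← Matrix.mul_assoc, ← Matrix.mul_assoc]
      congr 1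
      ext i j
      fin_cases i <;> fin_cases j <;>
        simp [heckeMatrix, Matrix.mul_apply, Fin.sum_univ_two, δ, h01, mul_comm]

/-- Index set for the right cosets. -/
abbrev HeckeIndex (p : ℕ) : Type := Fin (p ^ 2) ⊕ ({b : ZMod p // b ≠ 0} ⊕ Unit)

theorem exists_rep_mid {N p : ℕ} (hp : p.Prime) (hpN : ¬ p ∣ N) (hN : N ≠ 0) (b : {b : ZMod p // b ≠ 0}) :
    ∃ γ : Gamma0 N, γ.1 0 0 = p ∧ γ.1 0 1 = (b.1.val : ℤ) ∧ 0 < γ.1 1 0 ∧ 0 < γ.1 1 1 := by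
  have : Fact p.Prime := ⟨hp⟩
  have hb : 0 < b.1.val := Nat.pos_of_ne_zero fun h => b.2 ((ZMod.val_eq_zero b.1).1 h)
  set β := b.1.val
  have hu : ((N : ZMod p) * b.1) ≠ 0 := mul_ne_zero (by rwa [Ne, ZMod.natCast_eq_zero_iff]) b.2
  -- This `s` lets the top row `(p, β)` be completed with lower left entry `Ns`. A positive bottom
  -- row avoids the sign cases of the Kronecker symbol.
  obtain ⟨s, hs⟩ : ∃ s : ℕ, 0 < s ∧ ((p : ℤ) ∣ 1 + N * s * β) := by
    refine ⟨(-((N : ZMod p) * b.1)⁻¹).val, ?_, ?_⟩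
    · refine Nat.pos_of_ne_zero fun h => ?_
      rw [ZMod.val_eq_zero, neg_eq_zero] at h
      exact inv_ne_zero hu h
    · rw [← ZMod.intCast_zmod_eq_zero_iff_dvd]
      push_cast
      simp only [β, ZMod.natCast_val, ZMod.cast_id', id]
      have hN0 : (N : ZMod p) ≠ 0 := left_ne_zero_of_mul hu
      have := mul_inv_cancel₀ hu
      linear_combination -this
  obtain ⟨d, hd⟩ := hs.2
  have hpos : 0 < (p : ℤ) := by exact_mod_cast hp.pos
  refine ⟨⟨⟨!![(p : ℤ), β; N * s, d], ?_⟩, mem_Gamma0_of_dvd (Dvd.intro (s : ℤ) rfl)⟩, rfl, rfl, ?_, ?_⟩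
  · rw [Matrix.det_fin_two]; simp; linarith
  · change (0 : ℤ) < N * s
    have := hs.1
    positivity
  · change (0 : ℤ) < d
    have : 0 < (p : ℤ) * d := by rw [← hd]; positivity
    exact (pos_iff_pos_of_mul_pos this).1 hpos

theorem exists_rep_inf {N p : ℕ} (hp : p.Prime) (hpN : ¬ p ∣ N) (hN : N ≠ 0) :
    ∃ γ : Gamma0 N, γ.1 0 0 = (p : ℤ) ^ 2 ∧ 0 < γ.1 0 1 ∧ 0 < γ.1 1 0 ∧ 0 < γ.1 1 1 := by
  have hcop : Nat.Coprime N (p ^ 2) := Nat.Coprime.pow_right 2 ((hp.coprime_iff_not_dvd.2 hpN).symm)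
  have hp2 : 1 < p ^ 2 := Nat.one_lt_pow two_ne_zero hp.one_lt
  obtain ⟨m, hm⟩ := Nat.exists_mul_mod_eq_one_of_coprime hcop hp2
  -- The entry `m(p² - 1)` is a positive representative of `-1/N` modulo `p²`.
  have hdvd : ((p : ℤ) ^ 2) ∣ 1 + N * (m * (p ^ 2 - 1)) := by
    have h1 : ((p : ℤ) ^ 2) ∣ N * m - 1 := by
      have : ((N * m : ℕ) : ℤ) % ((p ^ 2 : ℕ) : ℤ) = 1 := by exact_mod_cast hm.2
      have h2 := Int.emod_add_mul_ediv ((N * m : ℕ) : ℤ) ((p ^ 2 : ℕ) : ℤ)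
      rw [this] at h2
      push_cast at h2
      exact ⟨_, by linarith⟩
    obtain ⟨k, hk⟩ := h1
    exact ⟨N * m - k, by linear_combination -hk⟩
  have hm0 : 0 < m := Nat.pos_of_ne_zero fun h => by rw [h, mul_zero, Nat.zero_mod] at hm; omega
  have hb : (0 : ℤ) < m * (p ^ 2 - 1) := by
    have : (1 : ℤ) < (p : ℤ) ^ 2 := by exact_mod_cast hp2
    have : (0 : ℤ) < m := by exact_mod_cast hm0
    apply mul_pos this; linarith
  have hNpos : (0 : ℤ) < N := by exact_mod_cast Nat.pos_of_ne_zero hN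
  obtain ⟨d, hd⟩ := hdvd
  refine ⟨⟨⟨!![(p : ℤ) ^ 2, m * (p ^ 2 - 1); N, d], ?_⟩, mem_Gamma0_of_dvd (dvd_refl _)⟩, rfl, ?_, ?_, ?_⟩
  · rw [Matrix.det_fin_two]; simp; linarith
  · exact hb
  · exact hNpos
  · change (0 : ℤ) < d
    have h2 : 0 < (p : ℤ) ^ 2 * d := by
      rw [← hd]
      have := mul_pos hNpos hb
      linarith
    exact (pos_iff_pos_of_mul_pos h2).1 (by have := hp.pos; positivity)

theorem upperU_mem (N : ℕ) (n : ℤ) : upperU n ∈ Gamma0 N := mem_Gamma0_of_dvd (dvd_zero _)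

/-- Representatives of the right cosets. -/
def heckeRep {N p : ℕ} (hp : p.Prime) (hpN : ¬ p ∣ N) (hN : N ≠ 0) : HeckeIndex p → Gamma0 N
  | Sum.inl n => ⟨upperU (n.1 : ℤ), upperU_mem N _⟩
  | Sum.inr (Sum.inl b) => (exists_rep_mid hp hpN hN b).choose
  | Sum.inr (Sum.inr ()) => (exists_rep_inf hp hpN hN).choose

/-- The top rows `(1, n)`, `(p, b)` and `(p², ·)` are the points of the projective line over `ℤ/p²`,
sorted by the power of `p` in the first coordinate. -/
theorem heckeRep_bijective {N p : ℕ} (hp : p.Prime) (hpN : ¬ p ∣ N) (hN : N ≠ 0) :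
    Function.Bijective fun i : HeckeIndex p =>
      (Quotient.mk (heckeCosets N p) (heckeRep hp hpN hN i)) := by
  have hF : Fact p.Prime := ⟨hp⟩
  have hpZ : Prime (p : ℤ) := Nat.prime_iff_prime_int.1 hp
  have hp0 : (p : ℤ) ≠ 0 := hpZ.ne_zero
  obtain ⟨ginf, einf, hinf⟩ : ∃ g, heckeRep hp hpN hN (Sum.inr (Sum.inr ())) = g ∧
      g.1 0 0 = (p : ℤ) ^ 2 := ⟨_, rfl, (exists_rep_inf hp hpN hN).choose_spec.1⟩
  obtain ⟨gmid, emid, hmid⟩ : ∃ g : {b : ZMod p // b ≠ 0} → Gamma0 N,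
      (∀ b, heckeRep hp hpN hN (Sum.inr (Sum.inl b)) = g b) ∧
        ∀ b, (g b).1 0 0 = p ∧ (g b).1 0 1 = (b.1.val : ℤ) :=
    ⟨fun b => (exists_rep_mid hp hpN hN b).choose, fun _ => rfl, fun b =>
      ⟨(exists_rep_mid hp hpN hN b).choose_spec.1, (exists_rep_mid hp hpN hN b).choose_spec.2.1⟩⟩
  have einl : ∀ n, heckeRep hp hpN hN (Sum.inl n) = ⟨upperU (n.1 : ℤ), upperU_mem N _⟩ := fun _ => rfl
  have hsq : (p : ℤ) ^ 2 = p * p := sq _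
  have hnb : ∀ b : {b : ZMod p // b ≠ 0}, ¬ (p : ℤ) ∣ (b.1.val : ℤ) := by
    intro b h
    rw [← ZMod.intCast_zmod_eq_zero_iff_dvd] at h
    exact b.2 (by simpa using h)
  have hninf : ¬ (p : ℤ) ∣ ginf.1 0 1 := by
    rintro ⟨k, hk⟩
    have := det_eq ginf.1
    rw [hinf, hk] at this
    exact hpZ.not_dvd_one ⟨_, this.symm.trans (by ring : _ = (p : ℤ) * (p * ginf.1 1 1 -
      k * ginf.1 1 0))⟩
  constructor
  · intro i j hij
    have hrel := (heckeCosets_iff hp.ne_zero _ _).1 (Quotient.exact hij)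
    rcases i with n | b | ⟨⟩ <;> rcases j with m | c | ⟨⟩
    · rw [einl, einl] at hrel
      simp only [upperU_00, upperU_01, one_mul] at hrel
      have h1 := n.2
      have h2 := m.2
      have : n = m := by
        apply Fin.ext
        obtain ⟨k, hk⟩ := hrel
        have hn : (n.1 : ℤ) < (p : ℤ) ^ 2 := by exact_mod_cast h1
        have hm : (m.1 : ℤ) < (p : ℤ) ^ 2 := by exact_mod_cast h2
        have hk0 : k = 0 := by
          by_contra hne
          rcases lt_or_gt_of_ne hne with h | h
          · nlinarith [Int.natCast_nonneg n.1, Int.natCast_nonneg m.1]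
          · nlinarith [Int.natCast_nonneg n.1, Int.natCast_nonneg m.1]
        rw [hk0] at hk
        omega
      rw [this]
    · rw [einl, emid, (hmid c).1, (hmid c).2] at hrel
      simp only [upperU_00, upperU_01, one_mul] at hrel
      exact absurd ((dvd_sub_left (dvd_mul_right _ _)).1 ((dvd_pow_self _ two_ne_zero).trans hrel)) (hnb c)
    · rw [einl, einf, hinf] at hrel
      simp only [upperU_00, upperU_01, one_mul] at hrel
      exact absurd ((dvd_sub_left ((dvd_pow_self _ two_ne_zero).mul_right _)).1
        ((dvd_pow_self _ two_ne_zero).trans hrel)) hninf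
    · rw [einl, emid, (hmid b).1, (hmid b).2] at hrel
      simp only [upperU_00, upperU_01, one_mul] at hrel
      exact absurd ((dvd_sub_right (dvd_mul_right _ _)).1 ((dvd_pow_self _ two_ne_zero).trans hrel)) (hnb b)
    · rw [emid, emid, (hmid b).1, (hmid b).2, (hmid c).1, (hmid c).2, ← mul_sub, hsq] at hrel
      have h1 := (mul_dvd_mul_iff_left hp0).1 hrel
      have : b = c := by
        apply Subtype.ext
        have h2 := (ZMod.intCast_eq_intCast_iff_dvd_sub ((b.1.val : ℕ) : ℤ) ((c.1.val : ℕ) : ℤ) p).2 h1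
        simpa using h2
      rw [this]
    · rw [emid, einf, (hmid b).1, (hmid b).2, hinf, hsq, mul_assoc, ← mul_sub] at hrel
      have h1 := (mul_dvd_mul_iff_left hp0).1 hrel
      exact absurd ((dvd_sub_left (dvd_mul_right _ _)).1 h1) hninf
    · rw [einl, einf, hinf] at hrel
      simp only [upperU_00, upperU_01, one_mul] at hrel
      exact absurd ((dvd_sub_right ((dvd_pow_self _ two_ne_zero).mul_right _)).1
        ((dvd_pow_self _ two_ne_zero).trans hrel)) hninf
    · rw [emid, einf, (hmid c).1, (hmid c).2, hinf, hsq, mul_assoc, ← mul_sub] at hrel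
      have h1 := (mul_dvd_mul_iff_left hp0).1 hrel
      exact absurd ((dvd_sub_right (dvd_mul_right _ _)).1 h1) hninf
    · rfl
  · intro q
    induction q using Quotient.inductionOn with
    | _ γ =>
    have hdet := det_eq γ.1
    set A := γ.1 0 0 with hA
    set Bq := γ.1 0 1 with hB
    by_cases h1 : (p : ℤ) ∣ A
    · have hB' : ¬ (p : ℤ) ∣ Bq := by
        intro h2
        exact hpZ.not_dvd_one (hdet ▸ dvd_sub (h1.mul_right _) (h2.mul_right _))
      obtain ⟨A', hA'⟩ := h1
      by_cases h2 : (p : ℤ) ∣ A'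
      · obtain ⟨A'', hA''⟩ := h2
        refine ⟨Sum.inr (Sum.inr ()), Quotient.sound ((heckeCosets_iff hp.ne_zero _ _).2 ?_)⟩
        rw [einf, hinf, ← hA, ← hB, hA', hA'']
        exact ⟨Bq - A'' * ginf.1 0 1, by ring⟩
      · have hA0 : (A' : ZMod p) ≠ 0 := by rwa [Ne, ZMod.intCast_zmod_eq_zero_iff_dvd]
        have hB0 : (Bq : ZMod p) ≠ 0 := by rwa [Ne, ZMod.intCast_zmod_eq_zero_iff_dvd]
        refine ⟨Sum.inr (Sum.inl ⟨Bq * (A' : ZMod p)⁻¹, mul_ne_zero hB0 (inv_ne_zero hA0)⟩),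
          Quotient.sound ((heckeCosets_iff hp.ne_zero _ _).2 ?_)⟩
        rw [emid, (hmid _).1, (hmid _).2, ← hA, ← hB, hA', hsq, mul_assoc, ← mul_sub]
        apply mul_dvd_mul_left
        rw [← ZMod.intCast_zmod_eq_zero_iff_dvd]
        push_cast
        simp only [ZMod.natCast_val, ZMod.cast_id', id]
        field_simp
        ring
    · have hcop : IsCoprime A ((p : ℤ) ^ 2) :=
        IsCoprime.pow_right ((hpZ.coprime_iff_not_dvd.2 h1).symm)
      obtain ⟨x, y, hxy⟩ := hcop
      have hp2pos : (0 : ℤ) < (p : ℤ) ^ 2 := by have := hp.pos; positivity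
      have hlt := Int.emod_lt_of_pos (Bq * x) hp2pos
      have hnn := Int.emod_nonneg (Bq * x) hp2pos.ne'
      refine ⟨Sum.inl ⟨((Bq * x) % (p : ℤ) ^ 2).toNat, ?_⟩, Quotient.sound ((heckeCosets_iff hp.ne_zero _ _).2 ?_)⟩
      · zify; rw [Int.toNat_of_nonneg hnn]; exact hlt
      · rw [einl]
        simp only [upperU_00, upperU_01, one_mul]
        rw [← hA, ← hB, Int.toNat_of_nonneg hnn, Int.emod_def]
        exact ⟨Bq * y + A * ((Bq * x) / (p : ℤ) ^ 2), by linear_combination Bq * (-hxy)⟩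

end

section

/-! ## Evaluation of the Hecke operator -/

open Complex CongruenceSubgroup

section

variable {N a : ℕ} {ψ : ℤ → ℂ} {Θ : ZMod a → ℍ → ℂ}

theorem lowerU_mem {N : ℕ} {n : ℤ} (h : (N : ℤ) ∣ n) : lowerU n ∈ Gamma0 N := mem_Gamma0_of_dvd h

theorem IsThetaFamily.upperU_smul (h : IsThetaFamily N a ψ Θ) (hψ : IsQuadChar N ψ) (b : ZMod a)
    (n : ℤ) (z : ℍ) : Θ b (upperU n • z) = Θ b z := by
  have := congrFun (h.slash_eq _ (upperU_mem N n) b) z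
  rw [slash_eq_thetaFactor (by decide), thetaFactor_upperU] at this
  simpa [hψ.one] using this

theorem IsThetaFamily.lowerU_smul (h : IsThetaFamily N a ψ Θ) (hψ : IsQuadChar N ψ) (h4 : 4 ∣ N)
    (b : ZMod a) {n : ℤ} (hn : (N : ℤ) ∣ n) (z : ℍ) :
    Θ b (lowerU n • z) = thetaFactor (lowerU n) z ^ 3 * Θ b z := by
  have := congrFun (h.slash_eq _ (lowerU_mem hn) b) z
  rw [slash_eq_thetaFactor (by decide)] at this
  have hne := thetaFactor_ne_zero (γ := lowerU n) ((by exact_mod_cast h4 : (4 : ℤ) ∣ N).trans hn) z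
  simp [hψ.one] at this
  rw [inv_mul_eq_iff_eq_mul₀ (pow_ne_zero _ hne)] at this
  exact this

theorem cpow_neg_three_half (x : ℂ) : x ^ (-((3 : ℕ) : ℂ) / 2) = ((x ^ (1 / 2 : ℂ)) ^ 3)⁻¹ := by
  rw [← Complex.cpow_nat_mul, ← Complex.cpow_neg]
  congr 1
  push_cast
  ring

/-- For writing `ξγ` as a lower unipotent element of `Γ₀(N)` times an upper triangular matrix, so
that `w` is an affine image of `z`. The denominators differ by a positive factor `r`, hence their
square roots by the root of `r`. -/
theorem slash_slashXi_of_lowerU {f : ℍ → ℂ} {p : ℕ} {γ : SL(2, ℤ)} {n : ℤ} {z w : ℍ} {r : ℝ} (hr : 0 < r)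
    (hf : f (lowerU n • w) = thetaFactor (lowerU n) w ^ 3 * f w)
    (hnw : (n : ℂ) * w + 1 = ((γ 1 0 : ℂ) * z + γ 1 1) * r)
    (hγ : ((γ • z : ℍ) : ℂ) / (p : ℂ) ^ 2 = w / (n * w + 1)) :
    slash 3 γ (slashXi 3 p f) z = (kronecker (γ 1 0) (γ 1 1) : ℂ) * epsilon (γ 1 1) ^ 3 *
      (((p : ℂ) ^ (1 / 2 : ℂ)) ^ 3)⁻¹ * ((r : ℂ) ^ (1 / 2 : ℂ)) ^ 3 * f w := by
  have hpt : ((γ • z : ℍ) : ℂ) / (p : ℂ) ^ 2 = ((lowerU n • w : ℍ) : ℂ) := by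
    rw [hγ, coe_lowerU_smul]
  have hden := denom_ne_zero γ z
  rw [slash, slashXi, ofComplex_eq hpt, hf, thetaFactor_lowerU, hnw,
    cpow_half_mul_of_pos hden hr rfl, cpow_neg_three_half, cpow_neg_three_half]
  have h0 : ((γ 1 0 : ℂ) * z + γ 1 1) ^ (1 / 2 : ℂ) ≠ 0 := by
    rw [Ne, Complex.cpow_eq_zero_iff]
    exact fun h => hden h.1
  field_simp

theorem slashXi_upperU {p : ℕ} (f : ℍ → ℂ) (n : ℤ) (z : ℍ) :
    slash 3 (upperU n) (slashXi 3 p f) z = (p : ℂ) ^ (-((3 : ℕ) : ℂ) / 2) *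
      f (UpperHalfPlane.ofComplex ((z + n) / (p : ℂ) ^ 2)) := by
  rw [slash_eq_thetaFactor (by decide), thetaFactor_upperU, slashXi, coe_upperU_smul]
  simp

theorem exists_coe_affine {r : ℝ} (hr : 0 < r) (s : ℝ) (z : ℍ) :
    ∃ w : ℍ, (w : ℂ) = r * z + s ∧ UpperHalfPlane.ofComplex (r * z + s) = w :=
  ⟨_, coe_ofComplex_affine hr s z, rfl⟩

/-- From `pd ≡ 1` modulo `c` follows `(c/pd) = 1`, hence `(c/d) = (c/p)`; and `c` is inverse to `-b`
modulo `p`. Modulo `4` the inverse `d` of `p` equals `p`. -/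
theorem kronecker_mid {p : ℕ} [Fact p.Prime] (hp2 : p ≠ 2) {b : ZMod p} {c d : ℤ}
    (hc : 4 ∣ c) (hc0 : 0 < c) (hd : 0 < d) (h : p * d - b.val * c = 1) :
    kronecker c d = quadraticChar (ZMod p) (-b) ∧ epsilon d = epsilon p := by
  have hp := (Fact.out : p.Prime)
  have hpo : p % 2 = 1 := hp.eq_two_or_odd.resolve_left hp2
  have hpd4 : (p : ℤ) * d % 4 = 1 := by
    obtain ⟨k, rfl⟩ := hc
    have : (p : ℤ) * d = 1 + 4 * (b.val * k) := by linear_combination h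
    omega
  have hd2 : d % 4 = (p : ℤ) % 4 := by
    have h1 := Int.mul_emod (p : ℤ) d 4
    rw [hpd4] at h1
    have h2 : (p : ℤ) % 4 = 1 ∨ (p : ℤ) % 4 = 3 := by omega
    have h3 : d % 4 = 0 ∨ d % 4 = 1 ∨ d % 4 = 2 ∨ d % 4 = 3 := by omega
    rcases h2 with h2 | h2 <;> rcases h3 with h3 | h3 | h3 | h3 <;> rw [h2, h3] at h1 <;> omega
  refine ⟨?_, epsilon_congr (by omega)⟩
  have hk1 : kronecker c (p * d) = 1 := by
    rw [show (p : ℤ) * d = 1 + b.val * c by linear_combination h, kronecker_add_mul hc (by norm_num)]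
    simp [kronecker]
  have hpZ : 0 < (p : ℤ) := by exact_mod_cast hp.pos
  rw [kronecker_of_pos (mul_pos hpZ hd), Int.natAbs_mul, Int.natAbs_natCast] at hk1
  have hdn : d.natAbs ≠ 0 := by omega
  have : NeZero d.natAbs := ⟨hdn⟩
  have : NeZero p := ⟨hp.ne_zero⟩
  rw [jacobiSym.mul_right, ← jacobiSym.legendreSym.to_jacobiSym] at hk1
  rw [kronecker_of_pos hd]
  have hbc : (-b) * (c : ZMod p) = 1 := by
    have := congrArg (Int.cast : ℤ → ZMod p) h
    push_cast at this
    rw [ZMod.natCast_self, ZMod.natCast_zmod_val] at this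
    linear_combination this
  have hq : quadraticChar (ZMod p) (-b) * legendreSym p c = 1 := by
    rw [legendreSym, ← map_mul, hbc, map_one]
  have hb0 : -b ≠ 0 := left_ne_zero_of_mul_eq_one hbc
  have hq2 := quadraticChar_sq_one hb0
  linear_combination quadraticChar (ZMod p) (-b) * hk1 - jacobiSym c d.natAbs * hq

theorem heckeTerm_mid (h : IsThetaFamily N a ψ Θ) (hψ : IsQuadChar N ψ) (h4 : 4 ∣ N) (haN : a ∣ N)
    {p : ℕ} [Fact p.Prime] (hp2 : p ≠ 2) {pb : ZMod a} (hpb : (p : ZMod a) * pb = 1) {b : ZMod p}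
    {γ : SL(2, ℤ)} (hγ : γ ∈ Gamma0 N) (h00 : γ 0 0 = p) (h01 : γ 0 1 = b.val)
    (h10 : 0 < γ 1 0) (h11 : 0 < γ 1 1) (z : ℍ) :
    heckeTerm p ψ Θ γ z = ψ p * epsilon p ^ 3 * ((quadraticChar (ZMod p) (-b) : ℤ) : ℂ) *
      Θ pb (UpperHalfPlane.ofComplex (z + b.val / p)) := by
  have hp := (Fact.out : p.Prime)
  have hpR : (0 : ℝ) < p := by exact_mod_cast hp.pos
  have hpC : (p : ℂ) ≠ 0 := by exact_mod_cast hp.ne_zero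
  have hdet := det_eq γ
  have hdvd := dvd_of_mem_Gamma0 hγ
  have h4c : (4 : ℤ) ∣ γ 1 0 := (by exact_mod_cast h4 : (4 : ℤ) ∣ N).trans hdvd
  rw [h00, h01] at hdet
  obtain ⟨hk, he⟩ := kronecker_mid hp2 h4c h10 h11 hdet
  have hcast : (γ 1 1 : ZMod a) = pb := by
    have h1 := cast_00_mul_11 haN hγ
    rw [h00, Int.cast_natCast] at h1
    linear_combination pb * h1 - (γ 1 1 : ZMod a) * hpb
  obtain ⟨w, hw, hw'⟩ := exists_coe_affine one_pos (b.val / p) z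
  have harg : ((1 : ℝ) : ℂ) * z + ((b.val / p : ℝ) : ℂ) = z + b.val / p := by push_cast; ring
  rw [harg] at hw hw'
  have hdetC : (p : ℂ) * γ 1 1 - b.val * γ 1 0 = 1 := by exact_mod_cast hdet
  have hnw : (((p * γ 1 0 : ℤ)) : ℂ) * w + 1 = ((γ 1 0 : ℂ) * z + γ 1 1) * (p : ℝ) := by
    rw [hw]; push_cast; field_simp; linear_combination -hdetC
  have hden := denom_ne_zero γ z
  have hs := slash_slashXi_of_lowerU (f := Θ pb) (γ := γ) (n := p * γ 1 0) (z := z) (w := w) hpR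
    (h.lowerU_smul hψ h4 pb (hdvd.mul_left _) w) hnw (by
      rw [hnw, hw, coe_sl_smul, h00, h01]; push_cast; field_simp)
  have hp3 : ((p : ℂ) ^ (1 / 2 : ℂ)) ≠ 0 := by
    rw [Ne, Complex.cpow_eq_zero_iff]
    exact fun h => hpC h.1
  rw [heckeTerm, hcast, Pi.smul_apply, hs, hw', hk, he, h00, smul_eq_mul, Complex.ofReal_natCast]
  field_simp

theorem heckeTerm_inf (h : IsThetaFamily N a ψ Θ) (hψ : IsQuadChar N ψ) (h4 : 4 ∣ N) (haN : a ∣ N)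
    {p : ℕ} (hp : p.Prime) (hpN : ¬ p ∣ N) {pb : ZMod a} (hpb : (p : ZMod a) * pb = 1)
    {γ : SL(2, ℤ)} (hγ : γ ∈ Gamma0 N) (h00 : γ 0 0 = (p : ℤ) ^ 2)
    (h11 : 0 < γ 1 1) (z : ℍ) :
    heckeTerm p ψ Θ γ z = ((p : ℂ) ^ (1 / 2 : ℂ)) ^ 3 *
      Θ (pb ^ 2) (UpperHalfPlane.ofComplex ((p : ℂ) ^ 2 * z)) := by
  have hpR : (0 : ℝ) < p := by exact_mod_cast hp.pos
  have hpC : (p : ℂ) ≠ 0 := by exact_mod_cast hp.ne_zero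
  have hdet := det_eq γ
  have hdvd := dvd_of_mem_Gamma0 hγ
  have h4c : (4 : ℤ) ∣ γ 1 0 := (by exact_mod_cast h4 : (4 : ℤ) ∣ N).trans hdvd
  rw [h00] at hdet
  have hp2 : p % 2 = 1 := hp.eq_two_or_odd.resolve_left fun h2 =>
    hpN (h2 ▸ (by norm_num : (2 : ℕ) ∣ 4).trans h4)
  have hd1 : γ 1 1 % 4 = 1 := by
    obtain ⟨k, hk⟩ := h4c
    obtain ⟨j, hj⟩ : ∃ j : ℤ, (p : ℤ) = 2 * j + 1 := ⟨p / 2, by omega⟩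
    have : γ 1 1 = 1 + 4 * (γ 0 1 * k - (j ^ 2 + j) * γ 1 1) := by
      rw [hk, hj] at hdet; linear_combination hdet
    omega
  have hk : kronecker (γ 1 0) (γ 1 1) = 1 := by
    have h1 : kronecker (γ 1 0) (p ^ 2 * γ 1 1) = 1 := by
      rw [show (p : ℤ) ^ 2 * γ 1 1 = 1 + γ 0 1 * γ 1 0 by linear_combination hdet,
        kronecker_add_mul h4c (by norm_num)]
      simp [kronecker]
    have hpZ : 0 < (p : ℤ) := by exact_mod_cast hp.pos
    have : NeZero (γ 1 1).natAbs := ⟨by omega⟩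
    have : NeZero p := ⟨hp.ne_zero⟩
    rw [kronecker_of_pos (mul_pos (pow_pos hpZ 2) h11), Int.natAbs_mul, Int.natAbs_pow, Int.natAbs_natCast,
      jacobiSym.mul_right, jacobiSym.pow_right] at h1
    rw [kronecker_of_pos h11]
    have hcop : IsCoprime (γ 1 0) ((p : ℕ) : ℤ) := ⟨-γ 0 1, p * γ 1 1, by linear_combination hdet⟩
    have h2 : jacobiSym (γ 1 0) p ^ 2 = 1 := by
      have := jacobiSym_sq_of_isCoprime hcop
      rwa [Int.natAbs_natCast] at this
    rwa [h2, one_mul] at h1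
  have he : epsilon (γ 1 1) = 1 := if_pos hd1
  have hcast : (γ 1 1 : ZMod a) = pb ^ 2 := by
    have h1 := cast_00_mul_11 haN hγ
    rw [h00] at h1
    push_cast at h1
    linear_combination pb ^ 2 * h1 - (γ 1 1 : ZMod a) * (1 + p * pb) * hpb
  have hψp : ψ ((p : ℤ) ^ 2) = 1 := by
    have hpZ : (p : ℤ) ≠ 0 := by exact_mod_cast hp.ne_zero
    rw [sq, hψ.mul _ _ hpZ hpZ, ← sq]
    apply hψ.sq
    rw [Nat.isCoprime_iff_coprime]
    exact hp.coprime_iff_not_dvd.2 hpN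
  obtain ⟨w, hw, -⟩ := exists_coe_affine (pow_pos hpR 2) (γ 0 1) z
  obtain ⟨w', hw1, hw2⟩ := exists_coe_affine (pow_pos hpR 2) 0 z
  have harg : (((p : ℝ) ^ 2 : ℝ) : ℂ) * z + ((0 : ℝ) : ℂ) = (p : ℂ) ^ 2 * z := by push_cast; ring
  rw [harg] at hw1 hw2
  have hww : w = upperU (γ 0 1) • w' := by
    ext
    rw [coe_upperU_smul, hw, hw1]; push_cast; ring
  have hdetC : (p : ℂ) ^ 2 * γ 1 1 - γ 0 1 * γ 1 0 = 1 := by exact_mod_cast hdet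
  have hnw : (γ 1 0 : ℂ) * w + 1 = ((γ 1 0 : ℂ) * z + γ 1 1) * ((p : ℝ) ^ 2 : ℝ) := by
    rw [hw]; push_cast; linear_combination -hdetC
  have hden := denom_ne_zero γ z
  have hs := slash_slashXi_of_lowerU (f := Θ (pb ^ 2)) (γ := γ) (n := γ 1 0) (z := z) (w := w)
    (pow_pos hpR 2) (h.lowerU_smul hψ h4 _ hdvd w) hnw (by
      rw [hnw, hw, coe_sl_smul, h00]; push_cast; field_simp)
  have hp3 : ((p : ℂ) ^ (1 / 2 : ℂ)) ≠ 0 := by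
    rw [Ne, Complex.cpow_eq_zero_iff]
    exact fun h => hpC h.1
  have hsq : (((p : ℝ) ^ 2 : ℝ) : ℂ) ^ (1 / 2 : ℂ) = (p : ℂ) ^ (1 / 2 : ℂ) * (p : ℂ) ^ (1 / 2 : ℂ) := by
    rw [← cpow_half_mul_of_pos hpC hpR (by simp)]
    push_cast
    rw [sq]
  rw [heckeTerm, hcast, Pi.smul_apply, hs, hw2, hk, he, h00, hψp, smul_eq_mul, hsq, hww,
    h.upperU_smul hψ]
  field_simp
  push_cast
  ring

theorem finite_heckeCosets {N p : ℕ} (hp : p.Prime) (hpN : ¬ p ∣ N) (hN : N ≠ 0) :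
    Finite (Quotient (heckeCosets N p)) := by
  have : Fact p.Prime := ⟨hp⟩
  have : Finite (HeckeIndex p) := inferInstance
  exact Finite.of_surjective _ (heckeRep_bijective hp hpN hN).2

theorem IsThetaFamily.hecke_apply [NeZero a] (h : IsThetaFamily N a ψ Θ) (hψ : IsQuadChar N ψ) (h4 : 4 ∣ N)
    (haN : a ∣ N) (hN : N ≠ 0) {p : ℕ} [Fact p.Prime] (hpN : ¬ p ∣ N) {pb : ZMod a}
    (hpb : (p : ZMod a) * pb = 1) (z : ℍ) :
    hecke 3 N a p ψ (Θ 1) z = ((p : ℂ) ^ (1 / 2 : ℂ))⁻¹ *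
      ((((p : ℂ) ^ (1 / 2 : ℂ)) ^ 3)⁻¹ *
        ∑ n : Fin (p ^ 2), Θ 1 (UpperHalfPlane.ofComplex ((z + (n : ℕ)) / (p : ℂ) ^ 2)) +
      ψ p * epsilon p ^ 3 * ∑ b : ZMod p, ((quadraticChar (ZMod p) (-b) : ℤ) : ℂ) *
        Θ pb (UpperHalfPlane.ofComplex (z + b.val / p)) +
      ((p : ℂ) ^ (1 / 2 : ℂ)) ^ 3 * Θ (pb ^ 2) (UpperHalfPlane.ofComplex ((p : ℂ) ^ 2 * z))) := by
  classical
  have hp := (Fact.out : p.Prime)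
  have hp2 : p ≠ 2 := fun h2 => hpN (h2 ▸ (by norm_num : (2 : ℕ) ∣ 4).trans h4)
  have := finite_heckeCosets hp hpN hN
  have e : ∑ᶠ c : Quotient (heckeCosets N p), heckeTerm p ψ Θ c.out.1 =
      ∑ i : HeckeIndex p, heckeTerm p ψ Θ (heckeRep hp hpN hN i).1 := by
    rw [← finsum_eq_sum_of_fintype]
    symm
    refine finsum_eq_of_bijective _ (heckeRep_bijective hp hpN hN) fun i => ?_
    refine heckeTerm_congr haN h4 hp.ne_zero hψ h ?_
    exact (heckeCosets N p).symm (Quotient.mk_out (s := heckeCosets N p) _)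
  rw [h.hecke_eq haN, e, Pi.smul_apply, Finset.sum_apply, Fintype.sum_sum_type, Fintype.sum_sum_type]
  have e1 : ∀ n : Fin (p ^ 2), heckeTerm p ψ Θ (heckeRep hp hpN hN (Sum.inl n)).1 z =
      (((p : ℂ) ^ (1 / 2 : ℂ)) ^ 3)⁻¹ * Θ 1 (UpperHalfPlane.ofComplex ((z + (n : ℕ)) / (p : ℂ) ^ 2)) := by
    intro n
    change heckeTerm p ψ Θ (upperU ((n : ℕ) : ℤ)) z = _
    rw [heckeTerm, Pi.smul_apply, slashXi_upperU, cpow_neg_three_half]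
    simp [hψ.one]
  have e2 : ∀ b : {b : ZMod p // b ≠ 0}, heckeTerm p ψ Θ (heckeRep hp hpN hN (Sum.inr (Sum.inl b))).1 z =
      ψ p * epsilon p ^ 3 * (((quadraticChar (ZMod p) (-b.1) : ℤ) : ℂ) *
        Θ pb (UpperHalfPlane.ofComplex (z + b.1.val / p))) := by
    intro b
    obtain ⟨g1, g2, g3, g4⟩ := (exists_rep_mid hp hpN hN b).choose_spec
    rw [← mul_assoc]
    exact heckeTerm_mid h hψ h4 haN hp2 hpb (exists_rep_mid hp hpN hN b).choose.2 g1 g2 g3 g4 z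
  have e3 : heckeTerm p ψ Θ (heckeRep hp hpN hN (Sum.inr (Sum.inr ()))).1 z = ((p : ℂ) ^ (1 / 2 : ℂ)) ^ 3 *
      Θ (pb ^ 2) (UpperHalfPlane.ofComplex ((p : ℂ) ^ 2 * z)) := by
    obtain ⟨g1, -, -, g4⟩ := (exists_rep_inf hp hpN hN).choose_spec
    exact heckeTerm_inf h hψ h4 haN hp hpN hpb (exists_rep_inf hp hpN hN).choose.2 g1 g4 z
  -- The character vanishes at `0`, so the missing index `b = 0` may be added.
  have e4 : ∑ b : ZMod p, ((quadraticChar (ZMod p) (-b) : ℤ) : ℂ) *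
      Θ pb (UpperHalfPlane.ofComplex (z + b.val / p)) = ∑ b : {b : ZMod p // b ≠ 0},
      ((quadraticChar (ZMod p) (-b.1) : ℤ) : ℂ) * Θ pb (UpperHalfPlane.ofComplex (z + b.1.val / p)) := by
    rw [← Finset.sum_subtype (Finset.univ.filter fun b : ZMod p => b ≠ 0) (by simp) fun b : ZMod p =>
      ((quadraticChar (ZMod p) (-b) : ℤ) : ℂ) * Θ pb (UpperHalfPlane.ofComplex (z + b.val / p)),
      Finset.sum_filter_of_ne]
    rintro b - hb rfl
    simp at hb
  rw [e4]
  simp only [e1, e2, Finset.univ_unique, Finset.sum_singleton, PUnit.default_eq_unit, e3, ← Finset.mul_sum, smul_eq_mul]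
  have : (p : ℂ) ^ ((3 : ℂ) / 2 - 2) = ((p : ℂ) ^ (1 / 2 : ℂ))⁻¹ := by
    rw [← Complex.cpow_neg]; norm_num
  rw [this]
  ring

end

end

section

/-! ## The Hecke operator on the theta series of a coset -/

open Complex

variable {V : Type*} [AddCommGroup V] [Module ℚ V]

theorem sum_exp_two_pi_div {M : ℕ} (hM : M ≠ 0) (k : ℤ) :
    ∑ n : Fin M, cexp (2 * Real.pi * I * k * ((n : ℕ) / M)) = if (M : ℤ) ∣ k then (M : ℂ) else 0 := by
  have hMC : (M : ℂ) ≠ 0 := by exact_mod_cast hM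
  set ζ : ℂ := cexp (2 * Real.pi * I * k / M) with hζ
  have e1 : ∀ n : Fin M, cexp (2 * Real.pi * I * k * ((n : ℕ) / M)) = ζ ^ (n : ℕ) := by
    intro n
    rw [hζ, ← Complex.exp_nat_mul]
    congr 1
    ring
  rw [Finset.sum_congr rfl fun n _ => e1 n, Fin.sum_univ_eq_sum_range (fun n => ζ ^ n)]
  have h1 : ζ = 1 ↔ (M : ℤ) ∣ k := by
    rw [hζ, Complex.exp_eq_one_iff]
    constructor
    · rintro ⟨n, hn⟩
      refine ⟨n, ?_⟩
      have : (k : ℂ) = M * n := by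
        have hpi : (2 * Real.pi * I : ℂ) ≠ 0 := Complex.two_pi_I_ne_zero
        field_simp at hn
        linear_combination hn
      exact_mod_cast this
    · rintro ⟨n, rfl⟩
      refine ⟨n, ?_⟩
      push_cast
      field_simp
  split_ifs with h
  · simp [h1.2 h]
  · rw [geom_sum_eq (mt h1.1 h)]
    have : ζ ^ M = 1 := by
      rw [hζ, ← Complex.exp_nat_mul, Complex.exp_eq_one_iff]
      exact ⟨k, by field_simp⟩
    rw [this, sub_self, zero_div]

theorem theta_eq_tsum_indicator (B : LinearMap.BilinForm ℚ V) (X : Set V) (z : ℍ) :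
    theta B X z = ∑' x : V, X.indicator (fun x => cexp (2 * Real.pi * I * ((B x x : ℚ) : ℂ) * z)) x :=
  tsum_subtype X fun x => cexp (2 * Real.pi * I * ((B x x : ℚ) : ℂ) * z)

/-- Absolute convergence of the theta series of `X`. -/
def ThetaSummable (B : LinearMap.BilinForm ℚ V) (X : Set V) : Prop :=
  ∀ z : ℍ, Summable fun x : X => ‖cexp (2 * Real.pi * I * ((B x x : ℚ) : ℂ) * z)‖

theorem ThetaSummable.summable {B : LinearMap.BilinForm ℚ V} {X : Set V} (h : ThetaSummable B X) (z : ℍ) :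
    Summable (X.indicator fun x => cexp (2 * Real.pi * I * ((B x x : ℚ) : ℂ) * z)) :=
  summable_subtype_iff_indicator.1 (h z).of_norm

open Classical in
/-- The multiplicity of `e(Q(y) z / p²)` in the image of `Θ_X` under `T(p²)`. -/
def heckeWeight (B : LinearMap.BilinForm ℚ V) (p : ℕ) [Fact p.Prime] (s : ℂ) (X' X'' : Set V) (y : V) : ℂ :=
  (if ∃ k : ℤ, B y y = p ^ 2 * k then 1 else 0) +
    (if (p : ℚ)⁻¹ • y ∈ X' then
      s * ((quadraticChar (ZMod p) (-((B ((p : ℚ)⁻¹ • y) ((p : ℚ)⁻¹ • y)).num : ZMod p)) : ℤ) : ℂ) else 0) +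
    if (p : ℚ)⁻¹ ^ 2 • y ∈ X'' then (p : ℂ) else 0

/-- Comparison of coefficients: the shifts by `n` detect `p² ∣ Q(y)`, the twisted shifts by `b/p`
give the quadratic character of `-Q` through the Gauss sum, whose `ε_p` completes `ε_p³` to `1`, and
the dilation contributes on `p²X''`. Rescaling puts all three parts on the same vectors `y`. -/
theorem hecke_theta {B : LinearMap.BilinForm ℚ V} {p : ℕ} [Fact p.Prime] (hp2 : p ≠ 2) {X X' X'' : Set V}
    (hX : ThetaSummable B X) (hX' : ThetaSummable B X') (hX'' : ThetaSummable B X'')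
    (hint : ∀ x ∈ X, ∃ k : ℤ, B x x = k) (hint' : ∀ x ∈ X', ∃ k : ℤ, B x x = k)
    (h' : ∀ y, (p : ℚ)⁻¹ • y ∈ X' → y ∈ X) (h'' : ∀ y, (p : ℚ)⁻¹ ^ 2 • y ∈ X'' → y ∈ X) (s : ℂ) (z : ℍ) :
    ((p : ℂ) ^ (1 / 2 : ℂ))⁻¹ *
      ((((p : ℂ) ^ (1 / 2 : ℂ)) ^ 3)⁻¹ *
        ∑ n : Fin (p ^ 2), theta B X (UpperHalfPlane.ofComplex ((z + (n : ℕ)) / (p : ℂ) ^ 2)) +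
      s * epsilon p ^ 3 * ∑ b : ZMod p, ((quadraticChar (ZMod p) (-b) : ℤ) : ℂ) *
        theta B X' (UpperHalfPlane.ofComplex (z + b.val / p)) +
      ((p : ℂ) ^ (1 / 2 : ℂ)) ^ 3 * theta B X'' (UpperHalfPlane.ofComplex ((p : ℂ) ^ 2 * z))) =
    ∑' y : V, X.indicator (fun y => heckeWeight B p s X' X'' y *
      cexp (2 * Real.pi * I * ((B y y : ℚ) : ℂ) * (z / (p : ℂ) ^ 2))) y := by
  classical
  have hp := (Fact.out : p.Prime)
  have hpR : (0 : ℝ) < p := by exact_mod_cast hp.pos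
  have hpC : (p : ℂ) ≠ 0 := by exact_mod_cast hp.ne_zero
  have hpQ : (p : ℚ) ≠ 0 := by exact_mod_cast hp.ne_zero
  set r : ℂ := (p : ℂ) ^ (1 / 2 : ℂ) with hr
  have hr2 : r ^ 2 = p := by
    rw [hr, ← Complex.cpow_nat_mul]; norm_num
  have hr0 : r ≠ 0 := by rintro h; rw [h] at hr2; exact hpC (by rw [← hr2]; ring)
  -- the three parts
  have hz1 : ∀ n : ℕ, (((UpperHalfPlane.ofComplex ((z + n) / (p : ℂ) ^ 2)) : ℍ) : ℂ) = (z + n) / (p : ℂ) ^ 2 := by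
    intro n
    have h := coe_ofComplex_affine (r := ((p : ℝ) ^ 2)⁻¹) (by positivity) (n / p ^ 2) z
    have e : ((((p : ℝ) ^ 2)⁻¹ : ℝ) : ℂ) * z + ((n / p ^ 2 : ℝ) : ℂ) = (z + n) / (p : ℂ) ^ 2 := by
      push_cast; ring
    rwa [e] at h
  have hz2 : ∀ n : ℕ, (((UpperHalfPlane.ofComplex (z + n / p)) : ℍ) : ℂ) = z + n / p := by
    intro n
    have h := coe_ofComplex_affine one_pos (n / p) z
    have e : ((1 : ℝ) : ℂ) * z + ((n / p : ℝ) : ℂ) = z + n / p := by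
      push_cast; ring
    rwa [e] at h
  have hz3 : (((UpperHalfPlane.ofComplex ((p : ℂ) ^ 2 * z)) : ℍ) : ℂ) = (p : ℂ) ^ 2 * z := by
    have h := coe_ofComplex_affine (pow_pos hpR 2) 0 z
    have e : (((p : ℝ) ^ 2 : ℝ) : ℂ) * z + ((0 : ℝ) : ℂ) = (p : ℂ) ^ 2 * z := by push_cast; ring
    rwa [e] at h
  have hM : p ^ 2 ≠ 0 := pow_ne_zero 2 hp.ne_zero
  -- first part
  have s1 : ∀ n : Fin (p ^ 2), Summable (X.indicator fun x => cexp (2 * Real.pi * I * ((B x x : ℚ) : ℂ) *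
      ((UpperHalfPlane.ofComplex ((z + (n : ℕ)) / (p : ℂ) ^ 2) : ℍ) : ℂ))) := fun n => hX.summable _
  have t1 : HasSum (X.indicator (fun y => (if ∃ k : ℤ, B y y = p ^ 2 * k then (p : ℂ) ^ 2 else 0) *
      cexp (2 * Real.pi * I * ((B y y : ℚ) : ℂ) * (z / (p : ℂ) ^ 2))))
      (∑ n : Fin (p ^ 2), theta B X (UpperHalfPlane.ofComplex ((z + (n : ℕ)) / (p : ℂ) ^ 2))) := by
    simp_rw [theta_eq_tsum_indicator]
    convert hasSum_sum fun n _ => (s1 n).hasSum using 1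
    ext y
    simp only [hz1]
    by_cases hy : y ∈ X
    · obtain ⟨k, hk⟩ := hint y hy
      have e := sum_exp_two_pi_div hM k
      have hiff : (∃ j : ℤ, B y y = p ^ 2 * j) ↔ ((p ^ 2 : ℕ) : ℤ) ∣ k := by
        rw [hk]
        constructor
        · rintro ⟨j, hj⟩; exact ⟨j, by push_cast; exact_mod_cast hj⟩
        · rintro ⟨j, hj⟩; exact ⟨j, by rw [hj]; push_cast; ring⟩
      simp only [Set.indicator_of_mem hy, hiff]
      rw [show (if ((p ^ 2 : ℕ) : ℤ) ∣ k then (p : ℂ) ^ 2 else 0) =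
        (if ((p ^ 2 : ℕ) : ℤ) ∣ k then ((p ^ 2 : ℕ) : ℂ) else 0) by push_cast; rfl, ← e, Finset.sum_mul]
      refine Finset.sum_congr rfl fun n _ => ?_
      rw [← Complex.exp_add, hk]
      congr 1
      push_cast
      ring
    · simp [Set.indicator_of_notMem hy]
  have s2 : ∀ b : ZMod p, Summable (X'.indicator fun x => cexp (2 * Real.pi * I * ((B x x : ℚ) : ℂ) *
      ((UpperHalfPlane.ofComplex (z + b.val / p) : ℍ) : ℂ))) := fun n => hX'.summable _
  have t2 : HasSum (X'.indicator (fun y => ((quadraticChar (ZMod p) (-((B y y).num : ZMod p)) : ℤ) : ℂ) *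
      epsilon p * r * cexp (2 * Real.pi * I * ((B y y : ℚ) : ℂ) * z)))
      (∑ b : ZMod p, ((quadraticChar (ZMod p) (-b) : ℤ) : ℂ) *
        theta B X' (UpperHalfPlane.ofComplex (z + b.val / p))) := by
    simp_rw [theta_eq_tsum_indicator]
    have h0 := hasSum_sum (s := Finset.univ) fun b _ =>
      (s2 b).hasSum.mul_left ((quadraticChar (ZMod p) (-b) : ℤ) : ℂ)
    refine Eq.mp (congrArg (fun f => HasSum f _) (funext fun y => ?_)) h0
    simp only [hz2]
    by_cases hy : y ∈ X'
    · obtain ⟨k, hk⟩ := hint' y hy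
      have e := sum_quadraticChar_exp hp2 k
      simp only [Set.indicator_of_mem hy, hk, Rat.num_intCast]
      rw [hr, ← e, Finset.sum_mul]
      refine Finset.sum_congr rfl fun n _ => ?_
      conv_rhs => rw [mul_assoc, ← Complex.exp_add]
      congr 2
      push_cast
      ring
    · simp [Set.indicator_of_notMem hy]
  have t3 : HasSum (X''.indicator fun y => cexp (2 * Real.pi * I * ((B y y : ℚ) : ℂ) * ((p : ℂ) ^ 2 * z)))
      (theta B X'' (UpperHalfPlane.ofComplex ((p : ℂ) ^ 2 * z))) := by
    have := (hX''.summable (UpperHalfPlane.ofComplex ((p : ℂ) ^ 2 * z))).hasSum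
    rw [theta_eq_tsum_indicator]
    rwa [hz3] at this ⊢
  have hpi : (p : ℚ)⁻¹ ≠ 0 := inv_ne_zero hpQ
  have t2' := (Equiv.hasSum_iff (LinearEquiv.smulOfNeZero ℚ V _ hpi).toEquiv).2 t2
  have t3' := (Equiv.hasSum_iff (LinearEquiv.smulOfNeZero ℚ V _ (pow_ne_zero 2 hpi)).toEquiv).2 t3
  have key := ((t1.mul_left (r ^ 3)⁻¹).add (t2'.mul_left (s * epsilon p ^ 3))).add (t3'.mul_left (r ^ 3))
  rw [← (key.mul_left r⁻¹).tsum_eq]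
  refine tsum_congr fun y => ?_
  have hQ : ∀ c : ℚ, B (c • y) (c • y) = c ^ 2 * B y y := fun c => by
    simp only [map_smul, LinearMap.smul_apply, smul_eq_mul]; ring
  simp only [Function.comp_apply, LinearEquiv.coe_toEquiv, LinearEquiv.smulOfNeZero_apply]
  by_cases hy : y ∈ X
  · have e4 := epsilon_pow_four (p : ℤ)
    have hr3 : r⁻¹ * (r ^ 3)⁻¹ * (p : ℂ) ^ 2 = 1 := by
      rw [← hr2]; field_simp
    have hr4 : r⁻¹ * r ^ 3 = p := by
      rw [← hr2]; field_simp
    have a2 : cexp (2 * Real.pi * I * ((B ((p : ℚ)⁻¹ • y) ((p : ℚ)⁻¹ • y) : ℚ) : ℂ) * z) =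
        cexp (2 * Real.pi * I * ((B y y : ℚ) : ℂ) * (z / (p : ℂ) ^ 2)) := by
      rw [hQ]; congr 1; push_cast; field_simp
    have a3 : cexp (2 * Real.pi * I * ((B ((p : ℚ)⁻¹ ^ 2 • y) ((p : ℚ)⁻¹ ^ 2 • y) : ℚ) : ℂ) * ((p : ℂ) ^ 2 * z)) =
        cexp (2 * Real.pi * I * ((B y y : ℚ) : ℂ) * (z / (p : ℂ) ^ 2)) := by
      rw [hQ]; congr 1; push_cast; field_simp
    simp only [Set.indicator_apply, if_pos hy, heckeWeight, a2, a3]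
    set E := cexp (2 * Real.pi * I * ((B y y : ℚ) : ℂ) * (z / (p : ℂ) ^ 2))
    set q := ((quadraticChar (ZMod p) (-((B ((p : ℚ)⁻¹ • y) ((p : ℚ)⁻¹ • y)).num : ZMod p)) : ℤ) : ℂ)
    have b1 : r⁻¹ * ((r ^ 3)⁻¹ * ((if ∃ k : ℤ, B y y = p ^ 2 * k then (p : ℂ) ^ 2 else 0) * E)) =
        (if ∃ k : ℤ, B y y = p ^ 2 * k then 1 else 0) * E := by
      split_ifs
      · linear_combination E * hr3
      · simp
    have b2 : r⁻¹ * (s * epsilon p ^ 3 * if (p : ℚ)⁻¹ • y ∈ X' then q * epsilon p * r * E else 0) =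
        (if (p : ℚ)⁻¹ • y ∈ X' then s * q else 0) * E := by
      split_ifs
      · linear_combination (exp := 1) (s * q * E * epsilon p ^ 4) * (inv_mul_cancel₀ hr0) + s * q * E * e4
      · simp
    have b3 : r⁻¹ * (r ^ 3 * if (p : ℚ)⁻¹ ^ 2 • y ∈ X'' then E else 0) =
        (if (p : ℚ)⁻¹ ^ 2 • y ∈ X'' then (p : ℂ) else 0) * E := by
      split_ifs
      · linear_combination E * hr4
      · simp
    rw [mul_add, mul_add, b1, b2, b3]
    ring
  · have n1 : (p : ℚ)⁻¹ • y ∉ X' := mt (h' y) hy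
    have n2 : (p : ℚ)⁻¹ ^ 2 • y ∉ X'' := mt (h'' y) hy
    simp only [Set.indicator_apply, if_neg hy, if_neg n1, if_neg n2]
    simp

end

section

/-! ## Lattices and orthogonal coordinates -/

variable {V : Type*} [AddCommGroup V] [Module ℚ V]

theorem IsLattice.exists_nsmul_mem {K : Submodule ℤ V} (hK : IsLattice K) (v : V) :
    ∃ n : ℕ, n ≠ 0 ∧ n • v ∈ K := by
  have hv : v ∈ Submodule.span ℚ (K : Set V) := by rw [hK.2]; trivial
  induction hv using Submodule.span_induction with
  | mem x hx => exact ⟨1, one_ne_zero, by simpa using hx⟩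
  | zero => exact ⟨1, one_ne_zero, by simp⟩
  | add x y _ _ hx hy =>
    obtain ⟨n, hn, hnx⟩ := hx
    obtain ⟨m, hm, hmy⟩ := hy
    refine ⟨n * m, mul_ne_zero hn hm, ?_⟩
    rw [smul_add]
    exact add_mem (by rw [mul_comm, mul_smul]; exact nsmul_mem hnx m) (by rw [mul_smul]; exact nsmul_mem hmy n)
  | smul q x _ hx =>
    obtain ⟨n, hn, hnx⟩ := hx
    refine ⟨n * q.den, mul_ne_zero hn q.den_ne_zero, ?_⟩
    have : (n * q.den) • q • x = q.num • n • x := by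
      rw [← Nat.cast_smul_eq_nsmul ℚ, ← Nat.cast_smul_eq_nsmul ℚ, ← Int.cast_smul_eq_zsmul ℚ, smul_smul, smul_smul]
      congr 1
      push_cast
      rw [mul_assoc, mul_comm (n : ℚ), Rat.den_mul_eq_num]
    rw [this]
    exact zsmul_mem hnx _

theorem exists_common_denominator {ι : Type*} (v : Module.Basis ι ℚ V) [Finite ι] {K : Submodule ℤ V} (hK : K.FG) :
    ∃ m : ℕ, m ≠ 0 ∧ ∀ x ∈ K, ∀ i, ∃ z : ℤ, m * v.repr x i = z := by
  have := Fintype.ofFinite ι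
  induction K, hK using Submodule.fg_induction with
  | singleton x =>
    refine ⟨∏ i, (v.repr x i).den, Finset.prod_ne_zero_iff.2 fun i _ => (v.repr x i).den_ne_zero, ?_⟩
    intro y hy i
    obtain ⟨c, rfl⟩ := Submodule.mem_span_singleton.1 hy
    obtain ⟨k, hk⟩ := Finset.dvd_prod_of_mem (fun i => (v.repr x i).den) (Finset.mem_univ i)
    refine ⟨c * k * (v.repr x i).num, ?_⟩
    rw [hk, map_zsmul, Finsupp.smul_apply, zsmul_eq_mul]
    have := Rat.den_mul_eq_num (v.repr x i)
    push_cast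
    rw [← this]; ring
  | sup K₁ K₂ _ _ h₁ h₂ =>
    obtain ⟨m₁, hm₁, h₁⟩ := h₁
    obtain ⟨m₂, hm₂, h₂⟩ := h₂
    refine ⟨m₁ * m₂, mul_ne_zero hm₁ hm₂, fun x hx i => ?_⟩
    obtain ⟨y, hy, z, hz, rfl⟩ := Submodule.mem_sup.1 hx
    obtain ⟨a, ha⟩ := h₁ y hy i
    obtain ⟨b, hb⟩ := h₂ z hz i
    refine ⟨m₂ * a + m₁ * b, ?_⟩
    rw [map_add, Finsupp.add_apply]
    push_cast
    rw [← ha, ← hb]; ring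

/-- An orthogonal basis of `V`. -/
theorem exists_orthogonal {B : LinearMap.BilinForm ℚ V} (hsymm : B.IsSymm)
    (hdim : Module.finrank ℚ V = 3) :
    ∃ u : Module.Basis (Fin 3) ℚ V, ∀ i j, i ≠ j → B (u i) (u j) = 0 := by
  have : FiniteDimensional ℚ V := Module.finite_of_finrank_pos (by omega)
  obtain ⟨v, hv⟩ := LinearMap.BilinForm.exists_orthogonal_basis (B := B) (LinearMap.BilinForm.isSymm_iff.1 hsymm)
  refine ⟨v.reindex (finCongr hdim), fun i j hij => ?_⟩
  rw [Module.Basis.reindex_apply, Module.Basis.reindex_apply]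
  exact hv (fun h => hij ((finCongr hdim).symm.injective h))

/-- An orthogonal basis is divided by a common denominator of `K`, so that `K` has integral
coordinates; a multiple `D` then brings the basis vectors into `aK`. -/
theorem exists_orthogonal_adapted {B : LinearMap.BilinForm ℚ V} (hsymm : B.IsSymm)
    (hdim : Module.finrank ℚ V = 3) {K : Submodule ℤ V} (hK : IsLattice K) {a : ℕ} (ha : a ≠ 0) :
    ∃ (u : Module.Basis (Fin 3) ℚ V) (D : ℕ), (∀ i j, i ≠ j → B (u i) (u j) = 0) ∧
      (∀ x ∈ K, ∃ n, x = pt u n) ∧ D ≠ 0 ∧ ∀ i, ∃ k ∈ K, D • u i = a • k := by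
  obtain ⟨v, hv⟩ := exists_orthogonal hsymm hdim
  obtain ⟨m, hm, hmK⟩ := exists_common_denominator v hK.1
  have hmQ : (m : ℚ) ≠ 0 := by exact_mod_cast hm
  let u : Module.Basis (Fin 3) ℚ V := v.isUnitSMul (w := fun _ => (m : ℚ)⁻¹) fun _ => (inv_ne_zero hmQ).isUnit
  have hu : ∀ i, u i = (m : ℚ)⁻¹ • v i := fun i => v.isUnitSMul_apply _ i
  choose n hn hnK using fun i => hK.exists_nsmul_mem (u i)
  refine ⟨u, a * ∏ i, n i, fun i j hij => ?_, fun x hx => ?_,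
    mul_ne_zero ha (Finset.prod_ne_zero_iff.2 fun i _ => hn i), fun i => ?_⟩
  · rw [hu, hu]; simp [hv i j hij]
  · choose z hz using hmK x hx
    refine ⟨z, ?_⟩
    rw [← v.sum_repr x, pt]
    refine Finset.sum_congr rfl fun i _ => ?_
    rw [hu, smul_smul, ← hz]
    congr 1
    field_simp
  · obtain ⟨k, hk⟩ := Finset.dvd_prod_of_mem n (Finset.mem_univ i)
    refine ⟨(∏ i, n i) • u i, ?_, by rw [mul_smul]⟩
    rw [hk, mul_comm, mul_smul]
    exact nsmul_mem (hnK i) k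

/-- The properties of a lattice that govern the transformation behaviour of the theta series of its
cosets: it is integral, and its dual lattice `K^#` satisfies `M K^# ⊆ K`. -/
structure IsIntegralOfLevel (B : LinearMap.BilinForm ℚ V) (M : ℕ) (K : Submodule ℤ V) : Prop where
  lattice : IsLattice K
  integral : ∀ x ∈ K, ∀ y ∈ K, ∃ m : ℤ, B x y = m
  dual : ∀ x, (∀ y ∈ K, ∃ m : ℤ, B x y = m) → M • x ∈ K

theorem latticeCoset_subset {W : Type*} [AddCommGroup W] {a : ℕ} {K : Submodule ℤ W} {μ : W} (hμ : μ ∈ K) : latticeCoset a K μ ⊆ K := by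
  rintro x ⟨y, hy, rfl⟩
  exact add_mem (nsmul_mem hy a) hμ

theorem latticeCoset_congr {W : Type*} [AddCommGroup W] {a : ℕ} {K : Submodule ℤ W} {μ μ' : W} (h : ∃ k ∈ K, μ' - μ = a • k) :
    latticeCoset a K μ' = latticeCoset a K μ := by
  obtain ⟨k, hk, h⟩ := h
  have h' : μ' = a • k + μ := by rw [← h, sub_add_cancel]
  ext x
  constructor
  · rintro ⟨y, hy, rfl⟩
    exact ⟨y + k, add_mem hy hk, by rw [h', smul_add, add_assoc]⟩
  · rintro ⟨y, hy, rfl⟩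
    exact ⟨y - k, sub_mem hy hk, by rw [h', smul_sub]; abel⟩

theorem latticeCoset_zsmul_congr {W : Type*} [AddCommGroup W] {a : ℕ} {K : Submodule ℤ W} {μ : W} (hμ : μ ∈ K) {b b' : ℤ}
    (h : (a : ℤ) ∣ b' - b) : latticeCoset a K (b' • μ) = latticeCoset a K (b • μ) := by
  obtain ⟨k, hk⟩ := h
  exact latticeCoset_congr ⟨k • μ, zsmul_mem hμ k, by
    rw [← sub_smul, hk, mul_smul, natCast_zsmul]⟩

theorem adapted_latticeCoset {B : LinearMap.BilinForm ℚ V} (hpos : ∀ x : V, x ≠ 0 → 0 < B x x)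
    {K : Submodule ℤ V} {M : ℕ} (hK : IsIntegralOfLevel B M K) {a : ℕ} {u : Module.Basis (Fin 3) ℚ V} {D : ℕ}
    (ho : ∀ i j, i ≠ j → B (u i) (u j) = 0) (hmem : ∀ x ∈ K, ∃ n, x = pt u n) (hD : D ≠ 0)
    (hDu : ∀ i, ∃ k ∈ K, D • u i = a • k) {μ : V} (hμ : μ ∈ K) : Adapted B u D (latticeCoset a K μ) where
  orth := ho
  pos i := hpos _ (u.ne_zero i)
  ne := hD
  mem x hx := hmem x (latticeCoset_subset hμ hx)
  per n m hn := by
    obtain ⟨y, hy, hny⟩ := hn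
    choose k hk hDk using hDu
    refine ⟨y + ∑ i, m i • k i, add_mem hy (sum_mem fun i _ => zsmul_mem (hk i) _), ?_⟩
    have : (D : ℤ) • pt u m = a • ∑ i, m i • k i := by
      rw [pt, Finset.smul_sum, Finset.smul_sum]
      refine Finset.sum_congr rfl fun i _ => ?_
      rw [Int.cast_smul_eq_zsmul, smul_comm, natCast_zsmul, hDk, smul_comm]
    rw [pt_add, pt_smul, hny, this, smul_add]
    abel
  int_self x hx := hK.integral x (latticeCoset_subset hμ hx) x (latticeCoset_subset hμ hx)
  int_mul x hx i := by
    obtain ⟨k, hk, hDk⟩ := hDu i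
    obtain ⟨z, hz⟩ := hK.integral x (latticeCoset_subset hμ hx) (a • k) (nsmul_mem hk a)
    refine ⟨z, ?_⟩
    rw [← hz, ← hDk, ← Nat.cast_smul_eq_nsmul ℚ, map_smul, smul_eq_mul]

end

section

/-! ## Modularity of the theta series of a coset -/

open Complex CongruenceSubgroup

variable {V : Type*} [AddCommGroup V] [Module ℚ V]

/-- Translation by `k` permutes the residue classes of `X` and multiplies all the exponentials by
the same root of unity. A nonzero coefficient therefore forces this root to be `1`. -/
theorem dualCoeff_mul_exp {u : Module.Basis (Fin 3) ℚ V} {D : ℕ} [NeZero D] {X : Set V}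
    {k : Fin 3 → ℤ} (hk : ∀ n, pt u n ∈ X ↔ pt u (n + k) ∈ X) (m : Fin 3 → ℤ) :
    dualCoeff u D X m = cexp (2 * Real.pi * I * ((∑ i, m i * k i / D : ℚ) : ℂ)) * dualCoeff u D X m := by
  classical
  have hDQ : (D : ℚ) ≠ 0 := by exact_mod_cast NeZero.ne D
  conv_lhs => rw [dualCoeff, ← Equiv.sum_comp (Equiv.addRight fun i => (k i : ZMod D))]
  rw [dualCoeff, Finset.mul_sum]
  refine Finset.sum_congr rfl fun r _ => ?_
  have hres : resMem u D X (r + fun i => (k i : ZMod D)) ↔ resMem u D X r := by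
    constructor
    · rintro ⟨n, hn, hX⟩
      refine ⟨n - k, fun i => ?_, (hk _).2 (by rwa [sub_add_cancel])⟩
      simp [hn i]
    · rintro ⟨n, hn, hX⟩
      exact ⟨n + k, fun i => by simp [hn i], (hk _).1 hX⟩
  simp only [Equiv.coe_addRight, hres]
  split_ifs with h
  · rw [← Complex.exp_add]
    have hj : ∀ i, ∃ j : ℤ, (((r i + (k i : ZMod D)).val : ℕ) : ℤ) = (r i).val + k i + D * j := by
      intro i
      have : ((((r i + (k i : ZMod D)).val : ℕ) : ℤ) : ZMod D) = (((r i).val + k i : ℤ) : ZMod D) := by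
        push_cast; simp
      obtain ⟨j, hj⟩ := (ZMod.intCast_eq_intCast_iff_dvd_sub _ _ _).1 this.symm
      exact ⟨j, by linarith⟩
    choose j hj using hj
    rw [Complex.exp_eq_exp_iff_exists_int]
    refine ⟨∑ i, m i * j i, ?_⟩
    have : (∑ i, (m i : ℚ) * ((r i + (k i : ZMod D)).val : ℕ) / D) =
        (∑ i, (m i : ℚ) * k i / D + ∑ i, (m i : ℚ) * (r i).val / D) + ((∑ i, m i * j i : ℤ) : ℚ) := by
      push_cast
      rw [← Finset.sum_add_distrib, ← Finset.sum_add_distrib]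
      refine Finset.sum_congr rfl fun i _ => ?_
      have h1 : (((r i + (k i : ZMod D)).val : ℕ) : ℚ) = (r i).val + k i + D * j i := by exact_mod_cast hj i
      rw [h1]
      field_simp
      ring
    simp only [Pi.add_apply]
    rw [this]
    push_cast
    ring
  · simp

theorem sum_div_of_dualCoeff_ne_zero {u : Module.Basis (Fin 3) ℚ V} {D : ℕ} [NeZero D] {X : Set V}
    {k : Fin 3 → ℤ} (hk : ∀ n, pt u n ∈ X ↔ pt u (n + k) ∈ X) {m : Fin 3 → ℤ}
    (hm : dualCoeff u D X m ≠ 0) : ∃ z : ℤ, (∑ i, m i * k i / D : ℚ) = z := by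
  have h := dualCoeff_mul_exp (D := D) hk m
  have h1 : cexp (2 * Real.pi * I * ((∑ i, m i * k i / D : ℚ) : ℂ)) = 1 :=
    mul_right_cancel₀ hm (by rw [one_mul]; exact h.symm)
  obtain ⟨z, hz⟩ := Complex.exp_eq_one_iff.1 h1
  refine ⟨z, ?_⟩
  have hpi : (2 * Real.pi * I : ℂ) ≠ 0 := Complex.two_pi_I_ne_zero
  rw [mul_comm] at hz
  exact_mod_cast mul_right_cancel₀ hpi hz

theorem mem_latticeCoset_add_iff {W : Type*} [AddCommGroup W] {a : ℕ} {K : Submodule ℤ W} {μ k : W}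
    (hk : k ∈ K) (x : W) :
    x ∈ latticeCoset a K μ ↔ x + a • k ∈ latticeCoset a K μ := by
  constructor
  · rintro ⟨y, hy, rfl⟩
    exact ⟨y + k, add_mem hy hk, by rw [smul_add]; abel⟩
  · rintro ⟨y, hy, h⟩
    exact ⟨y - k, sub_mem hy hk, by rw [smul_sub, sub_add_eq_add_sub, ← h, add_sub_cancel_right]⟩

/-- The exponents at the cusp `0` are the values `Q(y)` of vectors with `2ay` in the dual lattice.
The dual lattice is carried into `K` by `M`, which bounds the denominators of these values by
`4Ma²`. -/
theorem theta_latticeCoset_lowerU {B : LinearMap.BilinForm ℚ V}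
    {K : Submodule ℤ V} {M : ℕ} (hK : IsIntegralOfLevel B M K) {a : ℕ} {u : Module.Basis (Fin 3) ℚ V} {D : ℕ}
    (hmem : ∀ x ∈ K, ∃ n, x = pt u n) {μ : V} (h : Adapted B u D (latticeCoset a K μ)) {n : ℤ}
    (hn : ((4 * M * a ^ 2 : ℕ) : ℤ) ∣ n) (τ : ℍ) :
    theta B (latticeCoset a K μ) (lowerU n • τ) = thetaFactor (lowerU n) τ ^ 3 *
      theta B (latticeCoset a K μ) τ := by
  have : NeZero D := ⟨h.ne⟩
  have hDQ : (D : ℚ) ≠ 0 := by exact_mod_cast h.ne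
  have ho := h.orth
  have hs : ∀ i, B (u i) (u i) ≠ 0 := fun i => (h.pos i).ne'
  refine theta_lowerU h n (fun m hm => ?_) τ
  -- The vector with `B(y, D uᵢ) = mᵢ/2`, so that `Q(y)` is the exponent belonging to `m`.
  set y : V := ∑ i, ((m i : ℚ) / (2 * B (u i) (u i) * D)) • u i with hy
  have hyu : ∀ i, B y (u i) = m i / (2 * D) := by
    intro i
    rw [hy, map_sum, LinearMap.sum_apply, Finset.sum_eq_single i]
    · have := hs i
      simp only [map_smul, LinearMap.smul_apply, smul_eq_mul]
      field_simp
    · intro j _ hj; simp [ho j i hj]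
    · simp
  have hyy : B y y = ∑ i, (m i : ℚ) ^ 2 / (4 * (B (u i) (u i) * D ^ 2)) := by
    have e1 : B y y = B y (∑ i, ((m i : ℚ) / (2 * B (u i) (u i) * D)) • u i) := by rw [← hy]
    rw [e1, map_sum]
    refine Finset.sum_congr rfl fun i _ => ?_
    have := hs i
    rw [map_smul, hyu, smul_eq_mul]
    field_simp
    ring
  have hdual : M • ((2 * a) • y) ∈ K := by
    refine hK.dual _ fun k hk => ?_
    obtain ⟨nk, hnk⟩ := hmem _ (nsmul_mem hk a)
    obtain ⟨z, hz⟩ := sum_div_of_dualCoeff_ne_zero (k := nk) (fun n' => by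
      rw [pt_add, ← hnk]; exact mem_latticeCoset_add_iff hk _) hm
    refine ⟨z, ?_⟩
    have e1 : B ((2 * a) • y) k = 2 * B y (a • k) := by
      rw [← Nat.cast_smul_eq_nsmul ℚ, ← Nat.cast_smul_eq_nsmul ℚ]
      simp only [map_smul, LinearMap.smul_apply, smul_eq_mul]
      push_cast; ring
    rw [e1, hnk, ← hz, pt, map_sum, Finset.mul_sum]
    refine Finset.sum_congr rfl fun i _ => ?_
    rw [map_smul, hyu, smul_eq_mul]
    field_simp
  -- The integrality of `2B(y, ak)` for `k ∈ K`, used above to show that `2ay` is dual to `K`, is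
  -- applied again to the vector `k = M(2ay)` of `K` itself.
  obtain ⟨z, hz⟩ : ∃ z : ℤ, (4 * M * a ^ 2 : ℚ) * B y y = z := by
    obtain ⟨nk, hnk⟩ := hmem _ (nsmul_mem hdual a)
    obtain ⟨z, hz⟩ := sum_div_of_dualCoeff_ne_zero (k := nk) (fun n' => by
      rw [pt_add, ← hnk]; exact mem_latticeCoset_add_iff hdual _) hm
    refine ⟨z, ?_⟩
    have e1 : (4 * M * a ^ 2 : ℚ) * B y y = 2 * B y (a • M • ((2 * a) • y)) := by
      rw [← Nat.cast_smul_eq_nsmul ℚ, ← Nat.cast_smul_eq_nsmul ℚ, ← Nat.cast_smul_eq_nsmul ℚ]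
      simp only [map_smul, smul_eq_mul]
      push_cast; ring
    rw [e1, hnk, ← hz, pt, map_sum, Finset.mul_sum]
    refine Finset.sum_congr rfl fun i _ => ?_
    rw [map_smul, hyu, smul_eq_mul]
    field_simp
  obtain ⟨j, rfl⟩ := hn
  refine ⟨j * z, ?_⟩
  rw [← hyy]
  push_cast
  rw [← hz]; ring

/-- `δ` is a representative of the discriminant of the space, modulo squares. -/
def IsDiscr (B : LinearMap.BilinForm ℚ V) (δ : ℤ) : Prop :=
  0 < δ ∧ ∀ u : Module.Basis (Fin 3) ℚ V, (∀ i j, i ≠ j → B (u i) (u j) = 0) →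
    IsSquare ((δ : ℚ) * ∏ i, B (u i) (u i))

theorem jacobiSym_eq_of_isSquare_mul {s t : ℤ} (h : IsSquare (s * t)) {d : ℤ} (hs : IsCoprime s d)
    (ht : IsCoprime t d) : jacobiSym s d.natAbs = jacobiSym t d.natAbs := by
  obtain ⟨r, hr⟩ := h
  have hrd : IsCoprime r d := by
    have : IsCoprime (r * r) d := hr ▸ hs.mul_left ht
    exact this.of_mul_left_left
  have h1 : jacobiSym s d.natAbs * jacobiSym t d.natAbs = 1 := by
    rw [← jacobiSym.mul_left, hr, jacobiSym.mul_left, ← sq, jacobiSym_sq_of_isCoprime hrd]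
  have h2 := jacobiSym_sq_of_isCoprime ht
  linear_combination jacobiSym t d.natAbs * h1 - jacobiSym s d.natAbs * h2

theorem kronecker_four_mul {δ : ℤ} (hδ : 0 < δ) {d : ℤ} (hd : d % 2 = 1) :
    kronecker (4 * δ) d = jacobiSym δ d.natAbs := by
  rw [kronecker, if_neg (by omega), jacobiSym.mul_left]
  have ho : Odd d.natAbs := by rw [Nat.odd_iff]; omega
  rw [jacobiSym.at_four ho, one_mul]

/-- A unit modulo `c` lifts to a unit modulo `cM`. In the degenerate case `c = 0` already `d = ±1`.
-/
theorem exists_isCoprime_add_mul {c d : ℤ} (hcd : IsCoprime c d) {M : ℕ} (hM : M ≠ 0)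
    : ∃ n : ℤ, IsCoprime (d + n * c) (M : ℤ) := by
  rcases eq_or_ne c 0 with rfl | hc
  · rw [isCoprime_zero_left, Int.isUnit_iff] at hcd
    refine ⟨0, ?_⟩
    rcases hcd with rfl | rfl
    · simpa using isCoprime_one_left
    · simpa using isCoprime_one_left.neg_left
  · have hcn : c.natAbs ≠ 0 := by simpa using hc
    have : NeZero (c.natAbs * M) := ⟨mul_ne_zero hcn hM⟩
    have hd : IsUnit (d : ZMod c.natAbs) := by
      obtain ⟨x, y, hxy⟩ := hcd
      have := congrArg (Int.cast : ℤ → ZMod c.natAbs) hxy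
      have h0 : ((c : ℤ) : ZMod c.natAbs) = 0 :=
        (ZMod.intCast_zmod_eq_zero_iff_dvd _ _).2 (Int.natAbs_dvd.2 dvd_rfl)
      push_cast at this
      rw [h0, mul_zero, zero_add] at this
      exact IsUnit.of_mul_eq_one_right _ this
    obtain ⟨w, hw⟩ := ZMod.unitsMap_surjective (Dvd.intro M rfl : c.natAbs ∣ c.natAbs * M) hd.unit
    set v : ℤ := (((w : ZMod (c.natAbs * M)).val : ℕ) : ℤ) with hv
    have hvw : (v : ZMod (c.natAbs * M)) = w := by rw [hv]; simp
    have h1 : (v : ZMod c.natAbs) = d := by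
      have := congrArg Units.val hw
      rw [ZMod.unitsMap_val, IsUnit.unit_spec, ← hvw] at this
      simpa using this
    obtain ⟨k, hk⟩ := (ZMod.intCast_eq_intCast_iff_dvd_sub _ _ _).1 h1.symm
    have hk' : ∃ n, v = d + n * c := by
      rcases Int.natAbs_eq c with h | h
      · exact ⟨k, by rw [← h] at hk; linarith⟩
      · refine ⟨-k, ?_⟩
        have : (c.natAbs : ℤ) = -c := by omega
        rw [this] at hk; linarith
    obtain ⟨n, hn⟩ := hk'
    refine ⟨n, ?_⟩
    rw [← hn]
    have := ZMod.val_coe_unit_coprime w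
    rw [hv, Nat.isCoprime_iff_coprime]
    exact this.coprime_mul_left_right

end

/-! ### The transformation law of the theta series of a coset under `Γ₀(4Ma²)` -/

section

open Complex CongruenceSubgroup

variable {V : Type*} [AddCommGroup V] [Module ℚ V]

theorem slash_theta_of_dvd {B : LinearMap.BilinForm ℚ V} (hpos : ∀ x : V, x ≠ 0 → 0 < B x x)
    {K : Submodule ℤ V} {M : ℕ} (hK : IsIntegralOfLevel B M K) {a : ℕ} {u : Module.Basis (Fin 3) ℚ V} {D : ℕ}
    (ho : ∀ i j, i ≠ j → B (u i) (u j) = 0) (hmem : ∀ x ∈ K, ∃ n, x = pt u n) (hD : D ≠ 0)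
    (hDu : ∀ i, ∃ k ∈ K, D • u i = a • k) {t : Fin 3 → ℤ} (ht : ∀ i, (t i : ℚ) = B (u i) (u i) * D ^ 2)
    {μ : V} (hμ : μ ∈ K) {γ : SL(2, ℤ)} (hγt : ∀ i, 4 * t i ∣ γ 1 0) (hγD : (D : ℤ) ∣ γ 1 0)
    (hγa : (a : ℤ) ∣ γ 1 0) :
    slash 3 γ (theta B (latticeCoset a K μ)) =
      (jacobiSym (∏ i, t i) (γ 1 1).natAbs : ℂ) • theta B (latticeCoset a K (γ 0 0 • μ)) := by
  ext τ
  have hA := adapted_latticeCoset hpos hK ho hmem hD hDu hμ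
  have hA' := adapted_latticeCoset hpos hK ho hmem hD hDu (zsmul_mem hμ (γ 0 0))
  have hdet := det_eq γ
  have h4 : (4 : ℤ) ∣ γ 1 0 := (Dvd.intro _ rfl).trans (hγt 0)
  rw [slash_eq_thetaFactor (by decide), theta_smul hA hA' ht γ hγt hγD, Pi.smul_apply, smul_eq_mul]
  · have := thetaFactor_ne_zero h4 τ
    field_simp
  · intro n
    obtain ⟨k, hk⟩ := hγa
    rw [pt_smul]
    constructor
    · rintro ⟨y, hy, h⟩
      refine ⟨γ 1 1 • y + (γ 0 1 * k) • μ, add_mem (zsmul_mem hy _) (zsmul_mem hμ _), ?_⟩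
      rw [h, smul_add, smul_add, smul_smul, smul_comm, ← natCast_zsmul, ← natCast_zsmul, smul_smul]
      have : γ 1 1 * γ 0 0 = a * (γ 0 1 * k) + 1 := by rw [hk] at hdet; linear_combination hdet
      rw [this, add_smul, one_smul, add_assoc, mul_smul (a : ℤ) (γ 0 1 * k)]
    · rintro ⟨y, hy, h⟩
      -- `bc` times the vector lies in `aK`, because `D ∣ c`. With `ad - bc = 1` this recovers the
      -- vector modulo `aK` from its multiple by `d`.
      have hDn : ∃ w ∈ K, (γ 0 1 * γ 1 0) • pt u n = a • w := by
        obtain ⟨j, hj⟩ := hγD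
        choose w hw hDw using hDu
        refine ⟨(γ 0 1 * j) • ∑ i, n i • w i, zsmul_mem (sum_mem fun i _ => zsmul_mem (hw i) _) _, ?_⟩
        have e : (D : ℤ) • pt u n = a • ∑ i, n i • w i := by
          rw [pt, Finset.smul_sum, Finset.smul_sum]
          refine Finset.sum_congr rfl fun i _ => ?_
          rw [Int.cast_smul_eq_zsmul, smul_comm, natCast_zsmul, hDw, smul_comm]
        rw [hj, show γ 0 1 * (D * j) = (γ 0 1 * j) * D by ring, mul_smul, e, smul_comm]
      obtain ⟨w, hw, hDw⟩ := hDn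
      refine ⟨γ 0 0 • y - w, sub_mem (zsmul_mem hy _) hw, ?_⟩
      have e : pt u n = (γ 0 0 * γ 1 1) • pt u n - (γ 0 1 * γ 1 0) • pt u n := by
        rw [← sub_smul, hdet, one_smul]
      rw [e, mul_smul, h, hDw, smul_add, smul_sub, smul_comm a]
      abel

/-- Only the squarefree part `t` of `δ` matters on arguments prime to `N`. From `δ ∣ M³` it follows
that `t ∣ M`, so `4t` divides `N` even if `4δ` does not. -/
theorem kronecker_per {δ : ℤ} (hδ : 0 < δ) {M N : ℕ} (hδM : δ ∣ (M : ℤ) ^ 3) (hMN : 4 * M ∣ N) {d d' : ℤ}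
    (hd : IsCoprime d (N : ℤ)) (h : (N : ℤ) ∣ d' - d) : kronecker (4 * δ) d' = kronecker (4 * δ) d := by
  have h4N : (4 : ℤ) ∣ N := by exact_mod_cast (Dvd.intro _ rfl).trans hMN
  have hd2 : d % 2 = 1 := by
    by_contra hcon
    have h2 : (2 : ℤ) ∣ d := by omega
    have := hd.isUnit_of_dvd' h2 ((by norm_num : (2 : ℤ) ∣ 4).trans h4N)
    rw [Int.isUnit_iff] at this; omega
  have hd2' : d' % 2 = 1 := by
    have : (2 : ℤ) ∣ d' - d := ((by norm_num : (2 : ℤ) ∣ 4).trans h4N).trans h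
    omega
  obtain ⟨t, s, hst, hsq⟩ := Nat.sq_mul_squarefree δ.natAbs
  have hδn : (δ.natAbs : ℤ) = δ := by omega
  have hδst : δ = s ^ 2 * t := by rw [← hδn, ← hst]; push_cast; ring
  have hMd : ∀ {x : ℤ}, IsCoprime x (N : ℤ) → IsCoprime δ x := by
    intro x hx
    have h1 : IsCoprime x (M : ℤ) := hx.of_isCoprime_of_dvd_right
      (by exact_mod_cast (Dvd.intro_left 4 rfl).trans hMN)
    exact (h1.pow_right.of_isCoprime_of_dvd_right hδM).symm
  have htM : t ∣ M := by
    have h1 : t ∣ M ^ 3 := by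
      have : (δ.natAbs : ℤ) ∣ ((M ^ 3 : ℕ) : ℤ) := by rw [hδn]; exact_mod_cast hδM
      have := Int.natCast_dvd_natCast.1 this
      exact (Dvd.intro_left _ hst).trans this
    exact (hsq.dvd_pow_iff_dvd (by norm_num)).1 h1
  have htpos : 0 < t := Nat.pos_of_ne_zero fun h0 => by rw [h0] at hδst; simp at hδst; omega
  have key : ∀ {x : ℤ}, IsCoprime x (N : ℤ) → x % 2 = 1 → kronecker (4 * δ) x = kronecker (4 * t) x := by
    intro x hx hx2
    rw [kronecker_four_mul hδ hx2, kronecker_four_mul (by exact_mod_cast htpos) hx2, hδst, jacobiSym.mul_left]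
    have hsx : IsCoprime (s : ℤ) x := by
      have := hMd hx
      rw [hδst, sq, mul_assoc] at this
      exact this.of_mul_left_left
    have := jacobiSym_sq_of_isCoprime hsx
    rw [jacobiSym.pow_left, this, one_mul]
  have hd' : IsCoprime d' (N : ℤ) := by
    obtain ⟨k, hk⟩ := h
    have : d' = d + N * k := by linarith
    rw [this]
    exact hd.add_mul_left_left k
  rw [key hd hd2, key hd' hd2']
  obtain ⟨k, hk⟩ : ((4 * t : ℤ)) ∣ d' - d := by
    have : 4 * t ∣ N := (mul_dvd_mul_left 4 htM).trans hMN
    exact (by exact_mod_cast this : (4 * t : ℤ) ∣ N).trans h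
  have : d' = d + k * (4 * t) := by linarith
  rw [this, kronecker_add_mul (Dvd.intro _ rfl) hd2]

theorem isQuadChar_kronecker {δ : ℤ} (hδ : 0 < δ) {M N : ℕ} (hδM : δ ∣ (M : ℤ) ^ 3) (hMN : 4 * M ∣ N) :
    IsQuadChar N fun d => (kronecker (4 * δ) d : ℂ) where
  one := by simp [kronecker]
  mul m n hm hn := by
    have h1 : ∀ x, kronecker (4 * δ) x = jacobiSym (4 * δ) x.natAbs := fun x => by
      rw [kronecker, if_neg (by omega)]
    have : NeZero m.natAbs := ⟨by simpa using hm⟩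
    have : NeZero n.natAbs := ⟨by simpa using hn⟩
    rw [h1, h1, h1, Int.natAbs_mul, jacobiSym.mul_right]
    push_cast; rfl
  per d d' hd h := by rw [kronecker_per hδ hδM hMN hd h]
  sq d hd := by
    apply kronecker_sq_complex
    have h4 : IsCoprime (4 : ℤ) d := (hd.of_isCoprime_of_dvd_right
      (by exact_mod_cast (Dvd.intro _ rfl).trans hMN)).symm
    have h1 : IsCoprime d (M : ℤ) := hd.of_isCoprime_of_dvd_right
      (by exact_mod_cast (Dvd.intro_left 4 rfl).trans hMN)
    exact h4.mul_left (h1.pow_right.of_isCoprime_of_dvd_right hδM).symm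

/-- The law from the coordinates, `slash_theta_of_dvd`, needs a level `N'` that depends on the
auxiliary basis. Here `γ` is factored as an element of `Γ₀(N')` times `lowerU` with entry divisible
by `N` times `upperU`. The last two factors leave the theta series invariant, by the level and the
integrality of `K`. -/
theorem slash_theta {B : LinearMap.BilinForm ℚ V} (hsymm : B.IsSymm) (hpos : ∀ x : V, x ≠ 0 → 0 < B x x)
    (hdim : Module.finrank ℚ V = 3) {K : Submodule ℤ V} {M : ℕ} (hM : M ≠ 0) (hK : IsIntegralOfLevel B M K)
    {a : ℕ} (ha : a ≠ 0) {δ : ℤ} (hδ : IsDiscr B δ) (hδM : δ ∣ (M : ℤ) ^ 3) {μ : V} (hμ : μ ∈ K)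
    {γ : SL(2, ℤ)} (hγ : γ ∈ Gamma0 (4 * M * a ^ 2)) :
    slash 3 γ (theta B (latticeCoset a K μ)) =
      (kronecker (4 * δ) (γ 1 1) : ℂ) • theta B (latticeCoset a K (γ 0 0 • μ)) := by
  set N := 4 * M * a ^ 2 with hN
  have hN0 : N ≠ 0 := by positivity
  obtain ⟨u, D, ho, hmem, hD, hDu⟩ := exists_orthogonal_adapted hsymm hdim hK.lattice ha
  choose k hk hDk using hDu
  have htz : ∀ i, ∃ z : ℤ, (z : ℚ) = B (u i) (u i) * D ^ 2 := by
    intro i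
    obtain ⟨z, hz⟩ := hK.integral _ (nsmul_mem (hk i) a) _ (nsmul_mem (hk i) a)
    refine ⟨z, ?_⟩
    rw [← hz, ← hDk, ← Nat.cast_smul_eq_nsmul ℚ]
    simp only [map_smul, LinearMap.smul_apply, smul_eq_mul]
    ring
  choose t ht using htz
  have htpos : ∀ i, 0 < t i := by
    intro i
    have h1 : (0 : ℚ) < D := by exact_mod_cast Nat.pos_of_ne_zero hD
    have : (0 : ℚ) < t i := by
      rw [ht]; exact mul_pos (hpos _ (u.ne_zero i)) (pow_pos h1 2)
    exact_mod_cast this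
  set T : ℤ := ∏ i, t i with hT
  have hTpos : 0 < T := Finset.prod_pos fun i _ => htpos i
  -- a highly divisible level
  set N' : ℕ := N * D * (4 * T.natAbs) with hN'
  have hN'0 : N' ≠ 0 := by
    have : T.natAbs ≠ 0 := by omega
    positivity
  have hTN' : 4 * T ∣ (N' : ℤ) := by
    rw [hN']; push_cast
    rw [abs_of_pos hTpos]
    exact Dvd.intro_left _ rfl
  obtain ⟨n, hn⟩ := exists_isCoprime_add_mul (isCoprime_bottom γ) hN'0
  obtain ⟨c, hc⟩ := dvd_of_mem_Gamma0 hγ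
  obtain ⟨x, y, hxy⟩ := id hn
  set d' := γ 1 1 + n * γ 1 0 with hd'
  set γ₁ : SL(2, ℤ) := γ * upperU n with hγ₁
  -- With `xd' + yN' = 1` the lower left entry becomes `γ 1 0 * (1 - xd')`, a multiple of `N'`.
  set γ' : SL(2, ℤ) := γ₁ * lowerU (-(N * (c * x))) with hγ'
  have e10 : γ' 1 0 = N' * (y * γ 1 0) := by
    rw [hγ', mul_apply_sl, hγ₁, mul_apply_sl, mul_apply_sl]
    simp only [upperU_00, upperU_01, upperU_10, upperU_11, lowerU_00, lowerU_10]
    linear_combination (- γ 1 0) * hxy + x * d' * hc + (N * c * x) * hd'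
  have e11 : γ' 1 1 = d' := by
    rw [hγ', mul_apply_sl, hγ₁, mul_apply_sl, mul_apply_sl]
    simp only [upperU_00, upperU_01, upperU_10, upperU_11, lowerU_01, lowerU_11]
    rw [hd']; ring
  have e00 : γ' 0 0 = γ 0 0 - N * (c * x) * (γ 0 0 * n + γ 0 1) := by
    rw [hγ', mul_apply_sl, hγ₁, mul_apply_sl, mul_apply_sl]
    simp only [upperU_00, upperU_01, upperU_10, upperU_11, lowerU_00, lowerU_10]
    ring
  have hfact : γ = γ' * (lowerU (N * (c * x)) * upperU (-n)) := by
    have h1 : lowerU (-(N * (c * x))) * lowerU (N * (c * x)) = 1 := by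
      ext i j; fin_cases i <;> fin_cases j <;> simp [mul_apply_sl]
    have h2 : upperU n * upperU (-n) = 1 := by
      ext i j; fin_cases i <;> fin_cases j <;> simp [mul_apply_sl]
    rw [hγ', mul_assoc, ← mul_assoc (lowerU _) (lowerU _), h1, one_mul, hγ₁, mul_assoc, h2, mul_one]
  have hN'dvd : (N' : ℤ) ∣ γ' 1 0 := ⟨_, e10⟩
  have hN4 : (4 : ℤ) ∣ N := by rw [hN]; push_cast; exact ⟨M * a ^ 2, by ring⟩
  have h4' : (4 : ℤ) ∣ γ' 1 0 := (Dvd.intro T rfl).trans (hTN'.trans hN'dvd)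
  have haN : (a : ℤ) ∣ N := by rw [hN]; push_cast; exact ⟨4 * M * a, by ring⟩
  have hNN' : (N : ℤ) ∣ N' := by rw [hN']; push_cast; exact ⟨_, mul_assoc _ _ _⟩
  have hDN' : (D : ℤ) ∣ N' := by rw [hN']; push_cast; exact ⟨N * (4 * |T|), by ring⟩
  have key := slash_theta_of_dvd hpos hK ho hmem hD (fun i => ⟨k i, hk i, hDk i⟩) ht hμ (γ := γ')
    (fun i => ((mul_dvd_mul_left 4 (Finset.dvd_prod_of_mem t (Finset.mem_univ i))).trans hTN').trans hN'dvd)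
    (hDN'.trans hN'dvd) ((haN.trans hNN').trans hN'dvd)
  have hmemX : γ' 0 0 • μ ∈ K := zsmul_mem hμ _
  have hA := adapted_latticeCoset hpos hK ho hmem hD (fun i => ⟨k i, hk i, hDk i⟩) hmemX
  have hlow : slash 3 (lowerU (N * (c * x))) (theta B (latticeCoset a K (γ' 0 0 • μ))) =
      theta B (latticeCoset a K (γ' 0 0 • μ)) := by
    ext τ
    have h4l : (4 : ℤ) ∣ lowerU (N * (c * x)) 1 0 := by rw [lowerU_10]; exact hN4.mul_right _
    have := thetaFactor_ne_zero h4l τ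
    rw [slash_eq_thetaFactor (by decide), theta_latticeCoset_lowerU hK hmem hA (n := N * (c * x)) (Dvd.intro _ rfl)]
    field_simp
  have hup : slash 3 (upperU (-n)) (theta B (latticeCoset a K (γ' 0 0 • μ))) =
      theta B (latticeCoset a K (γ' 0 0 • μ)) := by
    ext τ
    rw [slash_eq_thetaFactor (by decide), thetaFactor_upperU, theta_upperU hA.int_self]
    simp
  have hTd : IsCoprime T d' := by
    have := hn.of_isCoprime_of_dvd_right hTN'
    exact this.symm.of_mul_left_right
  have hdN : IsCoprime (γ 1 1) (N : ℤ) := isCoprime_11 hγ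
  have hd'N : IsCoprime d' (N : ℤ) := hn.of_isCoprime_of_dvd_right hNN'
  have hδd : IsCoprime δ d' := by
    have h1 : IsCoprime d' (M : ℤ) := hd'N.of_isCoprime_of_dvd_right (by
      rw [hN]; push_cast; exact ⟨4 * a ^ 2, by ring⟩)
    exact (h1.pow_right.of_isCoprime_of_dvd_right hδM).symm
  -- `T` is `D⁶` times the discriminant of the orthogonal basis, so it agrees with `δ` up to squares
  -- and has the same symbol.
  have hsq : IsSquare (T * δ) := by
    rw [← Rat.isSquare_intCast_iff]
    obtain ⟨r, hr⟩ := hδ.2 u ho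
    refine ⟨D ^ 3 * r, ?_⟩
    rw [hT]
    push_cast
    rw [Finset.prod_congr rfl fun i _ => ht i, Finset.prod_mul_distrib, Finset.prod_const]
    simp only [Finset.card_univ, Fintype.card_fin]
    linear_combination (D : ℚ) ^ 6 * hr
  have hd'2 : d' % 2 = 1 := by
    have h2 := hd'N.of_isCoprime_of_dvd_right hN4
    by_contra hcon
    have h2' : (2 : ℤ) ∣ d' := by omega
    have := h2.isUnit_of_dvd' h2' (by norm_num)
    rw [Int.isUnit_iff] at this; omega
  have hker : kronecker (4 * δ) (γ 1 1) = jacobiSym T (γ' 1 1).natAbs := by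
    rw [e11, jacobiSym_eq_of_isSquare_mul hsq hTd hδd, ← kronecker_four_mul hδ.1 hd'2]
    symm
    refine kronecker_per hδ.1 hδM (Dvd.intro _ rfl) hdN ?_
    rw [hd', add_sub_cancel_left, hc]
    exact ⟨n * c, by rw [hN]; ring⟩
  have hcos : latticeCoset a K (γ' 0 0 • μ) = latticeCoset a K (γ 0 0 • μ) := by
    refine latticeCoset_zsmul_congr hμ ?_
    rw [e00, sub_sub_cancel_left]
    exact ((haN.mul_right _).mul_right _).neg_right
  rw [← hcos, hker]
  conv_lhs => rw [hfact]
  rw [slash_mul (by decide) h4' (four_dvd_mul (hN4.mul_right _) (dvd_zero _)), key, slash_smul,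
    slash_mul (by decide) (hN4.mul_right _) (dvd_zero _), hlow, hup]

end

section

/-! ## Discriminant and level of a lattice -/

variable {V : Type*} [AddCommGroup V] [Module ℚ V]

theorem exists_basis_of_lattice (hdim : Module.finrank ℚ V = 3) {L : Submodule ℤ V}
    (e : Module.Basis (Fin 3) ℤ L) : ∃ b : Module.Basis (Fin 3) ℚ V, ∀ i, b i = e i := by
  have h1 : LinearIndependent ℤ fun i => (e i : V) :=
    e.linearIndependent.map' L.subtype (LinearMap.ker_eq_bot.2 L.injective_subtype)
  have h2 : LinearIndependent ℚ fun i => (e i : V) := (LinearIndependent.iff_fractionRing ℤ ℚ).1 h1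
  refine ⟨basisOfLinearIndependentOfCardEqFinrank h2 (by rw [hdim, Fintype.card_fin]), fun i => ?_⟩
  rw [basisOfLinearIndependentOfCardEqFinrank]
  simp

theorem gram_eq {B : LinearMap.BilinForm ℚ V} {L : Submodule ℤ V} (e : Module.Basis (Fin 3) ℤ L)
    {b : Module.Basis (Fin 3) ℚ V} (hb : ∀ i, b i = e i) {u : Module.Basis (Fin 3) ℚ V}
    (ho : ∀ i j, i ≠ j → B (u i) (u j) = 0) :
    gram B e = (u.toMatrix b).transpose * Matrix.diagonal (fun i => B (u i) (u i)) * u.toMatrix b := by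
  ext i j
  rw [Matrix.mul_apply]
  simp only [Matrix.mul_diagonal, Matrix.transpose_apply, Module.Basis.toMatrix_apply, gram, Matrix.of_apply,
    ← hb]
  conv_lhs => rw [← u.sum_repr (b i), ← u.sum_repr (b j)]
  rw [map_sum]
  refine Finset.sum_congr rfl fun k _ => ?_
  rw [map_sum, LinearMap.sum_apply, Finset.sum_eq_single k]
  · simp only [map_smul, LinearMap.smul_apply, smul_eq_mul]; ring
  · intro l _ hl
    simp [ho l k hl]
  · simp

theorem det_gram_eq {B : LinearMap.BilinForm ℚ V} {L : Submodule ℤ V} (e : Module.Basis (Fin 3) ℤ L)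
    {b : Module.Basis (Fin 3) ℚ V} (hb : ∀ i, b i = e i) {u : Module.Basis (Fin 3) ℚ V}
    (ho : ∀ i j, i ≠ j → B (u i) (u j) = 0) :
    (gram B e).det = (u.toMatrix b).det ^ 2 * ∏ i, B (u i) (u i) := by
  rw [gram_eq e hb ho, Matrix.det_mul, Matrix.det_mul, Matrix.det_transpose, Matrix.det_diagonal]
  ring

variable {B : LinearMap.BilinForm ℚ V} (hsymm : B.IsSymm) (hpos : ∀ x : V, x ≠ 0 → 0 < B x x)
    (hdim : Module.finrank ℚ V = 3) {L : Submodule ℤ V}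
    (hint : ∀ x ∈ L, ∀ y ∈ L, ∃ m : ℤ, B x y = m) (e : Module.Basis (Fin 3) ℤ L)

include hint in
theorem exists_int_gram : ∃ A : Matrix (Fin 3) (Fin 3) ℤ, gram B e = A.map (Int.cast : ℤ → ℚ) := by
  choose m hm using fun i j => hint (e i) (e i).2 (e j) (e j).2
  exact ⟨Matrix.of m, by ext i j; exact hm i j⟩

include hint in
theorem discr_eq : (discr B e : ℚ) = (gram B e).det := by
  obtain ⟨A, hA⟩ := exists_int_gram hint e
  have : (gram B e).det = ((A.det : ℤ) : ℚ) := by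
    rw [hA]; exact (Int.cast_det A).symm
  rw [discr, this, Rat.num_intCast]

include hsymm hpos hdim hint in
theorem isDiscr_discr : IsDiscr B (discr B e) := by
  obtain ⟨b, hb⟩ := exists_basis_of_lattice hdim e
  constructor
  · obtain ⟨u, ho⟩ := exists_orthogonal hsymm hdim
    have h1 : (0 : ℚ) < discr B e := by
      rw [discr_eq hint, det_gram_eq e hb ho]
      have h2 : (u.toMatrix b).det ≠ 0 := by
        intro h0
        have := congrArg Matrix.det (u.toMatrix_mul_toMatrix_flip b)
        rw [Matrix.det_mul, h0, zero_mul, Matrix.det_one] at this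
        exact zero_ne_one this
      exact mul_pos (by positivity) (Finset.prod_pos fun i _ => hpos _ (u.ne_zero i))
    exact_mod_cast h1
  · intro u ho
    refine ⟨(u.toMatrix b).det * ∏ i, B (u i) (u i), ?_⟩
    rw [discr_eq hint, det_gram_eq e hb ho]
    ring

include hsymm hpos hdim hint in
-- The determinant of the Gram matrix belongs to the set in the definition, since it turns the
-- inverse into the adjugate; so the infimum is attained and is not the default value `0`.
theorem level_spec : 0 < level B e ∧ ∀ i j, ∃ m : ℤ, (level B e : ℚ) * (gram B e)⁻¹ i j = m := by
  have hne : {N : ℕ | 0 < N ∧ ∀ i j, ∃ m : ℤ, (N : ℚ) * (gram B e)⁻¹ i j = m}.Nonempty := by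
    obtain ⟨A, hA⟩ := exists_int_gram hint e
    have hd := isDiscr_discr hsymm hpos hdim hint e
    have hdet : (gram B e).det = ((A.det : ℤ) : ℚ) := by
      rw [hA]; exact (Int.cast_det A).symm
    have hApos : 0 < A.det := by
      have h1 := hd.1
      rw [discr, hdet, Rat.num_intCast] at h1
      exact h1
    refine ⟨A.det.natAbs, by omega, fun i j => ⟨A.adjugate i j, ?_⟩⟩
    have hAn : ((A.det.natAbs : ℕ) : ℚ) = (A.det : ℤ) := by
      rw [← Int.cast_natCast, Int.natAbs_of_nonneg hApos.le]
    have hne : ((A.det : ℤ) : ℚ) ≠ 0 := by exact_mod_cast hApos.ne'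
    rw [Matrix.inv_def, hdet, hAn, Matrix.smul_apply, smul_eq_mul, Ring.inverse_eq_inv', ← mul_assoc,
      mul_inv_cancel₀ hne, one_mul, hA]
    have := congrFun (congrFun (RingHom.map_adjugate (Int.castRingHom ℚ) A) i) j
    simpa using this.symm
  exact Nat.sInf_mem hne

include hsymm hpos hdim hint in
theorem det_gram_ne_zero : (gram B e).det ≠ 0 := by
  rw [← discr_eq hint]
  exact_mod_cast (isDiscr_discr hsymm hpos hdim hint e).1.ne'

include hsymm hpos hdim hint in
-- `N_L A⁻¹` is an integral matrix with determinant `N_L³/d_L`.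
theorem discr_dvd_level_pow : discr B e ∣ (level B e : ℤ) ^ 3 := by
  obtain ⟨-, h⟩ := level_spec hsymm hpos hdim hint e
  choose C hC using h
  have h1 : (level B e : ℚ) • (gram B e)⁻¹ = (Matrix.of C).map (Int.cast : ℤ → ℚ) := by
    ext i j; exact hC i j
  have h2 : (level B e : ℚ) ^ 3 * (gram B e).det⁻¹ = (((Matrix.of C).det : ℤ) : ℚ) := by
    rw [Int.cast_det]
    change _ = ((Matrix.of C).map (Int.cast : ℤ → ℚ)).det
    rw [← h1, Matrix.det_smul, Fintype.card_fin, Matrix.det_nonsing_inv, Ring.inverse_eq_inv']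
  have hne := det_gram_ne_zero hsymm hpos hdim hint e
  rw [← div_eq_mul_inv, div_eq_iff hne, ← discr_eq hint] at h2
  refine ⟨(Matrix.of C).det, ?_⟩
  rw [mul_comm]
  exact_mod_cast h2

include hsymm hpos hdim hint in
-- The coordinates of a vector of the dual lattice are an integral row vector times `A⁻¹`, and `N_L`
-- clears the denominators of `A⁻¹`.
theorem isIntegralOfLevel (hL : IsLattice L) : IsIntegralOfLevel B (level B e) L where
  lattice := hL
  integral := hint
  dual x hx := by
    obtain ⟨-, h⟩ := level_spec hsymm hpos hdim hint e
    choose C hC using h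
    obtain ⟨b, hb⟩ := exists_basis_of_lattice hdim e
    choose m hm using fun j => hx (e j) (e j).2
    have hdet := det_gram_ne_zero hsymm hpos hdim hint e
    have h1 : Matrix.vecMul (fun i => b.repr x i) (gram B e) = fun j => (m j : ℚ) := by
      ext j
      rw [Matrix.vecMul, dotProduct, ← hm]
      conv_rhs => rw [← b.sum_repr x]
      rw [map_sum, LinearMap.sum_apply]
      refine Finset.sum_congr rfl fun i _ => ?_
      simp only [gram, Matrix.of_apply, map_smul, LinearMap.smul_apply, smul_eq_mul, hb]
    have h2 : (fun i => b.repr x i) = Matrix.vecMul (fun j => (m j : ℚ)) (gram B e)⁻¹ := by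
      rw [← h1, Matrix.vecMul_vecMul, Matrix.mul_nonsing_inv _ hdet.isUnit, Matrix.vecMul_one]
    have h3 : level B e • x = ∑ i, (∑ j, m j * C j i) • (e i : V) := by
      conv_lhs => rw [← b.sum_repr x]
      rw [Finset.smul_sum]
      refine Finset.sum_congr rfl fun i _ => ?_
      have := congrFun h2 i
      rw [this, ← Nat.cast_smul_eq_nsmul ℚ, smul_smul, ← Int.cast_smul_eq_zsmul ℚ, hb, Matrix.vecMul, dotProduct]
      congr 1
      rw [Finset.mul_sum]
      push_cast
      refine Finset.sum_congr rfl fun j _ => ?_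
      rw [← hC]; ring
    rw [h3]
    exact sum_mem fun i _ => zsmul_mem (e i).2 _

end

section

/-! ## Lattices and their localizations -/

variable {V : Type*} [AddCommGroup V] [Module ℚ V]

theorem eq_sum_repr {W ι : Type*} [AddCommGroup W] [Fintype ι] {K : Submodule ℤ W} (e : Module.Basis ι ℤ K)
    {x : W} (hx : x ∈ K) : x = ∑ i, e.repr ⟨x, hx⟩ i • (e i : W) := by
  have := congrArg Subtype.val (e.sum_repr ⟨x, hx⟩)
  rw [Submodule.coe_sum] at this
  exact this.symm

theorem IsLattice.exists_basis (hdim : Module.finrank ℚ V = 3) {K : Submodule ℤ V} (hK : IsLattice K) :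
    Nonempty (Module.Basis (Fin 3) ℤ K) := by
  have : Module.Finite ℤ K := Module.Finite.iff_fg.2 hK.1
  have htf : Module.IsTorsionFree ℤ V := by
    have : CharZero ℚ := inferInstance
    exact Module.IsTorsionFree.trans ℚ
  have : Module.IsTorsionFree ℤ K := inferInstance
  have : Module.Free ℤ K := inferInstance
  let e := Module.Free.chooseBasis ℤ K
  have h1 : LinearIndependent ℤ fun i => (e i : V) :=
    e.linearIndependent.map' K.subtype (LinearMap.ker_eq_bot.2 K.injective_subtype)
  have h2 : LinearIndependent ℚ fun i => (e i : V) := (LinearIndependent.iff_fractionRing ℤ ℚ).1 h1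
  have h3 : ⊤ ≤ Submodule.span ℚ (Set.range fun i => (e i : V)) := by
    rw [← hK.2, Submodule.span_le]
    intro x hx
    rw [eq_sum_repr e hx]
    refine sum_mem fun i _ => ?_
    rw [← Int.cast_smul_eq_zsmul ℚ]
    exact Submodule.smul_mem _ _ (Submodule.subset_span ⟨i, rfl⟩)
  have hc := Module.finrank_eq_card_basis (Module.Basis.mk h2 h3)
  rw [hdim] at hc
  exact ⟨e.reindex (Fintype.equivFinOfCardEq hc.symm)⟩

section Local

variable (p : ℕ) [Fact p.Prime]

theorem padic_norm_rat_le_one_iff {r : ℚ} : ‖(r : ℚ_[p])‖ ≤ 1 ↔ ¬ p ∣ r.den := by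
  refine ⟨fun h hd => ?_, Padic.norm_rat_le_one⟩
  have h1 : ((r.den : ℕ) : ℚ_[p]) * (r : ℚ_[p]) = ((r.num : ℤ) : ℚ_[p]) := by
    exact_mod_cast congrArg (Rat.cast : ℚ → ℚ_[p]) (Rat.den_mul_eq_num r)
  have h2 : ‖((r.den : ℕ) : ℚ_[p])‖ < 1 := Padic.norm_natCast_lt_one_iff.2 hd
  have h3 : ‖((r.num : ℤ) : ℚ_[p])‖ < 1 := by
    rw [← h1, norm_mul]
    calc _ ≤ ‖((r.den : ℕ) : ℚ_[p])‖ * 1 := mul_le_mul_of_nonneg_left h (norm_nonneg _)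
      _ < 1 := by rwa [mul_one]
  have h4 := Padic.norm_intCast_lt_one_iff.1 h3
  have h5 : p ∣ r.num.natAbs := Int.natCast_dvd.1 h4
  have := Nat.dvd_gcd h5 hd
  rw [r.reduced] at this
  exact (Fact.out : p.Prime).one_lt.ne' (Nat.dvd_one.1 this)

theorem mem_localLattice_iff {K : Submodule ℤ V} (e : Module.Basis (Fin 3) ℤ K) {b : Module.Basis (Fin 3) ℚ V}
    (hb : ∀ i, b i = e i) (y : ℚ_[p] ⊗[ℚ] V) :
    y ∈ localLattice p K ↔ ∀ i, ‖(b.baseChange ℚ_[p]).repr y i‖ ≤ 1 := by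
  have hcoe : ∀ (c : ℤ_[p]) (z : ℚ_[p] ⊗[ℚ] V), c • z = (c : ℚ_[p]) • z := fun c z =>
    (algebraMap_smul ℚ_[p] c z).symm
  constructor
  · intro hy
    induction hy using Submodule.span_induction with
    | mem y hy =>
      obtain ⟨x, hx, rfl⟩ := hy
      intro i
      have hr : ∃ z : ℤ, b.repr x i = z := by
        refine ⟨e.repr ⟨x, hx⟩ i, ?_⟩
        have hx' : x = ∑ i, ((e.repr ⟨x, hx⟩ i : ℤ) : ℚ) • b i := by
          simpa only [hb, Int.cast_smul_eq_zsmul] using eq_sum_repr e hx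
        conv_lhs => rw [hx']
        rw [b.repr_sum_self]
      obtain ⟨z, hz⟩ := hr
      rw [Module.Basis.baseChange_repr_tmul, hz]
      simpa [Algebra.smul_def] using Padic.norm_int_le_one z
    | zero => simp
    | add x y _ _ hx hy =>
      intro i
      rw [map_add, Finsupp.add_apply]
      exact (Padic.nonarchimedean _ _).trans (max_le (hx i) (hy i))
    | smul c x _ hx =>
      intro i
      rw [hcoe, map_smul, Finsupp.smul_apply, smul_eq_mul, norm_mul]
      exact mul_le_one₀ c.2 (norm_nonneg _) (hx i)
  · intro h
    rw [← (b.baseChange ℚ_[p]).sum_repr y]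
    refine sum_mem fun i _ => ?_
    obtain ⟨c, hc⟩ : ∃ c : ℤ_[p], (c : ℚ_[p]) = (b.baseChange ℚ_[p]).repr y i := ⟨⟨_, h i⟩, rfl⟩
    rw [← hc, ← hcoe]
    refine Submodule.smul_mem _ _ (Submodule.subset_span ⟨e i, (e i).2, ?_⟩)
    rw [Module.Basis.baseChange_apply, hb]

theorem tmul_mem_localLattice_iff (hdim : Module.finrank ℚ V = 3) {K : Submodule ℤ V} (hK : IsLattice K) (x : V) :
    (1 : ℚ_[p]) ⊗ₜ[ℚ] x ∈ localLattice p K ↔ ∃ m : ℕ, ¬ p ∣ m ∧ m • x ∈ K := by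
  have hp := (Fact.out : p.Prime)
  obtain ⟨e⟩ := hK.exists_basis hdim
  obtain ⟨b, hb⟩ := exists_basis_of_lattice hdim e
  rw [mem_localLattice_iff p e hb]
  have hr : ∀ i, (b.baseChange ℚ_[p]).repr ((1 : ℚ_[p]) ⊗ₜ[ℚ] x) i = ((b.repr x i : ℚ) : ℚ_[p]) := by
    intro i
    rw [Module.Basis.baseChange_repr_tmul, Algebra.smul_def, mul_one]; rfl
  simp only [hr, padic_norm_rat_le_one_iff]
  constructor
  · intro h
    refine ⟨∏ i, (b.repr x i).den, ?_, ?_⟩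
    · rw [hp.prime.dvd_finsetProd_iff]
      push Not
      exact fun i _ => h i
    · rw [show (∏ i, (b.repr x i).den) • x = (∏ i, (b.repr x i).den) • ∑ i, b.repr x i • b i by
        rw [b.sum_repr], Finset.smul_sum]
      refine sum_mem fun i _ => ?_
      obtain ⟨k, hk⟩ := Finset.dvd_prod_of_mem (fun i => (b.repr x i).den) (Finset.mem_univ i)
      have : (∏ i, (b.repr x i).den) • b.repr x i • b i = (k * (b.repr x i).num : ℤ) • (e i : V) := by
        rw [← Nat.cast_smul_eq_nsmul ℚ, ← Int.cast_smul_eq_zsmul ℚ, smul_smul, hk, hb]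
        congr 1
        push_cast
        rw [← Rat.den_mul_eq_num (b.repr x i)]; ring
      rw [this]
      exact zsmul_mem (e i).2 _
  · rintro ⟨m, hm, hmx⟩ i
    have h1 : (m : ℚ) * b.repr x i = (e.repr ⟨m • x, hmx⟩ i : ℤ) := by
      have hx' : m • x = ∑ i, ((e.repr ⟨m • x, hmx⟩ i : ℤ) : ℚ) • b i := by
        simpa only [hb, Int.cast_smul_eq_zsmul] using eq_sum_repr e hmx
      have := congrArg (fun v => b.repr v i) hx'
      simp only [b.repr_sum_self] at this
      rw [← this, map_nsmul, Finsupp.smul_apply, nsmul_eq_mul]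
    intro hd
    refine hm ?_
    have h2 : (b.repr x i).den ∣ m := by
      have h3 : (b.repr x i).num * m = (e.repr ⟨m • x, hmx⟩ i : ℤ) * (b.repr x i).den := by
        have := Rat.den_mul_eq_num (b.repr x i)
        have h4 : ((b.repr x i).num : ℚ) * m = (e.repr ⟨m • x, hmx⟩ i : ℤ) * (b.repr x i).den := by
          rw [← h1, ← this]; ring
        exact_mod_cast h4
      have h5 : ((b.repr x i).den : ℤ) ∣ (b.repr x i).num * m := ⟨_, h3.trans (mul_comm _ _)⟩
      have h6 : IsCoprime ((b.repr x i).den : ℤ) (b.repr x i).num := by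
        rw [Int.isCoprime_iff_gcd_eq_one, Int.gcd_comm]
        exact (b.repr x i).reduced
      exact Int.natCast_dvd_natCast.1 (h6.dvd_of_dvd_mul_left h5)
    exact hd.trans h2

end Local

/-- A vector that lies in all localizations of a lattice lies in the lattice. -/
theorem mem_of_forall_local (hdim : Module.finrank ℚ V = 3) {K : Submodule ℤ V} (hK : IsLattice K) {x : V}
    (h : ∀ (p : ℕ) [Fact p.Prime], (1 : ℚ_[p]) ⊗ₜ[ℚ] x ∈ localLattice p K) : x ∈ K := by
  obtain ⟨n, hn0, hn⟩ := hK.exists_nsmul_mem x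
  -- The ideal of all `c` with `cx ∈ K`. It is nonzero since `K` spans `V`, and no maximal ideal
  -- contains it: local membership at `p` gives an element prime to `p`.
  let I : Ideal ℤ := { 
    carrier := {c | c • x ∈ K}
    add_mem' := fun ha hb => by
      simp only [Set.mem_ofPred_eq, add_smul] at *; exact add_mem ha hb
    zero_mem' := by simp
    smul_mem' := fun c y hy => by
      simp only [Set.mem_ofPred_eq, smul_eq_mul, mul_smul] at *; exact zsmul_mem hy c }
  have hI : I = ⊤ := by
    by_contra hI
    obtain ⟨P, hP, hIP⟩ := Ideal.exists_le_maximal I hI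
    obtain ⟨g, hg⟩ := (IsPrincipalIdealRing.principal P).principal
    have hgP : P = Ideal.span {g} := hg
    have hnP : (n : ℤ) ∈ P := hIP (by change (n : ℤ) • x ∈ K; rwa [natCast_zsmul])
    have hg0 : g ≠ 0 := by
      rintro rfl
      rw [hgP, Ideal.mem_span_singleton, zero_dvd_iff] at hnP
      exact hn0 (by exact_mod_cast hnP)
    have hgp : Prime g := (Ideal.span_singleton_prime hg0).1 (hgP ▸ hP.isPrime)
    have hpn : g.natAbs.Prime := Int.prime_iff_natAbs_prime.1 hgp
    have : Fact g.natAbs.Prime := ⟨hpn⟩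
    obtain ⟨m, hm, hmx⟩ := (tmul_mem_localLattice_iff g.natAbs hdim hK x).1 (h g.natAbs)
    have hmP : (m : ℤ) ∈ P := hIP (by change (m : ℤ) • x ∈ K; rwa [natCast_zsmul])
    rw [hgP, Ideal.mem_span_singleton, ← Int.natAbs_dvd_natAbs] at hmP
    exact hm (by simpa using hmP)
  have : (1 : ℤ) ∈ I := hI ▸ trivial
  simpa [I] using this

theorem rat_isInt_of_forall_local {r : ℚ} (h : ∀ (p : ℕ) [Fact p.Prime], ‖(r : ℚ_[p])‖ ≤ 1) :
    ∃ m : ℤ, r = m := by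
  refine ⟨r.num, ?_⟩
  have : r.den = 1 := by
    by_contra hne
    obtain ⟨p, hp, hd⟩ := Nat.exists_prime_and_dvd hne
    have : Fact p.Prime := ⟨hp⟩
    exact (padic_norm_rat_le_one_iff p).1 (h p) hd
  exact (Rat.den_eq_one_iff r).1 this |>.symm

end

section

/-! ## Cosets in a proper genus -/

variable {V : Type*} [AddCommGroup V] [Module ℚ V]

section Local

variable (p : ℕ) [Fact p.Prime]

theorem padicInt_smul_eq (c : ℤ_[p]) (z : ℚ_[p] ⊗[ℚ] V) : c • z = (c : ℚ_[p]) • z :=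
  (algebraMap_smul ℚ_[p] c z).symm

theorem mem_localLattice_of_nsmul {K : Submodule ℤ V} {m : ℤ} (hm : ¬ (p : ℤ) ∣ m) {y : ℚ_[p] ⊗[ℚ] V}
    (h : m • y ∈ localLattice p K) : y ∈ localLattice p K := by
  have hu : IsUnit (m : ℤ_[p]) := by
    rw [PadicInt.isUnit_iff]
    refine le_antisymm (PadicInt.norm_le_one _) (not_lt.1 fun h => hm ?_)
    exact PadicInt.norm_int_lt_one_iff_dvd _ |>.1 h
  obtain ⟨v, hv⟩ := hu.exists_left_inv
  have : y = v • m • y := by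
    rw [← Int.cast_smul_eq_zsmul ℤ_[p], smul_smul, hv, one_smul]
  rw [this]
  exact Submodule.smul_mem _ _ h

theorem tmul_mem_localLattice {K : Submodule ℤ V} {x : V} (hx : x ∈ K) :
    (1 : ℚ_[p]) ⊗ₜ[ℚ] x ∈ localLattice p K := Submodule.subset_span ⟨x, hx, rfl⟩

theorem nsmul_right_injective_local {a : ℕ} (ha : a ≠ 0) {x y : ℚ_[p] ⊗[ℚ] V} (h : a • x = a • y) : x = y := by
  rw [← Nat.cast_smul_eq_nsmul ℚ_[p], ← Nat.cast_smul_eq_nsmul ℚ_[p]] at h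
  exact smul_right_injective _ (by exact_mod_cast ha : (a : ℚ_[p]) ≠ 0) h

/-- Differences of elements of the coset, divided by `a`, recover the lattice. This separates the
condition on the lattice from a congruence for one vector. -/
theorem image_localCoset_iff {a : ℕ} (ha : a ≠ 0) {L K : Submodule ℤ V} {ν μ : V}
    (s : (ℚ_[p] ⊗[ℚ] V) ≃ₗ[ℚ_[p]] (ℚ_[p] ⊗[ℚ] V)) :
    s '' localCoset p a L ν = localCoset p a K μ ↔
      (s '' (localLattice p L : Set (ℚ_[p] ⊗[ℚ] V)) = localLattice p K ∧
        ∃ k ∈ localLattice p K, s ((1 : ℚ_[p]) ⊗ₜ[ℚ] ν) = a • k + (1 : ℚ_[p]) ⊗ₜ[ℚ] μ) := by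
  constructor
  · intro h
    obtain ⟨k, hk, hν⟩ : s ((1 : ℚ_[p]) ⊗ₜ[ℚ] ν) ∈ localCoset p a K μ := by
      rw [← h]
      exact ⟨_, ⟨0, zero_mem _, by simp⟩, rfl⟩
    refine ⟨?_, k, hk, hν⟩
    ext z
    constructor
    · rintro ⟨y, hy, rfl⟩
      obtain ⟨k', hk', h'⟩ : s (a • y + (1 : ℚ_[p]) ⊗ₜ[ℚ] ν) ∈ localCoset p a K μ := by
        rw [← h]
        exact ⟨_, ⟨y, hy, rfl⟩, rfl⟩
      have : s y = k' - k := by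
        apply nsmul_right_injective_local p ha
        rw [map_add, hν, map_nsmul] at h'
        rw [smul_sub, eq_sub_iff_add_eq]
        apply add_right_cancel (b := (1 : ℚ_[p]) ⊗ₜ[ℚ] μ)
        rw [add_assoc, h']
      rw [this]
      exact sub_mem hk' hk
    · intro hz
      have hmem : a • (z + k) + (1 : ℚ_[p]) ⊗ₜ[ℚ] μ ∈ localCoset p a K μ := ⟨_, add_mem hz hk, rfl⟩
      rw [← h] at hmem
      obtain ⟨_, ⟨y, hy, rfl⟩, h'⟩ := hmem
      refine ⟨y, hy, nsmul_right_injective_local p ha ?_⟩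
      rw [map_add, hν, map_nsmul, smul_add, add_assoc] at h'
      exact add_right_cancel h'
  · rintro ⟨h, k, hk, hν⟩
    have hmem : ∀ y, y ∈ localLattice p L → s y ∈ localLattice p K := fun y hy => by
      rw [← SetLike.mem_coe, ← h]; exact ⟨y, hy, rfl⟩
    ext z
    constructor
    · rintro ⟨_, ⟨y, hy, rfl⟩, rfl⟩
      refine ⟨s y + k, add_mem (hmem y hy) hk, ?_⟩
      rw [map_add, map_nsmul, hν, smul_add, add_assoc]
    · rintro ⟨k', hk', rfl⟩
      have h1 : k' - k ∈ (localLattice p K : Set (ℚ_[p] ⊗[ℚ] V)) := sub_mem hk' hk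
      rw [← h] at h1
      obtain ⟨y, hy, hyk⟩ := h1
      refine ⟨_, ⟨y, hy, rfl⟩, ?_⟩
      rw [map_add, map_nsmul, hν, hyk, smul_sub]
      abel

theorem norm_form_le_of_forall {B : LinearMap.BilinForm ℚ V} {K : Submodule ℤ V} {y : ℚ_[p] ⊗[ℚ] V}
    (h : ∀ x ∈ K, ‖B.baseChange ℚ_[p] y ((1 : ℚ_[p]) ⊗ₜ[ℚ] x)‖ ≤ 1) {z : ℚ_[p] ⊗[ℚ] V}
    (hz : z ∈ localLattice p K) : ‖B.baseChange ℚ_[p] y z‖ ≤ 1 := by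
  induction hz using Submodule.span_induction with
  | mem z hz => obtain ⟨x, hx, rfl⟩ := hz; exact h x hx
  | zero => simp
  | add x z _ _ hx hz =>
    rw [map_add]
    exact (Padic.nonarchimedean _ _).trans (max_le hx hz)
  | smul c x _ hx =>
    rw [padicInt_smul_eq, map_smul, smul_eq_mul, norm_mul]
    exact mul_le_one₀ c.2 (norm_nonneg _) hx

theorem baseChange_isSymm {B : LinearMap.BilinForm ℚ V} (hsymm : B.IsSymm) :
    (B.baseChange ℚ_[p]).IsSymm :=
  LinearMap.BilinForm.isSymm_iff.2
    (LinearMap.BilinForm.IsSymm.baseChange ℚ_[p] (LinearMap.BilinForm.isSymm_iff.1 hsymm))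

theorem baseChange_one_tmul (B : LinearMap.BilinForm ℚ V) (x y : V) :
    B.baseChange ℚ_[p] ((1 : ℚ_[p]) ⊗ₜ[ℚ] x) ((1 : ℚ_[p]) ⊗ₜ[ℚ] y) = ((B x y : ℚ) : ℚ_[p]) := by
  rw [LinearMap.BilinForm.baseChange_tmul, mul_one, Algebra.smul_def, mul_one]; rfl

theorem norm_form_le {B : LinearMap.BilinForm ℚ V} (hsymm : B.IsSymm) {L : Submodule ℤ V}
    (hint : ∀ x ∈ L, ∀ y ∈ L, ∃ m : ℤ, B x y = m) {y z : ℚ_[p] ⊗[ℚ] V} (hy : y ∈ localLattice p L)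
    (hz : z ∈ localLattice p L) : ‖B.baseChange ℚ_[p] y z‖ ≤ 1 := by
  refine norm_form_le_of_forall p (fun x hx => ?_) hz
  rw [(baseChange_isSymm p hsymm).eq]
  refine norm_form_le_of_forall p (fun w hw => ?_) hy
  obtain ⟨m, hm⟩ := hint x hx w hw
  rw [baseChange_one_tmul, hm]
  simpa using Padic.norm_int_le_one m

theorem nondegenerate_of_pos {B : LinearMap.BilinForm ℚ V}
    (hpos : ∀ x : V, x ≠ 0 → 0 < B x x) : B.Nondegenerate := by
  constructor
  · intro x h
    by_contra hx
    exact (hpos x hx).ne' (h x)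
  · intro x h
    by_contra hx
    exact (hpos x hx).ne' (h x)

/-- In the basis dual to a basis of `L` the coordinates of `y` are its products with `L`, hence
`p`-adic integers, and `M` carries the dual basis into `L`. -/
theorem nsmul_mem_localLattice_of_dual {B : LinearMap.BilinForm ℚ V}
    (hpos : ∀ x : V, x ≠ 0 → 0 < B x x) (hdim : Module.finrank ℚ V = 3) {L : Submodule ℤ V} {M : ℕ}
    (hL : IsIntegralOfLevel B M L) {y : ℚ_[p] ⊗[ℚ] V}
    (h : ∀ x ∈ L, ‖B.baseChange ℚ_[p] y ((1 : ℚ_[p]) ⊗ₜ[ℚ] x)‖ ≤ 1) : M • y ∈ localLattice p L := by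
  obtain ⟨e⟩ := hL.lattice.exists_basis hdim
  obtain ⟨b, hb⟩ := exists_basis_of_lattice hdim e
  have hnd := nondegenerate_of_pos hpos
  set b' := B.dualBasis hnd b
  have hx : ∀ x : V, x = ∑ i, B x (b i) • b' i := fun x => by
    conv_lhs => rw [← b'.sum_repr x]
    simp only [b', LinearMap.BilinForm.dualBasis_repr_apply]
  have hy : ∀ y, y = ∑ i, B.baseChange ℚ_[p] y ((1 : ℚ_[p]) ⊗ₜ[ℚ] b i) • ((1 : ℚ_[p]) ⊗ₜ[ℚ] b' i) := by
    intro y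
    induction y using TensorProduct.induction_on with
    | zero => simp
    | tmul c x =>
      conv_lhs => rw [hx x, TensorProduct.tmul_sum]
      refine Finset.sum_congr rfl fun i _ => ?_
      rw [LinearMap.BilinForm.baseChange_tmul, TensorProduct.tmul_smul, TensorProduct.smul_tmul',
        TensorProduct.smul_tmul', smul_eq_mul, mul_one, mul_one]
    | add x z hx hz =>
      conv_lhs => rw [hx, hz]
      rw [← Finset.sum_add_distrib]
      refine Finset.sum_congr rfl fun i _ => ?_
      rw [map_add, LinearMap.add_apply, add_smul]
  have hMb : ∀ i, M • b' i ∈ L := fun i => hL.dual _ fun x hx => by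
    refine ⟨e.repr ⟨x, hx⟩ i, ?_⟩
    conv_lhs => rw [eq_sum_repr e hx]
    rw [map_sum, Finset.sum_eq_single i]
    · rw [map_zsmul, ← hb, LinearMap.BilinForm.apply_dualBasis_left, if_pos rfl]; simp
    · intro j _ hj
      rw [map_zsmul, ← hb, LinearMap.BilinForm.apply_dualBasis_left, if_neg hj, smul_zero]
    · simp
  rw [hy y, Finset.smul_sum]
  refine sum_mem fun i _ => ?_
  obtain ⟨c, hc⟩ : ∃ c : ℤ_[p], (c : ℚ_[p]) = B.baseChange ℚ_[p] y ((1 : ℚ_[p]) ⊗ₜ[ℚ] b i) :=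
    ⟨⟨_, h (b i) (hb i ▸ (e i).2)⟩, rfl⟩
  rw [← hc, ← padicInt_smul_eq, smul_comm]
  have : M • ((1 : ℚ_[p]) ⊗ₜ[ℚ] b' i) = (1 : ℚ_[p]) ⊗ₜ[ℚ] (M • b' i) := (TensorProduct.tmul_smul _ _ _).symm
  rw [this]
  exact Submodule.smul_mem _ _ (tmul_mem_localLattice p (hMb i))

/-- `u` is invertible in `ℤ_p`, so a map which is integral up to the factor `u` in both directions
is an isomorphism of the localizations. -/
theorem image_localLattice_of_nsmul {K K' : Submodule ℤ V} {ρ : V ≃ₗ[ℚ] V} {u : ℤ} (hu : ¬ (p : ℤ) ∣ u)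
    (h : ∀ x ∈ K, u • ρ x ∈ K') (h' : ∀ x ∈ K', u • ρ.symm x ∈ K) :
    ρ.baseChange ℚ ℚ_[p] V V '' (localLattice p K : Set (ℚ_[p] ⊗[ℚ] V)) = localLattice p K' := by
  have aux : ∀ {K K' : Submodule ℤ V} {ρ : V ≃ₗ[ℚ] V}, (∀ x ∈ K, u • ρ x ∈ K') → ∀ y ∈ localLattice p K,
      ρ.baseChange ℚ ℚ_[p] V V y ∈ localLattice p K' := by
    intro K K' ρ h y hy
    induction hy using Submodule.span_induction with
    | mem y hy =>
      obtain ⟨x, hx, rfl⟩ := hy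
      apply mem_localLattice_of_nsmul p hu
      have : u • ρ.baseChange ℚ ℚ_[p] V V ((1 : ℚ_[p]) ⊗ₜ[ℚ] x) = (1 : ℚ_[p]) ⊗ₜ[ℚ] (u • ρ x) := by
        rw [LinearEquiv.baseChange_tmul, TensorProduct.tmul_smul]
      rw [this]
      exact tmul_mem_localLattice p (h x hx)
    | zero => simp
    | add x z _ _ hx hz => rw [map_add]; exact add_mem hx hz
    | smul c x _ hx =>
      rw [padicInt_smul_eq, map_smul, ← padicInt_smul_eq]
      exact Submodule.smul_mem _ _ hx
  ext z
  constructor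
  · rintro ⟨y, hy, rfl⟩
    exact aux h y hy
  · intro hz
    refine ⟨_, aux (ρ := ρ.symm) h' z hz, ?_⟩
    have : ρ.symm.baseChange ℚ ℚ_[p] V V = (ρ.baseChange ℚ ℚ_[p] V V).symm := rfl
    rw [this]
    exact LinearEquiv.apply_symm_apply _ _

theorem baseChange_mem_rotationGroup {B : LinearMap.BilinForm ℚ V} (hdim : Module.finrank ℚ V = 3)
    {ρ : V ≃ₗ[ℚ] V} (h : ρ ∈ rotationGroup B) :
    ρ.baseChange ℚ ℚ_[p] V V ∈ rotationGroup (B.baseChange ℚ_[p]) := by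
  have : FiniteDimensional ℚ V := Module.finite_of_finrank_pos (by omega)
  constructor
  · intro x y
    induction x using TensorProduct.induction_on with
    | zero => simp
    | add x z hx hz => simp only [map_add, LinearMap.add_apply, hx, hz]
    | tmul c x =>
      induction y using TensorProduct.induction_on with
      | zero => simp
      | add y z hy hz => simp only [map_add, hy, hz]
      | tmul d y =>
        rw [LinearEquiv.baseChange_tmul, LinearEquiv.baseChange_tmul, LinearMap.BilinForm.baseChange_tmul,
          LinearMap.BilinForm.baseChange_tmul, h.1]
  · have h1 : ((ρ.baseChange ℚ ℚ_[p] V V : (ℚ_[p] ⊗[ℚ] V) ≃ₗ[ℚ_[p]] _) : (ℚ_[p] ⊗[ℚ] V) →ₗ[ℚ_[p]] _) =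
      (ρ : V →ₗ[ℚ] V).baseChange ℚ_[p] := rfl
    rw [h1, LinearMap.det_baseChange, h.2, map_one]

end Local

theorem latticeCoset_injective {a : ℕ} (ha : a ≠ 0) {K K' : Submodule ℤ V} {μ μ' : V}
    (h : latticeCoset a K μ = latticeCoset a K' μ') : K = K' ∧ ∃ k ∈ K, μ' - μ = a • k := by
  have hinj : ∀ {x y : V}, a • x = a • y → x = y := fun {x y} hxy => by
    rw [← Nat.cast_smul_eq_nsmul ℚ, ← Nat.cast_smul_eq_nsmul ℚ] at hxy
    exact smul_right_injective _ (by exact_mod_cast ha : (a : ℚ) ≠ 0) hxy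
  have aux : ∀ {K K' : Submodule ℤ V} {μ μ' : V}, latticeCoset a K μ = latticeCoset a K' μ' →
      (∃ k ∈ K', μ - μ' = a • k) ∧ K ≤ K' := by
    intro K K' μ μ' h
    obtain ⟨k, hk, hμ⟩ : μ ∈ latticeCoset a K' μ' := h ▸ ⟨0, zero_mem _, by simp⟩
    refine ⟨⟨k, hk, by rw [hμ, add_sub_cancel_right]⟩, fun x hx => ?_⟩
    obtain ⟨y, hy, hxy⟩ : a • x + μ ∈ latticeCoset a K' μ' := h ▸ ⟨x, hx, rfl⟩
    have : x = y - k := hinj (by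
      rw [smul_sub, eq_sub_iff_add_eq]
      apply add_right_cancel (b := μ')
      rw [add_assoc, ← hμ, hxy])
    rw [this]
    exact sub_mem hy hk
  exact ⟨le_antisymm (aux h).2 (aux h.symm).2, (aux h.symm).1⟩

variable {B : LinearMap.BilinForm ℚ V} (hsymm : B.IsSymm) (hpos : ∀ x : V, x ≠ 0 → 0 < B x x)
    (hdim : Module.finrank ℚ V = 3)

/-- `s` maps the local coset `aL_q + ν` onto `aK_q + μ`. -/
def LocalMap (q : ℕ) [Fact q.Prime] (a : ℕ) (L : Submodule ℤ V) (ν : V) (K : Submodule ℤ V) (μ : V)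
    (s : (ℚ_[q] ⊗[ℚ] V) ≃ₗ[ℚ_[q]] (ℚ_[q] ⊗[ℚ] V)) : Prop :=
  s '' (localLattice q L : Set (ℚ_[q] ⊗[ℚ] V)) = localLattice q K ∧
        ∃ k ∈ localLattice q K, s ((1 : ℚ_[q]) ⊗ₜ[ℚ] ν) = a • k + (1 : ℚ_[q]) ⊗ₜ[ℚ] μ

include hsymm hpos hdim in
-- Integrality and level can be tested at each prime, and local rotations preserve the form; so all
-- lattices in the genus share them.
theorem isIntegralOfLevel_of_local {L : Submodule ℤ V} {M : ℕ} (hL : IsIntegralOfLevel B M L)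
    {K : Submodule ℤ V} (hK : IsLattice K) (σ : AdelicRotation B L)
    (hσ : ∀ (q : ℕ) [Fact q.Prime], (σ.comp q).1 '' (localLattice q L : Set (ℚ_[q] ⊗[ℚ] V)) = localLattice q K) :
    IsIntegralOfLevel B M K where
  lattice := hK
  integral x hx y hy := by
    refine rat_isInt_of_forall_local fun q _ => ?_
    have hx' : (1 : ℚ_[q]) ⊗ₜ[ℚ] x ∈ (localLattice q K : Set (ℚ_[q] ⊗[ℚ] V)) := tmul_mem_localLattice q hx
    have hy' : (1 : ℚ_[q]) ⊗ₜ[ℚ] y ∈ (localLattice q K : Set (ℚ_[q] ⊗[ℚ] V)) := tmul_mem_localLattice q hy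
    rw [← hσ q] at hx' hy'
    obtain ⟨x', hx', hxx⟩ := hx'
    obtain ⟨y', hy', hyy⟩ := hy'
    rw [← baseChange_one_tmul, ← hxx, ← hyy, (σ.comp q).2.1]
    exact norm_form_le q hsymm hL.integral hx' hy'
  dual x hx := by
    refine mem_of_forall_local hdim hK fun q _ => ?_
    have h1 : M • (σ.comp q).1.symm ((1 : ℚ_[q]) ⊗ₜ[ℚ] x) ∈ localLattice q L := by
      refine nsmul_mem_localLattice_of_dual q hpos hdim hL fun l hl => ?_
      rw [← (σ.comp q).2.1, LinearEquiv.apply_symm_apply]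
      refine norm_form_le_of_forall q (K := K) (fun y hy => ?_) ?_
      · obtain ⟨m, hm⟩ := hx y hy
        rw [baseChange_one_tmul, hm]
        simpa using Padic.norm_int_le_one m
      · rw [← SetLike.mem_coe, ← hσ q]
        exact ⟨_, tmul_mem_localLattice q hl, rfl⟩
    have h2 : (σ.comp q).1 (M • (σ.comp q).1.symm ((1 : ℚ_[q]) ⊗ₜ[ℚ] x)) ∈
        (localLattice q K : Set (ℚ_[q] ⊗[ℚ] V)) := by
      rw [← hσ q]; exact ⟨_, h1, rfl⟩
    rw [map_nsmul, LinearEquiv.apply_symm_apply] at h2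
    rwa [TensorProduct.tmul_smul]

include hsymm hpos hdim in
theorem exists_of_mem_properGenus {L : Submodule ℤ V} {M : ℕ} (hL : IsIntegralOfLevel B M L) {a : ℕ}
    (ha : a ≠ 0) {ν : V} (hν : ν ∈ L) {X : Set V} (hX : X ∈ properGenus B a L ν) :
    ∃ (K : Submodule ℤ V) (μ : V), IsIntegralOfLevel B M K ∧ μ ∈ K ∧ X = latticeCoset a K μ ∧
      ∃ σ : AdelicRotation B L, ∀ (q : ℕ) [Fact q.Prime], LocalMap q a L ν K μ (σ.comp q).1 := by
  obtain ⟨K, μ, hK, rfl, σ, hσ⟩ := hX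
  have hσ' : ∀ (q : ℕ) [Fact q.Prime], LocalMap q a L ν K μ (σ.comp q).1 := fun q _ =>
    (image_localCoset_iff q ha _).1 (hσ q)
  refine ⟨K, μ, isIntegralOfLevel_of_local hsymm hpos hdim hL hK σ fun q _ => (hσ' q).1, ?_, rfl, σ, hσ'⟩
  refine mem_of_forall_local hdim hK fun q _ => ?_
  obtain ⟨h1, k, hk, h2⟩ := hσ' q
  have h3 : (σ.comp q).1 ((1 : ℚ_[q]) ⊗ₜ[ℚ] ν) ∈ localLattice q K := by
    rw [← SetLike.mem_coe, ← h1]; exact ⟨_, tmul_mem_localLattice q hν, rfl⟩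
  rw [h2] at h3
  have := sub_mem h3 (nsmul_mem hk a)
  rwa [add_sub_cancel_left] at this

theorem latticeCoset_mem_properGenus {L : Submodule ℤ V} {a : ℕ} (ha : a ≠ 0) {ν : V} {K : Submodule ℤ V} {μ : V}
    (hK : IsLattice K) (σ : AdelicRotation B L) (hσ : ∀ (q : ℕ) [Fact q.Prime], LocalMap q a L ν K μ (σ.comp q).1) :
    latticeCoset a K μ ∈ properGenus B a L ν :=
  ⟨K, μ, hK, rfl, σ, fun q _ => (image_localCoset_iff q ha _).2 (hσ q)⟩

end

section

/-! ## Neighbors -/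

variable {V : Type*} [AddCommGroup V] [Module ℚ V]

/-- The sublattice of `K` of vectors orthogonal to `w` modulo `p`. -/
def perpLattice (B : LinearMap.BilinForm ℚ V) (p : ℕ) (K : Submodule ℤ V) (w : V) : Submodule ℤ V where
  carrier := {x | x ∈ K ∧ ∃ m : ℤ, B x w = p * m}
  add_mem' := by
    rintro x y ⟨hx, m, hm⟩ ⟨hy, n, hn⟩
    exact ⟨add_mem hx hy, m + n, by rw [map_add, LinearMap.add_apply, hm, hn]; push_cast; ring⟩
  zero_mem' := ⟨zero_mem _, 0, by simp⟩
  smul_mem' := by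
    rintro c x ⟨hx, m, hm⟩
    exact ⟨zsmul_mem hx c, c * m, by
      rw [map_zsmul, LinearMap.smul_apply, hm, zsmul_eq_mul]; push_cast; ring⟩

/-- The `p`-neighbor of `K` at `w`. -/
def neighbor (B : LinearMap.BilinForm ℚ V) (p : ℕ) (K : Submodule ℤ V) (w : V) : Submodule ℤ V :=
  perpLattice B p K w ⊔ Submodule.span ℤ {(p : ℚ)⁻¹ • w}

/-- `w` is a primitive vector of `K` modulo `p` with `Q(w)` divisible by `p²`. -/
structure IsNeighborVector (B : LinearMap.BilinForm ℚ V) (p : ℕ) (K : Submodule ℤ V) (w : V) : Prop where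
  mem : w ∈ K
  prim : ∀ y ∈ K, w ≠ p • y
  isotropic : ∃ k : ℤ, B w w = p ^ 2 * k

/-- `K` and `K'` are `p`-neighbors. -/
def IsNeighbor (B : LinearMap.BilinForm ℚ V) (p : ℕ) (K K' : Submodule ℤ V) : Prop :=
  ∃ w, IsNeighborVector B p K w ∧ K' = neighbor B p K w

theorem mem_neighbor {B : LinearMap.BilinForm ℚ V} {p : ℕ} {K : Submodule ℤ V} {w x : V} :
    x ∈ neighbor B p K w ↔ ∃ y ∈ perpLattice B p K w, ∃ c : ℤ, x = y + c • (p : ℚ)⁻¹ • w := by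
  rw [neighbor, Submodule.mem_sup]
  constructor
  · rintro ⟨y, hy, z, hz, rfl⟩
    obtain ⟨c, rfl⟩ := Submodule.mem_span_singleton.1 hz
    exact ⟨y, hy, c, rfl⟩
  · rintro ⟨y, hy, c, rfl⟩
    exact ⟨y, hy, _, Submodule.mem_span_singleton.2 ⟨c, rfl⟩, rfl⟩

section

variable {B : LinearMap.BilinForm ℚ V} (hsymm : B.IsSymm) (hpos : ∀ x : V, x ≠ 0 → 0 < B x x)
    (hdim : Module.finrank ℚ V = 3) {M : ℕ} {K : Submodule ℤ V} (hK : IsIntegralOfLevel B M K)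
    {p : ℕ} (hp : p.Prime) (hpM : ¬ p ∣ M) (hp2 : p ≠ 2)

include hp in
theorem nsmul_inv_smul (x : V) : p • (p : ℚ)⁻¹ • x = x := by
  have : (p : ℚ) ≠ 0 := by exact_mod_cast hp.ne_zero
  rw [← Nat.cast_smul_eq_nsmul ℚ, smul_smul, mul_inv_cancel₀ this, one_smul]

include hp in
theorem inv_smul_nsmul (x : V) : (p : ℚ)⁻¹ • p • x = x := by
  have : (p : ℚ) ≠ 0 := by exact_mod_cast hp.ne_zero
  rw [← Nat.cast_smul_eq_nsmul ℚ, smul_smul, inv_mul_cancel₀ this, one_smul]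

include hK hp hpM in
-- `K` is unimodular at `p`: otherwise `w/p` would lie in the dual lattice, so `M(w/p) ∈ K`, and as
-- `M` is prime to `p` even `w/p ∈ K`.
theorem exists_not_dvd_form {w : V} (hw : w ∈ K) (hprim : ∀ y ∈ K, w ≠ p • y) :
    ∃ y ∈ K, ∃ m : ℤ, B w y = m ∧ ¬ (p : ℤ) ∣ m := by
  by_contra! hcon
  have hpQ : (p : ℚ) ≠ 0 := by exact_mod_cast hp.ne_zero
  have h1 : M • (p : ℚ)⁻¹ • w ∈ K := hK.dual _ fun y hy => by
    obtain ⟨m, hm⟩ := hK.integral w hw y hy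
    obtain ⟨k, rfl⟩ := hcon y hy m hm
    exact ⟨k, by rw [map_smul, LinearMap.smul_apply, hm, smul_eq_mul]; push_cast; field_simp⟩
  obtain ⟨s, t, hst⟩ : IsCoprime (M : ℤ) (p : ℤ) :=
    (Nat.isCoprime_iff_coprime.2 (hp.coprime_iff_not_dvd.2 hpM)).symm
  refine hprim (s • M • (p : ℚ)⁻¹ • w + t • w) (add_mem (zsmul_mem h1 s) (zsmul_mem hw t)) ?_
  rw [smul_add, smul_comm p s, smul_comm p M, nsmul_inv_smul hp, ← natCast_zsmul w M, ← natCast_zsmul (t • w) p,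
    smul_smul, smul_smul, ← add_smul, mul_comm (p : ℤ) t, hst, one_smul]

include hK in
theorem nsmul_mem_perpLattice {w : V} (hw : w ∈ K) {x : V} (hx : x ∈ K) : p • x ∈ perpLattice B p K w := by
  obtain ⟨m, hm⟩ := hK.integral x hx w hw
  exact ⟨nsmul_mem hx p, m, by rw [map_nsmul, LinearMap.smul_apply, hm, nsmul_eq_mul]⟩

theorem perpLattice_le_neighbor {w : V} : perpLattice B p K w ≤ neighbor B p K w := le_sup_left

theorem inv_smul_mem_neighbor {w : V} : (p : ℚ)⁻¹ • w ∈ neighbor B p K w :=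
  mem_neighbor.2 ⟨0, zero_mem _, 1, by simp⟩

include hp in
theorem nsmul_mem_of_mem_neighbor {w : V} (hw : w ∈ K) {x : V} (hx : x ∈ neighbor B p K w) : p • x ∈ K := by
  obtain ⟨y, hy, c, rfl⟩ := mem_neighbor.1 hx
  rw [smul_add, smul_comm p c, nsmul_inv_smul hp]
  exact add_mem (nsmul_mem hy.1 p) (zsmul_mem hw c)

include hK hp in
theorem isLattice_neighbor {w : V} (hw : w ∈ K) : IsLattice (neighbor B p K w) := by
  constructor
  · refine Submodule.FG.sup (Submodule.FG.of_le hK.lattice.1 fun x hx => hx.1) (Submodule.fg_span_singleton _)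
  · rw [eq_top_iff, ← hK.lattice.2, Submodule.span_le]
    intro x hx
    have h := Submodule.subset_span (R := ℚ) (perpLattice_le_neighbor (nsmul_mem_perpLattice hK hw hx) : p • x ∈ neighbor B p K w)
    rw [← inv_smul_nsmul hp x]
    exact Submodule.smul_mem _ _ h

theorem isotropic_div {w : V} (hw : IsNeighborVector B p K w) : ∃ m : ℤ, B w w = p * m := by
  obtain ⟨k, hk⟩ := hw.isotropic
  exact ⟨p * k, by rw [hk]; push_cast; ring⟩

include hp in
-- Identifies the intersection of `K` with its neighbor: a multiple `c(w/p)` in `K` forces `p ∣ c`,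
-- because `w` is primitive.
theorem mem_perpLattice_of_mem {w : V} (hw : IsNeighborVector B p K w) {x : V} (hx : x ∈ K)
    (hx' : x ∈ neighbor B p K w) : x ∈ perpLattice B p K w := by
  obtain ⟨y, hy, c, rfl⟩ := mem_neighbor.1 hx'
  have h1 : c • (p : ℚ)⁻¹ • w ∈ K := by
    have := sub_mem hx hy.1
    rwa [add_sub_cancel_left] at this
  have hc : (p : ℤ) ∣ c := by
    by_contra hc
    obtain ⟨s, t, hst⟩ : IsCoprime c (p : ℤ) :=
      ((Nat.prime_iff_prime_int.1 hp).coprime_iff_not_dvd.2 hc).symm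
    refine hw.prim (s • c • (p : ℚ)⁻¹ • w + t • w) (add_mem (zsmul_mem h1 s) (zsmul_mem hw.mem t)) ?_
    rw [smul_add, smul_comm p s, smul_comm p c, nsmul_inv_smul hp, ← natCast_zsmul (t • w) p,
      smul_smul, smul_smul, ← add_smul, mul_comm (p : ℤ) t, hst, one_smul]
  obtain ⟨k, rfl⟩ := hc
  refine add_mem hy ?_
  rw [mul_comm, mul_smul, natCast_zsmul, nsmul_inv_smul hp]
  exact zsmul_mem (show w ∈ perpLattice B p K w from ⟨hw.mem, isotropic_div hw⟩) k

theorem form_add_self (hsymm : B.IsSymm) (x y : V) : B (x + y) (x + y) = B x x + 2 * B x y + B y y := by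
  simp only [map_add, LinearMap.add_apply]
  rw [hsymm.eq y x]; ring

theorem form_zsmul (x y : V) (m : ℤ) : B x (m • y) = m * B x y := by
  rw [map_zsmul, zsmul_eq_mul]

theorem form_zsmul_left (x y : V) (m : ℤ) : B (m • x) y = m * B x y := by
  rw [map_zsmul, LinearMap.smul_apply, zsmul_eq_mul]

include hsymm hK hp hp2 in
/-- Proportional isotropic vectors modulo `p` define the same neighbor. -/
theorem neighbor_le_of_eq_add {w w' z : V} (hw : IsNeighborVector B p K w) (hw' : IsNeighborVector B p K w')
    (hz : z ∈ K) {c : ℤ} (h : w = c • w' + p • z) : neighbor B p K w ≤ neighbor B p K w' := by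
  have hpQ : (p : ℚ) ≠ 0 := by exact_mod_cast hp.ne_zero
  have hpZ := Nat.prime_iff_prime_int.1 hp
  have hc : ¬ (p : ℤ) ∣ c := by
    rintro ⟨k, rfl⟩
    refine hw.prim (k • w' + z) (add_mem (zsmul_mem hw'.mem k) hz) ?_
    rw [h, smul_add, mul_smul, natCast_zsmul]
  -- Comparing `Q(w)` and `Q(cw' + pz)` modulo `p²` gives `p ∣ 2c B(z, w')`. Here divisibility by
  -- `p²`, and not only by `p`, is essential.
  have hzperp : z ∈ perpLattice B p K w' := by
    refine ⟨hz, ?_⟩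
    obtain ⟨m, hm⟩ := hK.integral z hz w' hw'.mem
    obtain ⟨k, hk⟩ := hw.isotropic
    obtain ⟨k', hk'⟩ := hw'.isotropic
    obtain ⟨q, hq⟩ := hK.integral z hz z hz
    rw [h, form_add_self hsymm, form_zsmul, form_zsmul_left, form_zsmul_left, ← natCast_zsmul, form_zsmul, form_zsmul,
      form_zsmul_left, hsymm.eq w' z, hk', hm, hq] at hk
    have h1 : (p : ℤ) * (2 * c * m) = p * (p * (k - c ^ 2 * k' - q)) := by
      have : ((p : ℤ) : ℚ) * (2 * c * m) = p * (p * (k - c ^ 2 * k' - q)) := by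
        push_cast at hk ⊢; linear_combination hk
      exact_mod_cast this
    have h2 : (p : ℤ) ∣ 2 * c * m := ⟨_, mul_left_cancel₀ hpZ.ne_zero h1⟩
    rcases hpZ.dvd_or_dvd h2 with h3 | ⟨j, hj⟩
    · rcases hpZ.dvd_or_dvd h3 with h4 | h4
      · have h5 : p ∣ 2 := by exact_mod_cast h4
        exact absurd ((Nat.prime_dvd_prime_iff_eq hp Nat.prime_two).1 h5) hp2
      · exact absurd h4 hc
    · exact ⟨j, by rw [hm, hj]; push_cast; rfl⟩
  refine sup_le (fun x hx => perpLattice_le_neighbor ⟨hx.1, ?_⟩) ?_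
  · obtain ⟨hxK, m, hm⟩ := hx
    obtain ⟨n, hn⟩ := hK.integral x hxK w' hw'.mem
    obtain ⟨q, hq⟩ := hK.integral x hxK z hz
    rw [h, map_add, form_zsmul, ← natCast_zsmul, form_zsmul, hn, hq] at hm
    have h1 : (p : ℤ) ∣ c * n := ⟨m - q, by
      have : (c : ℚ) * n = p * (m - q) := by push_cast at hm; linear_combination hm
      exact_mod_cast this⟩
    obtain ⟨j, rfl⟩ := (hpZ.dvd_or_dvd h1).resolve_left hc
    exact ⟨j, by rw [hn]; push_cast; rfl⟩
  · rw [Submodule.span_singleton_le_iff_mem]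
    refine mem_neighbor.2 ⟨z, hzperp, c, ?_⟩
    rw [h, smul_add, inv_smul_nsmul hp, add_comm, smul_comm]

include hsymm hK hp hpM hp2 in
/-- Isotropic vectors modulo `p` lift to isotropic vectors modulo `p²`. -/
theorem exists_isNeighborVector {w : V} (hw : w ∈ K) (hprim : ∀ y ∈ K, w ≠ p • y) {k : ℤ}
    (hk : B w w = p * k) : ∃ z ∈ K, IsNeighborVector B p K (w + p • z) := by
  obtain ⟨y, hy, m, hm, hpm⟩ := exists_not_dvd_form hK hp hpM hw hprim
  have hpZ := Nat.prime_iff_prime_int.1 hp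
  have h2m : ¬ (p : ℤ) ∣ 2 * m := by
    intro h
    rcases hpZ.dvd_or_dvd h with h4 | h4
    · have h5 : p ∣ 2 := by exact_mod_cast h4
      exact absurd ((Nat.prime_dvd_prime_iff_eq hp Nat.prime_two).1 h5) hp2
    · exact hpm h4
  obtain ⟨s, t, hst⟩ : IsCoprime (2 * m) (p : ℤ) := (hpZ.coprime_iff_not_dvd.2 h2m).symm
  obtain ⟨q, hq⟩ := hK.integral y hy y hy
  -- A Hensel step: `s` inverts `2B(w, y)` modulo `p`, and `Q(w + pz) ≡ pk + 2pB(w, z)` modulo `p²`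
  -- then vanishes for `z = -ksy`.
  refine ⟨(-k * s) • y, zsmul_mem hy _, add_mem hw (nsmul_mem (zsmul_mem hy _) p), fun x hx h => ?_, ?_⟩
  · refine hprim (x - (-k * s) • y) (sub_mem hx (zsmul_mem hy _)) ?_
    rw [smul_sub, ← h, add_sub_cancel_right]
  · refine ⟨k * t + (k * s) ^ 2 * q, ?_⟩
    rw [← natCast_zsmul, smul_smul, form_add_self hsymm, form_zsmul, form_zsmul, form_zsmul_left, hk, hm, hq]
    have : (s : ℚ) * (2 * m) + t * p = 1 := by exact_mod_cast hst
    push_cast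
    linear_combination (-(p : ℚ) * k) * this

include hsymm hK hp hpM in
-- If `B(w, y)` is prime to `p`, then `py` is a primitive vector of the neighbor, and its neighbor
-- contains `y` again; it is `K`.
theorem isNeighbor_symm {K' : Submodule ℤ V} (h : IsNeighbor B p K K') : IsNeighbor B p K' K := by
  obtain ⟨w, hw, rfl⟩ := h
  have hpQ : (p : ℚ) ≠ 0 := by exact_mod_cast hp.ne_zero
  have hpZ := Nat.prime_iff_prime_int.1 hp
  obtain ⟨y, hy, m, hm, hpm⟩ := exists_not_dvd_form hK hp hpM hw.mem hw.prim
  obtain ⟨s, t, hst⟩ : IsCoprime m (p : ℤ) := (hpZ.coprime_iff_not_dvd.2 hpm).symm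
  obtain ⟨q, hq⟩ := hK.integral y hy y hy
  have hwperp : w ∈ perpLattice B p K w := ⟨hw.mem, isotropic_div hw⟩
  refine ⟨p • y, ⟨perpLattice_le_neighbor (nsmul_mem_perpLattice hK hw.mem hy), fun x hx h => ?_, q, ?_⟩, ?_⟩
  · have hxy : x = y := by rw [← inv_smul_nsmul hp x, ← h, inv_smul_nsmul hp]
    subst hxy
    obtain ⟨-, j, hj⟩ := mem_perpLattice_of_mem hp hw hy hx
    rw [hsymm.eq, hm] at hj
    exact hpm ⟨j, by exact_mod_cast hj⟩
  · rw [← natCast_zsmul, form_zsmul, form_zsmul_left, hq]; push_cast; ring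
  · apply le_antisymm
    · intro x hx
      obtain ⟨n, hn⟩ := hK.integral x hx w hw.mem
      have hst' : (s : ℚ) * m + t * p = 1 := by exact_mod_cast hst
      refine mem_neighbor.2 ⟨x - (n * s) • y, ⟨?_, ?_⟩, n * s, by rw [inv_smul_nsmul hp, sub_add_cancel]⟩
      · refine perpLattice_le_neighbor ⟨sub_mem hx (zsmul_mem hy _), n * t, ?_⟩
        rw [map_sub, LinearMap.sub_apply, form_zsmul_left, hsymm.eq y w, hn, hm]
        push_cast
        linear_combination (-(n : ℚ)) * hst'
      · obtain ⟨l, hl⟩ := hK.integral (x - (n * s) • y) (sub_mem hx (zsmul_mem hy _)) y hy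
        exact ⟨l, by rw [← natCast_zsmul, form_zsmul, hl]; push_cast; rfl⟩
    · refine sup_le (fun x hx => ?_) ?_
      · obtain ⟨hx1, j, hj⟩ := hx
        obtain ⟨x', hx', c, rfl⟩ := mem_neighbor.1 hx1
        obtain ⟨l, hl⟩ := hK.integral x' hx'.1 y hy
        rw [← natCast_zsmul, form_zsmul, map_add, LinearMap.add_apply, form_zsmul_left, map_smul,
          LinearMap.smul_apply, hl, hm, smul_eq_mul] at hj
        have h1 : (p : ℤ) ∣ c * m := ⟨j - l, by
          have : (c : ℚ) * m = p * (j - l) := by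
            push_cast at hj; field_simp at hj; linear_combination hj
          exact_mod_cast this⟩
        obtain ⟨i, rfl⟩ := (hpZ.dvd_or_dvd h1).resolve_right hpm
        refine add_mem hx'.1 ?_
        rw [mul_comm, mul_smul, natCast_zsmul, nsmul_inv_smul hp]
        exact zsmul_mem hw.mem i
      · rw [Submodule.span_singleton_le_iff_mem, inv_smul_nsmul hp]
        exact hy

end

end

/-! ### Rotations between neighbors -/

section

variable {V : Type*} [AddCommGroup V] [Module ℚ V]

section

variable {B : LinearMap.BilinForm ℚ V} (hsymm : B.IsSymm) (hpos : ∀ x : V, x ≠ 0 → 0 < B x x)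
    (hdim : Module.finrank ℚ V = 3) {M : ℕ} {K : Submodule ℤ V} (hK : IsIntegralOfLevel B M K)
    {p : ℕ} (hp : p.Prime) (hpM : ¬ p ∣ M) (hp2 : p ≠ 2)

include hsymm hpos hdim in
/-- The half turn about a nonzero vector. -/
theorem exists_halfTurn {v : V} (hv : v ≠ 0) :
    ∃ ρ ∈ rotationGroup B, (∀ x, ρ x = (2 * B x v / B v v) • v - x) ∧ ∀ x, ρ.symm x = ρ x := by
  have : FiniteDimensional ℚ V := Module.finite_of_finrank_pos (by omega)
  have hvv := (hpos v hv).ne'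
  -- The negative of the reflection in `v`; in dimension three it has determinant `(-1)³(-1) = 1`.
  let f : V →ₗ[ℚ] V := (-1 : ℚ) • LinearMap.transvection (-(2 / B v v) • B v) v
  have hf : ∀ x, f x = (2 * B x v / B v v) • v - x := fun x => by
    simp only [f, LinearMap.smul_apply, LinearMap.transvection.apply, smul_eq_mul]
    rw [hsymm.eq v x, neg_one_smul, neg_add, ← neg_smul, neg_add_eq_sub]
    congr 2
    ring
  have hff : ∀ x, f (f x) = x := fun x => by
    rw [hf (f x), hf x, map_sub, LinearMap.sub_apply, map_smul, LinearMap.smul_apply, smul_eq_mul, sub_sub_eq_add_sub,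
      add_sub_right_comm, ← sub_smul]
    have : 2 * (2 * B x v / B v v * B v v - B x v) / B v v - 2 * B x v / B v v = 0 := by field_simp; ring
    rw [this, zero_smul, zero_add]
  let ρ : V ≃ₗ[ℚ] V := LinearEquiv.ofInvolutive f hff
  have hρ : ∀ x, ρ x = f x := fun _ => rfl
  have hdet : LinearMap.det (ρ : V →ₗ[ℚ] V) = 1 := by
    have : (ρ : V →ₗ[ℚ] V) = f := rfl
    rw [this, LinearMap.det_smul, hdim, LinearMap.transvection.det, LinearMap.smul_apply, smul_eq_mul]
    field_simp
    norm_num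
  refine ⟨ρ, ⟨fun x y => ?_, hdet⟩, fun x => by rw [hρ, hf], fun x => ?_⟩
  · rw [hρ, hρ, hf, hf]
    simp only [map_sub, map_smul, LinearMap.sub_apply, LinearMap.smul_apply, smul_eq_mul]
    rw [hsymm.eq v y]
    field_simp
    ring
  · rw [LinearEquiv.symm_apply_eq, hρ, hρ, hff]

include hsymm hpos hdim hK hp hpM hp2 in
/-- Neighbors are related by a rotation and an integral factor prime to `p`. -/
theorem exists_rotation_neighbor {w : V} (hw : IsNeighborVector B p K w) :
    ∃ ρ ∈ rotationGroup B, ∃ u : ℤ, ¬ (p : ℤ) ∣ u ∧ (∀ x ∈ K, u • ρ x ∈ neighbor B p K w) ∧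
      ∀ x ∈ neighbor B p K w, u • ρ.symm x ∈ K := by
  have hpQ : (p : ℚ) ≠ 0 := by exact_mod_cast hp.ne_zero
  have hpZ := Nat.prime_iff_prime_int.1 hp
  obtain ⟨y, hy, m, hm, hpm⟩ := exists_not_dvd_form hK hp hpM hw.mem hw.prim
  obtain ⟨q, hq⟩ := hK.integral y hy y hy
  obtain ⟨k, hk⟩ := hw.isotropic
  -- `Q(v) = pu` with `u ≡ 2B(w, y)` modulo `p`, so `p ∤ u`. The half turn about `v` therefore has
  -- denominator exactly `p`, in the direction of `w`, as the passage to the neighbor requires.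
  set v := w + p • y with hv
  have hvK : v ∈ K := add_mem hw.mem (nsmul_mem hy p)
  have hv0 : v ≠ 0 := fun h0 => hw.prim (-y) (neg_mem hy) (by
    rw [smul_neg, eq_neg_iff_add_eq_zero]; exact h0)
  set u : ℤ := p * k + 2 * m + p * q with hu
  have hBv : ∀ x, B x v = B x w + p * B x y := fun x => by
    rw [hv, map_add, ← natCast_zsmul, form_zsmul]; push_cast; rfl
  have hvv : B v v = p * u := by
    rw [hv, ← natCast_zsmul, form_add_self hsymm, form_zsmul, form_zsmul, form_zsmul_left, hk, hm, hq, hu]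
    push_cast; ring
  have hu2 : ¬ (p : ℤ) ∣ u := by
    intro h
    have h1 : (p : ℤ) ∣ 2 * m := by
      have : 2 * m = u - p * (k + q) := by rw [hu]; ring
      rw [this]
      exact dvd_sub h (Dvd.intro _ rfl)
    rcases hpZ.dvd_or_dvd h1 with h4 | h4
    · have h5 : p ∣ 2 := by exact_mod_cast h4
      exact hp2 ((Nat.prime_dvd_prime_iff_eq hp Nat.prime_two).1 h5)
    · exact hpm h4
  have huQ : (u : ℚ) ≠ 0 := by
    have : u ≠ 0 := fun h => hu2 (h ▸ dvd_zero _)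
    exact_mod_cast this
  obtain ⟨ρ, hρ, hρx, hρs⟩ := exists_halfTurn hsymm hpos hdim hv0
  have hρu : ∀ x, u • ρ x = (2 * B x v / p) • v - u • x := fun x => by
    rw [hρx, smul_sub, ← Int.cast_smul_eq_zsmul ℚ, smul_smul, hvv]
    congr 2
    field_simp
  refine ⟨ρ, hρ, u, hu2, fun x hx => ?_, fun x hx => ?_⟩
  · obtain ⟨b, hb⟩ := hK.integral x hx w hw.mem
    obtain ⟨b', hb'⟩ := hK.integral x hx y hy
    refine mem_neighbor.2 ⟨(2 * (b + p * b')) • y - u • x, ⟨sub_mem (zsmul_mem hy _) (zsmul_mem hx _), ?_⟩,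
      2 * (b + p * b'), ?_⟩
    · refine ⟨2 * b' * m - k * b - q * b, ?_⟩
      rw [map_sub, LinearMap.sub_apply, form_zsmul_left, form_zsmul_left, hsymm.eq y w, hm, hb, hu]
      push_cast; ring
    · rw [hρu, hBv, hb, hb', hv, smul_add]
      have : (2 * ((b : ℚ) + p * b') / p) • p • y = (2 * (b + p * b')) • y := by
        rw [← Nat.cast_smul_eq_nsmul ℚ, ← Int.cast_smul_eq_zsmul ℚ, smul_smul]
        congr 1
        push_cast; field_simp
      have h2 : (2 * ((b : ℚ) + p * b') / p) • w = (2 * (b + p * b')) • (p : ℚ)⁻¹ • w := by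
        rw [← Int.cast_smul_eq_zsmul ℚ, smul_smul]
        congr 1
        push_cast; field_simp
      rw [this, h2]
      abel
  · rw [hρs]
    obtain ⟨x', ⟨hx', j, hj⟩, c, rfl⟩ := mem_neighbor.1 hx
    rw [map_add, smul_add]
    refine add_mem ?_ ?_
    · obtain ⟨b', hb'⟩ := hK.integral x' hx' y hy
      have : (2 * B x' v / p) • v = (2 * (j + b')) • v := by
        rw [hBv, hj, hb', ← Int.cast_smul_eq_zsmul ℚ]
        congr 1
        push_cast; field_simp
      rw [hρu, this]
      exact sub_mem (zsmul_mem hvK _) (zsmul_mem hx' _)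
    · rw [map_zsmul, smul_comm]
      refine zsmul_mem ?_ c
      have h1 : (p : ℚ)⁻¹ • w = (p : ℚ)⁻¹ • v - y := by
        rw [hv, smul_add, inv_smul_nsmul hp, add_sub_cancel_right]
      have h2 : u • ρ ((p : ℚ)⁻¹ • w) = (k - q) • v + u • y := by
        rw [hρu, hBv, map_smul, LinearMap.smul_apply, LinearMap.smul_apply, hk, hm, h1, smul_sub, sub_sub_eq_add_sub, add_sub_right_comm,
          ← Int.cast_smul_eq_zsmul ℚ u ((p : ℚ)⁻¹ • v), smul_smul, ← sub_smul, ← Int.cast_smul_eq_zsmul ℚ (k - q)]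
        congr 2
        rw [hu]
        push_cast
        simp only [smul_eq_mul]
        field_simp
        ring
      rw [h2]
      exact add_mem (zsmul_mem hvK _) (zsmul_mem hy _)

end

end

section

variable {V : Type*} [AddCommGroup V] [Module ℚ V]

/-! ## Neighbors and proper genera -/

section

variable {B : LinearMap.BilinForm ℚ V} (hsymm : B.IsSymm) (hpos : ∀ x : V, x ≠ 0 → 0 < B x x)
    (hdim : Module.finrank ℚ V = 3) {M : ℕ} {K : Submodule ℤ V} (hK : IsIntegralOfLevel B M K)
    {p : ℕ} (hp : p.Prime) (hpM : ¬ p ∣ M) (hp2 : p ≠ 2)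

theorem localCoset_congr (q : ℕ) [Fact q.Prime] {a : ℕ} {L : Submodule ℤ V} {ν ν' : V}
    (h : ∃ k ∈ L, ν' - ν = a • k) : localCoset q a L ν' = localCoset q a L ν := by
  obtain ⟨k, hk, h⟩ := h
  have h' : (1 : ℚ_[q]) ⊗ₜ[ℚ] ν' = a • ((1 : ℚ_[q]) ⊗ₜ[ℚ] k) + (1 : ℚ_[q]) ⊗ₜ[ℚ] ν := by
    rw [← sub_eq_iff_eq_add, ← TensorProduct.tmul_sub, h, TensorProduct.tmul_smul]
  have hk' := tmul_mem_localLattice q hk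
  ext x
  constructor
  · rintro ⟨y, hy, rfl⟩
    exact ⟨y + (1 : ℚ_[q]) ⊗ₜ[ℚ] k, add_mem hy hk', by rw [h', smul_add, add_assoc]⟩
  · rintro ⟨y, hy, rfl⟩
    exact ⟨y - (1 : ℚ_[q]) ⊗ₜ[ℚ] k, sub_mem hy hk', by rw [h', smul_sub]; abel⟩

theorem properGenus_congr {a : ℕ} {L : Submodule ℤ V} {ν ν' : V} (h : ∃ k ∈ L, ν' - ν = a • k) :
    properGenus B a L ν' = properGenus B a L ν := by
  have := fun (q : ℕ) [Fact q.Prime] => localCoset_congr q h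
  simp only [properGenus, this]

theorem exists_localMap {a : ℕ} (ha : a ≠ 0) {L : Submodule ℤ V} {ν μ : V}
    (h : latticeCoset a K μ ∈ properGenus B a L ν) :
    ∃ σ : AdelicRotation B L, ∀ (q : ℕ) [Fact q.Prime], LocalMap q a L ν K μ (σ.comp q).1 := by
  obtain ⟨K', μ', hK', hX, σ, hσ⟩ := h
  obtain ⟨rfl, hμ⟩ := latticeCoset_injective ha hX
  refine ⟨σ, fun q _ => (image_localCoset_iff q ha _).1 ?_⟩
  rw [hσ q, localCoset_congr q hμ]

include hsymm hpos hdim hK hp hpM hp2 in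
/-- Passing to a `p`-neighbor does not leave the proper genus. -/
theorem neighbor_mem_properGenus {a : ℕ} (ha : a ≠ 0) (hpa : ¬ p ∣ a) {L : Submodule ℤ V} {ν μ : V} (hν : ν ∈ L)
    (hX : latticeCoset a K μ ∈ properGenus B a L ν) {K' : Submodule ℤ V} (hn : IsNeighbor B p K K') {m : ℤ}
    (hm : m • μ ∈ K') : latticeCoset a K' (m • μ) ∈ properGenus B a L (m • ν) := by
  obtain ⟨σ, hσ⟩ := exists_localMap ha hX
  obtain ⟨w, hw, rfl⟩ := hn
  obtain ⟨ρ, hρ, u, hu, hρK, hρK'⟩ := exists_rotation_neighbor hsymm hpos hdim hK hp hpM hp2 hw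
  -- The half turn is inserted at the single place `p`; the condition at almost all places is not
  -- affected.
  let τ : AdelicRotation B L :=
    { comp := fun q _ => if q = p then ⟨ρ.baseChange ℚ ℚ_[q] V V, baseChange_mem_rotationGroup q hdim hρ⟩ * σ.comp q
        else σ.comp q
      almost_all := by
        refine (σ.almost_all.union (Set.finite_singleton p)).subset ?_
        rintro q ⟨hq, h⟩
        by_cases hqp : q = p
        · exact Or.inr hqp
        · left
          refine ⟨hq, ?_⟩
          rwa [if_neg hqp] at h }
  refine latticeCoset_mem_properGenus ha (isLattice_neighbor hK hp hw.mem) τ fun q hq => ?_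
  obtain ⟨h1, k, hk, h2⟩ := hσ q
  by_cases hqp : q = p
  · subst hqp
    have hτ : (τ.comp q).1 = ρ.baseChange ℚ ℚ_[q] V V * (σ.comp q).1 := by
      simp only [τ, if_true]; rfl
    have himg : (τ.comp q).1 '' (localLattice q L : Set (ℚ_[q] ⊗[ℚ] V)) = localLattice q (neighbor B q K w) := by
      rw [← image_localLattice_of_nsmul q hu hρK hρK', ← h1, hτ, Set.image_image]
      rfl
    refine ⟨himg, ?_⟩
    -- At `p` the conductor `a` is a unit, so it suffices that both vectors lie in the lattice; no
    -- congruence between them is needed.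
    have h3 : (τ.comp q).1 ((1 : ℚ_[q]) ⊗ₜ[ℚ] (m • ν)) - (1 : ℚ_[q]) ⊗ₜ[ℚ] (m • μ) ∈ localLattice q (neighbor B q K w) := by
      refine sub_mem ?_ (tmul_mem_localLattice q hm)
      rw [← SetLike.mem_coe, ← himg]
      exact ⟨_, tmul_mem_localLattice q (zsmul_mem hν m), rfl⟩
    have h4 : a • (a : ℚ_[q])⁻¹ • ((τ.comp q).1 ((1 : ℚ_[q]) ⊗ₜ[ℚ] (m • ν)) - (1 : ℚ_[q]) ⊗ₜ[ℚ] (m • μ)) =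
        (τ.comp q).1 ((1 : ℚ_[q]) ⊗ₜ[ℚ] (m • ν)) - (1 : ℚ_[q]) ⊗ₜ[ℚ] (m • μ) := by
      rw [← Nat.cast_smul_eq_nsmul ℚ_[q], smul_smul, mul_inv_cancel₀ (by exact_mod_cast ha), one_smul]
    refine ⟨(a : ℚ_[q])⁻¹ • ((τ.comp q).1 ((1 : ℚ_[q]) ⊗ₜ[ℚ] (m • ν)) - (1 : ℚ_[q]) ⊗ₜ[ℚ] (m • μ)), ?_, ?_⟩
    · refine mem_localLattice_of_nsmul q (m := a) (by exact_mod_cast hpa) ?_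
      rw [natCast_zsmul, h4]
      exact h3
    · rw [h4, sub_add_cancel]
  · have hτ : (τ.comp q).1 = (σ.comp q).1 := by simp only [τ, if_neg hqp]
    -- Away from `p` the lattices have the same localization, as `p` carries each of them into the
    -- other.
    have hKK : localLattice q K = localLattice q (neighbor B p K w) := by
      apply SetLike.coe_injective
      have := image_localLattice_of_nsmul q (K := K) (K' := neighbor B p K w) (ρ := LinearEquiv.refl ℚ V) (u := p) ?_ ?_ ?_
      · rw [← this]
        have : (LinearEquiv.refl ℚ V).baseChange ℚ ℚ_[q] V V = LinearEquiv.refl ℚ_[q] _ := by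
          exact LinearEquiv.toLinearMap_injective LinearMap.baseChange_id
        rw [this]
        exact (Set.image_id _).symm
      · intro h
        exact hqp ((Nat.prime_dvd_prime_iff_eq hq.out hp).1 (by exact_mod_cast h))
      · intro x hx
        rw [natCast_zsmul]
        exact perpLattice_le_neighbor (nsmul_mem_perpLattice hK hw.mem hx)
      · intro x hx
        rw [natCast_zsmul]
        exact nsmul_mem_of_mem_neighbor hp hw.mem hx
    rw [LocalMap, hτ, ← hKK]
    exact ⟨h1, m • k, zsmul_mem hk m, by
      rw [TensorProduct.tmul_smul, map_zsmul, h2, smul_add, smul_comm m a, TensorProduct.tmul_smul]⟩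

end

end

section

/-! ## Ternary quadratic forms over a finite prime field -/

section

variable {p : ℕ} [Fact p.Prime] (G : Matrix (Fin 3) (Fin 3) (ZMod p))

open Matrix

/-- The bilinear form with Gram matrix `G`. -/
def gramForm (x y : Fin 3 → ZMod p) : ZMod p := x ⬝ᵥ G *ᵥ y

variable {G} in
theorem gramForm_add_left (x y z : Fin 3 → ZMod p) : gramForm G (x + y) z = gramForm G x z + gramForm G y z :=
  add_dotProduct _ _ _

theorem gramForm_add_right (x y z : Fin 3 → ZMod p) : gramForm G x (y + z) = gramForm G x y + gramForm G x z := by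
  simp only [gramForm, mulVec_add, dotProduct_add]

theorem gramForm_smul_left (c : ZMod p) (x y : Fin 3 → ZMod p) : gramForm G (c • x) y = c * gramForm G x y :=
  smul_dotProduct _ _ _

theorem gramForm_smul_right (c : ZMod p) (x y : Fin 3 → ZMod p) : gramForm G x (c • y) = c * gramForm G x y := by
  simp only [gramForm, mulVec_smul, dotProduct_smul, smul_eq_mul]

variable {G} (hG : G.IsSymm) (hdet : G.det ≠ 0) (hp2 : p ≠ 2)

include hG in
theorem gramForm_comm (x y : Fin 3 → ZMod p) : gramForm G x y = gramForm G y x := by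
  rw [gramForm, gramForm, dotProduct_mulVec, dotProduct_comm, ← mulVec_transpose, hG.eq]

/-- Chevalley's theorem: a form of degree `2` in `3` variables has a number of zeros divisible by
`p`, so the trivial zero is not the only one. -/
theorem exists_isotropic : ∃ x : Fin 3 → ZMod p, x ≠ 0 ∧ gramForm G x x = 0 := by
  classical
  let f : MvPolynomial (Fin 3) (ZMod p) := ∑ i, ∑ j, MvPolynomial.C (G i j) * (MvPolynomial.X i * MvPolynomial.X j)
  have hf : ∀ x, MvPolynomial.eval x f = gramForm G x x := fun x => by
    simp only [f, map_sum, map_mul, MvPolynomial.eval_C, MvPolynomial.eval_X, gramForm, dotProduct, mulVec,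
      Finset.mul_sum]
    exact Finset.sum_congr rfl fun i _ => Finset.sum_congr rfl fun j _ => by ring
  have hdeg : f.totalDegree < Fintype.card (Fin 3) := by
    refine lt_of_le_of_lt (b := 2) ?_ (by simp)
    refine (MvPolynomial.totalDegree_finsetSum _ _).trans (Finset.sup_le fun i _ => ?_)
    refine (MvPolynomial.totalDegree_finsetSum _ _).trans (Finset.sup_le fun j _ => ?_)
    refine (MvPolynomial.totalDegree_mul _ _).trans ?_
    rw [MvPolynomial.totalDegree_C, zero_add]
    refine (MvPolynomial.totalDegree_mul _ _).trans ?_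
    rw [MvPolynomial.totalDegree_X, MvPolynomial.totalDegree_X]
  have h := char_dvd_card_solutions p hdeg
  by_contra! hcon
  have : Fintype.card {x : Fin 3 → ZMod p // MvPolynomial.eval x f = 0} = 1 := by
    rw [Fintype.card_eq_one_iff]
    refine ⟨⟨0, by rw [hf]; simp [gramForm]⟩, fun y => Subtype.ext ?_⟩
    by_contra hy
    exact hcon y.1 hy ((hf _).symm.trans y.2)
  rw [this] at h
  exact (Fact.out : p.Prime).one_lt.ne' (Nat.dvd_one.1 h)

include hdet in
theorem eq_zero_of_gramForm {y : Fin 3 → ZMod p} (h : ∀ x, gramForm G x y = 0) : y = 0 := by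
  have h1 : G *ᵥ y = 0 := by
    ext i
    have := h (Pi.single i 1)
    rwa [gramForm, single_one_dotProduct] at this
  exact eq_zero_of_mulVec_eq_zero hdet h1

/-- A basis consisting of a hyperbolic pair and an orthogonal vector. -/
structure IsHyperbolic (G : Matrix (Fin 3) (Fin 3) (ZMod p)) (u v w : Fin 3 → ZMod p) : Prop where
  uu : gramForm G u u = 0
  vv : gramForm G v v = 0
  uv : gramForm G u v = 1
  uw : gramForm G u w = 0
  vw : gramForm G v w = 0
  ww : gramForm G w w = -G.det
  expand : ∀ x, x = gramForm G x v • u + gramForm G x u • v + (-(gramForm G x w) / G.det) • w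

theorem two_ne_zero_zmod {p : ℕ} [Fact p.Prime] (hp2 : p ≠ 2) : (2 : ZMod p) ≠ 0 := by
  intro h
  have h1 : ((2 : ℕ) : ZMod p) = 0 := by exact_mod_cast h
  rw [ZMod.natCast_eq_zero_iff] at h1
  exact hp2 ((Nat.prime_dvd_prime_iff_eq Fact.out Nat.prime_two).1 h1)

include hG hdet hp2 in
-- An isotropic `u` is completed to a hyperbolic pair `u, v`. The vector product of `Gu` and `Gv` is
-- orthogonal to both and normalized so that the base change has determinant `-1`, which gives its
-- norm `-det G`.
theorem exists_isHyperbolic : ∃ u v w, IsHyperbolic G u v w := by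
  have h2 := two_ne_zero_zmod hp2
  obtain ⟨u, hu, huu⟩ := exists_isotropic (G := G)
  obtain ⟨y, hy⟩ : ∃ y, gramForm G y u ≠ 0 := by
    by_contra! h
    exact hu (eq_zero_of_gramForm hdet h)
  obtain ⟨v', huv'⟩ : ∃ v', gramForm G u v' = 1 := ⟨(gramForm G y u)⁻¹ • y, by
    rw [gramForm_smul_right, gramForm_comm hG u y, inv_mul_cancel₀ hy]⟩
  obtain ⟨v, hv⟩ : ∃ v, v = v' + (-(gramForm G v' v') / 2) • u := ⟨_, rfl⟩
  have huv : gramForm G u v = 1 := by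
    rw [hv, gramForm_add_right, gramForm_smul_right, huu, huv']; ring
  have hvv : gramForm G v v = 0 := by
    rw [hv, gramForm_add_right, gramForm_add_left, gramForm_add_left, gramForm_smul_right, gramForm_smul_right,
      gramForm_smul_left, gramForm_smul_left, huu, huv', gramForm_comm hG v' u, huv']
    field_simp; ring
  set w := (G *ᵥ u) ⨯₃ (G *ᵥ v) with hw
  have hwu : gramForm G w u = 0 := by rw [gramForm, dotProduct_comm]; exact dot_self_cross _ _
  have hwv : gramForm G w v = 0 := by rw [gramForm, dotProduct_comm]; exact dot_cross_self _ _
  have huw : gramForm G u w = 0 := by rw [gramForm_comm hG, hwu]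
  have hvw : gramForm G v w = 0 := by rw [gramForm_comm hG, hwv]
  let P : Matrix (Fin 3) (Fin 3) (ZMod p) := ![u, v, w]
  have hP : P.det = -1 := by
    rw [← triple_product_eq_det, triple_product_permutation, triple_product_permutation]
    rw [hw, dotProduct_comm, cross_dot_cross]
    have e1 : u ⬝ᵥ G *ᵥ u = 0 := huu
    have e2 : v ⬝ᵥ G *ᵥ v = 0 := hvv
    have e3 : u ⬝ᵥ G *ᵥ v = 1 := huv
    have e4 : v ⬝ᵥ G *ᵥ u = 1 := by rw [← huv]; exact gramForm_comm hG _ _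
    rw [e1, e2, e3, e4]
    ring
  have hPG : ∀ i j, (P * G * Pᵀ) i j = gramForm G (P i) (P j) := fun i j => by
    rw [Matrix.mul_assoc, gramForm]
    rfl
  have hww : gramForm G w w = -G.det := by
    have h1 : (P * G * Pᵀ).det = G.det := by
      rw [det_mul, det_mul, det_transpose, hP]; ring
    have hvu : gramForm G v u = 1 := by rw [gramForm_comm hG, huv]
    rw [det_fin_three] at h1
    simp only [hPG] at h1
    have P0 : P 0 = u := rfl
    have P1 : P 1 = v := rfl
    have P2 : P 2 = w := rfl
    simp only [P0, P1, P2, huu, hvv, huv, huw, hvw, hwu, hwv, hvu] at h1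
    linear_combination -h1
  refine ⟨u, v, w, huu, hvv, huv, huw, hvw, hww, fun x => ?_⟩
  have hdw : IsUnit P.det := by rw [hP]; exact isUnit_one.neg
  rw [← sub_eq_zero]
  set d := x - (gramForm G x v • u + gramForm G x u • v + (-(gramForm G x w) / G.det) • w) with hd
  have hx : x = d + (gramForm G x v • u + gramForm G x u • v + (-(gramForm G x w) / G.det) • w) := by
    rw [hd, sub_add_cancel]
  have hvu : gramForm G v u = 1 := by rw [gramForm_comm hG, huv]
  have key : ∀ y, gramForm G x y = gramForm G d y + (gramForm G x v * gramForm G u y + gramForm G x u * gramForm G v y +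
      (-(gramForm G x w) / G.det) * gramForm G w y) := fun y => by
    conv_lhs => rw [hx]
    simp only [gramForm_add_left, gramForm_smul_left]
  have k1 := key u
  have k2 := key v
  have k3 := key w
  simp only [huu, hvv, huv, huw, hvw, hwu, hwv, hvu, hww] at k1 k2 k3
  have d1 : gramForm G u d = 0 := by rw [gramForm_comm hG]; linear_combination -k1
  have d2 : gramForm G v d = 0 := by rw [gramForm_comm hG]; linear_combination -k2
  have d3 : gramForm G w d = 0 := by
    rw [gramForm_comm hG]; field_simp at k3; linear_combination -k3
  have h3 : P *ᵥ (G *ᵥ d) = 0 := by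
    ext i
    fin_cases i
    · exact d1
    · exact d2
    · exact d3
  exact eq_zero_of_mulVec_eq_zero hdet (eq_zero_of_mulVec_eq_zero hdw.ne_zero h3)

/-- The isotropic points, up to scalars. -/
def isoPoint (G : Matrix (Fin 3) (Fin 3) (ZMod p)) (u v w : Fin 3 → ZMod p) : Option (ZMod p) → Fin 3 → ZMod p
  | none => v
  | some t => u + (G.det * t ^ 2 / 2) • v + t • w

variable {u v w : Fin 3 → ZMod p} (h : IsHyperbolic G u v w)

theorem gramForm_isoPoint_some (x : Fin 3 → ZMod p) (t : ZMod p) : gramForm G x (isoPoint G u v w (some t)) =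
    gramForm G x u + G.det * t ^ 2 / 2 * gramForm G x v + t * gramForm G x w := by
  rw [isoPoint, gramForm_add_right, gramForm_add_right, gramForm_smul_right, gramForm_smul_right]

include h hdet in
theorem gramForm_self (x : Fin 3 → ZMod p) :
    -(G.det * gramForm G x x) = gramForm G x w ^ 2 - 2 * G.det * gramForm G x v * gramForm G x u := by
  have h1 : gramForm G x x = gramForm G x v * gramForm G x u + gramForm G x u * gramForm G x v +
      (-(gramForm G x w) / G.det) * gramForm G x w := by
    conv_lhs => enter [3]; rw [h.expand x]
    rw [gramForm_add_right, gramForm_add_right, gramForm_smul_right, gramForm_smul_right, gramForm_smul_right]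
  rw [h1]
  field_simp
  ring

include h hG in
theorem isoPoint_some_left (t : ZMod p) : gramForm G (isoPoint G u v w (some t)) v = 1 ∧
    gramForm G (isoPoint G u v w (some t)) w = -G.det * t ∧
    gramForm G (isoPoint G u v w (some t)) u = G.det * t ^ 2 / 2 := by
  refine ⟨?_, ?_, ?_⟩
  · rw [gramForm_comm hG, gramForm_isoPoint_some, gramForm_comm hG v u, h.uv, h.vv, h.vw]; ring
  · rw [gramForm_comm hG, gramForm_isoPoint_some, gramForm_comm hG w u, gramForm_comm hG w v, h.uw, h.vw, h.ww]; ring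
  · rw [gramForm_comm hG, gramForm_isoPoint_some, h.uu, h.uv, h.uw]; ring

include h hG in
theorem isoPoint_ne_zero (o : Option (ZMod p)) : isoPoint G u v w o ≠ 0 := by
  intro h0
  cases o with
  | none =>
    have := h.uv
    rw [show v = 0 from h0] at this
    simp [gramForm] at this
  | some t =>
    have := (isoPoint_some_left hG h t).1
    rw [h0] at this
    simp [gramForm] at this

include h hG hp2 in
theorem gramForm_isoPoint_self (o : Option (ZMod p)) : gramForm G (isoPoint G u v w o) (isoPoint G u v w o) = 0 := by
  have h2 := two_ne_zero_zmod hp2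
  cases o with
  | none => exact h.vv
  | some t =>
    obtain ⟨h1, h3, h4⟩ := isoPoint_some_left hG h t
    rw [gramForm_isoPoint_some, h1, h3, h4]
    field_simp
    ring

include h hG in
theorem isoPoint_injective {o o' : Option (ZMod p)} (hdet : G.det ≠ 0) {c : ZMod p}
    (ho : isoPoint G u v w o = c • isoPoint G u v w o') : o = o' := by
  have e := fun y => congrArg (fun x => gramForm G x y) ho
  simp only [gramForm_smul_left] at e
  cases o with
  | none =>
    cases o' with
    | none => rfl
    | some t =>
      have h1 := e v
      rw [(isoPoint_some_left hG h t).1, show isoPoint G u v w none = v from rfl, h.vv, mul_one] at h1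
      rw [← h1, zero_smul] at ho
      exact absurd ho (isoPoint_ne_zero hG h none)
  | some t =>
    have h1 := e v
    rw [(isoPoint_some_left hG h t).1] at h1
    cases o' with
    | none =>
      rw [show isoPoint G u v w none = v from rfl, h.vv, mul_zero] at h1
      exact absurd h1 one_ne_zero
    | some t' =>
      rw [(isoPoint_some_left hG h t').1, mul_one] at h1
      have h2 := e w
      rw [(isoPoint_some_left hG h t).2.1, (isoPoint_some_left hG h t').2.1, ← h1, one_mul] at h2
      rw [mul_left_cancel₀ (neg_ne_zero.2 hdet) h2]

include h hdet hp2 in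
theorem exists_eq_smul_isoPoint {x : Fin 3 → ZMod p} (hx : gramForm G x x = 0) :
    ∃ (o : Option (ZMod p)) (c : ZMod p), x = c • isoPoint G u v w o := by
  have h2 := two_ne_zero_zmod hp2
  have h1 := gramForm_self hdet h x
  rw [hx, mul_zero, neg_zero] at h1
  by_cases hv : gramForm G x v = 0
  · have h3 : gramForm G x w = 0 := by
      rw [hv, mul_zero, zero_mul, sub_zero] at h1
      exact pow_eq_zero_iff (two_ne_zero) |>.1 h1.symm
    refine ⟨none, gramForm G x u, ?_⟩
    conv_lhs => rw [h.expand x, hv, h3]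
    simp [isoPoint]
  · refine ⟨some (-(gramForm G x w) / (G.det * gramForm G x v)), gramForm G x v, ?_⟩
    conv_lhs => rw [h.expand x]
    rw [isoPoint, smul_add, smul_add, smul_smul, smul_smul]
    congr 3
    · field_simp
      linear_combination h1
    · field_simp

include h hdet hp2 in
open Classical in
/-- The number of isotropic lines orthogonal to a given vector. -/
theorem sum_isoPoint_orthogonal {x : Fin 3 → ZMod p} (hx : x ≠ 0) :
    (∑ o, if gramForm G x (isoPoint G u v w o) = 0 then (1 : ℤ) else 0) =
      1 + quadraticChar (ZMod p) (-(G.det * gramForm G x x)) := by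
  have h2 := two_ne_zero_zmod hp2
  have hchar : ringChar (ZMod p) ≠ 2 := by rwa [ZMod.ringChar_zmod_n]
  rw [Fintype.sum_option, show isoPoint G u v w none = v from rfl]
  simp only [gramForm_isoPoint_some]
  rw [gramForm_self hdet h]
  by_cases hv : gramForm G x v = 0
  -- The point `v` counts, and the condition on `t` is linear in `t`. It has one solution if `x` is
  -- not orthogonal to `w`; otherwise `x` is a multiple of `v` and there is none.
  · rw [if_pos hv, hv]
    congr 1
    by_cases hw : gramForm G x w = 0
    · have hu : gramForm G x u ≠ 0 := fun hu => hx (by rw [h.expand x, hu, hv, hw]; simp)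
      simp [hw, hu]
    · rw [mul_zero, zero_mul, sub_zero, quadraticChar_sq_one' hw]
      have : ∀ t, gramForm G x u + G.det * t ^ 2 / 2 * 0 + t * gramForm G x w = 0 ↔
          t = -(gramForm G x u) / gramForm G x w := fun t => by
        rw [eq_div_iff hw, mul_zero, add_zero, ← sub_eq_zero (b := -(gramForm G x u))]
        constructor <;> intro h <;> linear_combination h
      simp only [this]
      simp
  -- The condition on `t` is a quadratic equation with discriminant `-(det G) Q(x)` up to squares.
  -- Completing the square matches its solutions with the square roots of this number.
  · rw [if_neg hv, zero_add, add_comm, ← quadraticChar_card_sqrts hchar]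
    rw [Finset.sum_boole, Nat.cast_inj]
    refine Finset.card_bij (fun t _ => G.det * gramForm G x v * t + gramForm G x w) ?_ ?_ ?_
    · intro t ht
      rw [Finset.mem_filter] at ht
      rw [Set.mem_toFinset]
      have h3 := ht.2
      field_simp at h3
      show _ = _
      linear_combination G.det * gramForm G x v * h3
    · intro t _ t' _ htt
      exact mul_left_cancel₀ (mul_ne_zero hdet hv) (add_right_cancel htt)
    · intro s hs
      rw [Set.mem_toFinset] at hs
      have hs' : s ^ 2 = _ := hs
      refine ⟨(s - gramForm G x w) / (G.det * gramForm G x v), ?_, ?_⟩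
      · rw [Finset.mem_filter]
        refine ⟨Finset.mem_univ _, ?_⟩
        field_simp
        linear_combination hs'
      · field_simp
        ring

end

end

section

variable {V : Type*} [AddCommGroup V] [Module ℚ V]

/-! ## Counting neighbors -/

/-- `r` is the reduction of the lattice `K` modulo `p`, and `G` the Gram matrix modulo `p`. -/
structure IsReduction (B : LinearMap.BilinForm ℚ V) {p : ℕ} [Fact p.Prime] (K : Submodule ℤ V)
    (G : Matrix (Fin 3) (Fin 3) (ZMod p)) (r : V → Fin 3 → ZMod p) : Prop where
  add : ∀ x ∈ K, ∀ y ∈ K, r (x + y) = r x + r y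
  zsmul : ∀ x ∈ K, ∀ n : ℤ, r (n • x) = (n : ZMod p) • r x
  eq_zero_iff : ∀ x ∈ K, r x = 0 ↔ ∃ y ∈ K, x = p • y
  surj : ∀ c, ∃ x ∈ K, r x = c
  form : ∀ x ∈ K, ∀ y ∈ K, ∀ m : ℤ, B x y = m → gramForm G (r x) (r y) = m

section

variable {B : LinearMap.BilinForm ℚ V} (hsymm : B.IsSymm) {M : ℕ} {K : Submodule ℤ V} (hK : IsIntegralOfLevel B M K)
    {p : ℕ} [hp : Fact p.Prime] (hpM : ¬ p ∣ M) (hp2 : p ≠ 2)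

theorem exists_isReduction (e : Module.Basis (Fin 3) ℤ K) {A : Matrix (Fin 3) (Fin 3) ℤ}
    (hA : gram B e = A.map (Int.cast : ℤ → ℚ)) :
    ∃ r, IsReduction B K (A.map (Int.cast : ℤ → ZMod p)) r := by
  classical
  let r : V → Fin 3 → ZMod p := fun x i => if hx : x ∈ K then ((e.repr ⟨x, hx⟩ i : ℤ) : ZMod p) else 0
  have hr : ∀ x (hx : x ∈ K) i, r x i = (e.repr ⟨x, hx⟩ i : ℤ) := fun x hx i => dif_pos hx
  refine ⟨r, fun x hx y hy => ?_, fun x hx n => ?_, fun x hx => ⟨fun h => ?_, ?_⟩, fun c => ?_, fun x hx y hy m hm => ?_⟩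
  · ext i
    rw [Pi.add_apply, hr _ (add_mem hx hy), hr x hx, hr y hy,
      show (⟨x + y, add_mem hx hy⟩ : K) = ⟨x, hx⟩ + ⟨y, hy⟩ from rfl, map_add, Finsupp.add_apply]
    push_cast; rfl
  · ext i
    rw [Pi.smul_apply, hr _ (zsmul_mem hx n), hr x hx,
      show (⟨n • x, zsmul_mem hx n⟩ : K) = n • ⟨x, hx⟩ from rfl, map_smul, Finsupp.smul_apply, smul_eq_mul, smul_eq_mul]
    push_cast; rfl
  · have h1 : ∀ i, ∃ k : ℤ, e.repr ⟨x, hx⟩ i = p * k := fun i => by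
      have := congrFun h i
      rw [hr x hx, Pi.zero_apply, ZMod.intCast_zmod_eq_zero_iff_dvd] at this
      exact this
    choose k hk using h1
    refine ⟨∑ i, k i • (e i : V), sum_mem fun i _ => zsmul_mem (e i).2 _, ?_⟩
    rw [Finset.smul_sum]
    conv_lhs => rw [eq_sum_repr e hx]
    exact Finset.sum_congr rfl fun i _ => by rw [hk, mul_smul, natCast_zsmul]
  · rintro ⟨y, hy, rfl⟩
    ext i
    rw [hr _ hx, show (⟨p • y, hx⟩ : K) = p • ⟨y, hy⟩ from rfl, map_nsmul, Finsupp.smul_apply]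
    simp
  · refine ⟨(∑ i, ((c i).val : ℤ) • e i : K), Subtype.mem _, ?_⟩
    ext i
    rw [hr _ (Subtype.mem _), Subtype.coe_eta, Module.Basis.repr_sum_self]
    simp
  · have h1 : m = ∑ i, e.repr ⟨x, hx⟩ i * ∑ j, A i j * e.repr ⟨y, hy⟩ j := by
      have : (m : ℚ) = ∑ i, e.repr ⟨x, hx⟩ i * ∑ j, (A i j : ℚ) * e.repr ⟨y, hy⟩ j := by
        rw [← hm]
        conv_lhs => rw [eq_sum_repr e hx, eq_sum_repr e hy]
        rw [LinearMap.map_sum₂]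
        refine Finset.sum_congr rfl fun i _ => ?_
        rw [map_zsmul, LinearMap.smul_apply, zsmul_eq_mul, map_sum]
        congr 1
        refine Finset.sum_congr rfl fun j _ => ?_
        rw [map_zsmul, zsmul_eq_mul, mul_comm]
        congr 1
        exact congrFun (congrFun hA i) j
      exact_mod_cast this
    rw [h1, gramForm]
    simp only [dotProduct, Matrix.mulVec, hr x hx, hr y hy, Matrix.map_apply]
    push_cast
    rfl

variable {G : Matrix (Fin 3) (Fin 3) (ZMod p)} {r : V → Fin 3 → ZMod p} (hr : IsReduction B K G r)

include hK hpM hr in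
-- A vector in the radical modulo `p` would be primitive with all products divisible by `p`, against
-- unimodularity at `p`.
theorem IsReduction.det_ne_zero : G.det ≠ 0 := by
  intro h
  obtain ⟨y, hy, h0⟩ := Matrix.exists_vecMul_eq_zero_iff.2 h
  obtain ⟨x, hx, rfl⟩ := hr.surj y
  obtain ⟨z, hz, m, hm, hpm⟩ := exists_not_dvd_form (p := p) hK hp.out hpM hx
    fun y' hy' hxy => hy ((hr.eq_zero_iff x hx).2 ⟨y', hy', hxy⟩)
  have h1 := hr.form x hx z hz m hm
  rw [gramForm, Matrix.dotProduct_mulVec, h0, zero_dotProduct, eq_comm, ZMod.intCast_zmod_eq_zero_iff_dvd] at h1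
  exact hpm h1

include hK hr in
theorem IsReduction.mem_perpLattice_iff {x w : V} (hx : x ∈ K) (hw : w ∈ K) :
    x ∈ perpLattice B p K w ↔ gramForm G (r x) (r w) = 0 := by
  obtain ⟨m, hm⟩ := hK.integral x hx w hw
  rw [hr.form x hx w hw m hm, ZMod.intCast_zmod_eq_zero_iff_dvd]
  constructor
  · rintro ⟨-, k, hk⟩
    exact ⟨k, by rw [hm] at hk; exact_mod_cast hk⟩
  · rintro ⟨k, rfl⟩
    exact ⟨hx, k, by rw [hm]; push_cast; rfl⟩

include hr in
theorem IsReduction.exists_eq_add {x y : V} (hx : x ∈ K) (hy : y ∈ K) {c : ZMod p} (h : r x = c • r y) :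
    ∃ z ∈ K, x = (c.val : ℤ) • y + p • z := by
  have h1 : r (x + (-(c.val : ℤ)) • y) = 0 := by
    rw [hr.add x hx _ (zsmul_mem hy _), hr.zsmul y hy, h, Int.cast_neg, neg_smul]
    simp
  obtain ⟨z, hz, hxz⟩ := (hr.eq_zero_iff _ (add_mem hx (zsmul_mem hy _))).1 h1
  exact ⟨z, hz, by rw [← hxz, neg_smul]; abel⟩

include hr in
theorem IsReduction.add_nsmul {x z : V} (hx : x ∈ K) (hz : z ∈ K) : r (x + p • z) = r x := by
  rw [hr.add x hx _ (nsmul_mem hz p), (hr.eq_zero_iff _ (nsmul_mem hz p)).2 ⟨z, hz, rfl⟩, add_zero]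

include hr in
theorem IsReduction.ne_zero {x : V} (hx : IsNeighborVector B p K x) : r x ≠ 0 := fun h => by
  obtain ⟨y, hy, hxy⟩ := (hr.eq_zero_iff x hx.mem).1 h
  exact hx.prim y hy hxy

include hr in
theorem IsReduction.exists_eq_smul_of_mem {x w : V} (hw : IsNeighborVector B p K w) (hx : x ∈ neighbor B p K w) :
    ∃ c : ZMod p, r (p • x) = c • r w := by
  obtain ⟨z, hz, c, rfl⟩ := mem_neighbor.1 hx
  refine ⟨c, ?_⟩
  rw [smul_add, smul_comm p c, nsmul_inv_smul hp.out, add_comm, hr.add_nsmul (zsmul_mem hw.mem c) hz.1,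
    hr.zsmul _ hw.mem]

include hK in
omit hp in
theorem isotropic_of_mem_neighbor (hsymm : B.IsSymm) (hp : p.Prime) {x w : V} (hw : IsNeighborVector B p K w)
    (hx : x ∈ neighbor B p K w) : ∃ k : ℤ, B (p • x) (p • x) = p ^ 2 * k := by
  obtain ⟨z, ⟨hz, j, hj⟩, c, rfl⟩ := mem_neighbor.1 hx
  obtain ⟨q, hq⟩ := hK.integral z hz z hz
  obtain ⟨k, hk⟩ := hw.isotropic
  refine ⟨q + 2 * c * j + c ^ 2 * k, ?_⟩
  rw [smul_add, smul_comm p c, nsmul_inv_smul hp, form_add_self hsymm, ← natCast_zsmul, form_zsmul, form_zsmul_left,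
    form_zsmul, form_zsmul_left, form_zsmul, form_zsmul_left, hq, hj, hk]
  push_cast
  ring

include hsymm hK hpM hp2 hr in
open Classical in
-- Neighbors correspond to isotropic lines of `K/pK`. A vector of `pK` lies in all `p + 1`; a vector
-- `x ∈ K` outside `pK` lies in those whose line is orthogonal to `x`, which
-- `sum_isoPoint_orthogonal` counts; and `x ∉ K` can lie only in the neighbor given by the line of
-- `px`, and does so exactly if `p² ∣ Q(px)`.
theorem IsReduction.exists_neighbors (hG : G.IsSymm) :
    ∃ n : Option (ZMod p) → Submodule ℤ V, Function.Injective n ∧ (∀ K', IsNeighbor B p K K' ↔ ∃ o, n o = K') ∧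
      ∀ x, p • x ∈ K → (∑ o, if x ∈ n o then (1 : ℤ) else 0) =
        (if ∃ k : ℤ, B (p • x) (p • x) = p ^ 2 * k then 1 else 0) +
        (if x ∈ K then quadraticChar (ZMod p) (-(G.det * (B x x).num)) else 0) +
        if (p : ℚ)⁻¹ • x ∈ K then (p : ℤ) else 0 := by
  have hdet := hr.det_ne_zero hK hpM
  obtain ⟨u, v, w, h⟩ := exists_isHyperbolic hG hdet hp2
  have hiso : ∀ x, IsNeighborVector B p K x → ∃ (o : Option (ZMod p)) (c : ZMod p), r x = c • isoPoint G u v w o := by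
    intro x hx
    obtain ⟨k, hk⟩ := hx.isotropic
    refine exists_eq_smul_isoPoint hdet hp2 h ?_
    rw [hr.form x hx.mem x hx.mem (p ^ 2 * k) (by rw [hk]; push_cast; rfl)]
    simp
  have hlift : ∀ o, ∃ x, IsNeighborVector B p K x ∧ r x = isoPoint G u v w o := fun o => by
    obtain ⟨x, hx, hxo⟩ := hr.surj (isoPoint G u v w o)
    obtain ⟨m, hm⟩ := hK.integral x hx x hx
    have h1 := hr.form x hx x hx m hm
    rw [hxo, gramForm_isoPoint_self hG hp2 h, eq_comm, ZMod.intCast_zmod_eq_zero_iff_dvd] at h1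
    obtain ⟨k, rfl⟩ := h1
    obtain ⟨z, hz, hxz⟩ := exists_isNeighborVector hsymm hK hp.out hpM hp2 hx
      (fun y hy hxy => isoPoint_ne_zero hG h o (hxo ▸ (hr.eq_zero_iff x hx).2 ⟨y, hy, hxy⟩))
      (k := k) (by rw [hm]; push_cast; rfl)
    exact ⟨_, hxz, by rw [hr.add_nsmul hx hz, hxo]⟩
  choose y hy hyo using hlift
  have hle : ∀ x x', IsNeighborVector B p K x → IsNeighborVector B p K x' → ∀ c : ZMod p, r x = c • r x' →
      neighbor B p K x ≤ neighbor B p K x' := fun x x' hx hx' c hc => by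
    obtain ⟨z, hz, hxz⟩ := hr.exists_eq_add hx.mem hx'.mem hc
    exact neighbor_le_of_eq_add hsymm hK hp.out hp2 hx hx' hz hxz
  have heq : ∀ x, IsNeighborVector B p K x → ∀ o (c : ZMod p), r x = c • isoPoint G u v w o →
      neighbor B p K x = neighbor B p K (y o) := fun x hx o c hc => by
    rw [← hyo] at hc
    have hc0 : c ≠ 0 := fun h0 => hr.ne_zero hx (by rw [hc, h0, zero_smul])
    exact le_antisymm (hle x _ hx (hy o) c hc) (hle _ x (hy o) hx c⁻¹ (by rw [hc, inv_smul_smul₀ hc0]))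
  have hmem : ∀ x ∈ K, ∀ o, x ∈ neighbor B p K (y o) ↔ gramForm G (r x) (isoPoint G u v w o) = 0 := fun x hx o => by
    rw [← hyo, ← hr.mem_perpLattice_iff hK hx (hy o).mem]
    exact ⟨mem_perpLattice_of_mem hp.out (hy o) hx, fun h => perpLattice_le_neighbor h⟩
  refine ⟨fun o => neighbor B p K (y o), fun o o' hoo => ?_, fun K' => ⟨?_, ?_⟩, fun x hx => ?_⟩
  · have h1 : (p : ℚ)⁻¹ • y o ∈ neighbor B p K (y o') := by
      rw [← show neighbor B p K (y o) = neighbor B p K (y o') from hoo]; exact inv_smul_mem_neighbor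
    obtain ⟨c, hc⟩ := hr.exists_eq_smul_of_mem (hy o') h1
    rw [nsmul_inv_smul hp.out, hyo, hyo] at hc
    exact isoPoint_injective hG h hdet hc
  · rintro ⟨x, hx, rfl⟩
    obtain ⟨o, c, hc⟩ := hiso x hx
    exact ⟨o, (heq x hx o c hc).symm⟩
  · rintro ⟨o, rfl⟩
    exact ⟨y o, hy o, rfl⟩
  · have hpx : (p : ℚ)⁻¹ • x ∈ K ↔ ∃ z ∈ K, x = p • z :=
      ⟨fun h => ⟨_, h, (nsmul_inv_smul hp.out x).symm⟩, fun ⟨z, hz, hxz⟩ => by rwa [hxz, inv_smul_nsmul hp.out]⟩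
    by_cases hxK : x ∈ K
    · obtain ⟨m, hm⟩ := hK.integral x hxK x hxK
      have h1 : ∃ k : ℤ, B (p • x) (p • x) = p ^ 2 * k := ⟨m, by
        rw [← natCast_zsmul, form_zsmul, form_zsmul_left, hm]; push_cast; ring⟩
      have h2 := hr.form x hxK x hxK m hm
      simp only [hmem x hxK]
      rw [if_pos h1, if_pos hxK, hm, Rat.num_intCast, ← h2, hpx, ← hr.eq_zero_iff x hxK]
      by_cases h0 : r x = 0
      · rw [h0]
        simp [gramForm, add_comm]
      · rw [if_neg h0, sum_isoPoint_orthogonal hdet hp2 h h0, add_zero]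
    · have h3 : ¬ (p : ℚ)⁻¹ • x ∈ K := by
        rw [hpx]
        rintro ⟨z, hz, rfl⟩
        exact hxK (nsmul_mem hz p)
      rw [if_neg hxK, if_neg h3, add_zero, add_zero]
      · by_cases hk : ∃ k : ℤ, B (p • x) (p • x) = p ^ 2 * k
        · have hpx' : IsNeighborVector B p K (p • x) := ⟨hx, fun y hy hxy => hxK (by
            rw [← inv_smul_nsmul hp.out x, hxy, inv_smul_nsmul hp.out]; exact hy), hk⟩
          obtain ⟨o, c, hc⟩ := hiso _ hpx'
          have : ∀ o', x ∈ neighbor B p K (y o') ↔ o' = o := fun o' => by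
            constructor
            · intro hxo
              obtain ⟨c', hc'⟩ := hr.exists_eq_smul_of_mem (hy o') hxo
              have hc0 : c' ≠ 0 := fun h0 => hr.ne_zero hpx' (by rw [hc', h0, zero_smul])
              refine isoPoint_injective hG h hdet (c := c'⁻¹ * c) ?_
              rw [mul_smul, ← hc, hc', inv_smul_smul₀ hc0, hyo]
            · rintro rfl
              rw [← heq _ hpx' _ c hc]
              have := inv_smul_mem_neighbor (B := B) (p := p) (K := K) (w := p • x)
              rwa [inv_smul_nsmul hp.out] at this
          simp only [this, if_pos hk]
          simp
        · rw [if_neg hk]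
          exact Finset.sum_eq_zero fun o _ => if_neg fun hxo =>
            hk (isotropic_of_mem_neighbor hK hsymm hp.out (hy o) hxo)

end

end

/-! ### The number of neighbors containing a vector, in terms of the discriminant -/

section

variable {V : Type*} [AddCommGroup V] [Module ℚ V]

section

variable {B : LinearMap.BilinForm ℚ V} (hsymm : B.IsSymm) (hpos : ∀ x : V, x ≠ 0 → 0 < B x x)
    (hdim : Module.finrank ℚ V = 3)

include hsymm hpos hdim in
theorem IsDiscr.isSquare_mul {δ δ' : ℤ} (hδ : IsDiscr B δ) (hδ' : IsDiscr B δ') : IsSquare (δ * δ') := by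
  obtain ⟨u, ho⟩ := exists_orthogonal hsymm hdim
  have hD : ∏ i, B (u i) (u i) ≠ 0 := (Finset.prod_pos fun i _ => hpos _ (u.ne_zero i)).ne'
  have h1 := ((hδ.2 u ho).mul (hδ'.2 u ho)).div (IsSquare.mul_self (∏ i, B (u i) (u i)))
  rw [← Rat.isSquare_intCast_iff]
  generalize ∏ i, B (u i) (u i) = D at h1 hD
  have h2 : (δ : ℚ) * D * (δ' * D) / (D * D) = ((δ * δ' : ℤ) : ℚ) := by
    push_cast; field_simp
  rwa [h2] at h1

variable {M : ℕ} {K : Submodule ℤ V} (hK : IsIntegralOfLevel B M K)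
    {p : ℕ} [hp : Fact p.Prime] (hpM : ¬ p ∣ M) (hp2 : p ≠ 2)

include hsymm hpos hdim hK hpM hp2 in
open Classical in
/-- A lattice has `p + 1` neighbors, and the number of those that contain a given vector is a local quantity. -/
theorem exists_neighbors {δ : ℤ} (hδ : IsDiscr B δ) (hpδ : ¬ (p : ℤ) ∣ δ) :
    ∃ n : Option (ZMod p) → Submodule ℤ V, Function.Injective n ∧ (∀ K', IsNeighbor B p K K' ↔ ∃ o, n o = K') ∧
      ∀ x, p • x ∈ K → (∑ o, if x ∈ n o then (1 : ℤ) else 0) =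
        (if ∃ k : ℤ, B (p • x) (p • x) = p ^ 2 * k then 1 else 0) +
        (if x ∈ K then kronecker (4 * δ) p * quadraticChar (ZMod p) (-((B x x).num : ZMod p)) else 0) +
        if (p : ℚ)⁻¹ • x ∈ K then (p : ℤ) else 0 := by
  obtain ⟨e⟩ := hK.lattice.exists_basis hdim
  obtain ⟨A, hA⟩ := exists_int_gram hK.integral e
  obtain ⟨r, hr⟩ := exists_isReduction (p := p) e hA
  have hG : (A.map (Int.cast : ℤ → ZMod p)).IsSymm := by
    ext i j
    have h1 : (A j i : ℚ) = A i j := by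
      rw [show (A j i : ℚ) = gram B e j i from (congrFun (congrFun hA j) i).symm,
        show (A i j : ℚ) = gram B e i j from (congrFun (congrFun hA i) j).symm]
      exact hsymm.eq _ _
    rw [Matrix.transpose_apply, Matrix.map_apply, Matrix.map_apply, (by exact_mod_cast h1 : A j i = A i j)]
  have hdet : (A.map (Int.cast : ℤ → ZMod p)).det = (A.det : ZMod p) := (Int.cast_det A).symm
  have hd := isDiscr_discr hsymm hpos hdim hK.integral e
  have hAd : discr B e = A.det := by
    have h1 := discr_eq hK.integral e
    rw [hA, show (A.map (Int.cast : ℤ → ℚ)).det = (A.det : ℚ) from (Int.cast_det A).symm] at h1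
    exact_mod_cast h1
  have hne := hr.det_ne_zero hK hpM
  rw [hdet, ne_eq, ZMod.intCast_zmod_eq_zero_iff_dvd] at hne
  have hpZ := Nat.prime_iff_prime_int.1 hp.out
  -- The Gram determinant of `K` may differ from `δ`, but only by a square factor, and both are
  -- prime to `p`.
  have hchar : quadraticChar (ZMod p) (A.det : ZMod p) = kronecker (4 * δ) p := by
    have hodd : (p : ℤ) % 2 = 1 := by
      have := hp.out.eq_two_or_odd; omega
    rw [kronecker_four_mul hδ.1 hodd, jacobiSym_eq_of_isSquare_mul (t := A.det)
      (hAd ▸ hδ.isSquare_mul hsymm hpos hdim hd) (hpZ.coprime_iff_not_dvd.2 hpδ).symm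
      (hpZ.coprime_iff_not_dvd.2 hne).symm, Int.natAbs_natCast, ← jacobiSym.legendreSym.to_jacobiSym]
    rfl
  obtain ⟨n, hn1, hn2, hn3⟩ := hr.exists_neighbors hsymm hK hpM hp2 hG
  refine ⟨n, hn1, hn2, fun x hx => ?_⟩
  rw [hn3 x hx, hdet, ← hchar, ← map_mul, mul_neg]

end

end

section

/-! ## Reduction of ternary lattices -/

/-- It suffices to treat `C = B`, since raising `C` adds more on the right. If `P + R ≤ A`, crude
estimates do. Otherwise `T = P + R - A` satisfies `S ≤ B - T`, and `(A - P)(A - R) ≥ 0` gives `AT ≤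
PR`. -/
theorem reduced_ineq_of_nonneg {A B C P R S : ℚ} (hA : 0 < A) (hAB : A ≤ B) (hBC : B ≤ C) (hP : 0 ≤ P) (hPA : P ≤ A)
    (hR : 0 ≤ R) (hRA : R ≤ A) (hS : 0 ≤ S) (hSB : S ≤ B) (h : P + R + S ≤ A + B) :
    P * R * S + A * S ^ 2 + B * R ^ 2 + C * P ^ 2 ≤ 2 * (A * B * C) := by
  have hB : 0 < B := hA.trans_le hAB
  have h1 : P * R * S + A * S ^ 2 + B * R ^ 2 + B * P ^ 2 ≤ 2 * (A * B * B) := by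
    have hPR : 0 ≤ P * R := mul_nonneg hP hR
    rcases le_total (P + R) A with hc | hc
    · have e1 : P * R * S ≤ P * R * B := mul_le_mul_of_nonneg_left hSB hPR
      have e2 : A * S ^ 2 ≤ A * B ^ 2 := by gcongr
      have e3 : B * (P + R) ^ 2 ≤ B * A ^ 2 := by gcongr
      have e4 : A * B * A ≤ A * B * B := by gcongr
      have e5 : 0 ≤ B * (P * R) := by positivity
      nlinarith
    · obtain ⟨T, hT⟩ : ∃ T, T = P + R - A := ⟨_, rfl⟩
      have hT0 : 0 ≤ T := by linarith
      have hTA : T ≤ A := by linarith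
      have hST : S ≤ B - T := by linarith
      have e1 : P * R * S ≤ P * R * (B - T) := mul_le_mul_of_nonneg_left hST hPR
      have e2 : A * S ^ 2 ≤ A * (B - T) ^ 2 := by gcongr
      have e3 : A * T ≤ P * R := by
        have := mul_nonneg (sub_nonneg.2 hPA) (sub_nonneg.2 hRA)
        rw [hT]; linarith
      have e4 : A * T * (B + T) ≤ P * R * (B + T) := mul_le_mul_of_nonneg_right e3 (by linarith)
      have e5 : B * (R ^ 2 + P ^ 2) = B * (A + T) ^ 2 - 2 * B * (P * R) := by rw [hT]; ring
      have e6 : A * B * A ≤ A * B * B := by gcongr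
      have e7 : 0 ≤ B * T * (A - T) := mul_nonneg (mul_nonneg hB.le hT0) (by linarith)
      linarith
  have h2 : 0 ≤ (C - B) * (2 * (A * B) - P ^ 2) := by
    refine mul_nonneg (by linarith) ?_
    have : P ^ 2 ≤ A * B := by rw [sq]; exact mul_le_mul hPA (hPA.trans hAB) hP hA.le
    have : 0 < A * B := mul_pos hA hB
    linarith
  linarith

/-- The right side is four times the determinant of the ternary form with diagonal `A, B, C` and
doubled products `f, g, h`. If `fgh ≥ 0`, each negative term is at most `ABC`. If `fgh < 0`, one of
the four sign conditions bounds `|f| + |g| + |h|` and `reduced_ineq_of_nonneg` applies. -/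
theorem reduced_ineq {A B C f g h : ℚ} (hA : 0 < A) (hAB : A ≤ B) (hBC : B ≤ C) (hf : |f| ≤ A) (hg : |g| ≤ A)
    (hh : |h| ≤ B) (h1 : 0 ≤ A + B + g + h + f) (h2 : 0 ≤ A + B + g - h - f) (h3 : 0 ≤ A + B - g + h - f)
    (h4 : 0 ≤ A + B - g - h + f) :
    A * B * C ≤ 4 * (A * B * C) + f * g * h - A * h ^ 2 - B * g ^ 2 - C * f ^ 2 := by
  have hB : 0 < B := hA.trans_le hAB
  have hC : 0 < C := hB.trans_le hBC
  have hABC : 0 < A * B * C := by positivity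
  have pos : 0 ≤ f * g * h → A * B * C ≤ 4 * (A * B * C) + f * g * h - A * h ^ 2 - B * g ^ 2 - C * f ^ 2 := by
    intro hfgh
    have e1 : A * h ^ 2 ≤ A * (B * C) := by
      rw [← sq_abs, sq]; gcongr; exact hh.trans hBC
    have e2 : B * g ^ 2 ≤ B * (A * C) := by
      rw [← sq_abs, sq]; gcongr; exact (hg.trans hAB).trans hBC
    have e3 : C * f ^ 2 ≤ C * (A * B) := by
      rw [← sq_abs, sq]; gcongr; exact hf.trans hAB
    linarith
  have neg : |f| + |g| + |h| ≤ A + B → f * g * h = -(|f| * |g| * |h|) →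
      A * B * C ≤ 4 * (A * B * C) + f * g * h - A * h ^ 2 - B * g ^ 2 - C * f ^ 2 := by
    intro hs hm
    have := reduced_ineq_of_nonneg hA hAB hBC (abs_nonneg f) hf (abs_nonneg g) hg (abs_nonneg h) hh hs
    rw [sq_abs, sq_abs, sq_abs] at this
    linarith
  rcases le_total 0 f with hf0 | hf0 <;> rcases le_total 0 g with hg0 | hg0 <;> rcases le_total 0 h with hh0 | hh0
  · exact pos (mul_nonneg (mul_nonneg hf0 hg0) hh0)
  · refine neg ?_ ?_
    · rw [abs_of_nonneg hf0, abs_of_nonneg hg0, abs_of_nonpos hh0]; linarith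
    · rw [abs_of_nonneg hf0, abs_of_nonneg hg0, abs_of_nonpos hh0]; ring
  · refine neg ?_ ?_
    · rw [abs_of_nonneg hf0, abs_of_nonpos hg0, abs_of_nonneg hh0]; linarith
    · rw [abs_of_nonneg hf0, abs_of_nonpos hg0, abs_of_nonneg hh0]; ring
  · exact pos (mul_nonneg_of_nonpos_of_nonpos (mul_nonpos_of_nonneg_of_nonpos hf0 hg0) hh0)
  · refine neg ?_ ?_
    · rw [abs_of_nonpos hf0, abs_of_nonneg hg0, abs_of_nonneg hh0]; linarith
    · rw [abs_of_nonpos hf0, abs_of_nonneg hg0, abs_of_nonneg hh0]; ring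
  · exact pos (mul_nonneg_of_nonpos_of_nonpos (mul_nonpos_of_nonpos_of_nonneg hf0 hg0) hh0)
  · exact pos (mul_nonneg (mul_nonneg_of_nonpos_of_nonpos hf0 hg0) hh0)
  · refine neg ?_ ?_
    · rw [abs_of_nonpos hf0, abs_of_nonpos hg0, abs_of_nonpos hh0]; linarith
    · rw [abs_of_nonpos hf0, abs_of_nonpos hg0, abs_of_nonpos hh0]; ring

variable {V : Type*} [AddCommGroup V] [Module ℚ V]

theorem span_triple_add {W : Type*} [AddCommGroup W] (x y z : W) (c d : ℤ) :
    Submodule.span ℤ {x, y, z + c • x + d • y} = Submodule.span ℤ {x, y, z} := by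
  apply le_antisymm
  · rw [Submodule.span_le]
    have hx : x ∈ Submodule.span ℤ {x, y, z} := Submodule.subset_span (by simp)
    have hy : y ∈ Submodule.span ℤ {x, y, z} := Submodule.subset_span (by simp)
    have hz : z ∈ Submodule.span ℤ {x, y, z} := Submodule.subset_span (by simp)
    rintro _ (rfl | rfl | rfl)
    · exact hx
    · exact hy
    · exact add_mem (add_mem hz (zsmul_mem hx c)) (zsmul_mem hy d)
  · rw [Submodule.span_le]
    have hx : x ∈ Submodule.span ℤ {x, y, z + c • x + d • y} := Submodule.subset_span (by simp)
    have hy : y ∈ Submodule.span ℤ {x, y, z + c • x + d • y} := Submodule.subset_span (by simp)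
    have hz : z + c • x + d • y ∈ Submodule.span ℤ {x, y, z + c • x + d • y} := Submodule.subset_span (by simp)
    rintro _ (rfl | rfl | rfl)
    · exact hx
    · exact hy
    · have := sub_mem (sub_mem hz (zsmul_mem hy d)) (zsmul_mem hx c)
      rwa [add_sub_cancel_right, add_sub_cancel_right] at this

/-- `x, y, z` generate `K` and the sum of their norms is minimal. -/
structure IsMinimalTriple (B : LinearMap.BilinForm ℚ V) (K : Submodule ℤ V) (x y z : V) : Prop where
  span : Submodule.span ℤ {x, y, z} = K
  le : ∀ x' y' z', Submodule.span ℤ {x', y', z'} = K → B x x + B y y + B z z ≤ B x' x' + B y' y' + B z' z'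

namespace IsMinimalTriple

variable {B : LinearMap.BilinForm ℚ V} {K : Submodule ℤ V} {x y z : V}

theorem swap_left (h : IsMinimalTriple B K x y z) : IsMinimalTriple B K y x z :=
  ⟨by rw [Set.insert_comm]; exact h.span, fun x' y' z' h' => by rw [add_comm (B y y)]; exact h.le x' y' z' h'⟩

theorem swap_right (h : IsMinimalTriple B K x y z) : IsMinimalTriple B K x z y :=
  ⟨by rw [Set.pair_comm]; exact h.span, fun x' y' z' h' => by rw [add_right_comm]; exact h.le x' y' z' h'⟩

theorem exists_monotone (h : IsMinimalTriple B K x y z) :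
    ∃ x y z, IsMinimalTriple B K x y z ∧ B x x ≤ B y y ∧ B y y ≤ B z z := by
  rcases le_total (B x x) (B y y) with h1 | h1 <;> rcases le_total (B y y) (B z z) with h2 | h2 <;>
    rcases le_total (B x x) (B z z) with h3 | h3
  · exact ⟨x, y, z, h, h1, h2⟩
  · exact ⟨x, y, z, h, h1, h2⟩
  · exact ⟨x, z, y, h.swap_right, h3, h2⟩
  · exact ⟨z, x, y, h.swap_right.swap_left, h3, h1⟩
  · exact ⟨y, x, z, h.swap_left, h1, h3⟩
  · exact ⟨y, z, x, h.swap_left.swap_right, h2, h3⟩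
  · exact ⟨z, y, x, h.swap_left.swap_right.swap_left, h2, h1⟩
  · exact ⟨z, y, x, h.swap_left.swap_right.swap_left, h2, h1⟩

theorem le_add (h : IsMinimalTriple B K x y z) (hsymm : B.IsSymm) (c d : ℤ) :
    0 ≤ c ^ 2 * B x x + d ^ 2 * B y y + 2 * c * B x z + 2 * d * B y z + 2 * c * d * B x y := by
  have h1 := h.le x y (z + c • x + d • y) (by rw [span_triple_add]; exact h.span)
  rw [form_add_self hsymm, form_add_self hsymm, form_zsmul, form_zsmul, form_zsmul, form_zsmul, form_zsmul_left, form_zsmul_left,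
    map_add, LinearMap.add_apply, form_zsmul_left, hsymm.eq z x, hsymm.eq z y] at h1
  linarith

/-- Minimality compared with `z ± x`, `z ± y`, `z ± x ± y` and `y ± x` yields precisely the
inequalities of a reduced form. -/
theorem mul_le (h : IsMinimalTriple B K x y z) (hsymm : B.IsSymm) (hx : 0 < B x x) (hxy : B x x ≤ B y y)
    (hyz : B y y ≤ B z z) : B x x * B y y * B z z ≤
      4 * (B x x * B y y * B z z + 2 * B x y * B x z * B y z - B x x * B y z ^ 2 - B y y * B x z ^ 2 -
        B z z * B x y ^ 2) := by
  have e1 := h.le_add hsymm 1 0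
  have e2 := h.le_add hsymm (-1) 0
  have e3 := h.le_add hsymm 0 1
  have e4 := h.le_add hsymm 0 (-1)
  have e5 := h.le_add hsymm 1 1
  have e6 := h.le_add hsymm 1 (-1)
  have e7 := h.le_add hsymm (-1) 1
  have e8 := h.le_add hsymm (-1) (-1)
  have e9 := h.swap_right.le_add hsymm 1 0
  have e10 := h.swap_right.le_add hsymm (-1) 0
  push_cast at *
  have := reduced_ineq (f := 2 * B x y) (g := 2 * B x z) (h := 2 * B y z) hx hxy hyz
    (abs_le.2 ⟨by linarith, by linarith⟩) (abs_le.2 ⟨by linarith, by linarith⟩) (abs_le.2 ⟨by linarith, by linarith⟩)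
    (by linarith) (by linarith) (by linarith) (by linarith)
  linarith

end IsMinimalTriple

end

/-! ### Bases of bounded norm -/

section

variable {V : Type*} [AddCommGroup V] [Module ℚ V]

section

variable {B : LinearMap.BilinForm ℚ V} (hsymm : B.IsSymm) (hpos : ∀ x : V, x ≠ 0 → 0 < B x x)
    (hdim : Module.finrank ℚ V = 3) {M : ℕ} {K : Submodule ℤ V} (hK : IsIntegralOfLevel B M K)

include hpos in
theorem form_self_nonneg (x : V) : 0 ≤ B x x := by
  by_cases h : x = 0
  · simp [h]
  · exact (hpos x h).le

include hpos hdim hK in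
theorem exists_isMinimalTriple : ∃ x y z, IsMinimalTriple B K x y z := by
  obtain ⟨e⟩ := hK.lattice.exists_basis hdim
  let S : Set ℕ := {n | ∃ x y z, Submodule.span ℤ {x, y, z} = K ∧ B x x + B y y + B z z = n}
  have hnat : ∀ x y z, Submodule.span ℤ {x, y, z} = K → ∃ n : ℕ, B x x + B y y + B z z = n := by
    intro x y z h
    have hm : ∀ w ∈ ({x, y, z} : Set V), ∃ n : ℕ, B w w = n := fun w hw => by
      have hwK : w ∈ K := h ▸ Submodule.subset_span hw
      obtain ⟨m, hm⟩ := hK.integral w hwK w hwK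
      have h0 : 0 ≤ m := by
        have := form_self_nonneg hpos w
        rw [hm] at this
        exact_mod_cast this
      exact ⟨m.toNat, by rw [hm]; exact_mod_cast (Int.toNat_of_nonneg h0).symm⟩
    obtain ⟨a, ha⟩ := hm x (by simp)
    obtain ⟨b, hb⟩ := hm y (by simp)
    obtain ⟨c, hc⟩ := hm z (by simp)
    exact ⟨a + b + c, by rw [ha, hb, hc]; push_cast; rfl⟩
  have hspan : Submodule.span ℤ {(e 0 : V), (e 1 : V), (e 2 : V)} = K := by
    apply le_antisymm
    · rw [Submodule.span_le]
      rintro _ (rfl | rfl | rfl) <;> exact Subtype.mem _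
    · intro x hx
      rw [eq_sum_repr e hx, Fin.sum_univ_three]
      refine add_mem (add_mem ?_ ?_) ?_ <;> exact zsmul_mem (Submodule.subset_span (by simp)) _
  have hne : S.Nonempty := by
    obtain ⟨n, hn⟩ := hnat _ _ _ hspan
    exact ⟨n, _, _, _, hspan, hn⟩
  obtain ⟨x, y, z, h, hn⟩ := Nat.sInf_mem hne
  refine ⟨x, y, z, h, fun x' y' z' h' => ?_⟩
  obtain ⟨n', hn'⟩ := hnat x' y' z' h'
  rw [hn, hn']
  exact_mod_cast Nat.sInf_le (show n' ∈ S from ⟨x', y', z', h', hn'⟩)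

/-- `M` times the dual basis has integral coordinates with respect to `b`, so `M` times the inverse
Gram matrix is integral; the claim follows by taking determinants. -/
theorem det_gram_dvd (b : Module.Basis (Fin 3) ℚ V) (hpos : ∀ x : V, x ≠ 0 → 0 < B x x) (hdim : Module.finrank ℚ V = 3)
    (hK : IsIntegralOfLevel B M K)
    (hb : ∀ x, x ∈ K ↔ ∃ n, x = pt b n) : ∃ m : ℤ, (M : ℚ) ^ 3 = m * (Matrix.of fun i j => B (b i) (b j)).det := by
  have : FiniteDimensional ℚ V := Module.finite_of_finrank_pos (by omega)
  set b' := B.dualBasis (nondegenerate_of_pos hpos) b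
  have h1 : ∀ i, ∃ n, M • b' i = pt b n := fun i => by
    rw [← hb]
    refine hK.dual _ fun x hx => ?_
    obtain ⟨n, rfl⟩ := (hb x).1 hx
    refine ⟨n i, ?_⟩
    rw [pt, map_sum, Finset.sum_eq_single i]
    · rw [map_smul, LinearMap.BilinForm.apply_dualBasis_left, if_pos rfl]; simp
    · intro j _ hj
      rw [map_smul, LinearMap.BilinForm.apply_dualBasis_left, if_neg hj, smul_zero]
    · simp
  choose C hC using h1
  have h2 : (Matrix.of C).map (Int.cast : ℤ → ℚ) * (Matrix.of fun i j => B (b i) (b j)) =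
      (M : ℚ) • (1 : Matrix (Fin 3) (Fin 3) ℚ) := by
    ext i j
    have := congrArg (fun x => B x (b j)) (hC i)
    simp only [map_nsmul, LinearMap.smul_apply, LinearMap.BilinForm.apply_dualBasis_left, b', pt, map_sum, LinearMap.sum_apply,
      map_smul] at this
    rw [Matrix.mul_apply, Matrix.smul_apply, Matrix.one_apply]
    simp only [Matrix.map_apply, Matrix.of_apply, smul_eq_mul]
    simp only [smul_eq_mul, nsmul_eq_mul] at this
    rw [← this]
    simp [eq_comm]
  refine ⟨(Matrix.of C).det, ?_⟩
  have h3 := congrArg Matrix.det h2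
  rw [Matrix.det_mul, Matrix.det_smul, Matrix.det_one, Fintype.card_fin, mul_one,
    show ((Matrix.of C).map (Int.cast : ℤ → ℚ)).det = ((Matrix.of C).det : ℚ) from (Int.cast_det _).symm] at h3
  exact h3.symm

include hsymm hpos hdim hK in
/-- Lattices have bases of bounded norm. -/
theorem exists_bounded_basis (hM : M ≠ 0) : ∃ b : Module.Basis (Fin 3) ℚ V, (∀ x, x ∈ K ↔ ∃ n, x = pt b n) ∧
    ∀ i, B (b i) (b i) ≤ 4 * (M : ℚ) ^ 3 := by
  have : FiniteDimensional ℚ V := Module.finite_of_finrank_pos (by omega)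
  obtain ⟨x', y', z', h'⟩ := exists_isMinimalTriple hpos hdim hK
  obtain ⟨x, y, z, h, hxy, hyz⟩ := h'.exists_monotone
  have hK3 : ∀ w, w ∈ K ↔ ∃ n : Fin 3 → ℤ, w = ∑ i, (n i : ℚ) • ![x, y, z] i := fun w => by
    rw [← h.span]
    constructor
    · intro hw
      obtain ⟨a, b, c, rfl⟩ := Submodule.mem_span_triple.1 hw
      exact ⟨![a, b, c], by simp [Fin.sum_univ_three, Int.cast_smul_eq_zsmul]⟩
    · rintro ⟨n, rfl⟩
      exact Submodule.mem_span_triple.2 ⟨n 0, n 1, n 2, by simp [Fin.sum_univ_three, Int.cast_smul_eq_zsmul]⟩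
  have htop : ⊤ ≤ Submodule.span ℚ (Set.range ![x, y, z]) := by
    rw [← hK.lattice.2, Submodule.span_le]
    intro w hw
    obtain ⟨n, rfl⟩ := (hK3 w).1 hw
    exact sum_mem fun i _ => Submodule.smul_mem _ _ (Submodule.subset_span ⟨i, rfl⟩)
  have hli : LinearIndependent ℚ ![x, y, z] :=
    linearIndependent_of_top_le_span_of_card_eq_finrank htop (by simp [hdim])
  let b : Module.Basis (Fin 3) ℚ V := Module.Basis.mk hli htop
  have hb : ∀ i, b i = ![x, y, z] i := fun i => Module.Basis.mk_apply hli htop i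
  have hbK : ∀ w, w ∈ K ↔ ∃ n, w = pt b n := fun w => by rw [hK3]; simp only [pt, hb]
  have hint : ∀ i, ∃ m : ℤ, B (b i) (b i) = m := fun i => by
    have : b i ∈ K := h.span ▸ Submodule.subset_span (by rw [hb]; fin_cases i <;> simp)
    exact hK.integral _ this _ this
  have hone : ∀ i, 1 ≤ B (b i) (b i) := fun i => by
    obtain ⟨m, hm⟩ := hint i
    have := hpos _ (b.ne_zero i)
    rw [hm] at this ⊢
    exact_mod_cast this
  obtain ⟨m, hm⟩ := det_gram_dvd b hpos hdim hK hbK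
  have h0 := hone 0
  have h1 := hone 1
  have h2 := hone 2
  have hmul := h.mul_le hsymm (lt_of_lt_of_le one_pos (by simpa [hb] using h0)) hxy hyz
  have hdet : (Matrix.of fun i j => B (b i) (b j)).det = B x x * B y y * B z z + 2 * B x y * B x z * B y z -
      B x x * B y z ^ 2 - B y y * B x z ^ 2 - B z z * B x y ^ 2 := by
    rw [Matrix.det_fin_three]
    simp only [Matrix.of_apply, hb, Matrix.cons_val_zero, Matrix.cons_val_one, Matrix.cons_val]
    rw [hsymm.eq y x, hsymm.eq z x, hsymm.eq z y]
    ring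
  rw [← hdet] at hmul
  simp only [hb, Matrix.cons_val_zero, Matrix.cons_val_one, Matrix.cons_val] at h0 h1 h2
  have hle : (Matrix.of fun i j => B (b i) (b j)).det ≤ (M : ℚ) ^ 3 := by
    have hdpos : 0 < (Matrix.of fun i j => B (b i) (b j)).det := by
      have : 0 < B x x * B y y * B z z := by positivity
      linarith
    have hMpos : 0 < (M : ℚ) ^ 3 := by positivity
    rw [hm] at hMpos ⊢
    have : 0 < m := by
      have := (pos_iff_pos_of_mul_pos hMpos).2 hdpos
      exact_mod_cast this
    have : (1 : ℚ) ≤ m := by exact_mod_cast this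
    nlinarith
  -- The product of the norms is at most `4 det ≤ 4M³`, and the two smaller ones are integers at
  -- least `1`.
  have hzz : B z z ≤ 4 * (M : ℚ) ^ 3 := by
    have : 1 * B z z ≤ B x x * B y y * B z z := by
      gcongr
      nlinarith
    linarith
  refine ⟨b, hbK, fun i => ?_⟩
  rw [hb]
  fin_cases i
  · exact (hxy.trans hyz).trans hzz
  · exact hyz.trans hzz
  · exact hzz

end

end

section

variable {V : Type*} [AddCommGroup V] [Module ℚ V]

/-! ## Finiteness of the class number -/

section

variable {B : LinearMap.BilinForm ℚ V} (hsymm : B.IsSymm) (hpos : ∀ x : V, x ≠ 0 → 0 < B x x)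
    (hdim : Module.finrank ℚ V = 3) {M : ℕ} {K : Submodule ℤ V} (hK : IsIntegralOfLevel B M K)

include hsymm hpos in
theorem abs_form_le {x y : V} {C : ℚ} (hx : B x x ≤ C) (hy : B y y ≤ C) : |B x y| ≤ C := by
  have h1 := form_self_nonneg hpos (x + y)
  have h2 := form_self_nonneg hpos (x - y)
  rw [form_add_self hsymm] at h1
  rw [sub_eq_add_neg, form_add_self hsymm] at h2
  simp only [map_neg, LinearMap.neg_apply, neg_neg] at h2
  exact abs_le.2 ⟨by linarith, by linarith⟩

include hpos hdim in
theorem det_sq_eq_one {σ : V ≃ₗ[ℚ] V} (h : ∀ x y, B (σ x) (σ y) = B x y) :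
    LinearMap.det (σ : V →ₗ[ℚ] V) ^ 2 = 1 := by
  have : FiniteDimensional ℚ V := Module.finite_of_finrank_pos (by omega)
  let b := Module.finBasis ℚ V
  have h1 : B.comp (σ : V →ₗ[ℚ] V) (σ : V →ₗ[ℚ] V) = B := by
    ext x y; exact h x y
  have h2 := congrArg Matrix.det (LinearMap.BilinForm.toMatrix_comp b b B (σ : V →ₗ[ℚ] V) (σ : V →ₗ[ℚ] V))
  rw [h1, Matrix.det_mul, Matrix.det_mul, Matrix.det_transpose, LinearMap.det_toMatrix] at h2
  have h3 : (LinearMap.BilinForm.toMatrix b B).det ≠ 0 :=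
    (LinearMap.BilinForm.nondegenerate_iff_det_ne_zero b).1 (nondegenerate_of_pos hpos)
  have h4 : (LinearMap.BilinForm.toMatrix b B).det * (LinearMap.det (σ : V →ₗ[ℚ] V) ^ 2 - 1) = 0 := by
    linear_combination -h2
  exact sub_eq_zero.1 ((mul_eq_zero.1 h4).resolve_left h3)

include hsymm hpos hdim hK in
theorem finite_short_vectors (C : ℚ) : {x | x ∈ K ∧ B x x ≤ C}.Finite := by
  obtain ⟨u, -, ho, hu, -⟩ := exists_orthogonal_adapted (B := B) hsymm hdim hK.lattice one_ne_zero
  have hup := fun i => hpos _ (u.ne_zero i)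
  have hfin : {n : Fin 3 → ℤ | ∀ i, n i ∈ Set.Icc (-⌈C / B (u i) (u i)⌉) ⌈C / B (u i) (u i)⌉}.Finite := by
    have := Set.Finite.pi' fun i : Fin 3 => Set.finite_Icc (-⌈C / B (u i) (u i)⌉) ⌈C / B (u i) (u i)⌉
    exact this
  refine (hfin.image (pt u)).subset ?_
  rintro x ⟨hx, hxC⟩
  obtain ⟨n, rfl⟩ := hu x hx
  refine ⟨n, fun i => ?_, rfl⟩
  rw [form_pt ho] at hxC
  have h1 : B (u i) (u i) * (n i * n i) ≤ C := le_trans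
    (Finset.single_le_sum (f := fun i => B (u i) (u i) * ((n i : ℚ) * n i))
      (fun j _ => mul_nonneg (hup j).le (mul_self_nonneg _)) (Finset.mem_univ i)) hxC
  have h2 : (n i : ℚ) * n i ≤ C / B (u i) (u i) := by
    rw [le_div_iff₀ (hup i)]; linarith
  have h3 : n i * n i ≤ ⌈C / B (u i) (u i)⌉ := by
    have := h2.trans (Int.le_ceil _)
    exact_mod_cast this
  have h4 := Int.natAbs_le_self_sq (n i)
  rw [sq] at h4
  have h5 : |n i| ≤ ⌈C / B (u i) (u i)⌉ := by rw [Int.abs_eq_natAbs]; exact h4.trans h3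
  exact abs_le.1 h5

include hpos hdim in
/-- Two cosets with the same Gram matrix, orientation and coordinates modulo `a` belong to the same proper class. -/
theorem exists_rotation_of_same_data {b b' b₀ : Module.Basis (Fin 3) ℚ V} {X X' : Set V}
    (hg : ∀ i j, B (b i) (b j) = B (b' i) (b' j)) (hs : 0 < b₀.det b ↔ 0 < b₀.det b')
    (hX : ∀ x ∈ X, ∃ n, x = pt b n) (hX' : ∀ x ∈ X', ∃ n, x = pt b' n)
    (hc : ∀ n : Fin 3 → ℤ, pt b n ∈ X ↔ pt b' n ∈ X') : ∃ σ ∈ rotationGroup B, σ '' X = X' := by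
  have : FiniteDimensional ℚ V := Module.finite_of_finrank_pos (by omega)
  let σ : V ≃ₗ[ℚ] V := b.equiv b' (Equiv.refl _)
  have hσ : ∀ i, σ (b i) = b' i := fun i => by simp [σ]
  have hiso : ∀ x y, B (σ x) (σ y) = B x y := by
    have : B.comp (σ : V →ₗ[ℚ] V) (σ : V →ₗ[ℚ] V) = B := by
      refine LinearMap.BilinForm.ext_basis b fun i j => ?_
      change B (σ (b i)) (σ (b j)) = _
      rw [hσ, hσ, hg]
    intro x y
    exact congrFun (congrArg DFunLike.coe (congrFun (congrArg DFunLike.coe this) x)) y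
  have hpt : ∀ n, σ (pt b n) = pt b' n := fun n => by
    simp only [pt, map_sum, map_smul, hσ]
  have hdet : LinearMap.det (σ : V →ₗ[ℚ] V) = 1 := by
    have h1 : b₀.det b' = LinearMap.det (σ : V →ₗ[ℚ] V) * b₀.det b := by
      rw [← Module.Basis.det_comp]
      congr 1
      ext i
      exact (hσ i).symm
    have h2 := det_sq_eq_one hpos hdim hiso
    have h3 : (LinearMap.det (σ : V →ₗ[ℚ] V) - 1) * (LinearMap.det (σ : V →ₗ[ℚ] V) + 1) = 0 := by linear_combination h2
    -- The isometry has determinant `±1`; the value `-1` would reverse the orientation, against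
    -- `hs`.
    rcases mul_eq_zero.1 h3 with h | h
    · exact sub_eq_zero.1 h
    · rw [eq_neg_of_add_eq_zero_left h, neg_one_mul] at h1
      rw [h1] at hs
      have h4 : b₀.det b ≠ 0 := (b₀.isUnit_det b).ne_zero
      rcases h4.lt_or_gt with h5 | h5
      · exact absurd (hs.2 (by linarith)) h5.not_gt
      · have := hs.1 h5
        linarith
  refine ⟨σ, ⟨hiso, hdet⟩, ?_⟩
  ext x
  constructor
  · rintro ⟨y, hy, rfl⟩
    obtain ⟨n, rfl⟩ := hX y hy
    rw [hpt, ← hc]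
    exact hy
  · intro hx
    obtain ⟨n, rfl⟩ := hX' x hx
    exact ⟨pt b n, (hc n).2 hx, hpt n⟩

include hsymm hpos hdim in
-- The Gram matrix of a bounded basis, its orientation and the coordinates of the coset modulo `a`
-- take finitely many values, and they determine the proper class.
theorem finite_properClass {L : Submodule ℤ V} (hL : IsIntegralOfLevel B M L) (hM : M ≠ 0) {a : ℕ} (ha : a ≠ 0) {ν : V}
    (hν : ν ∈ L) : Finite (Quotient (properClass B (properGenus B a L ν))) := by
  classical
  have : NeZero a := ⟨ha⟩
  have : FiniteDimensional ℚ V := Module.finite_of_finrank_pos (by omega)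
  -- `b₀` only fixes an orientation of `V`.
  obtain ⟨b₀, -⟩ := exists_orthogonal hsymm hdim
  have key : ∀ X : properGenus B a L ν, ∃ (b : Module.Basis (Fin 3) ℚ V) (K : Submodule ℤ V) (μ : V),
      IsIntegralOfLevel B M K ∧ μ ∈ K ∧ (X : Set V) = latticeCoset a K μ ∧ (∀ x, x ∈ K ↔ ∃ n, x = pt b n) ∧
      ∀ i, B (b i) (b i) ≤ 4 * (M : ℚ) ^ 3 := fun X => by
    obtain ⟨K, μ, hK, hμ, hX, -⟩ := exists_of_mem_properGenus hsymm hpos hdim hL ha hν X.2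
    obtain ⟨b, hb, hbC⟩ := exists_bounded_basis hsymm hpos hdim hK hM
    exact ⟨b, K, μ, hK, hμ, hX, hb, hbC⟩
  choose b K μ hK hμ hX hbK hbC using key
  have hbmem : ∀ X i, b X i ∈ K X := fun X i => (hbK X _).2 ⟨Pi.single i 1, by
    simp [pt, Pi.single_apply]⟩
  have hg : ∀ X i j, ∃ m : Set.Icc (-(4 * (M : ℤ) ^ 3)) (4 * (M : ℤ) ^ 3), B (b X i) (b X j) = (m : ℤ) := fun X i j => by
    obtain ⟨m, hm⟩ := (hK X).integral _ (hbmem X i) _ (hbmem X j)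
    have h1 := abs_form_le hsymm hpos (hbC X i) (hbC X j)
    rw [hm, abs_le] at h1
    exact ⟨⟨m, by exact_mod_cast h1.1, by exact_mod_cast h1.2⟩, hm⟩
  choose g hg using hg
  let f : properGenus B a L ν → (Fin 3 → Fin 3 → Set.Icc (-(4 * (M : ℤ) ^ 3)) (4 * (M : ℤ) ^ 3)) × Prop ×
      Set (Fin 3 → ZMod a) := fun X => (g X, 0 < b₀.det (b X), {c | pt (b X) (fun i => (c i).val) ∈ (X : Set V)})
  have hf : ∀ X Y, f X = f Y → ∃ σ ∈ rotationGroup B, σ '' (X : Set V) = Y := fun X Y hXY => by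
    simp only [f, Prod.mk.injEq] at hXY
    obtain ⟨h1, h2, h3⟩ := hXY
    have hred : ∀ (Z : properGenus B a L ν) (n : Fin 3 → ℤ), pt (b Z) n ∈ (Z : Set V) ↔
        (fun i => (n i : ZMod a)) ∈ {c : Fin 3 → ZMod a | pt (b Z) (fun i => (c i).val) ∈ (Z : Set V)} := fun Z n => by
      have hk : ∀ i, ∃ k : ℤ, n i = ((n i : ZMod a).val : ℤ) + a * k := fun i => by
        rw [ZMod.val_intCast]
        exact ⟨n i / a, (Int.emod_add_mul_ediv _ _).symm⟩
      choose k hk using hk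
      have h4 : pt (b Z) n = pt (b Z) (fun i => ((n i : ZMod a).val : ℤ)) + a • pt (b Z) k := by
        rw [← natCast_zsmul, ← pt_smul, ← pt_add]
        congr 1
        ext i
        simpa using hk i
      rw [Set.mem_ofPred_eq, hX, h4]
      exact (mem_latticeCoset_add_iff ((hbK Z _).2 ⟨k, rfl⟩) _).symm
    refine exists_rotation_of_same_data hpos hdim (b := b X) (b' := b Y) (b₀ := b₀) (fun i j => ?_) h2.to_iff ?_ ?_ fun n => ?_
    · rw [hg, hg, h1]
    · intro x hx
      rw [← hbK]
      rw [hX] at hx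
      exact latticeCoset_subset (hμ X) hx
    · intro x hx
      rw [← hbK]
      rw [hX] at hx
      exact latticeCoset_subset (hμ Y) hx
    · rw [hred, hred, h3]
  refine Finite.of_injective (fun c : Quotient (properClass B (properGenus B a L ν)) => f c.out) fun c d hcd => ?_
  rw [← c.out_eq, ← d.out_eq]
  exact Quotient.sound (hf _ _ hcd)

include hsymm hpos hdim hK in
-- An element of the stabilizer preserves `K`, and it is determined by the images of a bounded
-- basis, which are among the finitely many short vectors.
theorem finite_stabilizer {a : ℕ} (ha : a ≠ 0) (μ : V) (hM : M ≠ 0) :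
    Finite {σ : V ≃ₗ[ℚ] V // σ ∈ rotationGroup B ∧ σ '' latticeCoset a K μ = latticeCoset a K μ} := by
  obtain ⟨b, hbK, hbC⟩ := exists_bounded_basis hsymm hpos hdim hK hM
  have hbmem : ∀ i, b i ∈ K := fun i => (hbK _).2 ⟨Pi.single i 1, by simp [pt, Pi.single_apply]⟩
  have hmem : ∀ σ : {σ : V ≃ₗ[ℚ] V // σ ∈ rotationGroup B ∧ σ '' latticeCoset a K μ = latticeCoset a K μ},
      ∀ i, σ.1 (b i) ∈ {x | x ∈ K ∧ B x x ≤ 4 * (M : ℚ) ^ 3} := by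
    rintro ⟨σ, hσ, hX⟩ i
    refine ⟨?_, (hσ.1 _ _).trans_le (hbC i)⟩
    obtain ⟨y, hy, h1⟩ : σ (a • b i + μ) ∈ latticeCoset a K μ := hX ▸ ⟨_, ⟨b i, hbmem i, rfl⟩, rfl⟩
    obtain ⟨y', hy', h2⟩ : σ μ ∈ latticeCoset a K μ := hX ▸ ⟨μ, ⟨0, zero_mem _, by simp⟩, rfl⟩
    rw [map_add, h2, map_nsmul] at h1
    have h3 : (a : ℚ) • σ (b i) = (a : ℚ) • (y - y') := by
      rw [Nat.cast_smul_eq_nsmul, Nat.cast_smul_eq_nsmul, smul_sub, eq_sub_iff_add_eq]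
      apply add_right_cancel (b := μ)
      rw [← h1, add_assoc]
    have h4 := smul_right_injective V (by exact_mod_cast ha : (a : ℚ) ≠ 0) h3
    simp only at h4 ⊢
    rw [h4]
    exact sub_mem hy hy'
  have := (finite_short_vectors hsymm hpos hdim hK (4 * (M : ℚ) ^ 3)).to_subtype
  refine Finite.of_injective (fun σ i => (⟨σ.1 (b i), hmem σ i⟩ : {x | x ∈ K ∧ B x x ≤ 4 * (M : ℚ) ^ 3})) fun σ τ h => ?_
  refine Subtype.ext (LinearEquiv.toLinearMap_injective (b.ext fun i => ?_))
  exact congrArg Subtype.val (congrFun h i)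

end

end

section

variable {V : Type*} [AddCommGroup V] [Module ℚ V]

/-! ## Correspondences between proper genera -/

section

variable {B : LinearMap.BilinForm ℚ V}

theorem image_mul (σ τ : V ≃ₗ[ℚ] V) (X : Set V) : (σ * τ : V ≃ₗ[ℚ] V) '' X = σ '' (τ '' X) := by
  rw [Set.image_image]; rfl

theorem inv_image_image (σ : V ≃ₗ[ℚ] V) (X : Set V) : (σ⁻¹ : V ≃ₗ[ℚ] V) '' (σ '' X) = X := by
  rw [← image_mul, inv_mul_cancel]
  exact Set.image_id _

/-- Orbit and stabilizer: the fibres of `σ ↦ σ(Y)` are cosets of the stabilizer of `Y`. The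
condition `P` depends only on `σ(Y)`, so it may be imposed on both sides. -/
theorem card_orbit_mul_oPlus (Y : Set V) (P : Set V → Prop) :
    Nat.card {Y' : Set V // (∃ σ ∈ rotationGroup B, σ '' Y = Y') ∧ P Y'} * oPlus B Y =
      Nat.card {σ : V ≃ₗ[ℚ] V // σ ∈ rotationGroup B ∧ P (σ '' Y)} := by
  rw [oPlus, ← Nat.card_prod]
  choose g hg hgY using fun Y' : {Y' : Set V // (∃ σ ∈ rotationGroup B, σ '' Y = Y') ∧ P Y'} => Y'.2.1
  symm
  refine Nat.card_congr
    { toFun := fun σ => (⟨σ.1 '' Y, ⟨_, σ.2.1, rfl⟩, σ.2.2⟩, ⟨(g ⟨σ.1 '' Y, ⟨_, σ.2.1, rfl⟩, σ.2.2⟩)⁻¹ * σ.1,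
        mul_mem (inv_mem (hg _)) σ.2.1, ?_⟩)
      invFun := fun y => ⟨g y.1 * y.2.1, mul_mem (hg _) y.2.2.1, ?_⟩
      left_inv := fun σ => ?_
      right_inv := fun y => ?_ }
  · rw [image_mul]
    have h := hgY ⟨σ.1 '' Y, ⟨_, σ.2.1, rfl⟩, σ.2.2⟩
    have h' := inv_image_image (g ⟨σ.1 '' Y, ⟨_, σ.2.1, rfl⟩, σ.2.2⟩) Y
    rwa [h] at h'
  · rw [image_mul, y.2.2.2, hgY]
    exact y.1.2.2
  · exact Subtype.ext (mul_inv_cancel_left _ _)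
  · obtain ⟨Y', s⟩ := y
    have h1 : (g Y' * s.1) '' Y = Y'.1 := by rw [image_mul, s.2.2, hgY]
    have h2 : (⟨(g Y' * s.1) '' Y, ⟨_, mul_mem (hg _) s.2.1, rfl⟩, h1 ▸ Y'.2.2⟩ :
      {Y' : Set V // (∃ σ ∈ rotationGroup B, σ '' Y = Y') ∧ P Y'}) = Y' := Subtype.ext h1
    refine Prod.ext h2 (Subtype.ext ?_)
    change (g ⟨(g Y' * s.1) '' Y, _⟩)⁻¹ * (g Y' * s.1) = s.1
    rw [h2, inv_mul_cancel_left]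

open Classical in
-- Exactly one class contains `Y`. Inserting this sum makes it possible to interchange summations
-- over sets and over classes.
theorem sum_properClass_ite {G : Set (Set V)} [Fintype (Quotient (properClass B G))] {Y : Set V} (hY : Y ∈ G)
    {f : Set V → ℂ} (hf : ∀ σ ∈ rotationGroup B, ∀ X, f (σ '' X) = f X) :
    (∑ c : Quotient (properClass B G), if ∃ σ ∈ rotationGroup B, σ '' (c.out : Set V) = Y then f c.out else 0) = f Y := by
  have h : ∀ c : Quotient (properClass B G), (∃ σ ∈ rotationGroup B, σ '' (c.out : Set V) = Y) ↔ ⟦⟨Y, hY⟩⟧ = c := fun c => by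
    rw [eq_comm]
    conv_rhs => rw [← c.out_eq]
    rw [Quotient.eq]
    rfl
  simp only [h]
  rw [Finset.sum_ite_eq, if_pos (Finset.mem_univ _)]
  obtain ⟨σ, hσ, hσY⟩ := (h ⟦⟨Y, hY⟩⟧).2 rfl
  exact (hf σ hσ _).symm.trans (congrArg f hσY)

open Classical in
/-- Summation over a correspondence between two systems of proper classes. -/
theorem sum_correspondence {G₀ G₁ : Set (Set V)} [Finite (Quotient (properClass B G₀))]
    [Finite (Quotient (properClass B G₁))] {R : Set V → Set V → Prop}
    (hR : ∀ σ ∈ rotationGroup B, ∀ X Y, R X Y → R (σ '' X) (σ '' Y)) {succ pred : Set V → Finset (Set V)}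
    (hsucc : ∀ X ∈ G₀, ∀ Y, Y ∈ succ X ↔ R X Y) (hpred : ∀ Y ∈ G₁, ∀ X, X ∈ pred Y ↔ R X Y)
    (hG₁ : ∀ X ∈ G₀, ∀ Y, R X Y → Y ∈ G₁) (hG₀ : ∀ Y ∈ G₁, ∀ X, R X Y → X ∈ G₀)
    (ho₀ : ∀ X ∈ G₀, oPlus B X ≠ 0) (ho₁ : ∀ Y ∈ G₁, oPlus B Y ≠ 0) {q : ℕ} (hq : ∀ Y ∈ G₁, (pred Y).card = q)
    {f : Set V → ℂ} (hf : ∀ σ ∈ rotationGroup B, ∀ X, f (σ '' X) = f X) :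
    ∑ᶠ c : Quotient (properClass B G₀), (∑ Y ∈ succ c.out, f Y) / (oPlus B (c.out : Set V) : ℂ) =
      q * ∑ᶠ c : Quotient (properClass B G₁), f c.out / (oPlus B (c.out : Set V) : ℂ) := by
  have := Fintype.ofFinite (Quotient (properClass B G₀))
  have := Fintype.ofFinite (Quotient (properClass B G₁))
  -- Double counting: `n X Y / o⁺(Y)` is the number of successors of `X` in the class of `Y`, and `n
  -- X Y / o⁺(X)` the number of predecessors of `Y` in the class of `X`. The weight `1/o⁺` makes the
  -- two symmetric.
  let n : Set V → Set V → ℕ := fun X Y => Nat.card {σ : V ≃ₗ[ℚ] V // σ ∈ rotationGroup B ∧ R X (σ '' Y)}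
  have h1 : ∀ X ∈ G₀, ∀ Y ∈ G₁, (((succ X).filter fun Y' => ∃ σ ∈ rotationGroup B, σ '' Y = Y').card : ℂ) =
      n X Y / oPlus B Y := fun X hX Y hY => by
    rw [eq_div_iff (by exact_mod_cast ho₁ Y hY)]
    have := card_orbit_mul_oPlus (B := B) Y (R X)
    rw [← Nat.cast_mul, Nat.cast_inj, show n X Y = _ from this.symm, ← Nat.card_eq_finsetCard]
    congr 1
    refine Nat.card_congr (Equiv.subtypeEquivRight fun Y' => ?_)
    rw [Finset.mem_filter, hsucc X hX, and_comm]
  have h2 : ∀ X ∈ G₀, ∀ Y ∈ G₁, (((pred Y).filter fun X' => ∃ σ ∈ rotationGroup B, σ '' X = X').card : ℂ) =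
      n X Y / oPlus B X := fun X hX Y hY => by
    rw [eq_div_iff (by exact_mod_cast ho₀ X hX)]
    have := card_orbit_mul_oPlus (B := B) X (fun X' => R X' Y)
    have h3 : Nat.card {σ : V ≃ₗ[ℚ] V // σ ∈ rotationGroup B ∧ R (σ '' X) Y} = n X Y := by
      refine Nat.card_congr
        { toFun := fun σ => ⟨σ.1⁻¹, inv_mem σ.2.1, by
            have := hR _ (inv_mem σ.2.1) _ _ σ.2.2
            rwa [inv_image_image] at this⟩
          invFun := fun σ => ⟨σ.1⁻¹, inv_mem σ.2.1, by
            have := hR _ (inv_mem σ.2.1) _ _ σ.2.2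
            rwa [inv_image_image] at this⟩
          left_inv := fun σ => Subtype.ext (inv_inv _)
          right_inv := fun σ => Subtype.ext (inv_inv _) }
    rw [← Nat.cast_mul, Nat.cast_inj, ← h3, ← this, ← Nat.card_eq_finsetCard]
    congr 1
    refine Nat.card_congr (Equiv.subtypeEquivRight fun X' => ?_)
    rw [Finset.mem_filter, hpred Y hY, and_comm]
  have h3 : ∀ X ∈ G₀, ∑ Y ∈ succ X, f Y = ∑ c : Quotient (properClass B G₁), n X c.out / oPlus B (c.out : Set V) * f c.out := by
    intro X hX
    rw [Finset.sum_congr rfl fun Y hY => (sum_properClass_ite (hG₁ X hX Y ((hsucc X hX Y).1 hY)) hf).symm, Finset.sum_comm]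
    refine Finset.sum_congr rfl fun c _ => ?_
    rw [← h1 X hX _ c.out.2, ← Finset.sum_filter, Finset.sum_const, nsmul_eq_mul]
  have h4 : ∀ Y ∈ G₁, (q : ℂ) = ∑ c : Quotient (properClass B G₀), (n c.out Y : ℂ) / oPlus B (c.out : Set V) := by
    intro Y hY
    have h5 : (q : ℂ) = ∑ X ∈ pred Y, 1 := by rw [← hq Y hY]; simp
    rw [h5, Finset.sum_congr rfl fun X hX => (sum_properClass_ite (B := B) (hG₀ Y hY X ((hpred Y hY X).1 hX))
      (f := fun _ => 1) fun _ _ _ => rfl).symm, Finset.sum_comm]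
    refine Finset.sum_congr rfl fun c _ => ?_
    rw [← h2 _ c.out.2 Y hY, ← Finset.sum_filter, Finset.sum_const, nsmul_eq_mul, mul_one]
  rw [finsum_eq_sum_of_fintype, finsum_eq_sum_of_fintype, Finset.mul_sum,
    Finset.sum_congr rfl fun c _ => by rw [h3 _ c.out.2, Finset.sum_div], Finset.sum_comm]
  refine Finset.sum_congr rfl fun c _ => ?_
  rw [h4 _ c.out.2, Finset.sum_mul]
  exact Finset.sum_congr rfl fun d _ => by ring

end

end

section

variable {V : Type*} [AddCommGroup V] [Module ℚ V]

/-! ## Neighbors of cosets -/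

/-- `Y` is the `p`-neighbor `aK' + p̄μ` of the coset `X = aK + μ`. -/
def IsCosetNeighbor (B : LinearMap.BilinForm ℚ V) (p a : ℕ) (pb : ℤ) (X Y : Set V) : Prop :=
  ∃ (K K' : Submodule ℤ V) (μ : V), IsNeighbor B p K K' ∧ IsNeighbor B p K' K ∧ μ ∈ K ∧ X = latticeCoset a K μ ∧
    Y = latticeCoset a K' (pb • μ)

/-- The image of a lattice under a linear automorphism. -/
def mapLattice (σ : V ≃ₗ[ℚ] V) (K : Submodule ℤ V) : Submodule ℤ V :=
  K.map ((σ : V →ₗ[ℚ] V).restrictScalars ℤ)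

theorem mem_mapLattice {σ : V ≃ₗ[ℚ] V} {K : Submodule ℤ V} {x : V} : x ∈ mapLattice σ K ↔ ∃ y ∈ K, σ y = x := Iff.rfl

theorem image_latticeCoset (σ : V ≃ₗ[ℚ] V) (a : ℕ) (K : Submodule ℤ V) (μ : V) :
    σ '' latticeCoset a K μ = latticeCoset a (mapLattice σ K) (σ μ) := by
  ext x
  constructor
  · rintro ⟨_, ⟨y, hy, rfl⟩, rfl⟩
    exact ⟨σ y, ⟨y, hy, rfl⟩, by rw [map_add, map_nsmul]⟩
  · rintro ⟨_, ⟨y, hy, rfl⟩, rfl⟩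
    exact ⟨_, ⟨y, hy, rfl⟩, by rw [map_add, map_nsmul]; rfl⟩

theorem IsNeighbor.map {B : LinearMap.BilinForm ℚ V} {p : ℕ} {K K' : Submodule ℤ V} (h : IsNeighbor B p K K')
    {σ : V ≃ₗ[ℚ] V} (hσ : σ ∈ rotationGroup B) : IsNeighbor B p (mapLattice σ K) (mapLattice σ K') := by
  obtain ⟨w, hw, rfl⟩ := h
  refine ⟨σ w, ⟨⟨w, hw.mem, rfl⟩, ?_, ?_⟩, ?_⟩
  · rintro _ ⟨y, hy, rfl⟩ h
    refine hw.prim y hy (σ.injective ?_)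
    rw [h, map_nsmul]
    rfl
  · obtain ⟨k, hk⟩ := hw.isotropic
    exact ⟨k, by rw [hσ.1, hk]⟩
  · ext x
    rw [mem_mapLattice, mem_neighbor]
    constructor
    · rintro ⟨_, hy, rfl⟩
      obtain ⟨z, ⟨hz, m, hm⟩, c, rfl⟩ := mem_neighbor.1 hy
      exact ⟨σ z, ⟨⟨z, hz, rfl⟩, m, by rw [hσ.1, hm]⟩, c, by rw [map_add, map_zsmul, map_smul]⟩
    · rintro ⟨_, ⟨⟨z, hz, rfl⟩, m, hm⟩, c, rfl⟩
      refine ⟨z + c • (p : ℚ)⁻¹ • w, mem_neighbor.2 ⟨z, ⟨hz, m, ?_⟩, c, rfl⟩, by rw [map_add, map_zsmul, map_smul]; rfl⟩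
      rw [← hm, ← hσ.1]
      rfl

theorem IsCosetNeighbor.image {B : LinearMap.BilinForm ℚ V} {p a : ℕ} {pb : ℤ} {X Y : Set V}
    (h : IsCosetNeighbor B p a pb X Y) {σ : V ≃ₗ[ℚ] V} (hσ : σ ∈ rotationGroup B) :
    IsCosetNeighbor B p a pb (σ '' X) (σ '' Y) := by
  obtain ⟨K, K', μ, hn, hn', hμ, rfl, rfl⟩ := h
  exact ⟨_, _, σ μ, hn.map hσ, hn'.map hσ, ⟨μ, hμ, rfl⟩, image_latticeCoset _ _ _ _, by rw [image_latticeCoset, map_zsmul]⟩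

omit [Module ℚ V] in
-- Division by `d` modulo `a`: the vector `x` differs from `c(dx)` by an element of `aK`.
theorem mem_latticeCoset_of_zsmul {a : ℕ} {K : Submodule ℤ V} {μ x k : V} {c d : ℤ} (hcd : c * d ≡ 1 [ZMOD a])
    (hx : x ∈ K) (hk : c • k ∈ K) (h : d • x = a • k + μ) : x ∈ latticeCoset a K (c • μ) := by
  obtain ⟨t, ht⟩ := hcd.dvd
  refine ⟨c • k + t • x, add_mem hk (zsmul_mem hx t), ?_⟩
  have h1 : x = (c * d) • x + (a * t : ℤ) • x := by rw [← ht, ← add_smul]; simp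
  conv_lhs => rw [h1]
  rw [mul_smul, h, mul_smul, natCast_zsmul, smul_add, smul_add, smul_comm c a]
  abel

section

variable {B : LinearMap.BilinForm ℚ V} (hsymm : B.IsSymm) (hpos : ∀ x : V, x ≠ 0 → 0 < B x x)
    (hdim : Module.finrank ℚ V = 3) {M : ℕ} {K : Submodule ℤ V} (hK : IsIntegralOfLevel B M K)
    {p : ℕ} [hp : Fact p.Prime] (hpM : ¬ p ∣ M) (hp2 : p ≠ 2) {a : ℕ} (ha : a ≠ 0) {pb : ℤ} (hppb : (p : ℤ) ∣ pb)
    (hpb : (p : ℤ) * pb ≡ 1 [ZMOD a])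

include hp in
theorem IsNeighbor.nsmul_mem {K K' : Submodule ℤ V} (h : IsNeighbor B p K K') {x : V} (hx : x ∈ K') : p • x ∈ K := by
  obtain ⟨w, hw, rfl⟩ := h
  exact nsmul_mem_of_mem_neighbor hp.out hw.mem hx

omit hp in
include hK hppb in
theorem IsNeighbor.zsmul_mem {K' : Submodule ℤ V} (h : IsNeighbor B p K K') {x : V} (hx : x ∈ K) : pb • x ∈ K' := by
  obtain ⟨w, hw, rfl⟩ := h
  obtain ⟨c, rfl⟩ := hppb
  rw [mul_comm, mul_smul, natCast_zsmul]
  exact _root_.zsmul_mem (perpLattice_le_neighbor (nsmul_mem_perpLattice hK hw.mem hx)) c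

include hsymm hK hpM ha hppb in
-- Since `p ∣ pb`, multiplication by `pb` carries `K` into every neighbor `K'`. Hence `aK' + pb μ`
-- does not depend on the choice of `μ` in the coset.
theorem isCosetNeighbor_iff {μ : V} (hμ : μ ∈ K) {Y : Set V} :
    IsCosetNeighbor B p a pb (latticeCoset a K μ) Y ↔ ∃ K', IsNeighbor B p K K' ∧ latticeCoset a K' (pb • μ) = Y := by
  constructor
  · rintro ⟨K₁, K', μ₁, hn, -, hμ₁, hX, rfl⟩
    obtain ⟨rfl, k, hk, h⟩ := latticeCoset_injective ha hX
    exact ⟨K', hn, (latticeCoset_congr ⟨pb • k, hn.zsmul_mem hK hppb hk, by rw [← smul_sub, h, smul_comm]⟩).symm⟩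
  · rintro ⟨K', hn, rfl⟩
    exact ⟨K, K', μ, hn, isNeighbor_symm hsymm hK hp.out hpM hn, hμ, rfl, rfl⟩

include hsymm hK hpM ha hpb in
-- The relation seen from its target: as `p · pb ≡ 1` modulo `a`, it is undone by passing to a
-- neighbor with multiplier `p`.
theorem isCosetNeighbor_iff' {μ : V} (hμ : μ ∈ K) {X : Set V} :
    IsCosetNeighbor B p a pb X (latticeCoset a K μ) ↔ ∃ K', IsNeighbor B p K K' ∧ latticeCoset a K' ((p : ℤ) • μ) = X := by
  constructor
  · rintro ⟨K', K₁, μ₁, hn, hn', hμ₁, rfl, hY⟩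
    obtain ⟨rfl, k, hk, h⟩ := latticeCoset_injective ha hY.symm
    refine ⟨K', hn', latticeCoset_congr ?_⟩
    obtain ⟨t, ht⟩ := hpb.symm.dvd
    refine ⟨t • μ₁ + p • k, add_mem (zsmul_mem hμ₁ t) (hn.nsmul_mem hk), ?_⟩
    have h1 : μ = pb • μ₁ + a • k := by rw [← h]; abel
    rw [h1, smul_add, smul_smul, smul_add, natCast_zsmul (a • k), smul_comm p a, add_sub_right_comm,
      show ((p : ℤ) * pb) • μ₁ - μ₁ = ((p : ℤ) * pb - 1) • μ₁ by rw [sub_smul, one_smul], ht, mul_smul, natCast_zsmul]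
  · rintro ⟨K', hn, rfl⟩
    refine ⟨K', K, (p : ℤ) • μ, isNeighbor_symm hsymm hK hp.out hpM hn, hn, ?_, rfl, ?_⟩
    · obtain ⟨w, hw, rfl⟩ := hn
      rw [natCast_zsmul]
      exact perpLattice_le_neighbor (nsmul_mem_perpLattice hK hw.mem hμ)
    · rw [smul_smul]
      have := latticeCoset_zsmul_congr (a := a) hμ (b := pb * p) (b' := 1) (by rw [mul_comm]; exact hpb.dvd)
      rwa [one_smul] at this

end

end

/-! ### The Hecke operator as summation over the neighbors of a coset -/

section

open Complex

variable {V : Type*} [AddCommGroup V] [Module ℚ V]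

/-- The action of `T(p²)` on the triple of theta series that belong to `1`, `p⁻¹` and `p⁻²` modulo `a`. -/
def heckeExpr (p : ℕ) [Fact p.Prime] (s : ℂ) (f g h : ℍ → ℂ) (z : ℍ) : ℂ :=
  ((p : ℂ) ^ (1 / 2 : ℂ))⁻¹ *
    ((((p : ℂ) ^ (1 / 2 : ℂ)) ^ 3)⁻¹ *
      ∑ n : Fin (p ^ 2), f (UpperHalfPlane.ofComplex ((z + (n : ℕ)) / (p : ℂ) ^ 2)) +
    s * epsilon p ^ 3 * ∑ b : ZMod p, ((quadraticChar (ZMod p) (-b) : ℤ) : ℂ) *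
      g (UpperHalfPlane.ofComplex (z + b.val / p)) +
    ((p : ℂ) ^ (1 / 2 : ℂ)) ^ 3 * h (UpperHalfPlane.ofComplex ((p : ℂ) ^ 2 * z)))

theorem heckeExpr_sum (p : ℕ) [Fact p.Prime] (s : ℂ) {ι : Type*} [Fintype ι] (c : ι → ℂ) (f g h : ι → ℍ → ℂ) (z : ℍ) :
    heckeExpr p s (∑ i, c i • f i) (∑ i, c i • g i) (∑ i, c i • h i) z = ∑ i, c i * heckeExpr p s (f i) (g i) (h i) z := by
  simp only [heckeExpr, Finset.sum_apply, Pi.smul_apply, smul_eq_mul, Finset.mul_sum, mul_add, Finset.sum_add_distrib]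
  congr 1
  · congr 1
    · rw [Finset.sum_comm]
      exact Finset.sum_congr rfl fun i _ => Finset.sum_congr rfl fun j _ => by ring
    · rw [Finset.sum_comm]
      exact Finset.sum_congr rfl fun i _ => Finset.sum_congr rfl fun j _ => by ring
  · exact Finset.sum_congr rfl fun i _ => by ring

open Classical in
/-- The set of `p`-neighbors of a coset. -/
def cosetNeighbors (B : LinearMap.BilinForm ℚ V) (p a : ℕ) (pb : ℤ) (X : Set V) : Finset (Set V) :=
  if h : {Y | IsCosetNeighbor B p a pb X Y}.Finite then h.toFinset else ∅

theorem thetaSummable_of_subset {B : LinearMap.BilinForm ℚ V} (hsymm : B.IsSymm) (hpos : ∀ x : V, x ≠ 0 → 0 < B x x)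
    (hdim : Module.finrank ℚ V = 3) {K : Submodule ℤ V} (hK : IsLattice K) {X : Set V} (hX : X ⊆ K) :
    ThetaSummable B X := fun z => by
  obtain ⟨u, -, ho, hu, -⟩ := exists_orthogonal_adapted (B := B) hsymm hdim hK one_ne_zero
  exact summable_theta ho (fun i => hpos _ (u.ne_zero i)) (fun x hx => hu x (hX hx)) z

section

variable {B : LinearMap.BilinForm ℚ V} (hsymm : B.IsSymm) (hpos : ∀ x : V, x ≠ 0 → 0 < B x x)
    (hdim : Module.finrank ℚ V = 3) {M : ℕ} {K : Submodule ℤ V} (hK : IsIntegralOfLevel B M K)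
    {p : ℕ} [hp : Fact p.Prime] (hpM : ¬ p ∣ M) (hp2 : p ≠ 2) {a : ℕ} (ha : a ≠ 0) {pb : ℤ} (hppb : (p : ℤ) ∣ pb)
    (hpb : (p : ℤ) * pb ≡ 1 [ZMOD a]) {δ : ℤ} (hδ : IsDiscr B δ) (hpδ : ¬ (p : ℤ) ∣ δ) {μ : V} (hμ : μ ∈ K)

include hsymm hpos hdim hK hpM hp2 ha hppb hδ hpδ hμ in
open Classical in
theorem cosetNeighbors_eq_image : ∃ n : Option (ZMod p) → Submodule ℤ V,
    (∀ o, IsNeighbor B p K (n o)) ∧ cosetNeighbors B p a pb (latticeCoset a K μ) =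
      Finset.univ.image (fun o => latticeCoset a (n o) (pb • μ)) ∧
    Function.Injective (fun o => latticeCoset a (n o) (pb • μ)) ∧
    ∀ x, p • x ∈ K → (∑ o, if x ∈ n o then (1 : ℤ) else 0) =
        (if ∃ k : ℤ, B (p • x) (p • x) = p ^ 2 * k then 1 else 0) +
        (if x ∈ K then kronecker (4 * δ) p * quadraticChar (ZMod p) (-((B x x).num : ZMod p)) else 0) +
        if (p : ℚ)⁻¹ • x ∈ K then (p : ℤ) else 0 := by
  obtain ⟨n, hn1, hn2, hn3⟩ := exists_neighbors hsymm hpos hdim hK hpM hp2 hδ hpδ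
  refine ⟨n, fun o => (hn2 _).2 ⟨o, rfl⟩, ?_, fun o o' h => hn1 (latticeCoset_injective ha h).1, hn3⟩
  have h : {Y | IsCosetNeighbor B p a pb (latticeCoset a K μ) Y} =
      Finset.univ.image (fun o => latticeCoset a (n o) (pb • μ)) := by
    ext Y
    simp only [Set.mem_ofPred_eq, isCosetNeighbor_iff hsymm hK hpM ha hppb hμ, Finset.coe_image, Finset.coe_univ,
      Set.image_univ, Set.mem_range]
    constructor
    · rintro ⟨K', hn, rfl⟩
      obtain ⟨o, rfl⟩ := (hn2 K').1 hn
      exact ⟨o, rfl⟩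
    · rintro ⟨o, rfl⟩
      exact ⟨n o, (hn2 _).2 ⟨o, rfl⟩, rfl⟩
  have hfin : {Y | IsCosetNeighbor B p a pb (latticeCoset a K μ) Y}.Finite := h ▸ Finset.finite_toSet _
  rw [cosetNeighbors, dif_pos hfin]
  apply Finset.coe_injective
  rw [Set.Finite.coe_toFinset, h]

include hsymm hpos hdim hK hpM hp2 ha hppb hδ hpδ hμ in
theorem mem_cosetNeighbors_iff {Y : Set V} :
    Y ∈ cosetNeighbors B p a pb (latticeCoset a K μ) ↔ IsCosetNeighbor B p a pb (latticeCoset a K μ) Y := by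
  classical
  obtain ⟨n, hn, h, -, -⟩ := cosetNeighbors_eq_image hsymm hpos hdim hK hpM hp2 ha hppb hδ hpδ hμ
  have hfin : {Y | IsCosetNeighbor B p a pb (latticeCoset a K μ) Y}.Finite := by
    by_contra hcon
    rw [cosetNeighbors, dif_neg hcon] at h
    have : latticeCoset a (n none) (pb • μ) ∈ (∅ : Finset (Set V)) := h ▸ Finset.mem_image_of_mem _ (Finset.mem_univ _)
    exact Finset.notMem_empty _ this
  rw [cosetNeighbors, dif_pos hfin, Set.Finite.mem_toFinset]
  rfl

include hsymm hpos hdim hK hpM hp2 ha hppb hδ hpδ hμ in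
theorem card_cosetNeighbors : (cosetNeighbors B p a pb (latticeCoset a K μ)).card = p + 1 := by
  classical
  obtain ⟨n, -, h, hinj, -⟩ := cosetNeighbors_eq_image hsymm hpos hdim hK hpM hp2 ha hppb hδ hpδ hμ
  rw [h, Finset.card_image_of_injective _ hinj, Finset.card_univ, Fintype.card_option, ZMod.card]

include hsymm hpos hdim hK hpM hp2 ha hppb hpb hδ hpδ hμ in
/-- The Hecke operator is the summation over the neighbors of a coset. -/
theorem heckeExpr_theta (z : ℍ) : heckeExpr p (kronecker (4 * δ) p) (theta B (latticeCoset a K μ))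
    (theta B (latticeCoset a K (pb • μ))) (theta B (latticeCoset a K (pb ^ 2 • μ))) z =
    ∑ Y ∈ cosetNeighbors B p a pb (latticeCoset a K μ), theta B Y z := by
  classical
  have hpQ : (p : ℚ) ≠ 0 := by exact_mod_cast hp.out.ne_zero
  obtain ⟨n, hn, himg, hinj, hcount⟩ := cosetNeighbors_eq_image hsymm hpos hdim hK hpM hp2 ha hppb hδ hpδ hμ
  have hint : ∀ {b : ℤ}, ∀ x ∈ latticeCoset a K (b • μ), ∃ k : ℤ, B x x = k := fun {b} x hx => by
    have := latticeCoset_subset (zsmul_mem hμ b) hx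
    exact hK.integral x this x this
  have hsum : ∀ b : ℤ, ThetaSummable B (latticeCoset a K (b • μ)) := fun b =>
    thetaSummable_of_subset hsymm hpos hdim hK.lattice (latticeCoset_subset (zsmul_mem hμ b))
  obtain ⟨t, ht⟩ := hpb.symm.dvd
  have hmul : ∀ (K' : Submodule ℤ V) (b : ℤ), (∀ x ∈ K', p • x ∈ K) → ∀ x, x ∈ latticeCoset a K' ((pb * b) • μ) →
      p • x ∈ latticeCoset a K (b • μ) := by
    rintro K' b hK' _ ⟨y, hy, rfl⟩
    refine ⟨p • y + (t * b) • μ, add_mem (hK' y hy) (zsmul_mem hμ _), ?_⟩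
    have h1 : p • (pb * b) • μ = a • (t * b) • μ + b • μ := by
      rw [← natCast_zsmul _ p, ← natCast_zsmul _ a, smul_smul, smul_smul, ← add_smul]
      congr 1
      linear_combination b * ht
    rw [smul_add, h1, smul_add, smul_comm p a, add_assoc]
  -- Once `px` lies in `X`, the congruence modulo `a` is automatic, so membership in a coset reduces
  -- to membership in its lattice.
  have h1 : ∀ x, p • x ∈ latticeCoset a K μ → ∀ K' : Submodule ℤ V, (∀ y ∈ K, pb • y ∈ K') →
      (x ∈ latticeCoset a K' (pb • μ) ↔ x ∈ K') := fun x hx K' hK' => by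
    obtain ⟨k, hk, hxk⟩ := hx
    refine ⟨fun h => latticeCoset_subset (hK' μ hμ) h, fun h => ?_⟩
    exact mem_latticeCoset_of_zsmul (d := p) (by rw [mul_comm]; exact hpb) h (hK' k hk) (by rw [natCast_zsmul]; exact hxk)
  have h2 : ∀ x, p • x ∈ latticeCoset a K μ → ((p : ℚ)⁻¹ • x ∈ latticeCoset a K (pb ^ 2 • μ) ↔ (p : ℚ)⁻¹ • x ∈ K) :=
    fun x hx => by
    obtain ⟨k, hk, hxk⟩ := hx
    refine ⟨fun h => latticeCoset_subset (zsmul_mem hμ _) h, fun h => ?_⟩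
    refine mem_latticeCoset_of_zsmul (d := p ^ 2) ?_ h (zsmul_mem hk _) (k := k) ?_
    · have := hpb.pow 2
      rwa [mul_pow, one_pow, mul_comm] at this
    · rw [← hxk, ← Int.cast_smul_eq_zsmul ℚ, smul_smul, ← Nat.cast_smul_eq_nsmul ℚ]
      congr 1
      push_cast
      field_simp
  have hmem : ∀ o, ∀ x, x ∈ latticeCoset a (n o) (pb • μ) → p • x ∈ latticeCoset a K μ := fun o x hx => by
    have := hmul (n o) 1 (fun x hx => (hn o).nsmul_mem hx) x (by rwa [mul_one])
    rwa [one_smul] at this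
  -- Under the substitution `y = px` the Hecke weight of `y` is the number of neighbors that contain
  -- `x`; this is the point where analysis and the local count meet.
  have key : ∀ x, (∑ o, (latticeCoset a (n o) (pb • μ)).indicator
      (fun x => cexp (2 * Real.pi * I * ((B x x : ℚ) : ℂ) * z)) x) =
      (latticeCoset a K μ).indicator (fun y => heckeWeight B p (kronecker (4 * δ) p) (latticeCoset a K (pb • μ))
        (latticeCoset a K (pb ^ 2 • μ)) y * cexp (2 * Real.pi * I * ((B y y : ℚ) : ℂ) * (z / (p : ℂ) ^ 2))) (p • x) := by
    intro x
    by_cases hx : p • x ∈ latticeCoset a K μ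
    · rw [Set.indicator_of_mem hx]
      have e1 : ∀ o, (latticeCoset a (n o) (pb • μ)).indicator
          (fun x => cexp (2 * Real.pi * I * ((B x x : ℚ) : ℂ) * z)) x =
          ((if x ∈ n o then (1 : ℤ) else 0 : ℤ) : ℂ) * cexp (2 * Real.pi * I * ((B x x : ℚ) : ℂ) * z) := fun o => by
        rw [Set.indicator_apply]
        simp only [h1 x hx _ fun y hy => (hn o).zsmul_mem hK hppb hy]
        split_ifs <;> simp
      have e2 : heckeWeight B p (kronecker (4 * δ) p) (latticeCoset a K (pb • μ)) (latticeCoset a K (pb ^ 2 • μ)) (p • x) =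
          ((∑ o, if x ∈ n o then (1 : ℤ) else 0 : ℤ) : ℂ) := by
        have e3 : (p : ℚ)⁻¹ ^ 2 • p • x = (p : ℚ)⁻¹ • x := by rw [sq, mul_smul, inv_smul_nsmul hp.out]
        rw [hcount x (latticeCoset_subset hμ hx), heckeWeight, inv_smul_nsmul hp.out, e3]
        simp only [h1 x hx K fun y hy => zsmul_mem hy _, h2 x hx]
        split_ifs <;> simp
      rw [Finset.sum_congr rfl fun o _ => e1 o, ← Finset.sum_mul, e2]
      push_cast
      congr 2
      have : B (p • x) (p • x) = p ^ 2 * B x x := by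
        rw [← natCast_zsmul, form_zsmul, form_zsmul_left]; push_cast; ring
      rw [this]
      push_cast
      have hpC : (p : ℂ) ≠ 0 := by exact_mod_cast hp.out.ne_zero
      field_simp
    · rw [Set.indicator_of_notMem hx]
      exact Finset.sum_eq_zero fun o _ => Set.indicator_of_notMem (fun h => hx (hmem o x h)) _
  have hX1 : latticeCoset a K ((1 : ℤ) • μ) = latticeCoset a K μ := by rw [one_smul]
  rw [heckeExpr, hecke_theta hp2 (hX1 ▸ hsum 1) (hsum pb) (hsum (pb ^ 2)) (hX1 ▸ hint) hint ?_ ?_, himg,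
    Finset.sum_image fun o _ o' _ h => hinj h]
  · simp only [theta_eq_tsum_indicator]
    rw [← Summable.tsum_finsetSum fun o _ => (thetaSummable_of_subset hsymm hpos hdim (K := n o) ?_
      (latticeCoset_subset ((hn o).zsmul_mem hK hppb hμ))).summable z]
    · simp only [key]
      exact ((LinearEquiv.smulOfNeZero ℚ V (p : ℚ) hpQ).toEquiv.tsum_eq _).symm.trans
        (tsum_congr fun x => by
          rw [← Nat.cast_smul_eq_nsmul ℚ]; rfl)
    · obtain ⟨w, hw, ho⟩ := hn o
      rw [ho]
      exact isLattice_neighbor hK hp.out hw.mem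
  · intro y hy
    have := hmul K 1 (fun x hx => nsmul_mem hx p) _ (by rw [mul_one]; exact hy)
    rwa [one_smul, nsmul_inv_smul hp.out] at this
  · intro y hy
    have h3 := hmul K pb (fun x hx => nsmul_mem hx p) _ (by rw [← sq]; exact hy)
    have h4 := hmul K 1 (fun x hx => nsmul_mem hx p) _ (by rw [mul_one]; exact h3)
    rwa [one_smul, sq, mul_smul, nsmul_inv_smul hp.out, nsmul_inv_smul hp.out] at h4

end

end

section

open Complex CongruenceSubgroup

variable {V : Type*} [AddCommGroup V] [Module ℚ V]

/-! ## Theta series of proper genera -/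

theorem theta_image {B : LinearMap.BilinForm ℚ V} {σ : V ≃ₗ[ℚ] V} (hσ : σ ∈ rotationGroup B) (X : Set V) (z : ℍ) :
    theta B (σ '' X) z = theta B X z := by
  rw [theta, theta, tsum_image (fun x => cexp (2 * Real.pi * I * ((B x x : ℚ) : ℂ) * z)) σ.injective.injOn]
  simp only [hσ.1]

section

variable {B : LinearMap.BilinForm ℚ V} (hsymm : B.IsSymm) (hpos : ∀ x : V, x ≠ 0 → 0 < B x x)
    (hdim : Module.finrank ℚ V = 3) {M : ℕ} (hM : M ≠ 0) {L : Submodule ℤ V} (hL : IsIntegralOfLevel B M L)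
    {p : ℕ} [hp : Fact p.Prime] (hpM : ¬ p ∣ M) (hp2 : p ≠ 2) {a : ℕ} (ha : a ≠ 0) (hpa : ¬ p ∣ a) {pb : ℤ}
    (hppb : (p : ℤ) ∣ pb) (hpb : (p : ℤ) * pb ≡ 1 [ZMOD a]) {δ : ℤ} (hδ : IsDiscr B δ) (hδM : δ ∣ (M : ℤ) ^ 3)
    {ν : V} (hν : ν ∈ L)

include hsymm hpos hdim hM hL ha hν in
theorem oPlus_ne_zero {X : Set V} (hX : X ∈ properGenus B a L ν) : oPlus B X ≠ 0 := by
  obtain ⟨K, μ, hK, hμ, rfl, -⟩ := exists_of_mem_properGenus hsymm hpos hdim hL ha hν hX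
  have := finite_stabilizer hsymm hpos hdim hK ha μ hM
  have : Nonempty {σ : V ≃ₗ[ℚ] V // σ ∈ rotationGroup B ∧ σ '' latticeCoset a K μ = latticeCoset a K μ} :=
    ⟨1, one_mem _, Set.image_id _⟩
  exact Nat.card_pos.ne'

theorem latticeCoset_mem_properGenus_self (hL : IsLattice L) : latticeCoset a L ν ∈ properGenus B a L ν :=
  ⟨L, ν, hL, rfl, ⟨fun _ _ => 1, by
    convert! Set.finite_empty
    ext q
    simp only [Set.mem_ofPred_eq, Set.mem_empty_iff_false, iff_false, not_exists, not_not]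
    exact fun _ => Set.image_id _⟩, fun _ _ => Set.image_id _⟩

theorem not_dvd_of_dvd_pow (hpM : ¬ p ∣ M) (hδM : δ ∣ (M : ℤ) ^ 3) : ¬ (p : ℤ) ∣ δ := fun h =>
  hpM (by exact_mod_cast (Nat.prime_iff_prime_int.1 hp.out).dvd_of_dvd_pow (h.trans hδM))

include hsymm hpos hdim hM hL hpM hp2 ha hpa hppb hpb hδ hδM hν in
-- The neighbor relation commutes with rotations and every coset in the target genus has `p + 1`
-- predecessors, namely its neighbors with multiplier `p`; so `sum_correspondence` applies with
-- degree `p + 1`.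
theorem sum_cosetNeighbors {f : Set V → ℂ} (hf : ∀ σ ∈ rotationGroup B, ∀ X, f (σ '' X) = f X) :
    ∑ᶠ c : Quotient (properClass B (properGenus B a L ν)),
        (∑ Y ∈ cosetNeighbors B p a pb c.out, f Y) / (oPlus B (c.out : Set V) : ℂ) =
      (p + 1 : ℕ) * ∑ᶠ c : Quotient (properClass B (properGenus B a L (pb • ν))),
        f c.out / (oPlus B (c.out : Set V) : ℂ) := by
  classical
  have hpδ := not_dvd_of_dvd_pow hpM hδM
  have hν' := zsmul_mem hν pb
  have := finite_properClass hsymm hpos hdim hL hM ha hν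
  have := finite_properClass hsymm hpos hdim hL hM ha hν'
  have hpre : ∀ Y ∈ properGenus B a L (pb • ν), ∃ s : Finset (Set V), s.card = p + 1 ∧
      (∀ X, X ∈ s ↔ IsCosetNeighbor B p a pb X Y) ∧ ∀ X, IsCosetNeighbor B p a pb X Y → X ∈ properGenus B a L ν := by
    intro Y hY
    obtain ⟨K, μ, hK, hμ, rfl, -⟩ := exists_of_mem_properGenus hsymm hpos hdim hL ha hν' hY
    obtain ⟨n, hn1, hn2, -⟩ := exists_neighbors hsymm hpos hdim hK hpM hp2 hδ hpδ
    refine ⟨Finset.univ.image (fun o => latticeCoset a (n o) ((p : ℤ) • μ)), ?_, fun X => ?_, fun X h => ?_⟩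
    · rw [Finset.card_image_of_injective _ fun o o' h => hn1 (latticeCoset_injective ha h).1, Finset.card_univ,
        Fintype.card_option, ZMod.card]
    · rw [isCosetNeighbor_iff' hsymm hK hpM ha hpb hμ, Finset.mem_image]
      constructor
      · rintro ⟨o, -, rfl⟩
        exact ⟨n o, (hn2 _).2 ⟨o, rfl⟩, rfl⟩
      · rintro ⟨K', h, rfl⟩
        obtain ⟨o, rfl⟩ := (hn2 K').1 h
        exact ⟨o, Finset.mem_univ _, rfl⟩
    · obtain ⟨K', hn, rfl⟩ := (isCosetNeighbor_iff' hsymm hK hpM ha hpb hμ).1 h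
      -- With multiplier `p` the shift becomes `p · pb · ν`, congruent to `ν` modulo `aL`: the
      -- predecessor lies in the original genus.
      have h1 := neighbor_mem_properGenus hsymm hpos hdim hK hp.out hpM hp2 ha hpa hν' hY hn (m := p)
        (hn.zsmul_mem hK dvd_rfl hμ)
      obtain ⟨t, ht⟩ := hpb.symm.dvd
      rwa [smul_smul, properGenus_congr (ν := ν) ⟨t • ν, zsmul_mem hν t, by
        rw [← natCast_zsmul _ a, smul_smul, ← ht, sub_smul, one_smul]⟩] at h1
  choose! pred hcard hpred hG using hpre
  refine sum_correspondence (R := IsCosetNeighbor B p a pb) (pred := pred) (fun σ hσ X Y h => h.image hσ) ?_ hpred ?_ hG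
    (fun X hX => oPlus_ne_zero hsymm hpos hdim hM hL ha hν hX)
    (fun X hX => oPlus_ne_zero hsymm hpos hdim hM hL ha hν' hX) hcard hf
  · intro X hX Y
    obtain ⟨K, μ, hK, hμ, rfl, -⟩ := exists_of_mem_properGenus hsymm hpos hdim hL ha hν hX
    exact mem_cosetNeighbors_iff hsymm hpos hdim hK hpM hp2 ha hppb hδ hpδ hμ
  · intro X hX Y h
    obtain ⟨K, μ, hK, hμ, rfl, -⟩ := exists_of_mem_properGenus hsymm hpos hdim hL ha hν hX
    obtain ⟨K', hn, rfl⟩ := (isCosetNeighbor_iff hsymm hK hpM ha hppb hμ).1 h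
    exact neighbor_mem_properGenus hsymm hpos hdim hK hp.out hpM hp2 ha hpa hν hX hn (hn.zsmul_mem hK hppb hμ)

include hsymm hpos hdim hM hL hpM hp2 ha hpa hppb hpb hδ hδM hν in
-- Each coset also has `p + 1` successors, so the constant function `1` in `sum_cosetNeighbors`
-- gives the same multiple of both masses.
theorem mass_zsmul_eq : mass B (properGenus B a L (pb • ν)) = mass B (properGenus B a L ν) := by
  have h := sum_cosetNeighbors hsymm hpos hdim hM hL hpM hp2 ha hpa hppb hpb hδ hδM hν (f := fun _ => 1) fun _ _ _ => rfl
  have hp1 : ((p + 1 : ℕ) : ℂ) ≠ 0 := by exact_mod_cast p.succ_ne_zero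
  refine mul_left_cancel₀ hp1 (h.symm.trans ?_)
  have := finite_properClass hsymm hpos hdim hL hM ha hν
  have := Fintype.ofFinite (Quotient (properClass B (properGenus B a L ν)))
  rw [mass, finsum_eq_sum_of_fintype, finsum_eq_sum_of_fintype, Finset.mul_sum]
  refine Finset.sum_congr rfl fun c _ => ?_
  obtain ⟨K, μ, hK, hμ, hX, -⟩ := exists_of_mem_properGenus hsymm hpos hdim hL ha hν c.out.2
  rw [hX, Finset.sum_const, card_cosetNeighbors hsymm hpos hdim hK hpM hp2 ha hppb hδ (not_dvd_of_dvd_pow hpM hδM) hμ,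
    nsmul_eq_mul, mul_one, mul_one_div]

include hsymm hpos hdim hM hL ha hδ hδM hν in
/-- The theta series of a proper genus and of its dilations form a theta family. -/
theorem exists_isThetaFamily [NeZero a] : ∃ Θ : ZMod a → ℍ → ℂ,
    IsThetaFamily (4 * M * a ^ 2) a (fun d => (kronecker (4 * δ) d : ℂ)) Θ ∧
    Θ 1 = thetaGenus B (properGenus B a L ν) ∧
    ∀ (p : ℕ) [Fact p.Prime], ¬ p ∣ M → p ≠ 2 → ∀ pb : ℤ, (p : ℤ) ∣ pb → (p : ℤ) * pb ≡ 1 [ZMOD a] → ∀ z : ℍ,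
      heckeExpr p (kronecker (4 * δ) p) (Θ 1) (Θ pb) (Θ (pb ^ 2)) z = 1 / mass B (properGenus B a L ν) *
        ∑ᶠ c : Quotient (properClass B (properGenus B a L ν)),
          (∑ Y ∈ cosetNeighbors B p a pb c.out, theta B Y z) / (oPlus B (c.out : Set V) : ℂ) := by
  classical
  have := finite_properClass hsymm hpos hdim hL hM ha hν
  have := Fintype.ofFinite (Quotient (properClass B (properGenus B a L ν)))
  choose K μ hK hμ hX _ using fun c : Quotient (properClass B (properGenus B a L ν)) =>
    exists_of_mem_properGenus hsymm hpos hdim hL ha hν c.out.2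
  let w : Quotient (properClass B (properGenus B a L ν)) → ℂ := fun c =>
    1 / mass B (properGenus B a L ν) * (1 / (oPlus B (c.out : Set V) : ℂ))
  -- The representatives `aK + μ` stay fixed and only `μ` is multiplied by `b`. For `b ≠ 1` these
  -- series are auxiliary; no identification with the theta series of a genus is needed.
  let Θ : ZMod a → ℍ → ℂ := fun b => ∑ c, w c • theta B (latticeCoset a (K c) ((b.val : ℤ) • μ c))
  have hΘ : ∀ (b : ZMod a) (m : ℤ), (m : ZMod a) = b → Θ b = ∑ c, w c • theta B (latticeCoset a (K c) (m • μ c)) := by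
    rintro _ m rfl
    refine Finset.sum_congr rfl fun c _ => ?_
    rw [latticeCoset_zsmul_congr (hμ c) (b := m)]
    rw [← ZMod.intCast_zmod_eq_zero_iff_dvd]
    push_cast
    rw [ZMod.natCast_zmod_val, sub_self]
  have hΘ1 := hΘ 1 1 (by simp)
  simp only [one_smul, ← hX] at hΘ1
  refine ⟨Θ, ⟨fun γ hγ b => ?_, fun b => ?_, fun b => ?_⟩, ?_, ?_⟩
  · rw [hΘ ((γ 0 0 : ZMod a) * b) (γ 0 0 * b.val) (by push_cast; rw [ZMod.natCast_zmod_val]), Finset.smul_sum, slash_sum]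
    refine Finset.sum_congr rfl fun c _ => ?_
    rw [slash_smul, slash_theta hsymm hpos hdim hM (hK c) ha hδ hδM (zsmul_mem (hμ c) _) hγ, mul_smul (γ 0 0) _ (μ c), smul_comm (w c)]
  · refine mdifferentiable_fun_sum _ _ fun c _ => mdifferentiable_smul _ ?_
    obtain ⟨u, D, ho, hmem, hD, hDu⟩ := exists_orthogonal_adapted hsymm hdim (hK c).lattice ha
    exact mdifferentiable_theta (adapted_latticeCoset hpos (hK c) ho hmem hD hDu (zsmul_mem (hμ c) _))
  · refine growth_sum _ _ fun c _ => growth_smul _ ?_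
    obtain ⟨u, D, ho, hmem, hD, hDu⟩ := exists_orthogonal_adapted hsymm hdim (hK c).lattice ha
    exact norm_theta_le ho (fun i => hpos _ (u.ne_zero i)) fun x hx =>
      hmem x (latticeCoset_subset (zsmul_mem (hμ c) _) hx)
  · rw [hΘ1]
    ext z
    rw [thetaGenus, finsum_eq_sum_of_fintype, Finset.sum_apply, Finset.mul_sum]
    refine Finset.sum_congr rfl fun c _ => ?_
    rw [Pi.smul_apply, smul_eq_mul]
    ring
  · intro p hp hpM hp2 pb hppb hpb z
    rw [hΘ1, hΘ pb pb rfl, hΘ (pb ^ 2) (pb ^ 2) (by push_cast; rfl), heckeExpr_sum, finsum_eq_sum_of_fintype, Finset.mul_sum]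
    refine Finset.sum_congr rfl fun c _ => ?_
    rw [hX, heckeExpr_theta hsymm hpos hdim (hK c) hpM hp2 ha hppb hpb hδ (not_dvd_of_dvd_pow hpM hδM) (hμ c), ← hX]
    ring

end

end

/-! ### Invariance under `ν ↦ -ν`, nonvanishing and modularity -/

section

open Complex CongruenceSubgroup

variable {V : Type*} [AddCommGroup V] [Module ℚ V]

section

variable {B : LinearMap.BilinForm ℚ V}

omit [Module ℚ V] in
theorem neg_image_neg_image (X : Set V) : (Neg.neg : V → V) '' ((Neg.neg : V → V) '' X) = X := by
  simp

theorem theta_neg (X : Set V) (z : ℍ) : theta B ((Neg.neg : V → V) '' X) z = theta B X z := by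
  rw [theta, theta, tsum_image (fun x => cexp (2 * Real.pi * I * ((B x x : ℚ) : ℂ) * z)) neg_injective.injOn]
  simp

/-- In dimension three `-1` is not a rotation, so this does not follow from the definition of the
genus. But `-1` commutes with all local rotations, and the same adelic element works for the
negatives. -/
theorem neg_image_mem_properGenus {a : ℕ} (ha : a ≠ 0) {L : Submodule ℤ V} {ν : V} {X : Set V}
    (hX : X ∈ properGenus B a L ν) : (Neg.neg : V → V) '' X ∈ properGenus B a L (-ν) := by
  obtain ⟨K, μ, hK, rfl, -⟩ := id hX
  obtain ⟨σ, hσ⟩ := exists_localMap ha hX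
  have h : (Neg.neg : V → V) '' latticeCoset a K μ = latticeCoset a K (-μ) := by
    ext x
    constructor
    · rintro ⟨_, ⟨y, hy, rfl⟩, rfl⟩
      exact ⟨-y, neg_mem hy, by rw [smul_neg, neg_add]⟩
    · rintro ⟨y, hy, rfl⟩
      exact ⟨_, ⟨-y, neg_mem hy, rfl⟩, by rw [smul_neg, neg_add, neg_neg]⟩
  rw [h]
  refine latticeCoset_mem_properGenus ha hK σ fun q _ => ?_
  obtain ⟨h1, k, hk, h2⟩ := hσ q
  exact ⟨h1, -k, neg_mem hk, by rw [TensorProduct.tmul_neg, map_neg, h2, TensorProduct.tmul_neg, smul_neg, neg_add]⟩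

variable (hsymm : B.IsSymm) (hpos : ∀ x : V, x ≠ 0 → 0 < B x x)
    (hdim : Module.finrank ℚ V = 3) {M : ℕ} (hM : M ≠ 0) {L : Submodule ℤ V} (hL : IsIntegralOfLevel B M L)
    {a : ℕ} (ha : a ≠ 0) {ν : V} (hν : ν ∈ L)

include hsymm hpos hdim hM hL ha hν in
/-- The theta series of a proper genus does not change under `ν ↦ -ν`. -/
theorem thetaGenus_neg : thetaGenus B (properGenus B a L (-ν)) = thetaGenus B (properGenus B a L ν) := by
  have hν' := neg_mem hν
  have := finite_properClass hsymm hpos hdim hL hM ha hν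
  have := finite_properClass hsymm hpos hdim hL hM ha hν'
  have key : ∀ f : Set V → ℂ, (∀ σ ∈ rotationGroup B, ∀ X, f (σ '' X) = f X) → (∀ X, f ((Neg.neg : V → V) '' X) = f X) →
      ∑ᶠ c : Quotient (properClass B (properGenus B a L ν)), f c.out / (oPlus B (c.out : Set V) : ℂ) =
      ∑ᶠ c : Quotient (properClass B (properGenus B a L (-ν))), f c.out / (oPlus B (c.out : Set V) : ℂ) := by
    intro f hf hneg
    have h := sum_correspondence (G₀ := properGenus B a L ν) (G₁ := properGenus B a L (-ν))
      (R := fun X Y => Y = (Neg.neg : V → V) '' X)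
      (succ := fun X => {(Neg.neg : V → V) '' X}) (pred := fun Y => {(Neg.neg : V → V) '' Y}) (q := 1) (f := f)
      (fun σ _ X Y h => by
        rw [h, Set.image_image, Set.image_image]
        simp) (fun X _ Y => Finset.mem_singleton)
      (fun Y _ X => by
        rw [Finset.mem_singleton]
        constructor
        · rintro rfl; exact (neg_image_neg_image Y).symm
        · rintro rfl; exact (neg_image_neg_image X).symm)
      (fun X hX Y h => h ▸ neg_image_mem_properGenus ha hX)
      (fun Y hY X h => by
        have := neg_image_mem_properGenus ha hY
        rwa [h, neg_image_neg_image, neg_neg] at this)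
      (fun X hX => oPlus_ne_zero hsymm hpos hdim hM hL ha hν hX)
      (fun X hX => oPlus_ne_zero hsymm hpos hdim hM hL ha hν' hX) (fun Y _ => Finset.card_singleton _) hf
    simp only [Finset.sum_singleton, hneg, Nat.cast_one, one_mul] at h
    exact h
  ext z
  rw [thetaGenus, thetaGenus, mass, mass, key (fun _ => 1) (fun _ _ _ => rfl) fun _ => rfl,
    key (fun X => theta B X z) (fun σ hσ X => theta_image hσ X z) fun X => theta_neg X z]

include hsymm hpos hdim hM hL ha hν in
-- At `z = i` all terms of the theta series are positive real numbers, and so are the weights and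
-- the mass.
theorem thetaGenus_ne_zero : thetaGenus B (properGenus B a L ν) ≠ 0 := by
  intro h0
  have := finite_properClass hsymm hpos hdim hL hM ha hν
  have := Fintype.ofFinite (Quotient (properClass B (properGenus B a L ν)))
  have : Nonempty (Quotient (properClass B (properGenus B a L ν))) :=
    ⟨⟦⟨_, latticeCoset_mem_properGenus_self hL.lattice⟩⟧⟩
  have hpo : ∀ c : Quotient (properClass B (properGenus B a L ν)), (0 : ℝ) < oPlus B (c.out : Set V) := fun c => by
    exact_mod_cast Nat.pos_of_ne_zero (oPlus_ne_zero hsymm hpos hdim hM hL ha hν c.out.2)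
  have hth : ∀ c : Quotient (properClass B (properGenus B a L ν)), ∃ r : ℝ, 0 < r ∧
      theta B (c.out : Set V) UpperHalfPlane.I = r := fun c => by
    obtain ⟨K, μ, hK, hμ, hX, -⟩ := exists_of_mem_properGenus hsymm hpos hdim hL ha hν c.out.2
    have hexp : ∀ x : V, cexp (2 * Real.pi * I * ((B x x : ℚ) : ℂ) * (UpperHalfPlane.I : ℍ)) =
        (Real.exp (-(2 * Real.pi * (B x x : ℝ))) : ℝ) := fun x => by
      rw [UpperHalfPlane.coe_I, ofReal_exp]
      congr 1
      push_cast
      linear_combination (2 * Real.pi * ((B x x : ℚ) : ℂ)) * I_mul_I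
    have hs := thetaSummable_of_subset hsymm hpos hdim hK.lattice (latticeCoset_subset (a := a) hμ) UpperHalfPlane.I
    rw [← hX] at hs
    simp only [hexp, norm_real, Real.norm_eq_abs, Real.abs_exp] at hs
    refine ⟨_, hs.tsum_pos (fun x => (Real.exp_pos _).le) ⟨μ, hX ▸ ⟨0, zero_mem _, by simp⟩⟩ (Real.exp_pos _), ?_⟩
    rw [theta, ofReal_tsum]
    exact tsum_congr fun x => hexp x
  choose r hr hrθ using hth
  have h1 := congrFun h0 UpperHalfPlane.I
  rw [thetaGenus, mass, finsum_eq_sum_of_fintype, finsum_eq_sum_of_fintype, Pi.zero_apply] at h1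
  simp only [hrθ] at h1
  have h2 : (1 / ∑ c : Quotient (properClass B (properGenus B a L ν)), 1 / (oPlus B (c.out : Set V) : ℝ)) *
      ∑ c : Quotient (properClass B (properGenus B a L ν)), r c / (oPlus B (c.out : Set V) : ℝ) = 0 := by
    apply ofReal_injective
    rw [ofReal_zero, ← h1]
    push_cast
    rfl
  refine absurd h2 (mul_pos (one_div_pos.2 ?_) ?_).ne'
  · exact Finset.sum_pos (fun c _ => one_div_pos.2 (hpo c)) Finset.univ_nonempty
  · exact Finset.sum_pos (fun c _ => div_pos (hr c) (hpo c)) Finset.univ_nonempty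

end

theorem IsThetaFamily.isModularForm {N a : ℕ} {ψ : ℤ → ℂ} {Θ : ZMod a → ℍ → ℂ} (h : IsThetaFamily N a ψ Θ) :
    IsModularForm 3 (Gamma0 N ⊓ Gamma1 a) ψ (Θ 1) where
  slash_eq γ hγ := by
    rw [h.slash_eq γ hγ.1, ((Gamma1_mem a γ).1 hγ.2).1, one_mul]
  holo := h.holo 1
  growth := h.growth 1

end

end TernaryCoset

end

/-! ### The main theorem -/

theorem mainTheorem4 {V : Type*} [AddCommGroup V] [Module ℚ V]
    (B : LinearMap.BilinForm ℚ V) (hsymm : B.IsSymm) (hpos : ∀ x : V, x ≠ 0 → 0 < B x x)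
    (hdim : Module.finrank ℚ V = 3)
    (L : Submodule ℤ V) (hL : TernaryCoset.IsLattice L)
    (hint : ∀ x ∈ L, ∀ y ∈ L, ∃ m : ℤ, B x y = m)
    (e : Module.Basis (Fin 3) ℤ L)
    (a : ℕ) (ν : V) (hν : ν ∈ L) (hcond : TernaryCoset.HasConductor a L ν)
    (N : ℕ) (hN : N = 4 * TernaryCoset.level B e * a ^ 2)
    (ψ : ℤ → ℂ) (hψ : ψ = fun d => (TernaryCoset.kronecker (4 * TernaryCoset.discr B e) d : ℂ))
    (p : ℕ) (hp : p.Prime) (hpN : ¬ p ∣ N) :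
    TernaryCoset.IsModularForm 3 (CongruenceSubgroup.Gamma0 N ⊓ CongruenceSubgroup.Gamma1 a) ψ
      (TernaryCoset.thetaGenus B (TernaryCoset.properGenus B a L ν)) ∧
    (∀ pbar : ℤ, (p : ℤ) * pbar ≡ 1 [ZMOD a] →
      TernaryCoset.hecke 3 N a p ψ
          (TernaryCoset.thetaGenus B (TernaryCoset.properGenus B a L ν)) =
        ((p : ℂ) + 1) •
          TernaryCoset.thetaGenus B (TernaryCoset.properGenus B a L (pbar • ν))) ∧
    (((p : ℤ) ≡ 1 [ZMOD a] ∨ (p : ℤ) ≡ -1 [ZMOD a]) →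
      TernaryCoset.IsHeckeEigenform 3 N a p ψ
        (TernaryCoset.thetaGenus B (TernaryCoset.properGenus B a L ν)) ((p : ℂ) + 1)) := by
  have ha : a ≠ 0 := hcond.1.1.ne'
  have : NeZero a := ⟨ha⟩
  have : Fact p.Prime := ⟨hp⟩
  set M := TernaryCoset.level B e with hMdef
  have hM : M ≠ 0 := (TernaryCoset.level_spec hsymm hpos hdim hint e).1.ne'
  have hL' : TernaryCoset.IsIntegralOfLevel B M L := TernaryCoset.isIntegralOfLevel hsymm hpos hdim hint e hL
  have hδ := TernaryCoset.isDiscr_discr hsymm hpos hdim hint e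
  have hδM := TernaryCoset.discr_dvd_level_pow hsymm hpos hdim hint e
  have hpM : ¬ p ∣ M := fun h => hpN (hN ▸ (h.mul_left 4).mul_right _)
  have hpa : ¬ p ∣ a := fun h => hpN (hN ▸ (h.trans (dvd_pow_self a two_ne_zero)).mul_left _)
  have hp2 : p ≠ 2 := fun h => hpN (by rw [h, hN]; exact ⟨2 * M * a ^ 2, by ring⟩)
  have hquad : TernaryCoset.IsQuadChar N ψ :=
    hψ ▸ TernaryCoset.isQuadChar_kronecker hδ.1 hδM (hN ▸ Dvd.intro _ rfl)
  obtain ⟨Θ, hΘ, hΘ1, hΘp⟩ := TernaryCoset.exists_isThetaFamily hsymm hpos hdim hM hL' ha hδ hδM hν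
  rw [← hN, ← hψ] at hΘ
  have hmod : TernaryCoset.IsModularForm 3 (CongruenceSubgroup.Gamma0 N ⊓ CongruenceSubgroup.Gamma1 a) ψ
      (TernaryCoset.thetaGenus B (TernaryCoset.properGenus B a L ν)) := hΘ1 ▸ hΘ.isModularForm
  have hhecke : ∀ pbar : ℤ, (p : ℤ) * pbar ≡ 1 [ZMOD a] →
      TernaryCoset.hecke 3 N a p ψ (TernaryCoset.thetaGenus B (TernaryCoset.properGenus B a L ν)) =
        ((p : ℂ) + 1) • TernaryCoset.thetaGenus B (TernaryCoset.properGenus B a L (pbar • ν)) := by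
    intro pbar hpbar
    -- A representative of the class of `pbar` modulo `a` that is divisible by `p`; then `pb` maps
    -- each lattice into all its neighbors.
    obtain ⟨pb, hpb⟩ : ∃ pb : ℤ, pb = p * pbar * pbar := ⟨_, rfl⟩
    have hdvd : (p : ℤ) ∣ pb := ⟨pbar * pbar, by rw [hpb]; ring⟩
    have hcong : pb ≡ pbar [ZMOD a] := by
      rw [hpb]
      simpa using hpbar.mul_right pbar
    have hinv : (p : ℤ) * pb ≡ 1 [ZMOD a] := (hcong.mul_left p).trans hpbar
    have hgen : TernaryCoset.properGenus B a L (pbar • ν) = TernaryCoset.properGenus B a L (pb • ν) := by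
      obtain ⟨t, ht⟩ := hcong.dvd
      exact TernaryCoset.properGenus_congr ⟨t • ν, zsmul_mem hν t, by
        rw [← sub_smul, ht, mul_smul, natCast_zsmul]⟩
    have hinv' : (p : ZMod a) * (pb : ZMod a) = 1 := by
      have := (ZMod.intCast_eq_intCast_iff _ _ _).2 hinv
      exact_mod_cast this
    ext z
    rw [← hΘ1, hΘ.hecke_apply hquad ⟨M * a ^ 2, by rw [hN]; ring⟩ ⟨4 * M * a, by rw [hN]; ring⟩
      (by rw [hN]; positivity) hpN hinv' z]
    have h1 := hΘp p hpM hp2 pb hdvd hinv z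
    have hψp : ψ p = (TernaryCoset.kronecker (4 * TernaryCoset.discr B e) p : ℂ) := by rw [hψ]
    rw [← hψp] at h1
    refine h1.trans ?_
    rw [TernaryCoset.sum_cosetNeighbors hsymm hpos hdim hM hL' hpM hp2 ha hpa hdvd hinv hδ hδM hν
      (f := fun X => TernaryCoset.theta B X z) fun σ hσ X => TernaryCoset.theta_image hσ X z,
      ← TernaryCoset.mass_zsmul_eq hsymm hpos hdim hM hL' hpM hp2 ha hpa hdvd hinv hδ hδM hν, hgen, Pi.smul_apply,
      TernaryCoset.thetaGenus, smul_eq_mul]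
    push_cast
    ring
  refine ⟨hmod, hhecke, fun h => ⟨hmod, TernaryCoset.thetaGenus_ne_zero hsymm hpos hdim hM hL' ha hν, ?_⟩⟩
  rcases h with h | h
  · have := hhecke 1 (by rwa [mul_one])
    rwa [one_smul] at this
  · have := hhecke (-1) (by simpa using h.neg)
    rwa [neg_smul, one_smul, TernaryCoset.thetaGenus_neg hsymm hpos hdim hM hL' ha hν] at this
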